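/- Consider the Brusselator system with $a=2$ and $D=\mathrm{diag}(4,16)$, written in coordinates centred at its equilibrium with bifurcation parameter $b=\beta-4$, so that its reaction term is $$f(u)=\begin{pmatrix}(b+3)u_1+4u_2+(\tfrac b2+2)u_1^2+4u_1u_2+u_1^2u_2\\ -(b+4)u_1-4u_2-(\tfrac b2+2)u_1^2-4u_1u_2-u_1^2u_2\end{pmatrix}.$$ Put $b=\varepsilon^2$, $k=k(\varepsilon,\omega)=\frac{2\varepsilon\omega+\sqrt{4\varepsilon^2\omega^2+1}}2$, $I_E=[-\frac14,\frac14]$ and $I_S=(-\frac1{4\sqrt3},\frac1{4\sqrt3})$. There are $r>0$ and $\varepsilon_0>0$ such that for all $\varepsilon\in[0,\varepsilon_0)$, $\omega\in I_E$ the equation $k^2D\,\partial_\xi^2u+f(u)=0$ has exactly one even solution $u=u_{\varepsilon,\omega}\in H^2_{per}([0,2\pi],\mathbb R^2)$ with $\|u\|_{H^2}<r$ and $u_1(0)>0$ if $\varepsilon>0$ and $|\omega|<\frac14$; for $\varepsilon=0$ or $|\omega|=\frac14$ we set $u_{\varepsilon,\omega}=0$. For $\sigma\in\mathbb R$ let $$B(\varepsilon,\omega,\sigma)V=k^2D(\partial_\xi+i\sigma)^2V+df(u_{\varepsilon,\omega})V$$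 on $L^2_{per}([0,2\pi],\mathbb C^2)$ with domain $H^2_{per}([0,2\pi],\mathbb C^2)$ be the Bloch operators of the linearization about $u_{\varepsilon,\omega}$. Call $u_{\varepsilon,\omega}$ diffusively stable if $0$ is a simple eigenvalue of $B(\varepsilon,\omega,0)$, all other spectrum of $B(\varepsilon,\omega,0)$ has negative real part, and for some $\eta>0$ one has $\mathrm{Re}\,\lambda\le-\eta\sigma^2$ for all $\sigma\in[-\frac12,\frac12)$ and all $\lambda\in\mathrm{Sp}(B(\varepsilon,\omega,\sigma))$. Then there are $\tilde\varepsilon_0\in(0,\varepsilon_0]$, $\sigma_0>0$, $\delta>0$ and complex-valued functions $\lambda_1,\lambda_2$ of $(\varepsilon,\omega,\sigma)$ such that the following hold. (i) For all $\varepsilon\in[0,\tilde\varepsilon_0)$, $\sigma\in[0,\sigma_0)$, $\omega\in I_E$, $$\mathrm{Sp}(B(\varepsilon,\omega,\sigma))=S\cup\{\lambda_1,\lambda_2\},$$ where $\mathrm{Re}\,\lambda<-\delta$ for all $\lambda\in S$, and $\lambda_1,\lambda_2$ are eigenvalues with $|\lambda_j|<\delta$; moreover $\lambda_j\to0$ as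 $(\varepsilon,\sigma)\to(0,0)$, uniformly in $\omega\in I_E$. (ii) For each fixed $\omega\in I_S$ there are $\hat\varepsilon_0\in(0,\tilde\varepsilon_0)$, real functions $c,\tilde c,\tilde{\tilde c}_1,\tilde{\tilde c}_2$ of $\varepsilon\in[0,\hat\varepsilon_0)$ with $\tilde{\tilde c}_1,\tilde{\tilde c}_2>0$, $c(0)=0$ and $c(\varepsilon)<0$ for $\varepsilon>0$, and a constant $K$ (all of these may depend on $\omega$), such that for all $\varepsilon\in[0,\hat\varepsilon_0)$ and $\sigma\in[0,\sigma_0)$ $$\mathrm{Re}\,\lambda_1\le c(\varepsilon)+\tilde c(\varepsilon)\sigma-\tilde{\tilde c}_1(\varepsilon)\sigma^2+K\sigma^3,\qquad \mathrm{Re}\,\lambda_2\le-\tilde{\tilde c}_2(\varepsilon)\sigma^2+K\sigma^3,$$ and for all $\varepsilon\in(0,\hat\varepsilon_0)$ the pattern $u_{\varepsilon,\omega}$ is diffusively stable. (iii) For each fixed $\omega\in I_E\setminus\overline{I_S}$ there is $\hat\varepsilon_0\in(0,\tilde\varepsilon_0)$ such that for every $\varepsilon\in(0,\hat\varepsilon_0)$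 there is $\sigma\in[0,\sigma_0)$ with $\max\{\mathrm{Re}\,\lambda_1,\mathrm{Re}\,\lambda_2\}>0$, so that $u_{\varepsilon,\omega}$ is diffusively unstable. -/

import Mathlib

open Real MeasureTheory
open scoped ENNReal

noncomputable section

namespace Brusselator

instance factTwoPiPos : Fact (0 < 2 * π) := ⟨Real.two_pi_pos⟩

/-! ### Function spaces on the circle `ℝ / 2πℤ` -/

/-- The circle `ℝ / 2πℤ`: functions on it are the `2π`-periodic functions of `ξ`. -/
abbrev Circ : Type := AddCircle (2 * π)

/-- Complex-valued `L²_per[0,2π]` (with respect to normalised Lebesgue measure). -/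
abbrev L2 : Type := Lp ℂ 2 (AddCircle.haarAddCircle : Measure Circ)

/-- `L²_per([0,2π], ℂ²)`, as pairs of components. (The norm of the product is equivalent to the
Hilbert space norm; only the topology enters below.) -/
abbrev State : Type := L2 × L2

theorem coeff_add (v w : L2) (n : ℤ) :
    fourierCoeff (v + w : L2) n = fourierCoeff v n + fourierCoeff w n := by
  simp only [← fourierBasis_repr, map_add, lp.coeFn_add, Pi.add_apply]

theorem coeff_smul (c : ℂ) (v : L2) (n : ℤ) :
    fourierCoeff (c • v : L2) n = c * fourierCoeff v n := by
  simp only [← fourierBasis_repr, map_smul, lp.coeFn_smul, Pi.smul_apply, smul_eq_mul]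

theorem coeff_zero (n : ℤ) : fourierCoeff (0 : L2) n = 0 := by
  simp only [← fourierBasis_repr, map_zero, lp.coeFn_zero, Pi.zero_apply]

/-- The periodic Sobolev space `H²_per[0,2π]`: the `v ∈ L²` for which
`∑ (1 + n²)² |v̂(n)|²` converges. -/
def H2 : Submodule ℂ L2 where
  carrier := {v | Memℓp (fun n : ℤ => (1 + (n : ℂ) ^ 2) * fourierCoeff v n) 2}
  add_mem' {v w} hv hw := by
    have h := hv.add hw
    have e : (fun n : ℤ => (1 + (n : ℂ) ^ 2) * fourierCoeff (v + w : L2) n) =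
        (fun n : ℤ => (1 + (n : ℂ) ^ 2) * fourierCoeff v n) +
          (fun n : ℤ => (1 + (n : ℂ) ^ 2) * fourierCoeff w n) := by
      funext n
      simp only [coeff_add, Pi.add_apply, mul_add]
    simpa only [Set.mem_ofPred_eq, e] using h
  zero_mem' := by
    simp only [Set.mem_ofPred_eq, coeff_zero, mul_zero]
    exact zero_memℓp
  smul_mem' c v hv := by
    have h := hv.const_smul c
    have e : (fun n : ℤ => (1 + (n : ℂ) ^ 2) * fourierCoeff (c • v : L2) n) =
        c • (fun n : ℤ => (1 + (n : ℂ) ^ 2) * fourierCoeff v n) := by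
      funext n
      simp only [coeff_smul, Pi.smul_apply, smul_eq_mul]
      ring
    simpa only [Set.mem_ofPred_eq, e] using h

/-- The `H²` norm `(∑ (1 + n²)² |v̂(n)|²)^{1/2}`, meaningful for `v ∈ H2`. -/
def normH2 (v : L2) : ℝ :=
  √(∑' n : ℤ, ((1 + (n : ℝ) ^ 2) * ‖fourierCoeff v n‖) ^ 2)

theorem memℓp_deriv2 (σ : ℝ) (v : H2) :
    Memℓp (fun n : ℤ => (Complex.I * ((n : ℂ) + σ)) ^ 2 * fourierCoeff (v : L2) n) 2 := by
  have h : Memℓp (fun n : ℤ => (1 + (n : ℂ) ^ 2) * fourierCoeff (v : L2) n) 2 := v.2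
  have h2 := h.const_smul (2 * (1 + σ ^ 2) : ℝ)
  rw [memℓp_gen_iff (by norm_num)] at h2 ⊢
  refine Summable.of_nonneg_of_le (fun n => by positivity) (fun n => ?_) h2
  refine Real.rpow_le_rpow (norm_nonneg _) ?_ (by norm_num)
  have e1 : ‖(Complex.I * ((n : ℂ) + σ)) ^ 2‖ = ((n : ℝ) + σ) ^ 2 := by
    have : ((n : ℂ) + σ) = (((n : ℝ) + σ : ℝ) : ℂ) := by push_cast; rfl
    rw [norm_pow, norm_mul, Complex.norm_I, one_mul, this, Complex.norm_real, Real.norm_eq_abs,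
      sq_abs]
  have e2 : ‖(1 + (n : ℂ) ^ 2)‖ = 1 + (n : ℝ) ^ 2 := by
    have : (1 + (n : ℂ) ^ 2) = ((1 + (n : ℝ) ^ 2 : ℝ) : ℂ) := by push_cast; rfl
    rw [this, Complex.norm_real, Real.norm_of_nonneg (by positivity)]
  have e3 : (0 : ℝ) ≤ 2 * (1 + σ ^ 2) := by positivity
  rw [Pi.smul_apply, norm_smul, Real.norm_of_nonneg e3, norm_mul, norm_mul, e1, e2, ← mul_assoc]
  refine mul_le_mul_of_nonneg_right ?_ (norm_nonneg _)
  nlinarith [sq_nonneg ((n : ℝ) - σ), sq_nonneg ((n : ℝ) * σ)]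

/-- The operator `(∂_ξ + iσ)² : H²_per → L²_per`, which multiplies the `n`-th Fourier coefficient
by `(i(n + σ))²`. -/
def blochDeriv2 (σ : ℝ) : H2 →ₗ[ℂ] L2 where
  toFun v := fourierBasis.repr.symm
    ⟨fun n : ℤ => (Complex.I * ((n : ℂ) + σ)) ^ 2 * fourierCoeff (v : L2) n, memℓp_deriv2 σ v⟩
  map_add' v w := by
    rw [← map_add]
    congr 1
    ext n
    simp only [Submodule.coe_add, coeff_add, lp.coeFn_add, Pi.add_apply, mul_add]
  map_smul' c v := by
    rw [RingHom.id_apply, ← map_smul]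
    congr 1
    ext n
    simp only [Submodule.coe_smul, coeff_smul, lp.coeFn_smul, Pi.smul_apply, smul_eq_mul]
    ring

/-- A continuous real function on the circle, regarded as complex-valued. -/
def complexify (g : C(Circ, ℝ)) : C(Circ, ℂ) :=
  ⟨fun x => (g x : ℂ), Complex.continuous_ofReal.comp g.continuous⟩

/-- The class in `L²` of a continuous real function. -/
def toL2 (g : C(Circ, ℝ)) : L2 :=
  ContinuousMap.toLp 2 AddCircle.haarAddCircle ℂ (complexify g)

/-- The operator of multiplication by a continuous real function `g` on `L²`. -/
def mulOp (g : C(Circ, ℝ)) : L2 →L[ℂ] L2 :=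
  (ContinuousLinearMap.mul ℂ ℂ).holderL AddCircle.haarAddCircle ∞ 2 2
    (ContinuousMap.toLp ∞ AddCircle.haarAddCircle ℂ (complexify g))

/-! ### Spectrum of an unbounded operator -/

section Spectrum

variable {E : Type*} [NormedAddCommGroup E] [NormedSpace ℂ E]

/-- The resolvent set of an unbounded operator `T`: those `z` for which `T - z` maps the domain
bijectively onto the space, with bounded inverse `R`. -/
def resolventSet (T : E →ₗ.[ℂ] E) : Set ℂ :=
  {z | ∃ R : E →L[ℂ] E,
    (∀ f : E, ∃ v : T.domain, (v : E) = R f ∧ T v - z • (v : E) = f) ∧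
    ∀ v : T.domain, R (T v - z • (v : E)) = v}

/-- The spectrum of an unbounded operator. -/
def spec (T : E →ₗ.[ℂ] E) : Set ℂ := (resolventSet T)ᶜ

/-- `z` is an eigenvalue of the unbounded operator `T`. -/
def IsEigenvalue (T : E →ₗ.[ℂ] E) (z : ℂ) : Prop :=
  ∃ v : T.domain, (v : E) ≠ 0 ∧ T v = z • (v : E)

/-- `z` is an (algebraically) simple eigenvalue of `T`: the eigenspace is spanned by one vector
`φ`, and there is no generalised eigenvector above `φ`. -/
def IsSimpleEigenvalue (T : E →ₗ.[ℂ] E) (z : ℂ) : Prop :=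
  ∃ φ : T.domain, (φ : E) ≠ 0 ∧ T φ = z • (φ : E) ∧
    (∀ v : T.domain, T v = z • (v : E) → ∃ a : ℂ, (v : E) = a • (φ : E)) ∧
    ¬ ∃ v : T.domain, T v - z • (v : E) = (φ : E)

end Spectrum

/-! ### The Brusselator with `a = 2`, `D = diag(4, 16)`, centred at the equilibrium,
with bifurcation parameter `b = β - 4` -/

/-- A pair `(u₁, u₂)` of continuous real `2π`-periodic functions. Elements of
`H²_per([0,2π], ℝ²)` are identified with their continuous representatives. -/
abbrev Profile : Type := C(Circ, ℝ) × C(Circ, ℝ)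

/-- `f₁(u) = (b+3)u₁ + 4u₂ + (b/2+2)u₁² + 4u₁u₂ + u₁²u₂`. -/
def reaction₁ (b : ℝ) (u : Profile) : C(Circ, ℝ) :=
  (b + 3) • u.1 + (4 : ℝ) • u.2 + (b / 2 + 2) • u.1 ^ 2 + (4 : ℝ) • (u.1 * u.2) + u.1 ^ 2 * u.2

/-- `f₂(u) = -(b+4)u₁ - 4u₂ - (b/2+2)u₁² - 4u₁u₂ - u₁²u₂`. -/
def reaction₂ (b : ℝ) (u : Profile) : C(Circ, ℝ) :=
  -((b + 4) • u.1) - (4 : ℝ) • u.2 - (b / 2 + 2) • u.1 ^ 2 - (4 : ℝ) • (u.1 * u.2) - u.1 ^ 2 * u.2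

/-- `∂f₁/∂u₁` at `u`. -/
def jac₁₁ (b : ℝ) (u : Profile) : C(Circ, ℝ) :=
  ContinuousMap.const _ (b + 3) + (b + 4) • u.1 + (4 : ℝ) • u.2 + (2 : ℝ) • (u.1 * u.2)

/-- `∂f₁/∂u₂` at `u`. -/
def jac₁₂ (u : Profile) : C(Circ, ℝ) :=
  ContinuousMap.const _ 4 + (4 : ℝ) • u.1 + u.1 ^ 2

/-- `∂f₂/∂u₁` at `u`. -/
def jac₂₁ (b : ℝ) (u : Profile) : C(Circ, ℝ) :=
  ContinuousMap.const _ (-(b + 4)) - (b + 4) • u.1 - (4 : ℝ) • u.2 - (2 : ℝ) • (u.1 * u.2)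

/-- `∂f₂/∂u₂` at `u`. -/
def jac₂₂ (u : Profile) : C(Circ, ℝ) :=
  ContinuousMap.const _ (-4) - (4 : ℝ) • u.1 - u.1 ^ 2

/-- The wave number `k(ε, ω) = (2εω + √(4ε²ω² + 1)) / 2`. -/
def waveNumber (ε ω : ℝ) : ℝ := (2 * ε * ω + √(4 * ε ^ 2 * ω ^ 2 + 1)) / 2

/-- `u` is a stationary `2π`-periodic solution in `H²` of
`k² D ∂_ξ² u + f(u) = 0`, with `b = ε²` and `k = k(ε, ω)`. -/
def IsSteady (ε ω : ℝ) (u : Profile) : Prop :=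
  ∃ (h₁ : toL2 u.1 ∈ H2) (h₂ : toL2 u.2 ∈ H2),
    ((4 * waveNumber ε ω ^ 2 : ℝ) : ℂ) • blochDeriv2 0 ⟨toL2 u.1, h₁⟩ +
      toL2 (reaction₁ (ε ^ 2) u) = 0 ∧
    ((16 * waveNumber ε ω ^ 2 : ℝ) : ℂ) • blochDeriv2 0 ⟨toL2 u.2, h₂⟩ +
      toL2 (reaction₂ (ε ^ 2) u) = 0

/-- `u` is the small (of `H²` norm less than `r`) even stationary solution on the bifurcating
branch, normalised among translates by `u₁(0) > 0`; the branch degenerates to the equilibrium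
`0` for `ε = 0` and at the endpoints `ω = ±1/4` of the existence interval. -/
structure IsPattern (r ε ω : ℝ) (u : Profile) : Prop where
  steady : IsSteady ε ω u
  small : normH2 (toL2 u.1) ^ 2 + normH2 (toL2 u.2) ^ 2 < r ^ 2
  even : ∀ x : Circ, u.1 (-x) = u.1 x ∧ u.2 (-x) = u.2 x
  pos : ε ≠ 0 → |ω| ≠ 1 / 4 → 0 < u.1 0
  degenerate : ε = 0 ∨ |ω| = 1 / 4 → u = 0

/-- The Bloch operator `B(ε, ω, σ) V = k² D (∂_ξ + iσ)² V + df(u) V` on `L²_per([0,2π], ℂ²)` with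
domain `H²_per([0,2π], ℂ²)`, for the linearisation about the profile `u`. -/
def bloch (ε ω : ℝ) (u : Profile) (σ : ℝ) : State →ₗ.[ℂ] State where
  domain := H2.prod H2
  toFun :=
    { toFun := fun V =>
        (((4 * waveNumber ε ω ^ 2 : ℝ) : ℂ) • blochDeriv2 σ ⟨(V : State).1, V.2.1⟩ +
            mulOp (jac₁₁ (ε ^ 2) u) (V : State).1 + mulOp (jac₁₂ u) (V : State).2,
          ((16 * waveNumber ε ω ^ 2 : ℝ) : ℂ) • blochDeriv2 σ ⟨(V : State).2, V.2.2⟩ +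
            mulOp (jac₂₁ (ε ^ 2) u) (V : State).1 + mulOp (jac₂₂ u) (V : State).2)
      map_add' := fun V W => by
        have e₁ : (⟨((V + W : H2.prod H2) : State).1, (V + W).2.1⟩ : H2) =
          ⟨(V : State).1, V.2.1⟩ + ⟨(W : State).1, W.2.1⟩ := rfl
        have e₂ : (⟨((V + W : H2.prod H2) : State).2, (V + W).2.2⟩ : H2) =
          ⟨(V : State).2, V.2.2⟩ + ⟨(W : State).2, W.2.2⟩ := rfl
        rw [e₁, e₂]
        simp only [Submodule.coe_add, Prod.fst_add, Prod.snd_add, map_add, smul_add,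
          Prod.mk_add_mk]
        congr 1 <;> abel
      map_smul' := fun c V => by
        have e₁ : (⟨((c • V : H2.prod H2) : State).1, (c • V).2.1⟩ : H2) =
          c • ⟨(V : State).1, V.2.1⟩ := rfl
        have e₂ : (⟨((c • V : H2.prod H2) : State).2, (c • V).2.2⟩ : H2) =
          c • ⟨(V : State).2, V.2.2⟩ := rfl
        rw [e₁, e₂]
        simp only [Submodule.coe_smul, Prod.smul_fst, Prod.smul_snd, map_smul, RingHom.id_apply,
          Prod.smul_mk, smul_add, smul_comm c] }

/-- Diffusive (spectral) stability of the pattern `u`: `0` is a simple eigenvalue of the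
co-periodic operator `B(ε, ω, 0)`, all other spectrum of `B(ε, ω, 0)` has negative real part, and
for some `η > 0` the spectrum of each Bloch operator satisfies `Re λ ≤ -η σ²`. -/
def DiffusivelyStable (ε ω : ℝ) (u : Profile) : Prop :=
  IsSimpleEigenvalue (bloch ε ω u 0) 0 ∧
  (∀ z ∈ spec (bloch ε ω u 0), z ≠ 0 → z.re < 0) ∧
  ∃ η > (0 : ℝ), ∀ σ ∈ Set.Ico (-(1 / 2) : ℝ) (1 / 2), ∀ z ∈ spec (bloch ε ω u σ), z.re ≤ -η * σ ^ 2

/-- The existence interval `I_E = [-1/4, 1/4]`. -/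
def existInterval : Set ℝ := Set.Icc (-(1 / 4)) (1 / 4)

/-- The Eckhaus stability interval `I_S = (-1/(4√3), 1/(4√3))`. -/
def eckhausInterval : Set ℝ := Set.Ioo (-(1 / (4 * √3))) (1 / (4 * √3))

end Brusselator

end

open Brusselator

open Real MeasureTheory
open scoped ENNReal

noncomputable section

namespace Brusselator

/-! ### Inverses of unbounded operators, perturbation and invariant subspaces -/

section Abstract

variable {E : Type*} [NormedAddCommGroup E] [NormedSpace ℂ E]
variable {𝒟 : Submodule ℂ E}

/-! At the bifurcation point the linearisation at the equilibrium has the null vectors `(2, -1)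
e^{±iξ}`, and every other Fourier mode is uniformly damped. For small `ε` and `σ` exactly two Bloch
eigenvalues are therefore close to `0`, and stability is decided by the trace and the determinant of
a two by two matrix.

Patterns (`exists_patterns`). The nonlinear terms of the two equations are opposite, so the sum of
the equations is linear and each Fourier mode of a steady state is a multiple of `(4q, -(1+q))`,
where `q` is its squared wave number. Lyapunov-Schmidt reduction writes `u = s (e + s z)` with `e =
2 cos ξ (4κ, -(1+κ))` and `κ = 4k²`. For `κ = 1`, `b = 0` the quadratic terms vanish on `e`; hence
`u - s e = O(ε³)`, and the bifurcation equation is cubic with coefficient near `-96`. Because `(κ -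
1)² = 16 ε² ω² κ` holds exactly, it gives `24 s² = ε² (1 - 16 ω²) + O(ε³)`.

Reduction. Let `Φ` be `critIn`, `Ψ` be `critOut`, and `B` a Bloch operator. Adding `ΦΨ` moves the
null vectors to the eigenvalue `-1`, and `B + ΦΨ` has a uniformly bounded inverse `R`
(`admissible_shift`, `IsInv.perturb`). `exists_invariant_pair` solves `Θ = R (Θ A + Φ)`, `Ψ Θ = 1`,
which means `B Θ = Θ A`, and `isInv_of_reduced` shows that to the right of `Re z = -1/160` the
spectrum of `B` consists of eigenvalues of `A`. Applying `Ψ` gives `(Ψ R Θ) A = 1 - Ψ R Φ = W` with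
`Ψ R Θ` near `-1`, so the invariants of `A` can be read off from `W` (`reduced_op_bounds`).

Expansion of `W` (`exists_redBounds`). Reflection identifies the second row of `W` at `σ` with the
first row at `-σ`; translation invariance gives `W (1, -1) = 0` at `σ = 0`; and a potential
proportional to `cos ξ` does not couple the modes `±1` to first order, so the pattern changes the
entries only by `O(ε²)`. Thus the off-diagonal entry at `σ = 0` is the only one that has to be
computed. With `ρ = ε + |σ|`, `6 tr W` equals `8 ε² (1 - 16 ω²) + 32 σ²` up to `O(ρ³)`, and `36 det
W` equals `σ² (256 σ² + 128 ε² (1 - 48 ω²))` up to `O(σ² ρ³)`.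

The Eckhaus boundary is the zero of `1 - 48 ω²`. A conjugation symmetry makes the two eigenvalues
real or complex conjugate, so the signs of trace and determinant decide (`CritPair.re_le_of_stable`,
`CritPair.re_pos_of_unstable`). For `|σ|` bounded away from `0` the constant coefficient operator
needs no shift (`admissible_noncritical`, `re_lt_of_noncritical`). -/

/-- `R` is a bounded two-sided inverse of the operator `T` with domain `𝒟`. -/
def IsInv (T : 𝒟 →ₗ[ℂ] E) (R : E →L[ℂ] E) : Prop :=
  (∀ f : E, ∃ v : 𝒟, (v : E) = R f ∧ T v = f) ∧ ∀ v : 𝒟, R (T v) = v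

/-- A bounded operator, restricted to the domain `𝒟`. -/
def onDom (𝒟 : Submodule ℂ E) (U : E →L[ℂ] E) : 𝒟 →ₗ[ℂ] E := (U : E →ₗ[ℂ] E) ∘ₗ 𝒟.subtype

@[simp] theorem onDom_apply (U : E →L[ℂ] E) (v : 𝒟) : onDom 𝒟 U v = U v := rfl

theorem IsInv.unique {T : 𝒟 →ₗ[ℂ] E} {R R' : E →L[ℂ] E} (h : IsInv T R) (h' : IsInv T R') :
    R = R' := by
  ext f
  obtain ⟨v, hv, hTv⟩ := h.1 f
  rw [← hv, ← h'.2 v, hTv]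

/-- Second resolvent identity. Together with `IsInv.resolvent_right` it expands a perturbed inverse
to second order with the unperturbed inverse on both outer sides. -/
theorem IsInv.resolvent_left {T : 𝒟 →ₗ[ℂ] E} {R R' U : E →L[ℂ] E} (h : IsInv T R)
    (h' : IsInv (T + onDom 𝒟 U) R') (f : E) : R' f = R f - R' (U (R f)) := by
  obtain ⟨v, hv, hTv⟩ := h.1 f
  have := h'.2 v
  simp only [LinearMap.add_apply, onDom_apply, map_add, hTv, hv] at this
  exact eq_sub_of_add_eq this

theorem IsInv.resolvent_right {T : 𝒟 →ₗ[ℂ] E} {R R' U : E →L[ℂ] E} (h : IsInv T R)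
    (h' : IsInv (T + onDom 𝒟 U) R') (f : E) : R' f = R f - R (U (R' f)) := by
  obtain ⟨v, hv, hTv⟩ := h'.1 f
  have := h.2 v
  simp only [LinearMap.add_apply, onDom_apply] at hTv
  have e : T v = f - U (R' f) := by rw [← hv]; exact eq_sub_of_add_eq hTv
  rw [e, map_sub] at this
  rw [this, hv]

/-- Neumann series: the inverse is `(1 + R U)⁻¹ R`. The constants are explicit so that the smallness
conditions stay uniform in all parameters. -/
theorem IsInv.perturb [CompleteSpace E] {T : 𝒟 →ₗ[ℂ] E} {R : E →L[ℂ] E} (h : IsInv T R)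
    (U : E →L[ℂ] E) {C : ℝ} (hC : ‖R‖ ≤ C) (hU : C * ‖U‖ ≤ 1 / 2) :
    ∃ R', IsInv (T + onDom 𝒟 U) R' ∧ ‖R'‖ ≤ 2 * C ∧ ‖R' - R‖ ≤ 2 * C ^ 2 * ‖U‖ := by
  have hC0 : 0 ≤ C := (norm_nonneg _).trans hC
  have hx : ‖-(R * U)‖ < 1 := by
    rw [norm_neg]
    calc ‖R * U‖ ≤ ‖R‖ * ‖U‖ := norm_mul_le _ _
      _ ≤ C * ‖U‖ := by gcongr
      _ < 1 := by linarith
  set S := Units.oneSub (-(R * U)) hx with hS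
  have hSv : (S : E →L[ℂ] E) = 1 + R * U := by rw [hS, Units.val_oneSub]; abel
  have h1 : ∀ f, (↑S⁻¹ : E →L[ℂ] E) (f + R (U f)) = f := fun f => by
    have := congrArg (fun L : E →L[ℂ] E => L f) S.inv_mul
    simpa [hSv] using this
  have h2 : ∀ f, (↑S⁻¹ : E →L[ℂ] E) f + R (U ((↑S⁻¹ : E →L[ℂ] E) f)) = f := fun f => by
    have := congrArg (fun L : E →L[ℂ] E => L f) S.mul_inv
    simpa [hSv] using this
  have hinv : IsInv (T + onDom 𝒟 U) (↑S⁻¹ * R) := by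
    refine ⟨fun f => ?_, fun v => ?_⟩
    · obtain ⟨v, hv, hTv⟩ := h.1 (f - U ((↑S⁻¹ * R : E →L[ℂ] E) f))
      have hv' : (v : E) = (↑S⁻¹ * R : E →L[ℂ] E) f := by
        rw [hv, map_sub]
        rw [sub_eq_iff_eq_add]
        exact (h2 (R f)).symm
      refine ⟨v, hv', ?_⟩
      simp only [LinearMap.add_apply, onDom_apply, hTv, hv', sub_add_cancel]
    · change (↑S⁻¹ : E →L[ℂ] E) (R (T v + U v)) = v
      rw [map_add, h.2 v, h1]
  have key : ↑S⁻¹ * R = R - ↑S⁻¹ * R * (U * R) := by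
    ext f; exact h.resolvent_left hinv f
  have hb : ‖(↑S⁻¹ * R : E →L[ℂ] E)‖ ≤ 2 * C := by
    have h3 : ‖(↑S⁻¹ * R : E →L[ℂ] E)‖ ≤ ‖R‖ + ‖(↑S⁻¹ * R : E →L[ℂ] E)‖ * (‖U‖ * ‖R‖) := by
      conv_lhs => rw [key]
      refine (norm_sub_le _ _).trans ?_
      gcongr
      refine (norm_mul_le _ _).trans ?_
      gcongr
      exact norm_mul_le _ _
    have h4 : ‖U‖ * ‖R‖ ≤ 1 / 2 := by
      rw [mul_comm]; exact (mul_le_mul_of_nonneg_right hC (norm_nonneg _)).trans hU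
    nlinarith [norm_nonneg (↑S⁻¹ * R : E →L[ℂ] E)]
  refine ⟨_, hinv, hb, ?_⟩
  have : ↑S⁻¹ * R - R = -(↑S⁻¹ * R * (U * R)) := by
    rw [sub_eq_iff_eq_add, neg_add_eq_sub]; exact key
  rw [this, norm_neg]
  calc ‖(↑S⁻¹ * R * (U * R) : E →L[ℂ] E)‖ ≤ 2 * C * (‖U‖ * C) := by
        refine (norm_mul_le _ _).trans ?_
        gcongr
        exact (norm_mul_le _ _).trans (by gcongr)
    _ = _ := by ring

variable {F : Type*} [NormedAddCommGroup F] [NormedSpace ℂ F]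

open Filter Topology in
/-- If `R₀ Φ = -Φ` and `Ψ Φ = -1`, then for each `R` near `R₀` the equations
`Θ = R (Θ A + Φ)`, `Ψ Θ = 1` have a solution with `Θ` near `-Φ` and `A` near `0`. -/
theorem exists_invariant_pair [CompleteSpace E] [CompleteSpace F] (R₀ : E →L[ℂ] E) (Φ : F →L[ℂ] E)
    (Ψ : E →L[ℂ] F) (hΦ : R₀ ∘L Φ = -Φ) (hΨ : Ψ ∘L Φ = -1) {κ : ℝ} (hκ : 0 < κ) :
    ∃ ρ > 0, ∀ R : E →L[ℂ] E, ‖R - R₀‖ < ρ → ∃ (Θ : F →L[ℂ] E) (A : F →L[ℂ] F),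
      ‖Θ + Φ‖ < κ ∧ ‖A‖ < κ ∧ Θ = R ∘L (Θ ∘L A + Φ) ∧ Ψ ∘L Θ = 1 := by
  let f : (E →L[ℂ] E) × ((F →L[ℂ] E) × (F →L[ℂ] F)) → (F →L[ℂ] E) × (F →L[ℂ] F) :=
    fun x => (x.2.1 - x.1 ∘L (x.2.1 ∘L x.2.2 + Φ), Ψ ∘L x.2.1 - 1)
  let x₀ : (E →L[ℂ] E) × ((F →L[ℂ] E) × (F →L[ℂ] F)) := (R₀, (-Φ, 0))
  have hc : ContDiff ℂ 1 f := by
    refine ContDiff.prodMk ?_ ?_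
    · refine (contDiff_fst.comp contDiff_snd).sub (contDiff_fst.clm_comp ?_)
      exact ((contDiff_fst.comp contDiff_snd).clm_comp
        (contDiff_snd.comp contDiff_snd)).add contDiff_const
    · exact (contDiff_const.clm_comp (contDiff_fst.comp contDiff_snd)).sub contDiff_const
  have hs : HasStrictFDerivAt f (fderiv ℂ f x₀) x₀ :=
    hc.contDiffAt.hasStrictFDerivAt (by norm_num)
  have hder : (fderiv ℂ f x₀) ∘L .inr ℂ _ _ =
      (ContinuousLinearMap.fst ℂ (F →L[ℂ] E) (F →L[ℂ] F) -
        (ContinuousLinearMap.compL ℂ F F E Φ) ∘L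
          ContinuousLinearMap.snd ℂ (F →L[ℂ] E) (F →L[ℂ] F)).prod
        ((ContinuousLinearMap.compL ℂ F E F Ψ) ∘L
          ContinuousLinearMap.fst ℂ (F →L[ℂ] E) (F →L[ℂ] F)) := by
    have h1 : HasFDerivAt (fun y => f (R₀, y)) ((fderiv ℂ f x₀) ∘L .inr ℂ _ _) x₀.2 := by
      have h2 : HasFDerivAt f (fderiv ℂ f x₀) (R₀, x₀.2) := hs.hasFDerivAt
      exact h2.comp x₀.2 (hasFDerivAt_prodMk_right R₀ x₀.2)
    refine h1.unique ?_
    refine HasFDerivAt.prodMk ?_ ?_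
    · have h3 := (hasFDerivAt_const R₀ x₀.2).clm_comp
        (((hasFDerivAt_fst (𝕜 := ℂ) (p := x₀.2)).clm_comp
          (hasFDerivAt_snd (𝕜 := ℂ) (p := x₀.2))).add_const Φ)
      refine (hasFDerivAt_fst.sub h3).congr_fderiv ?_
      ext y c
      · simp [x₀]
      · have := congrArg (fun L : F →L[ℂ] E => L (y c)) hΦ
        simp only [ContinuousLinearMap.comp_apply] at this
        simp [x₀, this]
    · have h3 := (hasFDerivAt_const Ψ x₀.2).clm_comp (hasFDerivAt_fst (𝕜 := ℂ) (p := x₀.2))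
      refine (h3.sub_const 1).congr_fderiv ?_
      ext y c <;> simp
  have hΨ' : ∀ c, Ψ (Φ c) = -c := fun c => by
    simpa using congrArg (fun L : F →L[ℂ] F => L c) hΨ
  have hinv : ((fderiv ℂ f x₀) ∘L .inr ℂ _ _).IsInvertible := by
    rw [hder]
    -- At `(-Φ, 0)` the linearised system is `y - Φ c = x`, `Ψ y = w`. Applying `Ψ` to the first
    -- equation and using `Ψ Φ = -1` gives `c = Ψ x - w`, then `y = x + Φ c`.
    let g : (F →L[ℂ] E) × (F →L[ℂ] F) →L[ℂ] (F →L[ℂ] E) × (F →L[ℂ] F) :=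
      (ContinuousLinearMap.fst ℂ (F →L[ℂ] E) (F →L[ℂ] F) +
        (ContinuousLinearMap.compL ℂ F F E Φ) ∘L
          ((ContinuousLinearMap.compL ℂ F E F Ψ) ∘L
          ContinuousLinearMap.fst ℂ (F →L[ℂ] E) (F →L[ℂ] F) -
          ContinuousLinearMap.snd ℂ (F →L[ℂ] E) (F →L[ℂ] F))).prod
        ((ContinuousLinearMap.compL ℂ F E F Ψ) ∘L
          ContinuousLinearMap.fst ℂ (F →L[ℂ] E) (F →L[ℂ] F) -
          ContinuousLinearMap.snd ℂ (F →L[ℂ] E) (F →L[ℂ] F))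
    refine ⟨ContinuousLinearEquiv.equivOfInverse ((ContinuousLinearMap.fst ℂ (F →L[ℂ] E) (F →L[ℂ] F) -
        (ContinuousLinearMap.compL ℂ F F E Φ) ∘L
          ContinuousLinearMap.snd ℂ (F →L[ℂ] E) (F →L[ℂ] F)).prod
        ((ContinuousLinearMap.compL ℂ F E F Ψ) ∘L
          ContinuousLinearMap.fst ℂ (F →L[ℂ] E) (F →L[ℂ] F))) g ?_ ?_, rfl⟩
    · rintro ⟨x, y⟩
      ext c <;> simp [g, hΨ']
    · rintro ⟨x, y⟩
      ext c <;> simp [g, hΨ']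
  have hev := hs.eventually_apply_implicitFunctionOfProdDomain hinv
  have htd := hs.tendsto_implicitFunctionOfProdDomain hinv
  have hnb : ∀ᶠ y in 𝓝 x₀.2, ‖y.1 + Φ‖ < κ ∧ ‖y.2‖ < κ := by
    have c1 : ContinuousAt (fun y : (F →L[ℂ] E) × (F →L[ℂ] F) => ‖y.1 + Φ‖) x₀.2 := by fun_prop
    have c2 : ContinuousAt (fun y : (F →L[ℂ] E) × (F →L[ℂ] F) => ‖y.2‖) x₀.2 := by fun_prop
    exact (c1.eventually_lt continuousAt_const (by simpa [x₀] using hκ)).and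
      (c2.eventually_lt continuousAt_const (by simpa [x₀] using hκ))
  obtain ⟨ρ, hρ, H⟩ := Metric.eventually_nhds_iff.1 (hev.and (htd.eventually hnb))
  refine ⟨ρ, hρ, fun R hR => ?_⟩
  obtain ⟨h1, h2, h3⟩ := H (y := R) (by rw [dist_eq_norm]; exact hR)
  refine ⟨_, _, h2, h3, ?_, ?_⟩
  · have := congrArg Prod.fst h1
    have hz : (f x₀).1 = 0 := by simp [f, x₀, hΦ]
    rw [hz] at this
    exact sub_eq_zero.1 this
  · have := congrArg Prod.snd h1
    have hz : (f x₀).2 = 0 := by simp [f, x₀, hΨ]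
    rw [hz] at this
    exact sub_eq_zero.1 this

/-- Off the spectrum of the reduced operator `A`, the resolvent of `B` exists as soon as the
operator `B - Θ (A + 1) Ψ`, in which the invariant subspace is shifted to `-1`, has one. -/
theorem isInv_of_reduced {B : 𝒟 →ₗ[ℂ] E} {Θ : F →L[ℂ] E} {Ψ : E →L[ℂ] F} {A : F →L[ℂ] F}
    (hΘ : ∀ c, ∃ v : 𝒟, (v : E) = Θ c ∧ B v = Θ (A c)) (hΨ : ∀ c, Ψ (Θ c) = c)
    {z : ℂ} (hz : z ≠ -1) {R : E →L[ℂ] E}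
    (hR : IsInv (B - z • 𝒟.subtype - onDom 𝒟 (Θ ∘L (A + 1) ∘L Ψ)) R)
    {S : F →L[ℂ] F} (hS₁ : ∀ c, z • S c - A (S c) = c) (hS₂ : ∀ c, S (z • c - A c) = c) :
    ∃ R', IsInv (B - z • 𝒟.subtype) R' := by
  have hz' : 1 + z ≠ 0 := fun h => hz (by linear_combination h)
  -- On the range of `Θ` the shifted operator is the scalar `-1`, whence the factor `-(1 + z)⁻¹`.
  have hRΘ : ∀ c, R (Θ c) = -(1 + z)⁻¹ • Θ c := fun c => by
    obtain ⟨v, hv, hBv⟩ := hΘ c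
    have := hR.2 v
    simp only [LinearMap.sub_apply, onDom_apply, LinearMap.smul_apply, Submodule.subtype_apply, hv,
      hBv, ContinuousLinearMap.comp_apply, hΨ, add_apply,
      one_apply_eq_self, map_add, map_sub, map_smul] at this
    have e : -(1 + z) • R (Θ c) = Θ c := by
      linear_combination (norm := module) this
    have e2 : -(1 + z)⁻¹ * -(1 + z) = 1 := by rw [neg_mul_neg, inv_mul_cancel₀ hz']
    calc R (Θ c) = (-(1 + z)⁻¹ * -(1 + z)) • R (Θ c) := by rw [e2, one_smul]
      _ = _ := by rw [mul_smul, e]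
  -- `(B - z) R f` differs from `f` by `Θ (A + 1) Ψ R f`, and `(B - z) Θ = Θ (A - z)`; the defect is
  -- thus removed by a correction in the range of `Θ`, built from `S = (z - A)⁻¹`.
  refine ⟨R + Θ ∘L (A + 1) ∘L S ∘L Ψ ∘L R, fun f => ?_, fun v => ?_⟩
  · obtain ⟨v, hv, hTv⟩ := hR.1 f
    obtain ⟨w, hw, hBw⟩ := hΘ ((A + 1) (S (Ψ (R f))))
    refine ⟨v + w, by simp [hv, hw], ?_⟩
    simp only [LinearMap.sub_apply, onDom_apply, LinearMap.smul_apply, Submodule.subtype_apply,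
      ContinuousLinearMap.comp_apply, hv] at hTv
    simp only [LinearMap.sub_apply, LinearMap.smul_apply, Submodule.subtype_apply, map_add, hBw,
      hw, hv]
    have e := hS₁ (Ψ (R f))
    set s := S (Ψ (R f))
    have e2 : (A + 1) (Ψ (R f)) = z • (A + 1) s - A ((A + 1) s) := by
      rw [← e]
      simp only [add_apply, one_apply_eq_self, map_sub, map_add,
        map_smul]
    have e3 : Θ ((A + 1) (Ψ (R f))) = z • Θ ((A + 1) s) - Θ (A ((A + 1) s)) := by
      rw [e2, map_sub, map_smul]
    rw [e3] at hTv
    linear_combination (norm := module) hTv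
  · have h1 := hR.2 v
    simp only [LinearMap.sub_apply, onDom_apply, LinearMap.smul_apply, Submodule.subtype_apply,
      ContinuousLinearMap.comp_apply] at h1 ⊢
    set f := B v - z • (v : E) with hf
    rw [map_sub, hRΘ] at h1
    have h2 : R f = (v : E) - (1 + z)⁻¹ • Θ ((A + 1) (Ψ v)) := by
      linear_combination (norm := module) h1
    have h3 : Ψ (R f) = (1 + z)⁻¹ • (z • Ψ v - A (Ψ v)) := by
      rw [h2, map_sub, map_smul, hΨ]
      simp only [add_apply, one_apply_eq_self]
      have : (1 + z)⁻¹ • (1 + z) • Ψ (v : E) = Ψ (v : E) := by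
        rw [smul_smul, inv_mul_cancel₀ hz', one_smul]
      linear_combination (norm := module) -this
    simp only [add_apply, ContinuousLinearMap.comp_apply] at h2 ⊢
    rw [h3, map_smul, hS₂, map_smul, h2]
    simp only [one_apply_eq_self, map_smul, map_add]
    module

/-- A solution of `B v = Θ c` lies in the invariant subspace. -/
theorem mem_invariant_of_isInv {B : 𝒟 →ₗ[ℂ] E} {Θ : F →L[ℂ] E} {Ψ : E →L[ℂ] F} {A : F →L[ℂ] F}
    (hΘ : ∀ c, ∃ v : 𝒟, (v : E) = Θ c ∧ B v = Θ (A c)) (hΨ : ∀ c, Ψ (Θ c) = c)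
    {R : E →L[ℂ] E} (hR : IsInv (B - onDom 𝒟 (Θ ∘L (A + 1) ∘L Ψ)) R) {v : 𝒟} {c : F}
    (hv : B v = Θ c) : ∃ c', (v : E) = Θ c' ∧ A c' = c := by
  have hRΘ : ∀ c, R (Θ c) = -Θ c := fun c => by
    obtain ⟨w, hw, hBw⟩ := hΘ c
    have := hR.2 w
    simp only [LinearMap.sub_apply, onDom_apply, hw, hBw, ContinuousLinearMap.comp_apply, hΨ,
      add_apply, one_apply_eq_self, map_add, map_sub] at this
    linear_combination (norm := module) -this
  have h1 := hR.2 v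
  simp only [LinearMap.sub_apply, onDom_apply, ContinuousLinearMap.comp_apply, hv] at h1
  rw [← map_sub, hRΘ, ← map_neg] at h1
  refine ⟨_, h1.symm, ?_⟩
  obtain ⟨w, hw, hBw⟩ := hΘ (-(c - (A + 1) (Ψ v)))
  have hvw : v = w := Subtype.ext (by rw [hw, h1])
  have h2 : Θ c = Θ (A (-(c - (A + 1) (Ψ v)))) := by rw [← hv, hvw, ← hvw, ← hBw, ← hvw]
  have := congrArg Ψ h2
  rw [hΨ, hΨ] at this
  exact this.symm

end Abstract

/-! ### Fourier coefficients, multipliers and multiplication operators on `L²` -/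

/-- The `n`-th Fourier coefficient as a bounded functional. -/
def cf (n : ℤ) : L2 →L[ℂ] ℂ := innerSL ℂ (fourierBasis n : L2)

theorem cf_apply (n : ℤ) (v : L2) : cf n v = fourierCoeff v n := by
  rw [← fourierBasis_repr, HilbertBasis.repr_apply_apply]; rfl

theorem cf_eq_repr (n : ℤ) (v : L2) : cf n v = fourierBasis.repr v n := by
  rw [cf_apply, fourierBasis_repr]

theorem norm_cf_le (n : ℤ) (v : L2) : ‖cf n v‖ ≤ ‖v‖ := by
  have h : ‖(fourierBasis n : L2)‖ = 1 := fourierBasis.orthonormal.1 n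
  calc ‖cf n v‖ ≤ ‖(fourierBasis n : L2)‖ * ‖v‖ := by
        rw [cf, innerSL_apply_apply]; exact norm_inner_le_norm _ _
    _ = ‖v‖ := by rw [h, one_mul]

theorem L2_ext {v w : L2} (h : ∀ n, cf n v = cf n w) : v = w := by
  apply fourierBasis.repr.injective
  ext n
  rw [← cf_eq_repr, ← cf_eq_repr, h]

/-- The Fourier mode `e^{inξ}` in `L²`. -/
def fb (n : ℤ) : L2 := fourierBasis n

theorem norm_fb (n : ℤ) : ‖fb n‖ = 1 := fourierBasis.orthonormal.1 n

theorem cf_fb (n m : ℤ) : cf n (fb m) = if n = m then 1 else 0 := by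
  exact (orthonormal_iff_ite.1 (fourierBasis.orthonormal (𝕜 := ℂ) (E := L2))) n m

theorem summable_sq_cf (v : L2) : Summable fun n => ‖cf n v‖ ^ 2 := by
  simp only [cf_apply]
  exact (hasSum_sq_fourierCoeff v).summable

theorem tsum_sq_cf (v : L2) : ∑' n, ‖cf n v‖ ^ 2 = ‖v‖ ^ 2 := by
  have h : HasSum (fun i => ‖fourierBasis.repr v i‖ ^ 2) (‖fourierBasis.repr v‖ ^ 2) := by
    apply_mod_cast lp.hasSum_norm ?_ (fourierBasis.repr v)
    simp
  simp only [cf_eq_repr, h.tsum_eq, LinearIsometryEquiv.norm_map]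

/-- Hölder's inequality between `ℓ^∞` and `ℓ²`, transported by the Fourier isometry. -/
theorem exists_mult (m : ℤ → ℂ) {C : ℝ} (hm : ∀ n, ‖m n‖ ≤ C) :
    ∃ L : L2 →L[ℂ] L2, ‖L‖ ≤ C ∧ ∀ v n, cf n (L v) = m n * cf n v := by
  have hC : 0 ≤ C := (norm_nonneg _).trans (hm 0)
  let mm : lp (fun _ : ℤ => ℂ) ∞ := ⟨m, memℓp_infty ⟨C, by rintro _ ⟨n, rfl⟩; exact hm n⟩⟩
  have hmm : ‖mm‖ ≤ C := lp.norm_le_of_forall_le hC hm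
  have hB : ∀ _ : ℤ, ‖ContinuousLinearMap.mul ℂ ℂ‖ ≤ ((1 : NNReal) : ℝ) := fun _ => by simp
  let H := lp.holderL (p := ∞) (q := 2) 2 (fun _ : ℤ => ContinuousLinearMap.mul ℂ ℂ) hB mm
  have hH : ‖H‖ ≤ C := by
    refine (ContinuousLinearMap.le_opNorm _ _).trans ?_
    have := lp.norm_holderL_le (p := ∞) (q := 2) 2 (fun _ : ℤ => ContinuousLinearMap.mul ℂ ℂ) hB
    calc _ ≤ ((1 : NNReal) : ℝ) * C := by gcongr
      _ = C := by simp
  let e : L2 ≃ₗᵢ[ℂ] _ := fourierBasis.repr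
  refine ⟨(e.symm : _ →L[ℂ] L2) ∘L H ∘L (e : L2 →L[ℂ] _), ?_, fun v n => ?_⟩
  · refine ContinuousLinearMap.opNorm_le_bound _ hC fun v => ?_
    simp only [ContinuousLinearMap.comp_apply]
    calc _ = ‖H (e v)‖ := e.symm.norm_map _
      _ ≤ ‖H‖ * ‖e v‖ := H.le_opNorm _
      _ = ‖H‖ * ‖v‖ := by rw [e.norm_map]
      _ ≤ _ := by gcongr
  · rw [cf_eq_repr, cf_eq_repr]
    simp only [ContinuousLinearMap.comp_apply]
    have : fourierBasis.repr (e.symm (H (e v))) = H (e v) := e.apply_symm_apply _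
    change fourierBasis.repr (e.symm (H (e v))) n = _
    rw [this]
    rfl

open Classical in
/-- The Fourier multiplier operator with bounded symbol `m` (zero if `m` is unbounded). -/
def mult (m : ℤ → ℂ) : L2 →L[ℂ] L2 :=
  if h : ∃ C : ℝ, ∀ n, ‖m n‖ ≤ C then (exists_mult m h.choose_spec).choose else 0

theorem cf_mult {m : ℤ → ℂ} {C : ℝ} (hm : ∀ n, ‖m n‖ ≤ C) (v : L2) (n : ℤ) :
    cf n (mult m v) = m n * cf n v := by
  have h : ∃ C : ℝ, ∀ n, ‖m n‖ ≤ C := ⟨C, hm⟩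
  rw [mult, dif_pos h]
  exact (exists_mult m h.choose_spec).choose_spec.2 v n

theorem norm_mult_le {m : ℤ → ℂ} {C : ℝ} (hm : ∀ n, ‖m n‖ ≤ C) : ‖mult m‖ ≤ C := by
  obtain ⟨L, hL, hL'⟩ := exists_mult m hm
  have : mult m = L := by
    ext1 v
    exact L2_ext fun n => by rw [cf_mult hm, hL']
  rwa [this]

theorem complexify_add (f g : C(Circ, ℝ)) : complexify (f + g) = complexify f + complexify g := by
  ext x; simp [complexify]

theorem complexify_smul (c : ℝ) (g : C(Circ, ℝ)) : complexify (c • g) = (c : ℂ) • complexify g := by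
  ext x; simp [complexify]

theorem toL2_ae (g : C(Circ, ℝ)) :
    (toL2 g : Circ → ℂ) =ᵐ[AddCircle.haarAddCircle] fun x => (g x : ℂ) :=
  ContinuousMap.coeFn_toLp (p := 2) AddCircle.haarAddCircle (complexify g)

theorem toL2_add (f g : C(Circ, ℝ)) : toL2 (f + g) = toL2 f + toL2 g := by
  simp only [toL2, complexify_add, map_add]

theorem toL2_smul (c : ℝ) (g : C(Circ, ℝ)) : toL2 (c • g) = (c : ℂ) • toL2 g := by
  simp only [toL2, complexify_smul, map_smul]

theorem toL2_neg (g : C(Circ, ℝ)) : toL2 (-g) = -toL2 g := by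
  simpa using toL2_smul (-1) g

theorem toL2_sub (f g : C(Circ, ℝ)) : toL2 (f - g) = toL2 f - toL2 g := by
  rw [sub_eq_add_neg, toL2_add, toL2_neg, sub_eq_add_neg]

theorem toL2_injective : Function.Injective toL2 := by
  intro f g h
  have := ContinuousMap.toLp_injective (p := 2) (E := ℂ) (𝕜 := ℂ) AddCircle.haarAddCircle h
  ext x
  have := congrArg (fun φ : C(Circ, ℂ) => φ x) this
  exact Complex.ofReal_injective this

theorem mulOp_ae (g : C(Circ, ℝ)) (v : L2) :
    (mulOp g v : Circ → ℂ) =ᵐ[AddCircle.haarAddCircle] fun x => (g x : ℂ) * v x := by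
  have h := (ContinuousLinearMap.mul ℂ ℂ).coeFn_holder (r := 2)
    (ContinuousMap.toLp ∞ AddCircle.haarAddCircle ℂ (complexify g)) v
  have h' := ContinuousMap.coeFn_toLp (p := ∞) (𝕜 := ℂ) AddCircle.haarAddCircle (complexify g)
  filter_upwards [h, h'] with x hx hx'
  change ((ContinuousLinearMap.mul ℂ ℂ).holder 2 _ v) x = _
  rw [hx, hx']
  rfl

theorem mulOp_add (f g : C(Circ, ℝ)) : mulOp (f + g) = mulOp f + mulOp g := by
  simp only [mulOp, complexify_add, map_add]

theorem mulOp_smul (c : ℝ) (g : C(Circ, ℝ)) : mulOp (c • g) = (c : ℂ) • mulOp g := by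
  simp only [mulOp, complexify_smul, map_smul]

theorem mulOp_neg (g : C(Circ, ℝ)) : mulOp (-g) = -mulOp g := by
  simpa using mulOp_smul (-1) g

theorem mulOp_sub (f g : C(Circ, ℝ)) : mulOp (f - g) = mulOp f - mulOp g := by
  rw [sub_eq_add_neg, mulOp_add, mulOp_neg, sub_eq_add_neg]

theorem mulOp_const (c : ℝ) (v : L2) : mulOp (ContinuousMap.const _ c) v = (c : ℂ) • v := by
  apply Lp.ext
  filter_upwards [mulOp_ae (ContinuousMap.const _ c) v, Lp.coeFn_smul (c : ℂ) v] with x h1 h2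
  rw [h1, h2]; rfl

theorem norm_mulOp_le (g : C(Circ, ℝ)) : ‖mulOp g‖ ≤ ‖g‖ := by
  refine ContinuousLinearMap.opNorm_le_bound _ (norm_nonneg _) fun v => ?_
  refine Lp.norm_le_mul_norm_of_ae_le_mul ?_
  filter_upwards [mulOp_ae g v] with x hx
  rw [hx, norm_mul]
  gcongr
  simpa using g.norm_coe_le_norm x

theorem norm_mulOp_apply_le (g : C(Circ, ℝ)) (v : L2) : ‖mulOp g v‖ ≤ ‖g‖ * ‖v‖ :=
  (mulOp g).le_of_opNorm_le (norm_mulOp_le g) v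

theorem mulOp_toL2 (f g : C(Circ, ℝ)) : mulOp f (toL2 g) = toL2 (f * g) := by
  apply Lp.ext
  filter_upwards [mulOp_ae f (toL2 g), toL2_ae g, toL2_ae (f * g)] with x h1 h2 h3
  rw [h1, h2, h3]; simp

theorem norm_toL2_le (g : C(Circ, ℝ)) : ‖toL2 g‖ ≤ ‖g‖ := by
  refine (Lp.norm_le_of_ae_bound (norm_nonneg g) (C := ‖g‖) ?_).trans ?_
  · filter_upwards [toL2_ae g] with x hx
    rw [hx]; simpa using g.norm_coe_le_norm x
  · simp [measureUnivNNReal]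

theorem cf_toL2 (g : C(Circ, ℝ)) (n : ℤ) : cf n (toL2 g) = fourierCoeff (complexify g) n := by
  rw [cf_apply]; exact fourierCoeff_toLp _ _

/-- Multiplication is convolution of coefficients, so a matrix entry depends only on `n - m`.
Between the modes `±1` only the harmonics `0` and `±2` of a potential are visible. -/
theorem cf_mulOp_fb (g : C(Circ, ℝ)) (n m : ℤ) :
    cf n (mulOp g (fb m)) = cf (n - m) (toL2 g) := by
  rw [cf_apply, cf_apply]
  refine integral_congr_ae ?_
  have hfb : (fb m : Circ → ℂ) =ᵐ[AddCircle.haarAddCircle] fourier m := by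
    rw [fb, coe_fourierBasis]; exact coeFn_fourierLp 2 m
  filter_upwards [mulOp_ae g (fb m), toL2_ae g, hfb] with x h1 h2 h3
  rw [h1, h2, h3]
  have : fourier (-(n - m)) x = fourier (-n) x * fourier m x := by
    rw [← fourier_add]; congr 2; ring
  simp only [smul_eq_mul]
  rw [this]; ring

/-! ### Reflection and conjugation -/

theorem neg_measurePreserving :
    MeasurePreserving (fun x : Circ => -x) AddCircle.haarAddCircle AddCircle.haarAddCircle :=
  Measure.measurePreserving_neg _

/-- The reflection `v ↦ v(-ξ)`. -/
def reflL : L2 →ₗᵢ[ℂ] L2 := Lp.compMeasurePreservingₗᵢ ℂ (fun x : Circ => -x) neg_measurePreserving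

theorem reflL_ae (v : L2) :
    (reflL v : Circ → ℂ) =ᵐ[AddCircle.haarAddCircle] fun x => v (-x) :=
  Lp.coeFn_compMeasurePreserving v neg_measurePreserving

theorem cf_reflL (n : ℤ) (v : L2) : cf n (reflL v) = cf (-n) v := by
  rw [cf_apply, cf_apply, fourierCoeff, fourierCoeff]
  rw [← integral_neg_eq_self (fun t : Circ => fourier (-(-n)) t • v t)]
  refine integral_congr_ae ?_
  filter_upwards [reflL_ae v] with x hx
  rw [hx]
  congr 1
  simp only [fourier_apply]
  congr 2
  simp

/-- The conjugation `v ↦ conj v(-ξ)`, which conjugates the Fourier coefficients. -/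
def conjL (v : L2) : L2 := reflL (star v)

theorem star_ae (v : L2) :
    (star v : L2) =ᵐ[AddCircle.haarAddCircle] fun x => (starRingEnd ℂ) (v x) := Lp.coeFn_star v

theorem cf_star (n : ℤ) (v : L2) : cf n (star v) = (starRingEnd ℂ) (cf (-n) v) := by
  rw [cf_apply, cf_apply, fourierCoeff, fourierCoeff, ← integral_conj]
  refine integral_congr_ae ?_
  filter_upwards [star_ae v] with x hx
  rw [hx, smul_eq_mul, smul_eq_mul, map_mul, ← fourier_neg, neg_neg]

theorem cf_conjL (n : ℤ) (v : L2) : cf n (conjL v) = (starRingEnd ℂ) (cf n v) := by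
  rw [conjL, cf_reflL, cf_star, neg_neg]

theorem mulOp_reflL {g : C(Circ, ℝ)} (hg : ∀ x, g (-x) = g x) (v : L2) :
    mulOp g (reflL v) = reflL (mulOp g v) := by
  apply Lp.ext
  have h4 := neg_measurePreserving.quasiMeasurePreserving.ae (mulOp_ae g v)
  filter_upwards [mulOp_ae g (reflL v), reflL_ae v, reflL_ae (mulOp g v), h4] with x h1 h2 h3 h4
  rw [h1, h2, h3, h4, hg]

theorem mulOp_star (g : C(Circ, ℝ)) (v : L2) : mulOp g (star v) = star (mulOp g v) := by
  apply Lp.ext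
  filter_upwards [mulOp_ae g (star v), star_ae v, star_ae (mulOp g v), mulOp_ae g v]
    with x h1 h2 h3 h4
  rw [h1, h2, h3, h4, map_mul, Complex.conj_ofReal]

theorem mulOp_conjL {g : C(Circ, ℝ)} (hg : ∀ x, g (-x) = g x) (v : L2) :
    mulOp g (conjL v) = conjL (mulOp g v) := by
  rw [conjL, mulOp_reflL hg, mulOp_star, conjL]

/-! ### The constant coefficient part and its resolvent -/

/-- The factor `1 + q + ‖z‖` pays for the entries of the adjugate, which grow with `z`; the factor
`1 + q` remains and yields two derivatives. Translating by `δ` turns the half plane into `Re w ≥ 0`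
while both coefficients of the quadratic stay positive. -/
theorem norm_quadratic_ge {c q T d : ℝ} (hc : 0 < c) (hc1 : c ≤ 1) (hq : 0 ≤ q)
    (hT : (1 + q) / 2 ≤ T) (hT' : T ≤ 8 * (1 + q)) (hd : c * (1 + q) ^ 2 ≤ d) {z : ℂ}
    (hz : -(c / 32) ≤ z.re) :
    c / 384 * (1 + q) * (1 + q + ‖z‖) ≤ ‖z ^ 2 + T * z + d‖ := by
  set δ := c / 32 with hδ
  set w : ℂ := z + δ with hw
  have hwre : 0 ≤ w.re := by simp [hw]; linarith
  have hz' : z = w - δ := by rw [hw]; ring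
  have hδ0 : 0 < δ := by positivity
  have hδ1 : δ ≤ 1 / 32 := by rw [hδ]; linarith
  have hzw : ‖z‖ ≤ ‖w‖ + δ := by
    rw [hz']; refine (norm_sub_le _ _).trans ?_
    rw [Complex.norm_real, Real.norm_of_nonneg hδ0.le]
  set T' := T - 2 * δ with hT1
  set d' := d - T * δ + δ ^ 2 with hd1
  have hP : z ^ 2 + T * z + d = w ^ 2 + T' * w + d' := by
    rw [hz', hT1, hd1]; push_cast; ring
  have hT2 : (1 + q) / 4 ≤ T' := by rw [hT1]; linarith
  have hT3 : T' ≤ 8 * (1 + q) := by rw [hT1]; linarith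
  have hd2 : 3 / 4 * c * (1 + q) ^ 2 ≤ d' := by
    have h1 : T * δ ≤ 8 * (1 + q) * δ := by gcongr
    have h2 : 8 * (1 + q) * δ ≤ c / 4 * (1 + q) ^ 2 := by
      rw [hδ]; nlinarith [mul_nonneg hc.le (mul_nonneg hq (by linarith : 0 ≤ 1 + q))]
    nlinarith [sq_nonneg δ]
  rw [hP]
  have hq1 : 0 < 1 + q := by linarith
  -- For small `w` the constant term dominates.
  rcases le_total ‖w‖ (δ * (1 + q)) with h | h
  · have h1 : ‖w ^ 2 + T' * w‖ ≤ (δ * (1 + q)) ^ 2 + 8 * (1 + q) * (δ * (1 + q)) := by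
      refine (norm_add_le _ _).trans ?_
      rw [norm_pow, norm_mul, Complex.norm_real, Real.norm_of_nonneg (by linarith)]
      gcongr
    have h2 : d' ≤ ‖w ^ 2 + T' * w + d'‖ + ‖w ^ 2 + T' * w‖ := by
      have := norm_sub_le (w ^ 2 + T' * w + d') (w ^ 2 + T' * w)
      rw [add_sub_cancel_left, Complex.norm_real] at this
      exact (le_abs_self _).trans this
    have h3 : (δ * (1 + q)) ^ 2 + 8 * (1 + q) * (δ * (1 + q)) ≤ 9 * δ * (1 + q) ^ 2 := by
      have : δ ^ 2 ≤ δ := by nlinarith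
      nlinarith [mul_le_mul_of_nonneg_right this (sq_nonneg (1 + q))]
    have h4 : ‖z‖ ≤ 1 + q := by nlinarith
    have h5 : (1 + q) * (1 + q + ‖z‖) ≤ 2 * (1 + q) ^ 2 := by nlinarith
    have h6 : c / 384 * (1 + q) * (1 + q + ‖z‖) ≤ c / 384 * (2 * (1 + q) ^ 2) := by
      rw [mul_assoc]; gcongr
    have h7 : 9 * δ * (1 + q) ^ 2 = 9 / 32 * c * (1 + q) ^ 2 := by rw [hδ]; ring
    have h8 : 0 < c * (1 + q) ^ 2 := by positivity
    nlinarith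
  · have hw0 : 0 < ‖w‖ := lt_of_lt_of_le (by positivity) h
    -- Multiplication by the conjugate of `w` makes each of the three terms have nonnegative real
    -- part, so the middle one alone is a lower bound.
    have h1 : T' * ‖w‖ ^ 2 ≤ ‖w ^ 2 + T' * w + d'‖ * ‖w‖ := by
      have e : ((starRingEnd ℂ) w * (w ^ 2 + T' * w + d')).re =
          w.re * ‖w‖ ^ 2 + T' * ‖w‖ ^ 2 + d' * w.re := by
        rw [← Complex.normSq_eq_norm_sq, Complex.normSq_apply]
        simp [pow_two]
        ring
      have h2 := Complex.re_le_norm ((starRingEnd ℂ) w * (w ^ 2 + T' * w + d'))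
      rw [e, norm_mul, RCLike.norm_conj, mul_comm ‖w‖] at h2
      have : 0 ≤ d' := le_trans (by positivity) hd2
      nlinarith [mul_nonneg hwre (sq_nonneg ‖w‖), mul_nonneg this hwre]
    have h2 : T' * ‖w‖ ≤ ‖w ^ 2 + T' * w + d'‖ := by
      have : T' * ‖w‖ * ‖w‖ ≤ ‖w ^ 2 + T' * w + d'‖ * ‖w‖ := by nlinarith
      exact le_of_mul_le_mul_right this hw0
    refine le_trans ?_ h2
    have h3 : 1 + q + ‖z‖ ≤ 1 + q + ‖w‖ + δ := by linarith
    have h4 : δ * (1 + q + ‖w‖ + δ) ≤ 3 * ‖w‖ := by nlinarith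
    have h5 : δ * (1 + q + ‖z‖) ≤ 3 * ‖w‖ := le_trans (by gcongr) h4
    calc c / 384 * (1 + q) * (1 + q + ‖z‖) = (1 + q) / 12 * (δ * (1 + q + ‖z‖)) := by
          rw [hδ]; ring
      _ ≤ (1 + q) / 12 * (3 * ‖w‖) := by gcongr
      _ = (1 + q) / 4 * ‖w‖ := by ring
      _ ≤ _ := by gcongr

/-- The domain `H²_per([0,2π], ℂ²)` of the Bloch operators. -/
abbrev dom : Submodule ℂ State := H2.prod H2

theorem cf_blochDeriv2 (σ : ℝ) (v : H2) (n : ℤ) :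
    cf n (blochDeriv2 σ v) = -(((n + σ) ^ 2 : ℝ) : ℂ) * cf n v := by
  rw [cf_eq_repr]
  change fourierBasis.repr (fourierBasis.repr.symm _) n = _
  rw [LinearIsometryEquiv.apply_symm_apply, cf_apply]
  simp only
  rw [mul_pow, Complex.I_sq]; push_cast; ring

theorem mem_H2_of_cf {v w : L2} (h : ∀ n : ℤ, cf n w = (1 + (n : ℂ) ^ 2) * cf n v) : v ∈ H2 := by
  change Memℓp (fun n : ℤ => (1 + (n : ℂ) ^ 2) * fourierCoeff v n) 2
  have e : (fun n : ℤ => (1 + (n : ℂ) ^ 2) * fourierCoeff v n) = fun n => fourierBasis.repr w n := by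
    funext n; rw [← cf_apply, ← h, cf_eq_repr]
  rw [e]
  exact lp.memℓp _

/-- The linearisation at the equilibrium: `k² D (∂ + iσ)² + df(0)`, with `κ = 4 k²`. -/
def linOp (κ b σ : ℝ) : dom →ₗ[ℂ] State where
  toFun V := ((κ : ℂ) • blochDeriv2 σ ⟨(V : State).1, V.2.1⟩ + ((b + 3 : ℝ) : ℂ) • (V : State).1 +
      (4 : ℂ) • (V : State).2,
    ((4 * κ : ℝ) : ℂ) • blochDeriv2 σ ⟨(V : State).2, V.2.2⟩ - ((b + 4 : ℝ) : ℂ) • (V : State).1 -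
      (4 : ℂ) • (V : State).2)
  map_add' V W := by
    have e₁ : (⟨((V + W : dom) : State).1, (V + W).2.1⟩ : H2) =
      ⟨(V : State).1, V.2.1⟩ + ⟨(W : State).1, W.2.1⟩ := rfl
    have e₂ : (⟨((V + W : dom) : State).2, (V + W).2.2⟩ : H2) =
      ⟨(V : State).2, V.2.2⟩ + ⟨(W : State).2, W.2.2⟩ := rfl
    rw [e₁, e₂]
    simp only [Submodule.coe_add, Prod.fst_add, Prod.snd_add, map_add, Prod.mk_add_mk]
    congr 1 <;> module
  map_smul' c V := by
    have e₁ : (⟨((c • V : dom) : State).1, (c • V).2.1⟩ : H2) =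
      c • ⟨(V : State).1, V.2.1⟩ := rfl
    have e₂ : (⟨((c • V : dom) : State).2, (c • V).2.2⟩ : H2) =
      c • ⟨(V : State).2, V.2.2⟩ := rfl
    rw [e₁, e₂]
    simp only [Submodule.coe_smul, Prod.smul_fst, Prod.smul_snd, map_smul, RingHom.id_apply,
      Prod.smul_mk]
    congr 1 <;> module

/-- The squared wave number of the `n`-th mode, `κ (n + σ)²`. -/
def qv (κ σ : ℝ) (n : ℤ) : ℝ := κ * (n + σ) ^ 2

theorem cf_linOp_fst (κ b σ : ℝ) (V : dom) (n : ℤ) :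
    cf n (linOp κ b σ V).1 =
      (b + 3 - qv κ σ n) * cf n (V : State).1 + 4 * cf n (V : State).2 := by
  simp only [linOp, LinearMap.coe_mk, AddHom.coe_mk, map_add, map_smul, cf_blochDeriv2, qv,
    smul_eq_mul]
  push_cast; ring

theorem cf_linOp_snd (κ b σ : ℝ) (V : dom) (n : ℤ) :
    cf n (linOp κ b σ V).2 =
      -(b + 4) * cf n (V : State).1 - (4 + 4 * qv κ σ n) * cf n (V : State).2 := by
  simp only [linOp, LinearMap.coe_mk, AddHom.coe_mk, map_sub, map_smul, cf_blochDeriv2, qv,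
    smul_eq_mul]
  push_cast; ring

theorem State_ext {V W : State} (h₁ : ∀ n, cf n V.1 = cf n W.1) (h₂ : ∀ n, cf n V.2 = cf n W.2) :
    V = W := Prod.ext (L2_ext h₁) (L2_ext h₂)

/-- Fourier multiplier with matrix valued symbol. -/
def blockMult (m₁₁ m₁₂ m₂₁ m₂₂ : ℤ → ℂ) : State →L[ℂ] State :=
  (mult m₁₁ ∘L .fst ℂ L2 L2 + mult m₁₂ ∘L .snd ℂ L2 L2).prod
    (mult m₂₁ ∘L .fst ℂ L2 L2 + mult m₂₂ ∘L .snd ℂ L2 L2)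

theorem norm_blockMult_le {m₁₁ m₁₂ m₂₁ m₂₂ : ℤ → ℂ} {C : ℝ} (h₁₁ : ∀ n, ‖m₁₁ n‖ ≤ C)
    (h₁₂ : ∀ n, ‖m₁₂ n‖ ≤ C) (h₂₁ : ∀ n, ‖m₂₁ n‖ ≤ C) (h₂₂ : ∀ n, ‖m₂₂ n‖ ≤ C) :
    ‖blockMult m₁₁ m₁₂ m₂₁ m₂₂‖ ≤ 2 * C := by
  have hC : 0 ≤ C := (norm_nonneg _).trans (h₁₁ 0)
  refine ContinuousLinearMap.opNorm_le_bound _ (by positivity) fun V => ?_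
  have key : ∀ {m m' : ℤ → ℂ}, (∀ n, ‖m n‖ ≤ C) → (∀ n, ‖m' n‖ ≤ C) →
      ‖mult m V.1 + mult m' V.2‖ ≤ 2 * C * ‖V‖ := fun {m m'} h h' => by
    calc _ ≤ ‖mult m V.1‖ + ‖mult m' V.2‖ := norm_add_le _ _
      _ ≤ C * ‖V.1‖ + C * ‖V.2‖ := by
        gcongr
        · exact (mult m).le_of_opNorm_le (norm_mult_le h) _
        · exact (mult m').le_of_opNorm_le (norm_mult_le h') _
      _ ≤ C * ‖V‖ + C * ‖V‖ := by
        gcongr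
        · exact norm_fst_le V
        · exact norm_snd_le V
      _ = _ := by ring
  exact max_le (key h₁₁ h₁₂) (key h₂₁ h₂₂)

theorem cf_blockMult_fst {m₁₁ m₁₂ m₂₁ m₂₂ : ℤ → ℂ} {C : ℝ} (h₁₁ : ∀ n, ‖m₁₁ n‖ ≤ C)
    (h₁₂ : ∀ n, ‖m₁₂ n‖ ≤ C) (V : State) (n : ℤ) :
    cf n (blockMult m₁₁ m₁₂ m₂₁ m₂₂ V).1 = m₁₁ n * cf n V.1 + m₁₂ n * cf n V.2 := by
  simp [blockMult, cf_mult h₁₁, cf_mult h₁₂]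

theorem cf_blockMult_snd {m₁₁ m₁₂ m₂₁ m₂₂ : ℤ → ℂ} {C : ℝ} (h₂₁ : ∀ n, ‖m₂₁ n‖ ≤ C)
    (h₂₂ : ∀ n, ‖m₂₂ n‖ ≤ C) (V : State) (n : ℤ) :
    cf n (blockMult m₁₁ m₁₂ m₂₁ m₂₂ V).2 = m₂₁ n * cf n V.1 + m₂₂ n * cf n V.2 := by
  simp [blockMult, cf_mult h₂₁, cf_mult h₂₂]

/-! ### Symbol bounds and the resolvent of the shifted constant coefficient operator. -/

/-- The determinant of the symbol of `linOp κ b σ + X - z`, where `X` is the shift with symbol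
`χ (2, -1) ⊗ (0, 1)`. -/
def symDet (κ b σ : ℝ) (χ : ℤ → ℝ) (z : ℂ) (n : ℤ) : ℂ :=
  z ^ 2 + ((1 - b + 5 * qv κ σ n + χ n : ℝ) : ℂ) * z +
    ((4 * ((qv κ σ n - 1) ^ 2 - b * qv κ σ n) + χ n * (qv κ σ n + b + 5) : ℝ) : ℂ)

/-- Parameters for which the symbol of the shifted operator is uniformly invertible. -/
structure Admissible (c κ b σ : ℝ) (χ : ℤ → ℝ) : Prop where
  c_pos : 0 < c
  c_le : c ≤ 1
  κ_bd : |κ - 1| ≤ 1 / 10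
  b_bd : |b| ≤ 1 / 10
  σ_bd : |σ| ≤ 1 / 2
  χ_bd : ∀ n, 0 ≤ χ n ∧ χ n ≤ 1
  det_bd : ∀ n, c * (1 + qv κ σ n) ^ 2 ≤
    4 * ((qv κ σ n - 1) ^ 2 - b * qv κ σ n) + χ n * (qv κ σ n + b + 5)

namespace Admissible

variable {c κ b σ : ℝ} {χ : ℤ → ℝ} (h : Admissible c κ b σ χ)
include h

theorem qv_nonneg (n : ℤ) : 0 ≤ qv κ σ n := by
  have := (abs_le.1 h.κ_bd).1
  exact mul_nonneg (by linarith) (sq_nonneg _)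

/-- Compares the weight of `H²` with `1 + q`, so that the resolvent bound also controls `H²` norms.
-/
theorem one_add_sq_le (n : ℤ) : 1 + (n : ℝ) ^ 2 ≤ 4 * (1 + qv κ σ n) := by
  have h1 := (abs_le.1 h.κ_bd).1
  have h2 := (abs_le.1 h.σ_bd)
  have h3 : (n : ℝ) ^ 2 ≤ 2 * ((n : ℝ) + σ) ^ 2 + 1 / 2 := by
    nlinarith [sq_nonneg ((n : ℝ) + 2 * σ)]
  unfold qv
  nlinarith [sq_nonneg ((n : ℝ) + σ)]

theorem symDet_ge {z : ℂ} (hz : -(c / 32) ≤ z.re) (n : ℤ) :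
    c / 384 * (1 + qv κ σ n) * (1 + qv κ σ n + ‖z‖) ≤ ‖symDet κ b σ χ z n‖ := by
  have hb := abs_le.1 h.b_bd
  have hq := h.qv_nonneg n
  have hχ := h.χ_bd n
  exact norm_quadratic_ge h.c_pos h.c_le hq (by linarith) (by linarith) (h.det_bd n) hz

theorem symDet_ne_zero {z : ℂ} (hz : -(c / 32) ≤ z.re) (n : ℤ) : symDet κ b σ χ z n ≠ 0 := by
  have h1 := h.symDet_ge hz n
  have hq := h.qv_nonneg n
  have hc := h.c_pos
  have : 0 < c / 384 * (1 + qv κ σ n) * (1 + qv κ σ n + ‖z‖) := by positivity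
  exact norm_pos_iff.1 (this.trans_le h1)

/-- The lower bound on the determinant is a product: one factor absorbs the numerator `a`, the other
a weight `w` of order two. All weighted resolvents below are bounded through this estimate. -/
theorem norm_entry_le {z : ℂ} (hz : -(c / 32) ≤ z.re) (n : ℤ) {a w : ℂ} {K : ℝ}
    (ha : ‖a‖ ≤ 8 * (1 + qv κ σ n + ‖z‖)) (hw : ‖w‖ ≤ K * (1 + qv κ σ n)) :
    ‖w * (a / symDet κ b σ χ z n)‖ ≤ 3072 * K / c := by
  have h1 := h.symDet_ge hz n
  have hq := h.qv_nonneg n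
  have hc := h.c_pos
  have hK : 0 ≤ K := by
    by_contra hK
    have : K * (1 + qv κ σ n) < 0 := mul_neg_of_neg_of_pos (not_le.1 hK) (by linarith)
    linarith [norm_nonneg w]
  have hp : 0 < ‖symDet κ b σ χ z n‖ := norm_pos_iff.2 (h.symDet_ne_zero hz n)
  rw [norm_mul, norm_div, ← mul_div_assoc, div_le_div_iff₀ hp hc]
  calc ‖w‖ * ‖a‖ * c ≤ (K * (1 + qv κ σ n)) * (8 * (1 + qv κ σ n + ‖z‖)) * c := by gcongr
    _ = 3072 * K * (c / 384 * (1 + qv κ σ n) * (1 + qv κ σ n + ‖z‖)) := by ring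
    _ ≤ _ := by gcongr

end Admissible

/-- The resolvent of the shifted constant coefficient operator, multiplied by a weight `w`. -/
def resMult (w : ℤ → ℂ) (κ b σ : ℝ) (χ : ℤ → ℝ) (z : ℂ) : State →L[ℂ] State :=
  blockMult (fun n => w n * ((-(4 + 4 * qv κ σ n + χ n) - z) / symDet κ b σ χ z n))
    (fun n => w n * (-(4 + 2 * χ n) / symDet κ b σ χ z n))
    (fun n => w n * ((b + 4) / symDet κ b σ χ z n))
    (fun n => w n * ((b + 3 - qv κ σ n - z) / symDet κ b σ χ z n))

section ResMult

variable {c κ b σ : ℝ} {χ : ℤ → ℝ} (h : Admissible c κ b σ χ) {z : ℂ} (hz : -(c / 32) ≤ z.re)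
  {w : ℤ → ℂ} {K : ℝ} (hw : ∀ n, ‖w n‖ ≤ K * (1 + qv κ σ n))
include h hz hw

theorem resMult_bounds :
    (∀ n, ‖w n * ((-(4 + 4 * qv κ σ n + χ n) - z) / symDet κ b σ χ z n)‖ ≤ 3072 * K / c) ∧
    (∀ n, ‖w n * (-(4 + 2 * χ n) / symDet κ b σ χ z n)‖ ≤ 3072 * K / c) ∧
    (∀ n, ‖w n * ((b + 4) / symDet κ b σ χ z n)‖ ≤ 3072 * K / c) ∧
    (∀ n, ‖w n * ((b + 3 - qv κ σ n - z) / symDet κ b σ χ z n)‖ ≤ 3072 * K / c) := by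
  have hb := abs_le.1 h.b_bd
  refine ⟨fun n => ?_, fun n => ?_, fun n => ?_, fun n => ?_⟩ <;>
  refine h.norm_entry_le hz n ?_ (hw n) <;>
  have hq := h.qv_nonneg n <;>
  have hχ := h.χ_bd n
  · refine (norm_sub_le _ _).trans ?_
    have e : -(4 + 4 * (qv κ σ n : ℂ) + χ n) = ((-(4 + 4 * qv κ σ n + χ n) : ℝ) : ℂ) := by
      push_cast; rfl
    rw [e, Complex.norm_real, norm_neg, Real.norm_of_nonneg (by linarith)]
    nlinarith [norm_nonneg z]
  · have e : -(4 + 2 * (χ n : ℂ)) = ((-(4 + 2 * χ n) : ℝ) : ℂ) := by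
      push_cast; rfl
    rw [e, Complex.norm_real, norm_neg, Real.norm_of_nonneg (by linarith)]
    nlinarith [norm_nonneg z]
  · have e : (b : ℂ) + 4 = ((b + 4 : ℝ) : ℂ) := by
      push_cast; rfl
    rw [e, Complex.norm_real, Real.norm_of_nonneg (by linarith)]
    nlinarith [norm_nonneg z]
  · refine (norm_sub_le _ _).trans ?_
    have e : (b : ℂ) + 3 - (qv κ σ n : ℂ) = ((b + 3 - qv κ σ n : ℝ) : ℂ) := by
      push_cast; rfl
    have h1 : |b + 3 - qv κ σ n| ≤ 4 + qv κ σ n := by rw [abs_le]; constructor <;> linarith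
    rw [e, Complex.norm_real, Real.norm_eq_abs]
    nlinarith [norm_nonneg z]

theorem norm_resMult_le : ‖resMult w κ b σ χ z‖ ≤ 2 * (3072 * K / c) := by
  obtain ⟨h1, h2, h3, h4⟩ := resMult_bounds h hz hw
  exact norm_blockMult_le h1 h2 h3 h4

theorem cf_resMult_fst (f : State) (n : ℤ) : cf n (resMult w κ b σ χ z f).1 =
    w n * (((-(4 + 4 * qv κ σ n + χ n) - z) * cf n f.1 - (4 + 2 * χ n) * cf n f.2) /
      symDet κ b σ χ z n) := by
  obtain ⟨h1, h2, h3, h4⟩ := resMult_bounds h hz hw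
  rw [resMult, cf_blockMult_fst h1 h2]; ring

theorem cf_resMult_snd (f : State) (n : ℤ) : cf n (resMult w κ b σ χ z f).2 =
    w n * (((b + 4) * cf n f.1 + (b + 3 - qv κ σ n - z) * cf n f.2) /
      symDet κ b σ χ z n) := by
  obtain ⟨h1, h2, h3, h4⟩ := resMult_bounds h hz hw
  rw [resMult, cf_blockMult_snd h3 h4]; ring

end ResMult

/-- Cramer's rule on each Fourier mode; the determinant bound makes the resulting multipliers
bounded. -/
theorem Admissible.isInv {c κ b σ : ℝ} {χ : ℤ → ℝ} (h : Admissible c κ b σ χ) {z : ℂ}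
    (hz : -(c / 32) ≤ z.re) {X : State →L[ℂ] State}
    (hX₁ : ∀ V n, cf n (X V).1 = 2 * χ n * cf n V.2) (hX₂ : ∀ V n, cf n (X V).2 = -χ n * cf n V.2) :
    IsInv (linOp κ b σ + onDom dom X - z • dom.subtype) (resMult 1 κ b σ χ z) := by
  have hw1 : ∀ n : ℤ, ‖(1 : ℤ → ℂ) n‖ ≤ 1 * (1 + qv κ σ n) := fun n => by
    simp [h.qv_nonneg n]
  -- With the weight `1 + n²` the same multiplier is still bounded, so the resolvent takes values in
  -- the domain.
  have hw2 : ∀ n : ℤ, ‖(fun n : ℤ => 1 + (n : ℂ) ^ 2) n‖ ≤ 4 * (1 + qv κ σ n) := fun n => by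
    have e : 1 + (n : ℂ) ^ 2 = ((1 + (n : ℝ) ^ 2 : ℝ) : ℂ) := by push_cast; rfl
    simp only [e]
    rw [Complex.norm_real, Real.norm_of_nonneg (by positivity)]
    exact h.one_add_sq_le n
  have hdet : ∀ n, symDet κ b σ χ z n = (b + 3 - qv κ σ n - z) * (-(4 + 4 * qv κ σ n + χ n) - z) +
      (4 + 2 * χ n) * (b + 4) := fun n => by
    unfold symDet; push_cast; ring
  refine ⟨fun f => ?_, fun V => ?_⟩
  · have hm1 : (resMult 1 κ b σ χ z f).1 ∈ H2 :=
      mem_H2_of_cf (w := (resMult (fun n : ℤ => 1 + (n : ℂ) ^ 2) κ b σ χ z f).1) fun n => by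
        rw [cf_resMult_fst h hz hw2, cf_resMult_fst h hz hw1]; simp
    have hm2 : (resMult 1 κ b σ χ z f).2 ∈ H2 :=
      mem_H2_of_cf (w := (resMult (fun n : ℤ => 1 + (n : ℂ) ^ 2) κ b σ χ z f).2) fun n => by
        rw [cf_resMult_snd h hz hw2, cf_resMult_snd h hz hw1]; simp
    refine ⟨⟨resMult 1 κ b σ χ z f, hm1, hm2⟩, rfl, State_ext (fun n => ?_) (fun n => ?_)⟩
    · have hne := h.symDet_ne_zero hz n
      simp only [LinearMap.sub_apply, LinearMap.add_apply, onDom_apply, LinearMap.smul_apply,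
        Submodule.subtype_apply, Prod.fst_sub, Prod.fst_add, map_sub, map_add, Prod.smul_fst,
        map_smul, cf_linOp_fst, hX₁, cf_resMult_fst h hz hw1, cf_resMult_snd h hz hw1,
        Pi.one_apply, one_mul, smul_eq_mul]
      field_simp
      rw [hdet n]; ring
    · have hne := h.symDet_ne_zero hz n
      simp only [LinearMap.sub_apply, LinearMap.add_apply, onDom_apply, LinearMap.smul_apply,
        Submodule.subtype_apply, Prod.snd_sub, Prod.snd_add, map_sub, map_add, Prod.smul_snd,
        map_smul, cf_linOp_snd, hX₂, cf_resMult_fst h hz hw1, cf_resMult_snd h hz hw1,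
        Pi.one_apply, one_mul, smul_eq_mul]
      field_simp
      rw [hdet n]; ring
  · refine State_ext (fun n => ?_) (fun n => ?_)
    · have hne := h.symDet_ne_zero hz n
      rw [cf_resMult_fst h hz hw1]
      simp only [LinearMap.sub_apply, LinearMap.add_apply, onDom_apply, LinearMap.smul_apply,
        Submodule.subtype_apply, Prod.fst_sub, Prod.fst_add, map_sub, map_add, Prod.smul_fst,
        Prod.snd_sub, Prod.snd_add, Prod.smul_snd, cf_linOp_snd, hX₂,
        map_smul, cf_linOp_fst, hX₁, Pi.one_apply, one_mul, smul_eq_mul]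
      field_simp
      rw [hdet n]; ring
    · have hne := h.symDet_ne_zero hz n
      rw [cf_resMult_snd h hz hw1]
      simp only [LinearMap.sub_apply, LinearMap.add_apply, onDom_apply, LinearMap.smul_apply,
        Submodule.subtype_apply, Prod.fst_sub, Prod.fst_add, map_sub, map_add, Prod.smul_fst,
        Prod.snd_sub, Prod.snd_add, Prod.smul_snd, cf_linOp_snd, hX₂,
        map_smul, cf_linOp_fst, hX₁, Pi.one_apply, one_mul, smul_eq_mul]
      field_simp
      rw [hdet n]; ring

/-! ### The Bloch operator as a perturbation of the constant coefficient operator -/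

/-- The operator `V ↦ (h, -h)` with `h = g₁ V₁ + g₂ V₂`. -/
def potOp (g₁ g₂ : C(Circ, ℝ)) : State →L[ℂ] State :=
  (mulOp g₁ ∘L .fst ℂ L2 L2 + mulOp g₂ ∘L .snd ℂ L2 L2).prod
    (-(mulOp g₁ ∘L .fst ℂ L2 L2 + mulOp g₂ ∘L .snd ℂ L2 L2))

theorem potOp_fst (g₁ g₂ : C(Circ, ℝ)) (V : State) :
    (potOp g₁ g₂ V).1 = mulOp g₁ V.1 + mulOp g₂ V.2 := rfl

theorem potOp_snd (g₁ g₂ : C(Circ, ℝ)) (V : State) :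
    (potOp g₁ g₂ V).2 = -(mulOp g₁ V.1 + mulOp g₂ V.2) := rfl

theorem norm_potOp_le (g₁ g₂ : C(Circ, ℝ)) : ‖potOp g₁ g₂‖ ≤ ‖g₁‖ + ‖g₂‖ := by
  refine ContinuousLinearMap.opNorm_le_bound _ (by positivity) fun V => ?_
  have : ‖mulOp g₁ V.1 + mulOp g₂ V.2‖ ≤ (‖g₁‖ + ‖g₂‖) * ‖V‖ := by
    calc _ ≤ ‖mulOp g₁ V.1‖ + ‖mulOp g₂ V.2‖ := norm_add_le _ _
      _ ≤ ‖g₁‖ * ‖V.1‖ + ‖g₂‖ * ‖V.2‖ := by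
        gcongr <;> exact norm_mulOp_apply_le _ _
      _ ≤ ‖g₁‖ * ‖V‖ + ‖g₂‖ * ‖V‖ := by
        gcongr
        · exact norm_fst_le V
        · exact norm_snd_le V
      _ = _ := by ring
  refine max_le this ?_
  rw [potOp_snd, norm_neg]; exact this

/-- The nonconstant part of `∂f₁/∂u₁` at `u`. -/
def pot₁ (b : ℝ) (u : Profile) : C(Circ, ℝ) :=
  (b + 4) • u.1 + (4 : ℝ) • u.2 + (2 : ℝ) • (u.1 * u.2)

/-- The nonconstant part of `∂f₁/∂u₂` at `u`. -/
def pot₂ (u : Profile) : C(Circ, ℝ) := (4 : ℝ) • u.1 + u.1 ^ 2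

/-- Since `f₁ + f₂ = -u₁`, the nonconstant parts of the two rows of the Jacobian are opposite. This
is the source of the form `(h, -h)` of `potOp`. -/
theorem bloch_eq (ε ω : ℝ) (u : Profile) (σ : ℝ) :
    (bloch ε ω u σ).toFun = linOp (4 * waveNumber ε ω ^ 2) (ε ^ 2) σ +
      onDom dom (potOp (pot₁ (ε ^ 2) u) (pot₂ u)) := by
  have h11 : jac₁₁ (ε ^ 2) u = ContinuousMap.const _ (ε ^ 2 + 3) + pot₁ (ε ^ 2) u := by
    simp only [jac₁₁, pot₁]; abel
  have h12 : jac₁₂ u = ContinuousMap.const _ 4 + pot₂ u := by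
    simp only [jac₁₂, pot₂]; abel
  have h21 : jac₂₁ (ε ^ 2) u = ContinuousMap.const _ (-(ε ^ 2 + 4)) - pot₁ (ε ^ 2) u := by
    simp only [jac₂₁, pot₁]; abel
  have h22 : jac₂₂ u = ContinuousMap.const _ (-4) - pot₂ u := by
    simp only [jac₂₂, pot₂]; abel
  have e : (16 * waveNumber ε ω ^ 2 : ℝ) = 4 * (4 * waveNumber ε ω ^ 2) := by ring
  refine LinearMap.ext fun V => ?_
  refine Prod.ext ?_ ?_
  · change (_ • blochDeriv2 σ _ + mulOp (jac₁₁ (ε ^ 2) u) (V : State).1 +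
      mulOp (jac₁₂ u) (V : State).2 : L2) = (_ • blochDeriv2 σ _ + _ + _) +
      (mulOp (pot₁ (ε ^ 2) u) (V : State).1 + mulOp (pot₂ u) (V : State).2)
    rw [h11, h12, mulOp_add, mulOp_add]
    simp only [add_apply, mulOp_const]
    push_cast
    module
  · change (_ • blochDeriv2 σ _ + mulOp (jac₂₁ (ε ^ 2) u) (V : State).1 +
      mulOp (jac₂₂ u) (V : State).2 : L2) = (_ • blochDeriv2 σ _ - _ - _) +
      -(mulOp (pot₁ (ε ^ 2) u) (V : State).1 + mulOp (pot₂ u) (V : State).2)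
    rw [h21, h22, mulOp_sub, mulOp_sub, e]
    simp only [sub_apply, mulOp_const]
    push_cast
    module

/-! ### The shifted operator -/

/-- The critical directions `(2, -1) e^{±iξ}`. -/
def critIn : (Fin 2 → ℂ) →L[ℂ] State :=
  let L : (Fin 2 → ℂ) →L[ℂ] L2 :=
    (ContinuousLinearMap.proj (R := ℂ) (φ := fun _ : Fin 2 => ℂ) 0).smulRight (fb 1) +
      (ContinuousLinearMap.proj (R := ℂ) (φ := fun _ : Fin 2 => ℂ) 1).smulRight (fb (-1))
  ((2 : ℂ) • L).prod (-L)

/-- The Fourier coefficients `±1` of the second component. -/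
def critOut : State →L[ℂ] (Fin 2 → ℂ) :=
  ContinuousLinearMap.pi ![cf 1 ∘L .snd ℂ L2 L2, cf (-1) ∘L .snd ℂ L2 L2]

/-- The indicator function of the critical modes `±1`. -/
def critMode (n : ℤ) : ℝ := if n = 1 ∨ n = -1 then 1 else 0

/-- The modes as a function of the index of the critical directions. -/
def modeOf (j : Fin 2) : ℤ := ![1, -1] j

@[simp] theorem modeOf_zero : modeOf 0 = 1 := rfl
@[simp] theorem modeOf_one : modeOf 1 = -1 := rfl

theorem critOut_apply (V : State) (j : Fin 2) : critOut V j = cf (modeOf j) V.2 := by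
  fin_cases j <;> rfl

theorem critIn_fst (c : Fin 2 → ℂ) : (critIn c).1 = (2 : ℂ) • (c 0 • fb 1 + c 1 • fb (-1)) := rfl

theorem critIn_snd (c : Fin 2 → ℂ) : (critIn c).2 = -(c 0 • fb 1 + c 1 • fb (-1)) := rfl

theorem critIn_single (j : Fin 2) :
    critIn (Pi.single j 1) = ((2 : ℂ) • fb (modeOf j), -fb (modeOf j)) := by
  refine Prod.ext ?_ ?_
  · rw [critIn_fst]; fin_cases j <;> simp
  · rw [critIn_snd]; fin_cases j <;> simp

/-- The rank two operator which shifts the critical modes. -/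
def shiftOp : State →L[ℂ] State := critIn ∘L critOut

theorem cf_modes (c : Fin 2 → ℂ) (n : ℤ) : cf n (c 0 • fb 1 + c 1 • fb (-1)) =
    (if n = 1 then c 0 else 0) + (if n = -1 then c 1 else 0) := by
  simp only [map_add, map_smul, cf_fb, smul_eq_mul, mul_ite, mul_one, mul_zero]

theorem cf_modes_critOut (V : State) (n : ℤ) :
    cf n (critOut V 0 • fb 1 + critOut V 1 • fb (-1)) = critMode n * cf n V.2 := by
  rw [cf_modes]
  simp only [critOut_apply, modeOf_zero, modeOf_one, critMode]
  by_cases h1 : n = 1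
  · subst h1; simp
  · by_cases h2 : n = -1
    · subst h2; simp
    · simp [h1, h2]

theorem cf_shiftOp_fst (V : State) (n : ℤ) :
    cf n (shiftOp V).1 = 2 * critMode n * cf n V.2 := by
  rw [shiftOp, ContinuousLinearMap.comp_apply, critIn_fst, map_smul, cf_modes_critOut, smul_eq_mul,
    mul_assoc]

theorem cf_shiftOp_snd (V : State) (n : ℤ) :
    cf n (shiftOp V).2 = -critMode n * cf n V.2 := by
  rw [shiftOp, ContinuousLinearMap.comp_apply, critIn_snd, map_neg, cf_modes_critOut, neg_mul]

/-- The sign comes from the second component of `(2, -1)`. By it `shiftOp` acts as `-1` on the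
critical directions, which moves them into the left half plane. -/
theorem critOut_critIn (c : Fin 2 → ℂ) : critOut (critIn c) = -c := by
  ext j
  rw [critOut_apply, critIn_snd, map_neg, cf_modes]
  fin_cases j <;> simp

theorem norm_critIn_le : ‖critIn‖ ≤ 4 := by
  refine ContinuousLinearMap.opNorm_le_bound _ (by norm_num) fun c => ?_
  have h : ‖c 0 • fb 1 + c 1 • fb (-1)‖ ≤ 2 * ‖c‖ := by
    refine (norm_add_le _ _).trans ?_
    rw [norm_smul, norm_smul, norm_fb, norm_fb]
    linarith [norm_le_pi_norm c 0, norm_le_pi_norm c 1]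
  refine max_le ?_ ?_
  · rw [critIn_fst, norm_smul]; norm_num; linarith
  · rw [critIn_snd, norm_neg]; linarith [norm_nonneg c]

theorem norm_critOut_le : ‖critOut‖ ≤ 1 := by
  refine ContinuousLinearMap.opNorm_le_bound _ (by norm_num) fun V => ?_
  rw [one_mul, pi_norm_le_iff_of_nonneg (norm_nonneg _)]
  intro j
  rw [critOut_apply]
  exact (norm_cf_le _ _).trans (norm_snd_le V)

/-- The ranges of `κ` and `σ` keep `q` below `0.275` for `n = 0` and above `2.02` for `|n| ≥ 2`,
away from the critical value `q = 1`. -/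
theorem qv_far {κ σ : ℝ} (hκ : |κ - 1| ≤ 1 / 10) (hσ : |σ| ≤ 1 / 2) {n : ℤ} (h1 : n ≠ 1)
    (h2 : n ≠ -1) : qv κ σ n ≤ 1 / 2 ∨ 9 / 5 ≤ qv κ σ n := by
  have hκ' := abs_le.1 hκ
  have hσ' := abs_le.1 hσ
  unfold qv
  rcases lt_trichotomy n 0 with h | h | h
  · right
    have : (n : ℝ) ≤ -2 := by exact_mod_cast (by omega : n ≤ -2)
    have h3 : 9 / 4 ≤ ((n : ℝ) + σ) ^ 2 := by nlinarith
    nlinarith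
  · left
    subst h
    have h3 : (((0 : ℤ) : ℝ) + σ) ^ 2 ≤ 1 / 4 := by push_cast; nlinarith
    nlinarith [sq_nonneg (((0 : ℤ) : ℝ) + σ)]
  · right
    have : (2 : ℝ) ≤ n := by exact_mod_cast (by omega : 2 ≤ n)
    have h3 : 9 / 4 ≤ ((n : ℝ) + σ) ^ 2 := by nlinarith
    nlinarith

theorem det_far {q b : ℝ} (hq : 0 ≤ q) (hb : |b| ≤ 1 / 10) (h : q ≤ 1 / 2 ∨ 9 / 5 ≤ q) :
    1 / 5 * (1 + q) ^ 2 ≤ 4 * ((q - 1) ^ 2 - b * q) := by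
  have hb' := abs_le.1 hb
  have h1 : b * q ≤ q / 10 := by nlinarith
  rcases h with h | h <;> nlinarith

/-- On the modes `±1` the determinant may vanish, but the shift adds `q + b + 5`; on all other modes
the determinant is large by itself. -/
theorem admissible_shift {κ b σ : ℝ} (hκ : |κ - 1| ≤ 1 / 10) (hb : |b| ≤ 1 / 10)
    (hσ : |σ| ≤ 1 / 2) : Admissible (1 / 5) κ b σ critMode where
  c_pos := by norm_num
  c_le := by norm_num
  κ_bd := hκ
  b_bd := hb
  σ_bd := hσ
  χ_bd n := by unfold critMode; split_ifs <;> norm_num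
  det_bd n := by
    have hq : 0 ≤ qv κ σ n := mul_nonneg (by linarith [(abs_le.1 hκ).1]) (sq_nonneg _)
    by_cases h : n = 1 ∨ n = -1
    · rw [critMode, if_pos h]
      have hb' := abs_le.1 hb
      nlinarith [sq_nonneg (qv κ σ n - 1)]
    · rw [critMode, if_neg h, zero_mul, add_zero]
      exact det_far hq hb (qv_far hκ hσ (fun h' => h (Or.inl h')) (fun h' => h (Or.inr h')))

/-- No shift is needed when `|σ| ≥ s`: on the modes `±1` the term `t (2 + t)`, `t = ±σ`, forces `|q
- 1| ≥ s`, since the detuning `κ - 1` is too small to compensate. The determinant is then of order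
`s²`. -/
theorem admissible_noncritical {κ b σ s : ℝ} (hs : 0 < s) (hs' : s ≤ 1 / 2)
    (hκ : |κ - 1| ≤ s / 10) (hb : |b| ≤ s ^ 2 / 10) (hσ : |σ| ≤ 1 / 2) (hσs : s ≤ |σ|) :
    Admissible (s ^ 2 / 8) κ b σ 0 where
  c_pos := by positivity
  c_le := by nlinarith
  κ_bd := by linarith
  b_bd := by nlinarith
  σ_bd := hσ
  χ_bd n := by simp
  det_bd n := by
    have hκ1 : |κ - 1| ≤ 1 / 10 := by linarith
    have hb1 : |b| ≤ 1 / 10 := by nlinarith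
    have hκ' := abs_le.1 hκ
    have hσ' := abs_le.1 hσ
    have hb' := abs_le.1 hb
    have hq : 0 ≤ qv κ σ n := mul_nonneg (by linarith [(abs_le.1 hκ).1]) (sq_nonneg _)
    rw [Pi.zero_apply, zero_mul, add_zero]
    by_cases h : n = 1 ∨ n = -1
    · have key : ∀ t : ℝ, |t| ≤ 1 / 2 → s ≤ |t| → s ^ 2 / 8 * (1 + κ * (1 + t) ^ 2) ^ 2 ≤
          4 * ((κ * (1 + t) ^ 2 - 1) ^ 2 - b * (κ * (1 + t) ^ 2)) := by
        intro t ht hts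
        have ht' := abs_le.1 ht
        have hp : (1 + t) ^ 2 ≤ 9 / 4 := by nlinarith
        have hq2 : κ * (1 + t) ^ 2 ≤ 5 / 2 := by nlinarith [sq_nonneg (1 + t)]
        have hq0 : 0 ≤ κ * (1 + t) ^ 2 := mul_nonneg (by linarith) (sq_nonneg _)
        have hd : s ^ 2 ≤ (κ * (1 + t) ^ 2 - 1) ^ 2 := by
          have e : κ * (1 + t) ^ 2 - 1 = (κ - 1) * (1 + t) ^ 2 + t * (2 + t) := by ring
          have h1 : |(κ - 1) * (1 + t) ^ 2| ≤ s / 10 * (9 / 4) := by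
            rw [abs_mul, abs_of_nonneg (sq_nonneg (1 + t))]; gcongr
          have h2 : 3 / 2 * s ≤ |t * (2 + t)| := by
            rw [abs_mul, abs_of_nonneg (by linarith : 0 ≤ 2 + t)]; nlinarith [abs_nonneg t]
          have h3 : s ≤ |κ * (1 + t) ^ 2 - 1| := by
            rw [e]
            have := abs_sub_abs_le_abs_sub (t * (2 + t)) (-((κ - 1) * (1 + t) ^ 2))
            rw [abs_neg, sub_neg_eq_add, add_comm (t * (2 + t))] at this
            linarith
          rw [← sq_abs (κ * (1 + t) ^ 2 - 1)]
          gcongr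
        have hbq : b * (κ * (1 + t) ^ 2) ≤ s ^ 2 / 10 * (5 / 2) := by
          refine (mul_le_mul_of_nonneg_right hb'.2 hq0).trans ?_
          gcongr
        have hq3 : (1 + κ * (1 + t) ^ 2) ^ 2 ≤ 49 / 4 := by nlinarith
        have : s ^ 2 / 8 * (1 + κ * (1 + t) ^ 2) ^ 2 ≤ s ^ 2 / 8 * (49 / 4) := by gcongr
        nlinarith
      rcases h with h | h
      · subst h
        have := key σ hσ hσs
        simpa [qv] using this
      · subst h
        have := key (-σ) (by rwa [abs_neg]) (by rwa [abs_neg])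
        have e : (1 + -σ) ^ 2 = (-1 + σ) ^ 2 := by ring
        rw [e] at this
        simpa [qv] using this
    · refine le_trans ?_ (det_far hq hb1
        (qv_far hκ1 hσ (fun h' => h (Or.inl h')) (fun h' => h (Or.inr h'))))
      have : s ^ 2 / 8 ≤ 1 / 5 := by nlinarith
      exact mul_le_mul_of_nonneg_right this (sq_nonneg _)

/-- The resolvent of the shifted constant coefficient operator. -/
abbrev shiftRes (κ b σ : ℝ) (z : ℂ) : State →L[ℂ] State := resMult 1 κ b σ critMode z

theorem isInv_shiftRes {κ b σ : ℝ} (hκ : |κ - 1| ≤ 1 / 10) (hb : |b| ≤ 1 / 10)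
    (hσ : |σ| ≤ 1 / 2) {z : ℂ} (hz : -(1 / 160) ≤ z.re) :
    IsInv (linOp κ b σ + onDom dom shiftOp - z • dom.subtype) (shiftRes κ b σ z) :=
  (admissible_shift hκ hb hσ).isInv (by linarith) cf_shiftOp_fst cf_shiftOp_snd

theorem Admissible.norm_resMult_one_le {c κ b σ : ℝ} {χ : ℤ → ℝ} (h : Admissible c κ b σ χ) {z : ℂ}
    (hz : -(c / 32) ≤ z.re) : ‖resMult 1 κ b σ χ z‖ ≤ 6144 / c := by
  have := norm_resMult_le h hz (w := 1) (K := 1) fun n => by simp [h.qv_nonneg n]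
  refine this.trans (le_of_eq ?_)
  ring

theorem norm_shiftRes_le {κ b σ : ℝ} (hκ : |κ - 1| ≤ 1 / 10) (hb : |b| ≤ 1 / 10)
    (hσ : |σ| ≤ 1 / 2) {z : ℂ} (hz : -(1 / 160) ≤ z.re) : ‖shiftRes κ b σ z‖ ≤ 30720 := by
  have := (admissible_shift hκ hb hσ).norm_resMult_one_le (z := z) (by linarith)
  norm_num at this ⊢
  exact this

/-- At the bifurcation point the critical directions are null vectors, so the shifted operator acts
on them as `shiftOp`, that is as `-1`. This is the base point of the implicit function argument. -/
theorem shiftRes_critIn : shiftRes 1 0 0 0 ∘L critIn = -critIn := by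
  have hA := admissible_shift (κ := 1) (b := 0) (σ := 0) (by norm_num) (by norm_num) (by norm_num)
  have hw1 : ∀ n : ℤ, ‖(1 : ℤ → ℂ) n‖ ≤ 1 * (1 + qv 1 0 n) := fun n => by
    simp [hA.qv_nonneg n]
  have hz : -((1 / 5 : ℝ) / 32) ≤ (0 : ℂ).re := by norm_num
  ext1 c
  rw [ContinuousLinearMap.comp_apply]
  refine State_ext (fun n => ?_) (fun n => ?_)
  · rw [cf_resMult_fst hA hz hw1, neg_apply, Prod.fst_neg, map_neg, critIn_fst, critIn_snd,
      map_smul, map_neg, cf_modes]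
    by_cases h : n = 1 ∨ n = -1
    · have : qv 1 0 n = 1 := by rcases h with h | h <;> subst h <;> norm_num [qv]
      simp only [symDet, critMode, if_pos h, this]
      norm_num
      ring
    · have h1 : n ≠ 1 := fun h' => h (Or.inl h')
      have h2 : n ≠ -1 := fun h' => h (Or.inr h')
      simp [h1, h2]
  · rw [cf_resMult_snd hA hz hw1, neg_apply, Prod.snd_neg, map_neg, critIn_fst, critIn_snd,
      map_smul, map_neg, cf_modes]
    by_cases h : n = 1 ∨ n = -1
    · have : qv 1 0 n = 1 := by rcases h with h | h <;> subst h <;> norm_num [qv]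
      simp only [symDet, critMode, if_pos h, this]
      norm_num
      ring
    · have h1 : n ≠ 1 := fun h' => h (Or.inl h')
      have h2 : n ≠ -1 := fun h' => h (Or.inr h')
      simp [h1, h2]

/-! ### Cosine series of continuous functions -/

/-- A function on the circle is even. -/
def IsEven (g : C(Circ, ℝ)) : Prop := ∀ x, g (-x) = g x

theorem IsEven.add {f g : C(Circ, ℝ)} (hf : IsEven f) (hg : IsEven g) : IsEven (f + g) :=
  fun x => by simp [hf x, hg x]

theorem IsEven.mul {f g : C(Circ, ℝ)} (hf : IsEven f) (hg : IsEven g) : IsEven (f * g) :=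
  fun x => by simp [hf x, hg x]

theorem IsEven.pow {f : C(Circ, ℝ)} (hf : IsEven f) (k : ℕ) : IsEven (f ^ k) :=
  fun x => by simp [hf x]

theorem IsEven.smul {f : C(Circ, ℝ)} (hf : IsEven f) (c : ℝ) : IsEven (c • f) :=
  fun x => by simp [hf x]

/-- The function `cos (n ξ)`. -/
def cosn (n : ℤ) : C(Circ, ℝ) :=
  ⟨fun x => (fourier n x).re, Complex.continuous_re.comp (fourier n).continuous⟩

theorem cosn_apply (n : ℤ) (x : Circ) : cosn n x = (fourier n x).re := rfl

theorem norm_cosn_le (n : ℤ) : ‖cosn n‖ ≤ 1 := by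
  rw [ContinuousMap.norm_le _ zero_le_one]
  intro x
  rw [cosn_apply, Real.norm_eq_abs]
  refine (Complex.abs_re_le_norm _).trans ?_
  exact ((fourier n).norm_coe_le_norm x).trans (fourier_norm n).le

theorem cosn_even (n : ℤ) : IsEven (cosn n) := by
  intro x
  have : fourier n (-x) = fourier (-n) x := by
    simp only [fourier_apply]; congr 2; simp
  rw [cosn_apply, cosn_apply, this, fourier_neg, Complex.conj_re]

theorem cosn_neg (n : ℤ) : cosn (-n) = cosn n := by
  ext x; rw [cosn_apply, cosn_apply, fourier_neg, Complex.conj_re]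

theorem cosn_mul (n m : ℤ) : cosn n * cosn m = (1 / 2 : ℝ) • (cosn (n + m) + cosn (n - m)) := by
  ext x
  simp only [ContinuousMap.mul_apply, ContinuousMap.smul_apply, ContinuousMap.add_apply,
    cosn_apply, sub_eq_add_neg, fourier_add, fourier_neg, smul_eq_mul, Complex.mul_re,
    Complex.conj_re, Complex.conj_im]
  ring

theorem complexify_cosn (n : ℤ) :
    complexify (cosn n) = (1 / 2 : ℂ) • (fourier n + fourier (-n)) := by
  ext x
  change ((cosn n x : ℝ) : ℂ) = (1 / 2 : ℂ) * (fourier n x + fourier (-n) x)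
  rw [fourier_neg, Complex.add_conj, cosn_apply]
  push_cast; ring

theorem toL2_cosn (n : ℤ) : toL2 (cosn n) = (1 / 2 : ℂ) • (fb n + fb (-n)) := by
  rw [toL2, complexify_cosn, map_smul, map_add, fb, fb, coe_fourierBasis]

theorem cf_cosn (n m : ℤ) : cf n (toL2 (cosn m)) =
    1 / 2 * ((if n = m then 1 else 0) + (if n = -m then 1 else 0)) := by
  rw [toL2_cosn, map_smul, map_add, cf_fb, cf_fb, smul_eq_mul]

/-- `toL2` as a bounded real linear map. -/
def toL2L : C(Circ, ℝ) →L[ℝ] L2 :=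
  LinearMap.mkContinuous
    { toFun := toL2
      map_add' := toL2_add
      map_smul' := fun c g => by rw [toL2_smul]; rfl } 1 fun g => by
    rw [one_mul]; exact norm_toL2_le g

/-- The cosine coefficient `∫ g cos(nξ)`. -/
def cc (n : ℤ) : C(Circ, ℝ) →L[ℝ] ℝ :=
  Complex.reCLM ∘L (cf n).restrictScalars ℝ ∘L toL2L

theorem cc_apply (n : ℤ) (g : C(Circ, ℝ)) : cc n g = (cf n (toL2 g)).re := rfl

theorem abs_cc_le (n : ℤ) (g : C(Circ, ℝ)) : |cc n g| ≤ ‖g‖ := by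
  rw [cc_apply]
  exact (Complex.abs_re_le_norm _).trans ((norm_cf_le _ _).trans (norm_toL2_le g))

theorem star_toL2 (g : C(Circ, ℝ)) : star (toL2 g) = toL2 g := by
  apply Lp.ext
  filter_upwards [star_ae (toL2 g), toL2_ae g] with x h1 h2
  rw [h1, h2, Complex.conj_ofReal]

theorem cf_neg_toL2 (n : ℤ) (g : C(Circ, ℝ)) :
    cf (-n) (toL2 g) = (starRingEnd ℂ) (cf n (toL2 g)) := by
  have := cf_star (-n) (toL2 g)
  rwa [star_toL2, neg_neg] at this

theorem cc_neg (n : ℤ) (g : C(Circ, ℝ)) : cc (-n) g = cc n g := by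
  rw [cc_apply, cc_apply, cf_neg_toL2, Complex.conj_re]

theorem IsEven.cf_eq {g : C(Circ, ℝ)} (hg : IsEven g) (n : ℤ) : cf n (toL2 g) = cc n g := by
  have h1 : reflL (toL2 g) = toL2 g := by
    apply Lp.ext
    have h4 := neg_measurePreserving.quasiMeasurePreserving.ae (toL2_ae g)
    filter_upwards [reflL_ae (toL2 g), toL2_ae g, h4] with x h1 h2 h3
    rw [h1, h2, h3, hg]
  have h2 : cf n (toL2 g) = (starRingEnd ℂ) (cf n (toL2 g)) := by
    rw [← cf_neg_toL2, ← cf_reflL, h1]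
  rw [cc_apply]
  exact (Complex.conj_eq_iff_re.1 h2.symm).symm

theorem IsEven.ext_cc {f g : C(Circ, ℝ)} (hf : IsEven f) (hg : IsEven g)
    (h : ∀ n, cc n f = cc n g) : f = g :=
  toL2_injective (L2_ext fun n => by rw [hf.cf_eq, hg.cf_eq, h])

theorem cc_cosn (n m : ℤ) :
    cc n (cosn m) = 1 / 2 * ((if n = m then 1 else 0) + (if n = -m then 1 else 0)) := by
  have h := (cosn_even m).cf_eq n
  rw [cf_cosn] at h
  apply Complex.ofReal_injective
  rw [← h]; split_ifs <;> norm_num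

theorem summable_smul_cosn {a : ℤ → ℝ} (ha : Summable fun n => |a n|) :
    Summable fun n => a n • cosn n := by
  refine Summable.of_norm (Summable.of_nonneg_of_le (fun _ => norm_nonneg _) (fun n => ?_) ha)
  rw [norm_smul, Real.norm_eq_abs]
  exact mul_le_of_le_one_right (abs_nonneg _) (norm_cosn_le n)

/-- The cosine series with coefficients `a`. -/
def synth (a : ℤ → ℝ) : C(Circ, ℝ) := ∑' n, a n • cosn n

section Synth

variable {a : ℤ → ℝ} (ha : Summable fun n => |a n|)
include ha

theorem hasSum_synth : HasSum (fun n => a n • cosn n) (synth a) := (summable_smul_cosn ha).hasSum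

theorem norm_synth_le : ‖synth a‖ ≤ ∑' n, |a n| := by
  have hn : Summable fun n => ‖a n • cosn n‖ :=
    Summable.of_nonneg_of_le (fun _ => norm_nonneg _) (fun n => by
      rw [norm_smul, Real.norm_eq_abs]
      exact mul_le_of_le_one_right (abs_nonneg _) (norm_cosn_le n)) ha
  refine (norm_tsum_le_tsum_norm hn).trans (hn.tsum_le_tsum (fun n => ?_) ha)
  rw [norm_smul, Real.norm_eq_abs]
  exact mul_le_of_le_one_right (abs_nonneg _) (norm_cosn_le n)

theorem synth_even : IsEven (synth a) := fun x => by
  have h := hasSum_synth ha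
  have h1 := h.mapL (ContinuousMap.evalCLM ℝ (-x))
  have h2 := h.mapL (ContinuousMap.evalCLM ℝ x)
  refine h1.unique (h2.congr_fun ?_)
  intro n
  simp only [ContinuousMap.evalCLM_apply, ContinuousMap.smul_apply, cosn_even n x]

/-- The indices `n` and `-n` give the same cosine, and each contributes half of the coefficient; for
`n = 0` the two halves fall on one index. -/
theorem cc_synth (hev : ∀ n, a (-n) = a n) (n : ℤ) : cc n (synth a) = a n := by
  have h1 := (hasSum_synth ha).mapL (cc n)
  have h2 : ∀ k, cc n (a k • cosn k) =
      (if k = n then a n / 2 else 0) + (if k = -n then a n / 2 else 0) := fun k => by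
    rw [map_smul, cc_cosn, smul_eq_mul]
    have e1 : (n = k) = (k = n) := propext eq_comm
    have e2 : (n = -k) = (k = -n) := by
      apply propext; constructor <;> intro h <;> omega
    simp only [e1, e2]
    by_cases h : k = n
    · subst h
      split_ifs <;> ring
    · by_cases h' : k = -n
      · subst h'
        rw [hev]; simp [h]; ring
      · simp [h, h']
  have h3 : HasSum (fun k => (if k = n then a n / 2 else 0) + (if k = -n then a n / 2 else 0))
      (a n / 2 + a n / 2) := (hasSum_ite_eq n _).add (hasSum_ite_eq (-n) _)
  have := h1.unique (h3.congr_fun h2)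
  rw [this]; ring

end Synth

theorem summable_one_div_one_add_sq : Summable fun n : ℤ => 1 / (1 + (n : ℝ) ^ 2) := by
  have h : Summable fun n : ℤ => 1 / (n : ℝ) ^ 2 := Real.summable_one_div_int_pow.2 (by norm_num)
  refine Summable.of_norm_bounded_eventually (g := fun n : ℤ => 1 / (n : ℝ) ^ 2) h ?_
  rw [Filter.eventually_cofinite]
  refine (Set.finite_singleton (0 : ℤ)).subset fun n hn => ?_
  by_contra h0
  apply hn
  have : (n : ℝ) ≠ 0 := by exact_mod_cast h0
  rw [Real.norm_of_nonneg (by positivity)]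
  gcongr
  linarith

/-- The value of `∑ 1 / (1 + n²)`. -/
def sumInv : ℝ := ∑' n : ℤ, 1 / (1 + (n : ℝ) ^ 2)

theorem one_le_sumInv : 1 ≤ sumInv := by
  have := summable_one_div_one_add_sq.le_tsum 0 (fun n _ => by positivity)
  simpa [sumInv] using this

section Kmul

variable {m : ℤ → ℝ} {C : ℝ} (hm : ∀ n : ℤ, |m n| ≤ C * (1 / (1 + (n : ℝ) ^ 2)))
include hm

theorem summable_mul_cc (g : C(Circ, ℝ)) : Summable fun n => |m n * cc n g| := by
  have : Summable fun n : ℤ => C * (1 / (1 + (n : ℝ) ^ 2)) * ‖g‖ :=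
    (summable_one_div_one_add_sq.mul_left C).mul_right _
  refine Summable.of_nonneg_of_le (fun _ => abs_nonneg _) (fun n => ?_) this
  rw [abs_mul]
  exact mul_le_mul (hm n) (abs_cc_le n g) (abs_nonneg _) ((abs_nonneg _).trans (hm n))

theorem norm_synth_mul_cc_le (g : C(Circ, ℝ)) :
    ‖synth fun n => m n * cc n g‖ ≤ C * sumInv * ‖g‖ := by
  refine (norm_synth_le (summable_mul_cc hm g)).trans ?_
  have : Summable fun n : ℤ => C * (1 / (1 + (n : ℝ) ^ 2)) * ‖g‖ :=
    (summable_one_div_one_add_sq.mul_left C).mul_right _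
  refine ((summable_mul_cc hm g).tsum_le_tsum (fun n => ?_) this).trans ?_
  · rw [abs_mul]
    exact mul_le_mul (hm n) (abs_cc_le n g) (abs_nonneg _) ((abs_nonneg _).trans (hm n))
  · rw [tsum_mul_right, tsum_mul_left, sumInv]

/-- Fourier multipliers of order `-2` act boundedly on continuous functions (after projection to
the even functions). -/
theorem exists_Kmul (hev : ∀ n, m (-n) = m n) : ∃ L : C(Circ, ℝ) →L[ℝ] C(Circ, ℝ),
    (∀ g, ‖L g‖ ≤ C * sumInv * ‖g‖) ∧ (∀ g, IsEven (L g)) ∧ ∀ g n, cc n (L g) = m n * cc n g := by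
  let L : C(Circ, ℝ) →ₗ[ℝ] C(Circ, ℝ) :=
    { toFun := fun g => synth fun n => m n * cc n g
      map_add' := fun f g => by
        have h := (hasSum_synth (summable_mul_cc hm f)).add (hasSum_synth (summable_mul_cc hm g))
        refine (hasSum_synth (summable_mul_cc hm (f + g))).unique (h.congr_fun fun n => ?_)
        rw [map_add]; module
      map_smul' := fun c g => by
        have h := (hasSum_synth (summable_mul_cc hm g)).const_smul c
        refine (hasSum_synth (summable_mul_cc hm (c • g))).unique (h.congr_fun fun n => ?_)
        rw [map_smul, smul_eq_mul]; module }
  refine ⟨L.mkContinuous (C * sumInv) (norm_synth_mul_cc_le hm), norm_synth_mul_cc_le hm,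
    fun g => synth_even (summable_mul_cc hm g), fun g n => ?_⟩
  exact cc_synth (summable_mul_cc hm g) (fun n => by rw [hev, cc_neg]) n

end Kmul

theorem normH2_eq {v w : L2} (h : ∀ n : ℤ, cf n w = (1 + (n : ℂ) ^ 2) * cf n v) :
    normH2 v = ‖w‖ := by
  have e : ∀ n : ℤ, ((1 + (n : ℝ) ^ 2) * ‖fourierCoeff v n‖) ^ 2 = ‖cf n w‖ ^ 2 := fun n => by
    have e2 : (1 + (n : ℂ) ^ 2) = ((1 + (n : ℝ) ^ 2 : ℝ) : ℂ) := by push_cast; rfl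
    rw [h, norm_mul, e2, Complex.norm_real, Real.norm_of_nonneg (by positivity), cf_apply]
  rw [normH2]
  simp only [e]
  rw [tsum_sq_cf, Real.sqrt_sq (norm_nonneg _)]

theorem exists_cf_of_mem_H2 {v : L2} (hv : v ∈ H2) :
    ∃ w : L2, ∀ n : ℤ, cf n w = (1 + (n : ℂ) ^ 2) * cf n v := by
  have hv' : Memℓp (fun n : ℤ => (1 + (n : ℂ) ^ 2) * fourierCoeff v n) 2 := hv
  refine ⟨fourierBasis.repr.symm ⟨_, hv'⟩, fun n => ?_⟩
  rw [cf_eq_repr, LinearIsometryEquiv.apply_symm_apply, cf_apply]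

/-- Sobolev embedding with an explicit constant: the cosine coefficients are bounded by `‖w‖ / (1 +
n²)`, so the series converges absolutely to `g`. -/
theorem IsEven.norm_le_normH2 {g : C(Circ, ℝ)} (hg : IsEven g) (h : toL2 g ∈ H2) :
    ‖g‖ ≤ sumInv * normH2 (toL2 g) := by
  obtain ⟨w, hw⟩ := exists_cf_of_mem_H2 h
  rw [normH2_eq hw]
  have hb : ∀ n : ℤ, |cc n g| ≤ 1 / (1 + (n : ℝ) ^ 2) * ‖w‖ := fun n => by
    have e2 : (1 + (n : ℂ) ^ 2) = ((1 + (n : ℝ) ^ 2 : ℝ) : ℂ) := by push_cast; rfl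
    have := norm_cf_le n w
    rw [hw, norm_mul, e2, Complex.norm_real, Real.norm_of_nonneg (by positivity), hg.cf_eq,
      Complex.norm_real, Real.norm_eq_abs] at this
    rw [div_mul_eq_mul_div, one_mul, le_div_iff₀ (by positivity), mul_comm]
    exact this
  have hs : Summable fun n : ℤ => 1 / (1 + (n : ℝ) ^ 2) * ‖w‖ :=
    summable_one_div_one_add_sq.mul_right _
  have ha : Summable fun n => |cc n g| := Summable.of_nonneg_of_le (fun _ => abs_nonneg _) hb hs
  have e : g = synth fun n => cc n g :=
    hg.ext_cc (synth_even ha) fun n => (cc_synth ha (fun n => cc_neg n g) n).symm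
  rw [e]
  refine (norm_synth_le ha).trans ((ha.tsum_le_tsum hb hs).trans ?_)
  rw [tsum_mul_right, sumInv]

/-! ### The steady state equation -/

/-- The nonlinear part of the reaction term. -/
def nonlin (b : ℝ) (u : Profile) : C(Circ, ℝ) :=
  (b / 2 + 2) • u.1 ^ 2 + (4 : ℝ) • (u.1 * u.2) + u.1 ^ 2 * u.2

/-- The nonlinearity rescaled by the amplitude `s`. -/
def nl (b s : ℝ) (y : Profile) : C(Circ, ℝ) :=
  (b / 2 + 2) • y.1 ^ 2 + (4 : ℝ) • (y.1 * y.2) + s • (y.1 ^ 2 * y.2)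

theorem nonlin_smul (b s : ℝ) (y : Profile) : nonlin b (s • y) = s ^ 2 • nl b s y := by
  ext x
  simp only [nonlin, nl, Prod.smul_fst, Prod.smul_snd, ContinuousMap.add_apply,
    ContinuousMap.smul_apply, ContinuousMap.mul_apply, ContinuousMap.pow_apply, smul_eq_mul]
  ring

theorem nonlin_even (b : ℝ) {u : Profile} (h₁ : IsEven u.1) (h₂ : IsEven u.2) :
    IsEven (nonlin b u) :=
  (((h₁.pow 2).smul _).add ((h₁.mul h₂).smul _)).add ((h₁.pow 2).mul h₂)

theorem norm_profile_le {y : Profile} {R : ℝ} (h : ‖y‖ ≤ R) (x : Circ) :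
    |y.1 x| ≤ R ∧ |y.2 x| ≤ R :=
  ⟨(y.1.norm_coe_le_norm x).trans ((norm_fst_le y).trans h),
    (y.2.norm_coe_le_norm x).trans ((norm_snd_le y).trans h)⟩

theorem norm_nonlin_le {b : ℝ} (hb : |b| ≤ 1) {u : Profile} (hu : ‖u‖ ≤ 1) :
    ‖nonlin b u‖ ≤ 10 * ‖u‖ ^ 2 := by
  rw [ContinuousMap.norm_le _ (by positivity)]
  intro x
  obtain ⟨h1, h2⟩ := norm_profile_le le_rfl x (y := u)
  simp only [nonlin, ContinuousMap.add_apply, ContinuousMap.smul_apply, ContinuousMap.mul_apply,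
    ContinuousMap.pow_apply, smul_eq_mul, Real.norm_eq_abs]
  have h3 : |b / 2 + 2| ≤ 3 := by rw [abs_le] at hb ⊢; constructor <;> linarith
  calc |(b / 2 + 2) * u.1 x ^ 2 + 4 * (u.1 x * u.2 x) + u.1 x ^ 2 * u.2 x|
      ≤ |b / 2 + 2| * |u.1 x| ^ 2 + 4 * (|u.1 x| * |u.2 x|) + |u.1 x| ^ 2 * |u.2 x| := by
        refine (abs_add_le _ _).trans (add_le_add ((abs_add_le _ _).trans (add_le_add ?_ ?_)) ?_)
        · rw [abs_mul, abs_pow]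
        · rw [abs_mul, abs_mul]; norm_num
        · rw [abs_mul, abs_pow]
    _ ≤ 3 * ‖u‖ ^ 2 + 4 * (‖u‖ * ‖u‖) + ‖u‖ ^ 2 * 1 := by
        gcongr
        exact h2.trans hu
    _ ≤ 10 * ‖u‖ ^ 2 := by nlinarith [sq_nonneg ‖u‖]

theorem norm_nl_sub_le {b s t : ℝ} (hb : |b| ≤ 1) (hs : |s| ≤ 1) {y y' : Profile}
    (hy : ‖y‖ ≤ 20) (hy' : ‖y'‖ ≤ 20) :
    ‖nl b s y - nl b t y'‖ ≤ 10000 * (‖y - y'‖ + |s - t|) := by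
  rw [ContinuousMap.norm_le _ (by positivity)]
  intro x
  obtain ⟨h1, h2⟩ := norm_profile_le hy x
  obtain ⟨h1', h2'⟩ := norm_profile_le hy' x
  obtain ⟨d1, d2⟩ := norm_profile_le le_rfl x (y := y - y')
  simp only [nl, Prod.fst_sub, Prod.snd_sub, ContinuousMap.add_apply, ContinuousMap.sub_apply,
    ContinuousMap.smul_apply, ContinuousMap.mul_apply,
    ContinuousMap.pow_apply, smul_eq_mul, Real.norm_eq_abs] at d1 d2 ⊢
  set a := y.1 x
  set c := y.2 x
  set a' := y'.1 x
  set c' := y'.2 x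
  set D := ‖y - y'‖
  have hD : 0 ≤ D := norm_nonneg _
  have h3 : |b / 2 + 2| ≤ 5 / 2 := by rw [abs_le] at hb ⊢; constructor <;> linarith
  have e : (b / 2 + 2) * a ^ 2 + 4 * (a * c) + s * (a ^ 2 * c) -
      ((b / 2 + 2) * a' ^ 2 + 4 * (a' * c') + t * (a' ^ 2 * c')) =
      (b / 2 + 2) * ((a + a') * (a - a')) + 4 * (a * (c - c') + c' * (a - a')) +
      (s * (a ^ 2 * (c - c') + c' * ((a + a') * (a - a'))) + (s - t) * (a' ^ 2 * c')) := by ring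
  rw [e]
  have haa : |a + a'| ≤ 40 := (abs_add_le _ _).trans (by linarith)
  have t1 : |(b / 2 + 2) * ((a + a') * (a - a'))| ≤ 5 / 2 * (40 * D) := by
    rw [abs_mul, abs_mul]; gcongr
  have t2 : |4 * (a * (c - c') + c' * (a - a'))| ≤ 4 * (20 * D + 20 * D) := by
    rw [abs_mul, abs_of_pos (by norm_num : (0 : ℝ) < 4)]
    gcongr
    refine (abs_add_le _ _).trans (add_le_add ?_ ?_) <;> rw [abs_mul] <;> gcongr
  have t3 : |s * (a ^ 2 * (c - c') + c' * ((a + a') * (a - a')))| ≤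
      1 * (20 ^ 2 * D + 20 * (40 * D)) := by
    rw [abs_mul]
    gcongr
    refine (abs_add_le _ _).trans (add_le_add ?_ ?_)
    · rw [abs_mul, abs_pow]; gcongr
    · rw [abs_mul, abs_mul]; gcongr
  have t4 : |(s - t) * (a' ^ 2 * c')| ≤ |s - t| * (20 ^ 2 * 20) := by
    rw [abs_mul, abs_mul, abs_pow]; gcongr
  refine (abs_add_le _ _).trans ?_
  refine (add_le_add ((abs_add_le _ _).trans (add_le_add t1 t2))
    ((abs_add_le _ _).trans (add_le_add t3 t4))).trans ?_
  nlinarith [abs_nonneg (s - t)]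

/-! ### The critical profile and the cancellation of the quadratic terms. -/

/-- The critical profile `2 cos ξ (4κ, -(1+κ))`. -/
def critProfile (κ : ℝ) : Profile :=
  ((4 * κ) • ((2 : ℝ) • cosn 1), (-(1 + κ)) • ((2 : ℝ) • cosn 1))

theorem norm_critProfile_le {κ : ℝ} (hκ : |κ - 1| ≤ 1 / 10) : ‖critProfile κ‖ ≤ 10 := by
  have hκ' := abs_le.1 hκ
  have h := norm_cosn_le 1
  refine max_le ?_ ?_
  · simp only [critProfile]
    rw [norm_smul, norm_smul, Real.norm_of_nonneg (by linarith), Real.norm_of_nonneg (by norm_num)]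
    nlinarith [norm_nonneg (cosn 1)]
  · simp only [critProfile]
    rw [norm_smul, norm_smul, norm_neg, Real.norm_of_nonneg (by linarith),
      Real.norm_of_nonneg (by norm_num)]
    nlinarith [norm_nonneg (cosn 1)]

theorem critProfile_even (κ : ℝ) : IsEven (critProfile κ).1 ∧ IsEven (critProfile κ).2 :=
  ⟨((cosn_even 1).smul _).smul _, ((cosn_even 1).smul _).smul _⟩

theorem cc_critProfile (κ : ℝ) (n : ℤ) : cc n (critProfile κ).1 = critMode n * (4 * κ) ∧
    cc n (critProfile κ).2 = critMode n * (-(1 + κ)) := by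
  have : cc n ((2 : ℝ) • cosn 1) = critMode n := by
    rw [map_smul, cc_cosn, critMode, smul_eq_mul]
    by_cases h1 : n = 1
    · subst h1; norm_num
    · by_cases h2 : n = -1
      · subst h2; norm_num
      · simp [h1, h2]
  constructor
  · simp only [critProfile]; rw [map_smul, this, smul_eq_mul, mul_comm]
  · simp only [critProfile]; rw [map_smul, this, smul_eq_mul, mul_comm]

/-- The quadratic form of the nonlinearity nearly vanishes on the critical direction: the factor is
`O(|b| + |κ - 1|)`. Because of this the slaved modes are one order smaller than in a generic
bifurcation. -/
theorem nl_critProfile (b κ : ℝ) :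
    nl b 0 (critProfile κ) = (64 * κ * (b / 2 * κ + (κ - 1))) • (cosn 1 ^ 2) := by
  ext x
  simp only [nl, critProfile, ContinuousMap.add_apply, ContinuousMap.smul_apply,
    ContinuousMap.mul_apply, ContinuousMap.pow_apply, smul_eq_mul]
  ring

theorem norm_nl_critProfile_le {b κ : ℝ} (hκ : |κ - 1| ≤ 1 / 10) :
    ‖nl b 0 (critProfile κ)‖ ≤ 300 * (|b| + |κ - 1|) := by
  have hκ' := abs_le.1 hκ
  rw [nl_critProfile, norm_smul, Real.norm_eq_abs]
  have h1 : ‖cosn 1 ^ 2‖ ≤ 1 := by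
    refine (norm_pow_le _ 2).trans ?_
    exact pow_le_one₀ (norm_nonneg _) (norm_cosn_le 1)
  have h2 : |64 * κ * (b / 2 * κ + (κ - 1))| ≤ 300 * (|b| + |κ - 1|) := by
    rw [abs_mul, abs_mul, abs_of_pos (by norm_num : (0 : ℝ) < 64), abs_of_pos (by linarith : 0 < κ)]
    have h3 : |b / 2 * κ + (κ - 1)| ≤ |b| + |κ - 1| := by
      refine (abs_add_le _ _).trans (add_le_add_left ?_ _)
      rw [abs_mul, abs_div, abs_of_pos (by linarith : 0 < κ), abs_of_pos (by norm_num : (0 : ℝ) < 2)]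
      nlinarith [abs_nonneg b]
    have h4 : 64 * κ ≤ 300 := by linarith
    gcongr
  calc _ ≤ 300 * (|b| + |κ - 1|) * 1 := by gcongr
    _ = _ := mul_one _

/-- `cos²` contains only the harmonics `0` and `2`, so the quadratic terms do not enter the
bifurcation equation at lowest order. -/
theorem cc_one_nl_critProfile (b κ : ℝ) : cc 1 (nl b 0 (critProfile κ)) = 0 := by
  rw [nl_critProfile, pow_two, cosn_mul, map_smul, map_smul, map_add, cc_cosn, cc_cosn]
  norm_num

/-- The part of the rescaled nonlinearity of first order in the amplitude. -/
def nlRest (b s : ℝ) (e z : Profile) : C(Circ, ℝ) :=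
  (b / 2 + 2) • ((2 : ℝ) • (e.1 * z.1) + s • z.1 ^ 2) +
    (4 : ℝ) • (e.1 * z.2 + z.1 * e.2 + s • (z.1 * z.2)) + (e + s • z).1 ^ 2 * (e + s • z).2

theorem nl_eq_add (b s : ℝ) (e z : Profile) :
    nl b s (e + s • z) = nl b 0 e + s • nlRest b s e z := by
  ext x
  simp only [nl, nlRest, Prod.fst_add, Prod.snd_add, Prod.smul_fst, Prod.smul_snd,
    ContinuousMap.add_apply, ContinuousMap.smul_apply,
    ContinuousMap.mul_apply, ContinuousMap.pow_apply, smul_eq_mul]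
  ring

theorem norm_nlRest_sub_le {b s t : ℝ} (hb : |b| ≤ 1) (hs : |s| ≤ 1) (ht : |t| ≤ 1)
    {e z w : Profile} (he : ‖e‖ ≤ 10) (hz : ‖z‖ ≤ 1) (hw : ‖w‖ ≤ 1) :
    ‖nlRest b s e z - nlRest b t e w‖ ≤ 10000 * (‖z - w‖ + |s - t|) := by
  rw [ContinuousMap.norm_le _ (by positivity)]
  intro x
  obtain ⟨e1, e2⟩ := norm_profile_le he x
  obtain ⟨z1, z2⟩ := norm_profile_le hz x
  obtain ⟨w1, w2⟩ := norm_profile_le hw x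
  obtain ⟨d1, d2⟩ := norm_profile_le le_rfl x (y := z - w)
  simp only [nlRest, Prod.fst_sub, Prod.snd_sub, Prod.fst_add, Prod.snd_add, Prod.smul_fst,
    Prod.smul_snd, ContinuousMap.add_apply, ContinuousMap.sub_apply,
    ContinuousMap.smul_apply, ContinuousMap.mul_apply,
    ContinuousMap.pow_apply, smul_eq_mul, Real.norm_eq_abs] at d1 d2 ⊢
  set p := e.1 x
  set q := e.2 x
  set a := z.1 x
  set c := z.2 x
  set a' := w.1 x
  set c' := w.2 x
  set D := ‖z - w‖
  have hD : 0 ≤ D := norm_nonneg _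
  have h3 : |b / 2 + 2| ≤ 5 / 2 := by rw [abs_le] at hb ⊢; constructor <;> linarith
  set r := |s - t|
  have hr : 0 ≤ r := abs_nonneg _
  have hsa : |s * a - t * a'| ≤ D + r := by
    have : s * a - t * a' = s * (a - a') + (s - t) * a' := by ring
    rw [this]
    refine (abs_add_le _ _).trans ?_
    rw [abs_mul, abs_mul]
    exact add_le_add (by nlinarith [abs_nonneg s, abs_nonneg (a - a')])
      (by nlinarith [abs_nonneg a'])
  have hsc : |s * c - t * c'| ≤ D + r := by
    have : s * c - t * c' = s * (c - c') + (s - t) * c' := by ring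
    rw [this]
    refine (abs_add_le _ _).trans ?_
    rw [abs_mul, abs_mul]
    exact add_le_add (by nlinarith [abs_nonneg s, abs_nonneg (c - c')])
      (by nlinarith [abs_nonneg c'])
  have habs : ∀ {u v : ℝ}, |u| ≤ 1 → |v| ≤ 1 → |u * v| ≤ 1 := fun {u v} hu hv => by
    rw [abs_mul]; exact mul_le_one₀ hu (abs_nonneg _) hv
  have hta : |t * a'| ≤ 1 := habs ht w1
  have hsa1 : |s * a| ≤ 1 := habs hs z1
  have hsc1 : |s * c| ≤ 1 := habs hs z2
  have htc1 : |t * c'| ≤ 1 := habs ht w2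
  have e : (b / 2 + 2) * (2 * (p * a) + s * a ^ 2) + 4 * (p * c + a * q + s * (a * c)) +
      (p + s * a) ^ 2 * (q + s * c) - ((b / 2 + 2) * (2 * (p * a') + t * a' ^ 2) +
      4 * (p * c' + a' * q + t * (a' * c')) + (p + t * a') ^ 2 * (q + t * c')) =
      (b / 2 + 2) * (2 * p * (a - a') + ((s * a) * (a - a') + (s * a - t * a') * a')) +
      4 * (p * (c - c') + q * (a - a') + ((s * a) * (c - c') + (s * a - t * a') * c')) +
      ((p + s * a) ^ 2 * (s * c - t * c') +
        (s * a - t * a') * (2 * p + s * a + t * a') * (q + t * c')) := by ring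
  rw [e]
  have t1 : |(b / 2 + 2) * (2 * p * (a - a') + ((s * a) * (a - a') + (s * a - t * a') * a'))| ≤
      5 / 2 * (2 * 10 * D + (1 * D + (D + r) * 1)) := by
    rw [abs_mul]
    gcongr
    refine (abs_add_le _ _).trans (add_le_add ?_ ((abs_add_le _ _).trans (add_le_add ?_ ?_)))
    · rw [abs_mul, abs_mul, abs_of_pos (by norm_num : (0 : ℝ) < 2)]; gcongr
    · rw [abs_mul]; gcongr
    · rw [abs_mul]; gcongr
  have t2 : |4 * (p * (c - c') + q * (a - a') + ((s * a) * (c - c') + (s * a - t * a') * c'))| ≤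
      4 * (10 * D + 10 * D + (1 * D + (D + r) * 1)) := by
    rw [abs_mul, abs_of_pos (by norm_num : (0 : ℝ) < 4)]
    gcongr
    refine (abs_add_le _ _).trans (add_le_add ((abs_add_le _ _).trans (add_le_add ?_ ?_))
      ((abs_add_le _ _).trans (add_le_add ?_ ?_))) <;> rw [abs_mul] <;> gcongr
  have hp1 : |p + s * a| ≤ 11 := (abs_add_le _ _).trans (by linarith)
  have hq1 : |q + t * c'| ≤ 11 := (abs_add_le _ _).trans (by linarith)
  have hp2 : |2 * p + s * a + t * a'| ≤ 22 := by
    refine (abs_add_le _ _).trans (le_trans (add_le_add_left (abs_add_le _ _) _) ?_)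
    rw [abs_mul 2 p, abs_of_pos (by norm_num : (0 : ℝ) < 2)]; linarith
  have t3 : |(p + s * a) ^ 2 * (s * c - t * c') +
        (s * a - t * a') * (2 * p + s * a + t * a') * (q + t * c')| ≤
      11 ^ 2 * (D + r) + (D + r) * 22 * 11 := by
    refine (abs_add_le _ _).trans (add_le_add ?_ ?_)
    · rw [abs_mul, abs_pow]; gcongr
    · rw [abs_mul, abs_mul]; gcongr
  refine (abs_add_le _ _).trans
    ((add_le_add ((abs_add_le _ _).trans (add_le_add t1 t2)) t3).trans ?_)
  linarith

/-- Only the cubic term survives, and `cos³ ξ = (3 cos ξ + cos 3ξ) / 4`. The value is `-96` at `κ =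
1`; its negative sign makes the bifurcation supercritical. -/
theorem cc_one_nlRest_zero (b κ : ℝ) :
    cc 1 (nlRest b 0 (critProfile κ) 0) = -(48 * κ ^ 2 * (1 + κ)) := by
  have e : nlRest b 0 (critProfile κ) 0 =
      (-(128 * κ ^ 2 * (1 + κ))) • ((1 / 4 : ℝ) • ((3 : ℝ) • cosn 1 + cosn 3)) := by
    have e3 : (1 / 4 : ℝ) • ((3 : ℝ) • cosn 1 + cosn 3) = cosn 1 * (cosn 1 * cosn 1) := by
      have h0 := cosn_mul 1 1
      have h2 := cosn_mul 1 2
      norm_num at h0 h2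
      have h1 : cosn 1 * cosn 0 = cosn 1 := by
        ext x; simp [cosn_apply]
      rw [h0, mul_add, mul_smul_comm, mul_smul_comm, h2, h1, cosn_neg]
      ext x; simp; ring
    rw [e3]
    ext x
    simp only [nlRest, critProfile, Prod.fst_add, Prod.snd_add, Prod.smul_fst, Prod.smul_snd,
      ContinuousMap.add_apply, ContinuousMap.smul_apply, Prod.fst_zero, Prod.snd_zero,
      ContinuousMap.mul_apply, ContinuousMap.pow_apply, smul_eq_mul, ContinuousMap.zero_apply]
    ring
  rw [e, map_smul, map_smul, map_add, map_smul, cc_cosn, cc_cosn]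
  norm_num
  ring

/-- The steady state equation in terms of cosine coefficients. -/
theorem isSteady_iff {ε ω : ℝ} {u : Profile} (h₁ : IsEven u.1) (h₂ : IsEven u.2) :
    IsSteady ε ω u ↔ toL2 u.1 ∈ H2 ∧ toL2 u.2 ∈ H2 ∧ ∀ n,
      (ε ^ 2 + 3 - qv (4 * waveNumber ε ω ^ 2) 0 n) * cc n u.1 + 4 * cc n u.2 +
        cc n (nonlin (ε ^ 2) u) = 0 ∧
      -(ε ^ 2 + 4) * cc n u.1 - (4 + 4 * qv (4 * waveNumber ε ω ^ 2) 0 n) * cc n u.2 -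
        cc n (nonlin (ε ^ 2) u) = 0 := by
  have hN := nonlin_even (ε ^ 2) h₁ h₂
  have r1 : toL2 (reaction₁ (ε ^ 2) u) = ((ε ^ 2 + 3 : ℝ) : ℂ) • toL2 u.1 + (4 : ℂ) • toL2 u.2 +
      toL2 (nonlin (ε ^ 2) u) := by
    have : reaction₁ (ε ^ 2) u = (ε ^ 2 + 3) • u.1 + (4 : ℝ) • u.2 + nonlin (ε ^ 2) u := by
      simp only [reaction₁, nonlin]; abel
    rw [this, toL2_add, toL2_add, toL2_smul, toL2_smul, Complex.ofReal_ofNat]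
  have r2 : toL2 (reaction₂ (ε ^ 2) u) = -(((ε ^ 2 + 4 : ℝ) : ℂ) • toL2 u.1) - (4 : ℂ) • toL2 u.2 -
      toL2 (nonlin (ε ^ 2) u) := by
    have : reaction₂ (ε ^ 2) u = -((ε ^ 2 + 4) • u.1) - (4 : ℝ) • u.2 - nonlin (ε ^ 2) u := by
      simp only [reaction₂, nonlin]; abel
    rw [this, toL2_sub, toL2_sub, toL2_neg, toL2_smul, toL2_smul, Complex.ofReal_ofNat]
  have e1 : ∀ (h : toL2 u.1 ∈ H2) (n : ℤ),
      cf n (((4 * waveNumber ε ω ^ 2 : ℝ) : ℂ) • blochDeriv2 0 ⟨toL2 u.1, h⟩ +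
        toL2 (reaction₁ (ε ^ 2) u)) =
      (((ε ^ 2 + 3 - qv (4 * waveNumber ε ω ^ 2) 0 n) * cc n u.1 + 4 * cc n u.2 +
        cc n (nonlin (ε ^ 2) u) : ℝ) : ℂ) := fun h n => by
    rw [r1]
    simp only [map_add, map_smul, cf_blochDeriv2, h₁.cf_eq, h₂.cf_eq, hN.cf_eq, smul_eq_mul, qv]
    push_cast; ring
  have e2 : ∀ (h : toL2 u.2 ∈ H2) (n : ℤ),
      cf n (((16 * waveNumber ε ω ^ 2 : ℝ) : ℂ) • blochDeriv2 0 ⟨toL2 u.2, h⟩ +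
        toL2 (reaction₂ (ε ^ 2) u)) =
      ((-(ε ^ 2 + 4) * cc n u.1 - (4 + 4 * qv (4 * waveNumber ε ω ^ 2) 0 n) * cc n u.2 -
        cc n (nonlin (ε ^ 2) u) : ℝ) : ℂ) := fun h n => by
    rw [r2]
    simp only [map_add, map_sub, map_neg, map_smul, cf_blochDeriv2, h₁.cf_eq, h₂.cf_eq, hN.cf_eq,
      smul_eq_mul, qv]
    push_cast; ring
  constructor
  · rintro ⟨m1, m2, E1, E2⟩
    refine ⟨m1, m2, fun n => ⟨?_, ?_⟩⟩
    · have := e1 m1 n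
      rw [E1, map_zero] at this
      exact_mod_cast this.symm
    · have := e2 m2 n
      rw [E2, map_zero] at this
      exact_mod_cast this.symm
  · rintro ⟨m1, m2, H⟩
    refine ⟨m1, m2, L2_ext fun n => ?_, L2_ext fun n => ?_⟩
    · rw [e1, (H n).1, map_zero]; norm_cast
    · rw [e2, (H n).2, map_zero]; norm_cast

/-! ### Lyapunov-Schmidt reduction: the solution operator on the noncritical modes. -/

/-- The determinant of the linearisation at the equilibrium on the `n`-th mode. -/
def modeDet (κ b : ℝ) (n : ℤ) : ℝ := 4 * ((qv κ 0 n - 1) ^ 2 - b * qv κ 0 n)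

theorem qv_neg (κ : ℝ) (n : ℤ) : qv κ 0 (-n) = qv κ 0 n := by simp [qv]

theorem critMode_neg (n : ℤ) : critMode (-n) = critMode n := by
  unfold critMode
  congr 1
  apply propext; constructor <;> rintro (h | h) <;> omega

/-- The inverse of the linearisation on the noncritical modes, restricted to the range of the
nonlinearity. -/
structure IsSolOp (κ b : ℝ) (Kop : C(Circ, ℝ) →L[ℝ] Profile) : Prop where
  bound : ∀ g, ‖Kop g‖ ≤ 80 * sumInv * ‖g‖
  even₁ : ∀ g, IsEven (Kop g).1
  even₂ : ∀ g, IsEven (Kop g).2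
  coeff₁ : ∀ g n, cc n (Kop g).1 = (1 - critMode n) * (4 * qv κ 0 n / modeDet κ b n) * cc n g
  coeff₂ : ∀ g n, cc n (Kop g).2 = (1 - critMode n) * (-(1 + qv κ 0 n) / modeDet κ b n) * cc n g

theorem modeDet_ge {κ b : ℝ} (hκ : |κ - 1| ≤ 1 / 10) (hb : |b| ≤ 1 / 10) {n : ℤ}
    (hn : ¬(n = 1 ∨ n = -1)) : 1 / 5 * (1 + qv κ 0 n) ^ 2 ≤ modeDet κ b n := by
  have hq : 0 ≤ qv κ 0 n := mul_nonneg (by linarith [(abs_le.1 hκ).1]) (sq_nonneg _)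
  exact det_far hq hb (qv_far hκ (by norm_num) (fun h => hn (Or.inl h)) (fun h => hn (Or.inr h)))

/-- A symbol of order two divided by a determinant of order four; `80` is the product of the `4` in
the hypothesis, the `4` in `Admissible.one_add_sq_le` and the `5` in `modeDet_ge`. -/
theorem solOp_symbol_le {κ b : ℝ} (hκ : |κ - 1| ≤ 1 / 10) (hb : |b| ≤ 1 / 10) (n : ℤ) {a : ℝ}
    (ha : |a| ≤ 4 * (1 + qv κ 0 n)) :
    |(1 - critMode n) * (a / modeDet κ b n)| ≤ 80 * (1 / (1 + (n : ℝ) ^ 2)) := by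
  by_cases hn : n = 1 ∨ n = -1
  · rw [critMode, if_pos hn]; simp; positivity
  · have hA := admissible_shift hκ hb (σ := 0) (by norm_num)
    have hq := hA.qv_nonneg n
    have h1 := modeDet_ge hκ hb hn
    have h2 := hA.one_add_sq_le n
    have hd : 0 < modeDet κ b n := lt_of_lt_of_le (by positivity) h1
    rw [critMode, if_neg hn, sub_zero, one_mul, abs_div, abs_of_pos hd, mul_one_div,
      div_le_div_iff₀ hd (by positivity)]
    calc |a| * (1 + (n : ℝ) ^ 2) ≤ 4 * (1 + qv κ 0 n) * (4 * (1 + qv κ 0 n)) := by gcongr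
      _ = 80 * (1 / 5 * (1 + qv κ 0 n) ^ 2) := by ring
      _ ≤ _ := by gcongr

theorem exists_solOp {κ b : ℝ} (hκ : |κ - 1| ≤ 1 / 10) (hb : |b| ≤ 1 / 10) :
    ∃ Kop, IsSolOp κ b Kop := by
  have hq : ∀ n, 0 ≤ qv κ 0 n := (admissible_shift hκ hb (σ := 0) (by norm_num)).qv_nonneg
  have s1 : ∀ n, |(1 - critMode n) * (4 * qv κ 0 n / modeDet κ b n)| ≤
      80 * (1 / (1 + (n : ℝ) ^ 2)) := fun n => solOp_symbol_le hκ hb n (by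
    rw [abs_of_nonneg (by linarith [hq n])]; linarith)
  have s2 : ∀ n, |(1 - critMode n) * (-(1 + qv κ 0 n) / modeDet κ b n)| ≤
      80 * (1 / (1 + (n : ℝ) ^ 2)) := fun n => solOp_symbol_le hκ hb n (by
    rw [abs_neg, abs_of_nonneg (by linarith [hq n])]; linarith [hq n])
  obtain ⟨L₁, b1, v1, c1⟩ := exists_Kmul s1 fun n => by simp only [critMode_neg, qv_neg, modeDet]
  obtain ⟨L₂, b2, v2, c2⟩ := exists_Kmul s2 fun n => by simp only [critMode_neg, qv_neg, modeDet]
  exact ⟨L₁.prod L₂, fun g => max_le (b1 g) (b2 g), v1, v2, c1, c2⟩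

theorem modeDet_one (κ b : ℝ) {n : ℤ} (hn : n = 1 ∨ n = -1) :
    qv κ 0 n = κ ∧ modeDet κ b n = 4 * ((κ - 1) ^ 2 - b * κ) := by
  have : qv κ 0 n = κ := by rcases hn with h | h <;> subst h <;> simp [qv]
  exact ⟨this, by rw [modeDet, this]⟩

/-- Profiles of the form `s e + Kop g` with `g` the nonlinearity satisfy the steady state equation if
the bifurcation equation holds, and conversely. -/
theorem steady_coeff_iff {κ b s : ℝ} (hκ : |κ - 1| ≤ 1 / 10) (hb : |b| ≤ 1 / 10)
    {Kop : C(Circ, ℝ) →L[ℝ] Profile} (hK : IsSolOp κ b Kop) {u : Profile} (h₁ : IsEven u.1)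
    (h₂ : IsEven u.2) (hs : cc 1 u.1 = 4 * κ * s) :
    (∀ n, (b + 3 - qv κ 0 n) * cc n u.1 + 4 * cc n u.2 + cc n (nonlin b u) = 0 ∧
      -(b + 4) * cc n u.1 - (4 + 4 * qv κ 0 n) * cc n u.2 - cc n (nonlin b u) = 0) ↔
    u = s • critProfile κ + Kop (nonlin b u) ∧
      4 * ((κ - 1) ^ 2 - b * κ) * s = cc 1 (nonlin b u) := by
  have hκ' := abs_le.1 hκ
  obtain ⟨ev1, ev2⟩ := critProfile_even κ
  have ccu : ∀ n, cc n (s • critProfile κ + Kop (nonlin b u)).1 = s * (critMode n * (4 * κ)) +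
      (1 - critMode n) * (4 * qv κ 0 n / modeDet κ b n) * cc n (nonlin b u) ∧
      cc n (s • critProfile κ + Kop (nonlin b u)).2 = s * (critMode n * (-(1 + κ))) +
      (1 - critMode n) * (-(1 + qv κ 0 n) / modeDet κ b n) * cc n (nonlin b u) := fun n => by
    constructor
    · rw [Prod.fst_add, Prod.smul_fst, map_add, map_smul, (cc_critProfile κ n).1, hK.coeff₁,
        smul_eq_mul]
    · rw [Prod.snd_add, Prod.smul_snd, map_add, map_smul, (cc_critProfile κ n).2, hK.coeff₂,
        smul_eq_mul]
  constructor
  · intro H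
    have hs' : ∀ n, (n = 1 ∨ n = -1) → cc n u.1 = 4 * κ * s ∧ cc n u.2 = -(1 + κ) * s := by
      -- The nonlinearity cancels in the sum of the two equations, which fixes the direction of the
      -- mode `1`.
      have h2 : cc 1 u.2 = -(1 + κ) * s := by
        obtain ⟨E1, E2⟩ := H 1
        rw [(modeDet_one κ b (Or.inl rfl)).1, hs] at E1 E2
        have : 4 * κ * (cc 1 u.2 + (1 + κ) * s) = 0 := by linarith
        rcases mul_eq_zero.1 this with h | h <;> linarith
      rintro n (h | h)
      · subst h; exact ⟨hs, h2⟩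
      · subst h; rw [cc_neg, cc_neg]; exact ⟨hs, h2⟩
    refine ⟨?_, ?_⟩
    · have key : ∀ n, cc n u.1 = cc n (s • critProfile κ + Kop (nonlin b u)).1 ∧
          cc n u.2 = cc n (s • critProfile κ + Kop (nonlin b u)).2 := fun n => by
        rw [(ccu n).1, (ccu n).2]
        by_cases hn : n = 1 ∨ n = -1
        · rw [(hs' n hn).1, (hs' n hn).2, critMode, if_pos hn]
          constructor <;> ring
        -- On a noncritical mode the two by two system is solved by Cramer's rule; the coefficients
        -- of the linear combinations below are the adjugate entries.
        · have hd : modeDet κ b n ≠ 0 := by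
            have hq := (admissible_shift hκ hb (σ := 0) (by norm_num)).qv_nonneg n
            exact (lt_of_lt_of_le (by positivity) (modeDet_ge hκ hb hn)).ne'
          obtain ⟨E1, E2⟩ := H n
          rw [critMode, if_neg hn]
          constructor
          · field_simp
            rw [modeDet]
            linear_combination (-(4 + 4 * qv κ 0 n)) * E1 - 4 * E2
          · field_simp
            rw [modeDet]
            linear_combination (b + 4) * E1 + (b + 3 - qv κ 0 n) * E2
      exact Prod.ext (h₁.ext_cc ((ev1.smul s).add (hK.even₁ _)) fun n => (key n).1)
        (h₂.ext_cc ((ev2.smul s).add (hK.even₂ _)) fun n => (key n).2)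
    · obtain ⟨E1, -⟩ := H 1
      rw [(modeDet_one κ b (Or.inl rfl)).1, (hs' 1 (Or.inl rfl)).1, (hs' 1 (Or.inl rfl)).2] at E1
      linear_combination -E1
  · rintro ⟨hu, hbif⟩ n
    have c1 := (ccu n).1
    have c2 := (ccu n).2
    rw [← hu] at c1 c2
    rw [c1, c2]
    by_cases hn : n = 1 ∨ n = -1
    · have hb1 : cc n (nonlin b u) = cc 1 (nonlin b u) := by
        rcases hn with h | h
        · rw [h]
        · rw [h, cc_neg]
      rw [critMode, if_pos hn, (modeDet_one κ b hn).1, hb1, ← hbif]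
      constructor <;> ring
    · have hd : modeDet κ b n ≠ 0 := by
        have hq := (admissible_shift hκ hb (σ := 0) (by norm_num)).qv_nonneg n
        exact (lt_of_lt_of_le (by positivity) (modeDet_ge hκ hb hn)).ne'
      rw [critMode, if_neg hn]
      constructor
      · field_simp
        rw [modeDet]
        ring
      · field_simp
        rw [modeDet]
        ring

/-- The solution operator gains two derivatives, so the `H²` norm of a profile of this form is
controlled by its amplitude and the sup norm of its source. This puts the constructed branch inside
the ball of uniqueness. -/
theorem normH2_add_solOp_le {κ b s : ℝ} (hκ : |κ - 1| ≤ 1 / 10) (hb : |b| ≤ 1 / 10)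
    {Kop : C(Circ, ℝ) →L[ℝ] Profile} (hK : IsSolOp κ b Kop) {u : Profile} (h₁ : IsEven u.1)
    (h₂ : IsEven u.2) {g : C(Circ, ℝ)} (hg : IsEven g) (hu : u = s • critProfile κ + Kop g) :
    (toL2 u.1 ∈ H2 ∧ normH2 (toL2 u.1) ≤ 20 * |s| + 80 * ‖g‖) ∧
    (toL2 u.2 ∈ H2 ∧ normH2 (toL2 u.2) ≤ 20 * |s| + 80 * ‖g‖) := by
  have hq : ∀ n, 0 ≤ qv κ 0 n := (admissible_shift hκ hb (σ := 0) (by norm_num)).qv_nonneg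
  obtain ⟨ev1, ev2⟩ := critProfile_even κ
  have key : ∀ (v e : C(Circ, ℝ)) (a : ℤ → ℝ) (r : ℝ), IsEven v → IsEven e → ‖e‖ ≤ 10 →
      (∀ n, |a n| ≤ 4 * (1 + qv κ 0 n)) → (∀ n, cc n e = critMode n * r) →
      (∀ n, cc n v = s * cc n e + (1 - critMode n) * (a n / modeDet κ b n) * cc n g) →
      toL2 v ∈ H2 ∧ normH2 (toL2 v) ≤ 20 * |s| + 80 * ‖g‖ := by
    intro v e a r hv he hen ha hce hcv
    set m : ℤ → ℂ := fun n =>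
      (((1 + (n : ℝ) ^ 2) * ((1 - critMode n) * (a n / modeDet κ b n)) : ℝ) : ℂ)
    have hm : ∀ n, ‖m n‖ ≤ 80 := fun n => by
      have := solOp_symbol_le hκ hb n (ha n)
      simp only [m]
      rw [Complex.norm_real, Real.norm_eq_abs, abs_mul, abs_of_pos (by positivity)]
      calc (1 + (n : ℝ) ^ 2) * |(1 - critMode n) * (a n / modeDet κ b n)| ≤
          (1 + (n : ℝ) ^ 2) * (80 * (1 / (1 + (n : ℝ) ^ 2))) := by gcongr
        _ = 80 := by field_simp
    -- The factor `2` is the weight `1 + n²` at `n = ±1`.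
    set w : L2 := ((2 * s : ℝ) : ℂ) • toL2 e + mult m (toL2 g)
    have hw : ∀ n : ℤ, cf n w = (1 + (n : ℂ) ^ 2) * cf n (toL2 v) := fun n => by
      simp only [w, map_add, map_smul, cf_mult hm, he.cf_eq, hg.cf_eq, hv.cf_eq, hcv, m, hce,
        smul_eq_mul]
      by_cases hn : n = 1 ∨ n = -1
      · have : (n : ℂ) ^ 2 = 1 := by rcases hn with h | h <;> rw [h] <;> norm_num
        rw [this, critMode, if_pos hn]; push_cast; ring
      · rw [critMode, if_neg hn]; push_cast; ring
    refine ⟨mem_H2_of_cf hw, ?_⟩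
    rw [normH2_eq hw]
    refine (norm_add_le _ _).trans (add_le_add ?_ ?_)
    · rw [norm_smul, Complex.norm_real, Real.norm_eq_abs, abs_mul,
        abs_of_pos (by norm_num : (0 : ℝ) < 2)]
      have := (norm_toL2_le e).trans hen
      nlinarith [abs_nonneg s, norm_nonneg (toL2 e)]
    · refine ((mult m).le_of_opNorm_le (norm_mult_le hm) _).trans ?_
      gcongr
      exact norm_toL2_le g
  have hcp := norm_critProfile_le hκ
  refine ⟨key u.1 (critProfile κ).1 (fun n => 4 * qv κ 0 n) (4 * κ) h₁ ev1
      ((norm_fst_le _).trans hcp) (fun n => ?_) (fun n => (cc_critProfile κ n).1) (fun n => ?_),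
    key u.2 (critProfile κ).2 (fun n => -(1 + qv κ 0 n)) (-(1 + κ)) h₂ ev2
      ((norm_snd_le _).trans hcp) (fun n => ?_) (fun n => (cc_critProfile κ n).2) (fun n => ?_)⟩
  · rw [abs_of_nonneg (by linarith [hq n])]; linarith [hq n]
  · conv_lhs => rw [hu]
    rw [Prod.fst_add, Prod.smul_fst, map_add, map_smul, hK.coeff₁, smul_eq_mul]
  · rw [abs_neg, abs_of_nonneg (by linarith [hq n])]; linarith [hq n]
  · conv_lhs => rw [hu]
    rw [Prod.snd_add, Prod.smul_snd, map_add, map_smul, hK.coeff₂, smul_eq_mul]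

/-! ### The noncritical part of the profile -/

section FixedPoint

variable {κ b : ℝ} {Kop : C(Circ, ℝ) →L[ℝ] Profile}

/-- `z` solves the noncritical part of the rescaled steady state equation at amplitude `s`. -/
structure IsSlaved (κ b : ℝ) (Kop : C(Circ, ℝ) →L[ℝ] Profile) (s : ℝ) (z : Profile) : Prop where
  norm_le : ‖z‖ ≤ 1
  eq : z = Kop (nl b s (critProfile κ + s • z))

/-- Smallness of the amplitude and of the parameters in terms of `C = 80 ∑ 1/(1+n²)`. -/
structure SmallParam (κ b : ℝ) : Prop where
  κ_bd : |κ - 1| ≤ 1 / 10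
  b_bd : |b| ≤ 1 / 10
  sum_bd : 80 * sumInv * (600 * (|b| + |κ - 1|)) ≤ 1

/-- The largest admissible amplitude in the fixed point argument. -/
def ampMax : ℝ := 1 / (10 ^ 6 * (80 * sumInv))

theorem ampMax_pos : 0 < ampMax := by
  have := one_le_sumInv
  unfold ampMax; positivity

theorem ampMax_mul : 80 * sumInv * (10 ^ 6 * ampMax) = 1 := by
  have := one_le_sumInv
  unfold ampMax; field_simp

theorem ampMax_le_one : ampMax ≤ 1 := by
  have := one_le_sumInv
  have h2 := ampMax_mul
  nlinarith [ampMax_pos]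

theorem norm_critProfile_add_le (hκ : |κ - 1| ≤ 1 / 10) {s : ℝ} (hs : |s| ≤ 1) {z : Profile}
    (hz : ‖z‖ ≤ 1) : ‖critProfile κ + s • z‖ ≤ 20 := by
  refine (norm_add_le _ _).trans ?_
  rw [norm_smul, Real.norm_eq_abs]
  have := norm_critProfile_le hκ
  nlinarith [abs_nonneg s, norm_nonneg z]

/-- `z` enters only through `s • z`, so for `|s| ≤ ampMax` the fixed point map contracts. Keeping
two amplitudes gives Lipschitz dependence on `s` from the same estimate. -/
theorem norm_solOp_nl_sub_le (hP : SmallParam κ b) (hK : IsSolOp κ b Kop) {s t : ℝ}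
    (hs : |s| ≤ ampMax) (ht : |t| ≤ ampMax) {z w : Profile} (hz : ‖z‖ ≤ 1) (hw : ‖w‖ ≤ 1) :
    ‖Kop (nl b s (critProfile κ + s • z)) - Kop (nl b t (critProfile κ + t • w))‖ ≤
      1 / 2 * ‖z - w‖ + 80 * sumInv * 20000 * |s - t| := by
  have h1 := one_le_sumInv
  have hs1 := hs.trans ampMax_le_one
  have ht1 := ht.trans ampMax_le_one
  have hb1 : |b| ≤ 1 := hP.b_bd.trans (by norm_num)
  rw [← map_sub]
  refine (hK.bound _).trans ?_
  have h2 := norm_nl_sub_le hb1 hs1 (t := t) (norm_critProfile_add_le hP.κ_bd hs1 hz)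
    (norm_critProfile_add_le hP.κ_bd ht1 hw)
  have h3 : ‖critProfile κ + s • z - (critProfile κ + t • w)‖ ≤ ampMax * ‖z - w‖ + |s - t| := by
    have e : critProfile κ + s • z - (critProfile κ + t • w) = s • (z - w) + (s - t) • w := by
      module
    rw [e]
    refine (norm_add_le _ _).trans ?_
    rw [norm_smul, norm_smul, Real.norm_eq_abs, Real.norm_eq_abs]
    refine add_le_add (by gcongr) ?_
    exact mul_le_of_le_one_right (abs_nonneg _) hw
  calc 80 * sumInv * ‖nl b s (critProfile κ + s • z) - nl b t (critProfile κ + t • w)‖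
      ≤ 80 * sumInv * (10000 * (ampMax * ‖z - w‖ + |s - t| + |s - t|)) := by
        gcongr
        exact h2.trans (by gcongr)
    _ = (80 * sumInv * (10 ^ 6 * ampMax)) / 100 * ‖z - w‖ + 80 * sumInv * 20000 * |s - t| := by ring
    _ ≤ _ := by
        rw [ampMax_mul]
        gcongr
        norm_num

theorem IsSlaved.dist_le (hP : SmallParam κ b) (hK : IsSolOp κ b Kop) {s t : ℝ}
    (hs : |s| ≤ ampMax) (ht : |t| ≤ ampMax) {z w : Profile} (hz : IsSlaved κ b Kop s z)
    (hw : IsSlaved κ b Kop t w) : ‖z - w‖ ≤ 80 * sumInv * 40000 * |s - t| := by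
  have := norm_solOp_nl_sub_le hP hK hs ht hz.norm_le hw.norm_le
  rw [← hz.eq, ← hw.eq] at this
  linarith

theorem norm_solOp_nl_le (hP : SmallParam κ b) (hK : IsSolOp κ b Kop) {s : ℝ} (hs : |s| ≤ 1)
    {y : Profile} (hy : ‖s • y‖ ≤ 10) :
    ‖Kop (nl b s (critProfile κ + s • y))‖ ≤
      80 * sumInv * (10000 * (‖s • y‖ + |s|) + 300 * (|b| + |κ - 1|)) := by
  have h1 := one_le_sumInv
  have hb1 : |b| ≤ 1 := hP.b_bd.trans (by norm_num)
  refine (hK.bound _).trans ?_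
  gcongr
  have hc := norm_critProfile_le hP.κ_bd
  have h2 := norm_nl_sub_le (b := b) (t := 0) hb1 hs
    ((norm_add_le (critProfile κ) (s • y)).trans (by linarith))
    (hc.trans (by norm_num : (10 : ℝ) ≤ 20))
  rw [add_sub_cancel_left, sub_zero] at h2
  have h3 := norm_le_norm_sub_add (nl b s (critProfile κ + s • y)) (nl b 0 (critProfile κ))
  linarith [norm_nl_critProfile_le hP.κ_bd (b := b)]

/-- By the near cancellation of the quadratic terms on the critical profile the slaved part is not
merely bounded but `O(|s| + |b| + |κ - 1|)`; this yields `u - s e = O(ε³)`. -/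
theorem IsSlaved.norm_le' (hP : SmallParam κ b) (hK : IsSolOp κ b Kop) {s : ℝ}
    (hs : |s| ≤ ampMax) {z : Profile} (hz : IsSlaved κ b Kop s z) :
    ‖z‖ ≤ 80 * sumInv * (20000 * |s| + 300 * (|b| + |κ - 1|)) := by
  have h1 := one_le_sumInv
  have hs1 := hs.trans ampMax_le_one
  have h2 : ‖s • z‖ ≤ |s| := by
    rw [norm_smul, Real.norm_eq_abs]
    exact mul_le_of_le_one_right (abs_nonneg _) hz.norm_le
  have := norm_solOp_nl_le hP hK hs1 (y := z) (by linarith)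
  rw [← hz.eq] at this
  exact this.trans (mul_le_mul_of_nonneg_left (by linarith) (by linarith))

theorem exists_isSlaved (hP : SmallParam κ b) (hK : IsSolOp κ b Kop) {s : ℝ} (hs : |s| ≤ ampMax) :
    ∃ z, IsSlaved κ b Kop s z := by
  set f : Profile → Profile := fun z => Kop (nl b s (critProfile κ + s • z))
  have h1 := one_le_sumInv
  have hs1 := hs.trans ampMax_le_one
  have hmaps : Set.MapsTo f (Metric.closedBall 0 1) (Metric.closedBall 0 1) := by
    intro z hz
    rw [mem_closedBall_zero_iff] at hz ⊢
    have h2 : ‖s • z‖ ≤ |s| := by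
      rw [norm_smul, Real.norm_eq_abs]
      exact mul_le_of_le_one_right (abs_nonneg _) hz
    refine (norm_solOp_nl_le hP hK hs1 (y := z) (by linarith)).trans ?_
    have h3 := hP.sum_bd
    have h4 := ampMax_mul
    have h5 : 80 * sumInv * (10000 * (‖s • z‖ + |s|)) ≤ 80 * sumInv * (10000 * (ampMax + ampMax)) := by
      gcongr
      exact h2.trans hs
    nlinarith
  have hc : ContractingWith (1 / 2) (hmaps.restrict f _ _) := by
    refine ⟨by norm_num, LipschitzWith.of_dist_le_mul fun z w => ?_⟩
    have h6 := norm_solOp_nl_sub_le hP hK hs hs (mem_closedBall_zero_iff.1 z.2)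
      (mem_closedBall_zero_iff.1 w.2)
    rw [sub_self, abs_zero, mul_zero, add_zero] at h6
    rw [Subtype.dist_eq, Subtype.dist_eq, dist_eq_norm, dist_eq_norm]
    simpa using h6
  obtain ⟨z, hz, hfix, -⟩ := hc.exists_fixedPoint' (Metric.isClosed_closedBall.isComplete) hmaps
    (x := 0) (by simp) (edist_ne_top _ _)
  exact ⟨z, mem_closedBall_zero_iff.1 hz, hfix.symm⟩

end FixedPoint

/-! ### The bifurcation equation -/

section Bifurcation

variable {κ b : ℝ} {Kop : C(Circ, ℝ) →L[ℝ] Profile}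

/-- The largest amplitude for which the bifurcation equation is shown to be uniquely solvable. -/
def ampSmall : ℝ := 1 / (10 ^ 9 * (80 * sumInv) ^ 2)

theorem ampSmall_pos : 0 < ampSmall := by
  have := one_le_sumInv
  unfold ampSmall; positivity

theorem ampSmall_mul : 80 * sumInv * (80 * sumInv * (10 ^ 9 * ampSmall)) = 1 := by
  have := one_le_sumInv
  unfold ampSmall; field_simp

theorem ampSmall_mul_le : 80 * sumInv * (10 ^ 9 * ampSmall) ≤ 1 / 80 := by
  have := one_le_sumInv
  have h2 := ampSmall_mul
  have h3 : 0 < 80 * sumInv * (10 ^ 9 * ampSmall) := by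
    have := ampSmall_pos; positivity
  nlinarith

theorem ampSmall_le : ampSmall ≤ 1 / 10 ^ 9 := by
  have := one_le_sumInv
  have := ampSmall_mul_le
  nlinarith [ampSmall_pos]

theorem ampSmall_le_ampMax : ampSmall ≤ ampMax := by
  have h0 := one_le_sumInv
  have h1 := ampSmall_mul_le
  have h2 := ampMax_mul
  by_contra! h
  nlinarith [ampMax_pos]

theorem smallParam_of_le (h : |b| + |κ - 1| ≤ 10 * ampSmall) : SmallParam κ b := by
  have h0 := one_le_sumInv
  have h1 := ampSmall_mul_le
  have h2 := ampSmall_le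
  refine ⟨by linarith [abs_nonneg b], by linarith [abs_nonneg (κ - 1)], ?_⟩
  nlinarith

/-- The reduced cubic coefficient of the bifurcation equation. -/
def bifCoeff (κ b s : ℝ) (z : Profile) : ℝ := cc 1 (nlRest b s (critProfile κ) z)

/-- Compares with the value at `s = 0`, `z = 0`, `κ = 1`; the deviation is Lipschitz in `s`, `z` and
`κ`, and `z` is small by `IsSlaved.norm_le'`. -/
theorem abs_bifCoeff_add_le (h : |b| + |κ - 1| ≤ 10 * ampSmall) (hK : IsSolOp κ b Kop) {s : ℝ}
    (hs : |s| ≤ ampSmall) {z : Profile} (hz : IsSlaved κ b Kop s z) :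
    |bifCoeff κ b s z + 96| ≤ 80 * sumInv * (10 ^ 9 * (|s| + (|b| + |κ - 1|))) := by
  have h0 := one_le_sumInv
  have hP := smallParam_of_le h
  have ha := ampSmall_le
  have h1 := hz.norm_le' hP hK (hs.trans ampSmall_le_ampMax)
  have h2 := norm_nlRest_sub_le (b := b) (t := 0) (w := 0) (hP.b_bd.trans (by norm_num))
    (hs.trans (by linarith)) (by norm_num) (norm_critProfile_le hP.κ_bd) hz.norm_le (by simp)
  have h3 := (abs_cc_le 1 _).trans h2
  rw [map_sub, cc_one_nlRest_zero, sub_zero, sub_zero, abs_le] at h3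
  have h4 : |48 * κ ^ 2 * (1 + κ) - 96| ≤ 300 * |κ - 1| := by
    have e : 48 * κ ^ 2 * (1 + κ) - 96 = (κ - 1) * (48 * (κ ^ 2 + 2 * κ + 2)) := by ring
    have hk := abs_le.1 hP.κ_bd
    rw [e, abs_mul, mul_comm]
    refine mul_le_mul_of_nonneg_right ?_ (abs_nonneg _)
    rw [abs_le]; constructor <;> nlinarith
  rw [abs_le] at h4
  have hp : 0 ≤ |b| + |κ - 1| := by positivity
  have hs0 := abs_nonneg s
  have hb0 := abs_nonneg b
  have hk0 := abs_nonneg (κ - 1)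
  have h6 : 10000 * (‖z‖ + |s|) + 300 * |κ - 1| ≤
      80 * sumInv * (10 ^ 9 * (|s| + (|b| + |κ - 1|))) := by
    nlinarith
  rw [bifCoeff, abs_le]
  constructor <;> linarith [h3.1, h3.2, h4.1, h4.2]

theorem bifCoeff_bounds (h : |b| + |κ - 1| ≤ 10 * ampSmall) (hK : IsSolOp κ b Kop) {s : ℝ}
    (hs : |s| ≤ ampSmall) {z : Profile} (hz : IsSlaved κ b Kop s z) :
    -97 ≤ bifCoeff κ b s z ∧ bifCoeff κ b s z ≤ -95 := by
  have h0 := one_le_sumInv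
  have h1 := abs_bifCoeff_add_le h hK hs hz
  have h2 := ampSmall_mul_le
  have h3 : 80 * sumInv * (10 ^ 9 * (|s| + (|b| + |κ - 1|))) ≤ 80 * sumInv * (10 ^ 9 * (11 * ampSmall)) := by
    gcongr; linarith
  have h4 := abs_le.1 h1
  constructor <;> linarith

theorem bifCoeff_lipschitz (h : |b| + |κ - 1| ≤ 10 * ampSmall) (hK : IsSolOp κ b Kop) {s t : ℝ}
    (hs : |s| ≤ ampSmall) (ht : |t| ≤ ampSmall) {z w : Profile} (hz : IsSlaved κ b Kop s z)
    (hw : IsSlaved κ b Kop t w) :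
    |bifCoeff κ b s z - bifCoeff κ b t w| ≤ 80 * sumInv * 10 ^ 9 * |s - t| := by
  have h0 := one_le_sumInv
  have hP := smallParam_of_le h
  have ha := ampSmall_le
  have h1 := hz.dist_le hP hK (hs.trans ampSmall_le_ampMax) (ht.trans ampSmall_le_ampMax) hw
  have h2 := norm_nlRest_sub_le (b := b) (hP.b_bd.trans (by norm_num))
    (hs.trans (by linarith)) (ht.trans (by linarith)) (norm_critProfile_le hP.κ_bd) hz.norm_le
    hw.norm_le
  have h3 := (abs_cc_le 1 _).trans h2
  rw [map_sub] at h3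
  refine h3.trans ?_
  have := abs_nonneg (s - t)
  nlinarith

/-- The coefficient is at most `-95`, while its variation with the amplitude is multiplied by the
small amplitude itself; hence `t² - s²` dominates. -/
theorem bif_strictMono (h : |b| + |κ - 1| ≤ 10 * ampSmall) (hK : IsSolOp κ b Kop) {s t : ℝ}
    (hs0 : 0 ≤ s) (hst : s < t) (ht : t ≤ ampSmall) {z w : Profile} (hz : IsSlaved κ b Kop s z)
    (hw : IsSlaved κ b Kop t w) : t ^ 2 * bifCoeff κ b t w < s ^ 2 * bifCoeff κ b s z := by
  have h0 := one_le_sumInv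
  have hs' : |s| ≤ ampSmall := by rw [abs_of_nonneg hs0]; linarith
  have ht' : |t| ≤ ampSmall := by rw [abs_of_nonneg (by linarith)]; linarith
  have h1 := bifCoeff_lipschitz h hK hs' ht' hz hw
  have h2 := bifCoeff_bounds h hK ht' hw
  have h3 := ampSmall_mul_le
  rw [abs_of_nonpos (by linarith : s - t ≤ 0), abs_le] at h1
  have h4 : 80 * sumInv * 10 ^ 9 * s ≤ 1 / 80 := by nlinarith
  have h5 : s * (80 * sumInv * 10 ^ 9 * s) ≤ s * (1 / 80) := by gcongr
  have h6 : s ^ 2 * (bifCoeff κ b t w - bifCoeff κ b s z) ≤ s * (1 / 80) * (t - s) := by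
    calc s ^ 2 * (bifCoeff κ b t w - bifCoeff κ b s z)
        ≤ s ^ 2 * (80 * sumInv * 10 ^ 9 * (t - s)) := by gcongr; linarith [h1.1]
      _ = s * (80 * sumInv * 10 ^ 9 * s) * (t - s) := by ring
      _ ≤ _ := mul_le_mul_of_nonneg_right h5 (by linarith)
  have h7 : (t ^ 2 - s ^ 2) * bifCoeff κ b t w ≤ (t ^ 2 - s ^ 2) * -95 :=
    mul_le_mul_of_nonneg_left h2.2 (by nlinarith)
  nlinarith [mul_pos (sub_pos.2 hst) (by linarith : 0 < t)]

theorem bif_unique (h : |b| + |κ - 1| ≤ 10 * ampSmall) (hK : IsSolOp κ b Kop) {s t : ℝ}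
    (hs0 : 0 ≤ s) (hs : s ≤ ampSmall) (ht0 : 0 ≤ t) (ht : t ≤ ampSmall) {z w : Profile}
    (hz : IsSlaved κ b Kop s z) (hw : IsSlaved κ b Kop t w)
    (he : s ^ 2 * bifCoeff κ b s z = t ^ 2 * bifCoeff κ b t w) : s = t ∧ z = w := by
  have hst : s = t := by
    rcases lt_trichotomy s t with h1 | h1 | h1
    · linarith [bif_strictMono h hK hs0 h1 ht hz hw]
    · exact h1
    · linarith [bif_strictMono h hK ht0 h1 hs hw hz]
  refine ⟨hst, ?_⟩
  subst hst
  have hs' : |s| ≤ ampMax := by rw [abs_of_nonneg hs0]; linarith [ampSmall_le_ampMax]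
  have := hz.dist_le (smallParam_of_le h) hK hs' hs' hw
  rw [sub_self, abs_zero, mul_zero] at this
  exact sub_eq_zero.1 (norm_le_zero_iff.1 this)

theorem bif_exists (h : |b| + |κ - 1| ≤ 10 * ampSmall) (hK : IsSolOp κ b Kop) {t g : ℝ}
    (ht0 : 0 ≤ t) (ht : t ≤ ampSmall) (hg0 : 0 ≤ g) (hg : g ≤ 95 * t ^ 2) :
    ∃ s, 0 ≤ s ∧ s ≤ t ∧ ∃ z, IsSlaved κ b Kop s z ∧ s ^ 2 * bifCoeff κ b s z = -g := by
  have h0 := one_le_sumInv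
  have hP := smallParam_of_le h
  have hm : ∀ s : Set.Icc 0 t, |(s : ℝ)| ≤ ampSmall := fun s => by
    rw [abs_of_nonneg s.2.1]; exact s.2.2.trans ht
  choose z hz using fun s : Set.Icc 0 t =>
    exists_isSlaved hP hK ((hm s).trans ampSmall_le_ampMax)
  -- The slaved parts are chosen arbitrarily for each amplitude; continuity follows because the
  -- Lipschitz bound holds for every choice. The extension makes `F` continuous on the whole line
  -- before the intermediate value theorem is applied.
  set F : ℝ → ℝ := Set.IccExtend ht0 fun s : Set.Icc 0 t => bifCoeff κ b s (z s)
  have hF : Continuous F := by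
    refine Continuous.Icc_extend' ?_
    refine (LipschitzWith.of_dist_le_mul (K := Real.toNNReal (80 * sumInv * 10 ^ 9))
      fun s t => ?_).continuous
    rw [Real.coe_toNNReal _ (by positivity), Real.dist_eq, Subtype.dist_eq, Real.dist_eq]
    exact bifCoeff_lipschitz h hK (hm s) (hm t) (hz s) (hz t)
  have hF' : ∀ s (hs : s ∈ Set.Icc 0 t), F s = bifCoeff κ b s (z ⟨s, hs⟩) := fun s hs =>
    Set.IccExtend_of_mem ht0 _ hs
  have hG : ContinuousOn (fun s => -(s ^ 2 * F s)) (Set.Icc 0 t) := by fun_prop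
  have h1 := intermediate_value_Icc ht0 hG
  have htm : t ∈ Set.Icc 0 t := ⟨ht0, le_rfl⟩
  obtain ⟨s, hs, hs2⟩ := h1 (a := g) ⟨by simpa using hg0, by
    change g ≤ -(t ^ 2 * F t)
    rw [hF' t htm]
    nlinarith [(bifCoeff_bounds h hK (hm ⟨t, htm⟩) (hz ⟨t, htm⟩)).2, sq_nonneg t]⟩
  refine ⟨s, hs.1, hs.2, z ⟨s, hs⟩, hz ⟨s, hs⟩, ?_⟩
  rw [← hF' s hs]
  exact neg_eq_iff_eq_neg.1 hs2

/-! ### Correspondence with small steady states -/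

/-- For slaved profiles the noncritical modes are already solved, so one scalar equation is left. It
keeps the factor `s`, which accounts for the trivial solution. -/
theorem IsSlaved.steady_iff (h : |b| + |κ - 1| ≤ 10 * ampSmall) (hK : IsSolOp κ b Kop) {s : ℝ}
    {z : Profile} (hz : IsSlaved κ b Kop s z) {u : Profile}
    (hu : u = s • (critProfile κ + s • z)) :
    IsEven u.1 ∧ IsEven u.2 ∧ u = s • critProfile κ + Kop (nonlin b u) ∧
    ((∀ n, (b + 3 - qv κ 0 n) * cc n u.1 + 4 * cc n u.2 + cc n (nonlin b u) = 0 ∧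
      -(b + 4) * cc n u.1 - (4 + 4 * qv κ 0 n) * cc n u.2 - cc n (nonlin b u) = 0) ↔
      4 * ((κ - 1) ^ 2 - b * κ) * s = s * (s ^ 2 * bifCoeff κ b s z)) := by
  have hP := smallParam_of_le h
  obtain ⟨ev1, ev2⟩ := critProfile_even κ
  have hz1 : IsEven z.1 := by rw [hz.eq]; exact hK.even₁ _
  have hz2 : IsEven z.2 := by rw [hz.eq]; exact hK.even₂ _
  have h1 : IsEven u.1 := by rw [hu]; exact (ev1.add (hz1.smul s)).smul s
  have h2 : IsEven u.2 := by rw [hu]; exact (ev2.add (hz2.smul s)).smul s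
  have hN : nonlin b u = s ^ 2 • nl b s (critProfile κ + s • z) := by rw [hu, nonlin_smul]
  have hfix : u = s • critProfile κ + Kop (nonlin b u) := by
    rw [hN, map_smul, ← hz.eq, hu]; module
  have hc : cc 1 u.1 = 4 * κ * s := by
    have hcz : cc 1 z.1 = 0 := by rw [hz.eq, hK.coeff₁, critMode, if_pos (Or.inl rfl)]; ring
    rw [hu, Prod.smul_fst, Prod.fst_add, Prod.smul_fst, map_smul, map_add, map_smul, hcz,
      (cc_critProfile κ 1).1, critMode, if_pos (Or.inl rfl)]
    simp only [smul_eq_mul]; ring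
  refine ⟨h1, h2, hfix, ?_⟩
  rw [steady_coeff_iff hP.κ_bd hP.b_bd hK h1 h2 hc, and_iff_right hfix, hN, nl_eq_add, map_smul,
    map_add, map_smul, cc_one_nl_critProfile, zero_add, bifCoeff, smul_eq_mul, smul_eq_mul]
  constructor <;> intro h <;> linarith

/-- Small even steady states come from solutions of the bifurcation equation. -/
theorem exists_isSlaved_of_steady (h : |b| + |κ - 1| ≤ 10 * ampSmall) (hK : IsSolOp κ b Kop)
    {u : Profile} (h₁ : IsEven u.1) (h₂ : IsEven u.2) (hu : ‖u‖ ≤ ampSmall)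
    (H : ∀ n, (b + 3 - qv κ 0 n) * cc n u.1 + 4 * cc n u.2 + cc n (nonlin b u) = 0 ∧
      -(b + 4) * cc n u.1 - (4 + 4 * qv κ 0 n) * cc n u.2 - cc n (nonlin b u) = 0) :
    u = 0 ∨ ∃ s z, s ≠ 0 ∧ |s| ≤ ampSmall ∧ IsSlaved κ b Kop s z ∧
      u = s • (critProfile κ + s • z) := by
  have h0 := one_le_sumInv
  have hP := smallParam_of_le h
  have ha := ampSmall_le
  have ha0 := ampSmall_pos
  have hκ := abs_le.1 hP.κ_bd
  have hb1 : |b| ≤ 1 := hP.b_bd.trans (by norm_num)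
  set s := cc 1 u.1 / (4 * κ) with hsdef
  have hc : cc 1 u.1 = 4 * κ * s := by 
    rw [hsdef]
    have : κ ≠ 0 := by linarith [hκ.1]
    field_simp
  have hs : |s| ≤ ampSmall := by
    have h3 := (abs_cc_le 1 u.1).trans ((norm_fst_le u).trans hu)
    rw [hc, abs_mul, abs_of_pos (by linarith : 0 < 4 * κ)] at h3
    nlinarith [abs_nonneg s]
  have hfix := ((steady_coeff_iff hP.κ_bd hP.b_bd hK h₁ h₂ hc).1 H).1
  have he := norm_critProfile_le hP.κ_bd
  have hx1 : ‖u - s • critProfile κ‖ ≤ 80 * sumInv * (10 * ‖u‖ ^ 2) := by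
    have : u - s • critProfile κ = Kop (nonlin b u) := sub_eq_iff_eq_add'.2 hfix
    rw [this]
    refine (hK.bound _).trans ?_
    gcongr
    exact norm_nonlin_le hb1 (by linarith)
  have hse : ‖s • critProfile κ‖ ≤ 10 * |s| := by
    rw [norm_smul, Real.norm_eq_abs]; nlinarith [abs_nonneg s]
  set x := ‖u - s • critProfile κ‖
  have hx0 : 0 ≤ x := norm_nonneg _
  have hu1 : ‖u‖ ≤ 10 * |s| + x := by
    have := norm_le_norm_sub_add u (s • critProfile κ)
    linarith
  have hS : 80 * sumInv * (10 ^ 9 * ampSmall) ≤ 1 / 80 := ampSmall_mul_le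
  have hx2 : x ≤ 80 * sumInv * (10 * ampSmall * (10 * |s| + x)) := by
    refine hx1.trans (mul_le_mul_of_nonneg_left ?_ (by positivity))
    nlinarith [norm_nonneg u, mul_le_mul hu hu1 (norm_nonneg u) ha0.le]
  -- Bootstrap: the coefficient of `x` on the right of `hx2` is tiny and is absorbed. Reinserting
  -- `‖u‖ ≤ 11 |s|` then improves the bound to `O(s²)`, which lets `z` be defined by division by
  -- `s²`.
  have hx3 : x ≤ |s| := by nlinarith [abs_nonneg s]
  have hx4 : x ≤ 80 * sumInv * (1210 * s ^ 2) := by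
    refine hx1.trans ?_
    have : ‖u‖ ≤ 11 * |s| := by linarith
    have h5 : ‖u‖ ^ 2 ≤ (11 * |s|) ^ 2 := by gcongr
    rw [mul_pow, sq_abs] at h5
    exact mul_le_mul_of_nonneg_left (by linarith) (by positivity)
  by_cases hs0 : s = 0
  · left
    rw [hs0, abs_zero] at hx3
    have := hu1
    rw [hs0, abs_zero] at this
    exact norm_le_zero_iff.1 (by linarith)
  · right
    set z : Profile := (s ^ 2)⁻¹ • (u - s • critProfile κ) with hzdef
    have hsz : s ^ 2 • z = u - s • critProfile κ := by
      rw [hzdef, smul_smul, mul_inv_cancel₀ (pow_ne_zero 2 hs0), one_smul]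
    have hzu : u = s • (critProfile κ + s • z) := by
      rw [smul_add, smul_smul, ← pow_two, hsz]; abel
    have hzeq : z = Kop (nl b s (critProfile κ + s • z)) := by
      have h6 : s ^ 2 • z = s ^ 2 • Kop (nl b s (critProfile κ + s • z)) := by
        rw [hsz, ← map_smul, ← nonlin_smul, ← hzu]
        exact sub_eq_iff_eq_add'.2 hfix
      exact smul_right_injective _ (pow_ne_zero 2 hs0) h6
    have hz1 : ‖z‖ ≤ 80 * sumInv * 1210 := by
      have h7 : s ^ 2 * ‖z‖ = x := by
        rw [← Real.norm_of_nonneg (sq_nonneg s), ← norm_smul, hsz]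
      have h8 : 0 < s ^ 2 := by positivity
      nlinarith
    have hszn : ‖s • z‖ ≤ 80 * sumInv * 1210 * |s| := by
      rw [norm_smul, Real.norm_eq_abs, mul_comm]
      gcongr
    -- The previous bound on `z` is a large constant, but it makes `s • z` small, and the fixed
    -- point equation then returns `‖z‖ ≤ 1`. The constant `80 * sumInv` is used twice, which is why
    -- `ampSmall` contains its square.
    have hz2 : ‖z‖ ≤ 1 := by
      have h9 : ‖s • z‖ ≤ 10 := by nlinarith
      have h10 := norm_solOp_nl_le hP hK (y := z) (hs.trans (by linarith)) h9
      rw [← hzeq] at h10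
      refine h10.trans ?_
      have h11 := hP.sum_bd
      have h12 : 80 * sumInv * (10000 * (‖s • z‖ + |s|)) ≤
          80 * sumInv * (80 * sumInv * (10 ^ 9 * ampSmall)) / 10 := by
        have : 10000 * (‖s • z‖ + |s|) ≤ 80 * sumInv * (10 ^ 9 * ampSmall) / 10 := by
          have : |s| ≤ 80 * sumInv * |s| := by nlinarith [abs_nonneg s]
          have : 80 * sumInv * |s| ≤ 80 * sumInv * ampSmall := by gcongr
          nlinarith
        calc _ ≤ 80 * sumInv * (80 * sumInv * (10 ^ 9 * ampSmall) / 10) := by gcongr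
          _ = _ := by ring
      rw [ampSmall_mul] at h12
      linarith
    exact ⟨s, z, hs0, hs, ⟨hz2, hzeq⟩, hzu⟩

end Bifurcation

/-! ### The branch of patterns -/

/-- The rescaled wave number `4k²`. -/
def kap (ε ω : ℝ) : ℝ := 4 * waveNumber ε ω ^ 2

section Kap

variable {ε ω : ℝ}

/-- `w = 2k` is the positive root of `w² - 4 ε ω w - 1 = 0`. The wave number is parametrised so that
the detuning `κ - 1` is exactly `4 ε ω w`. -/
theorem kap_eq (ε ω : ℝ) : ∃ w, 0 < w ∧ w ^ 2 = kap ε ω ∧ kap ε ω - 1 = 4 * ε * ω * w ∧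
    w = 2 * ε * ω + √(4 * ε ^ 2 * ω ^ 2 + 1) := by
  have h1 : √(4 * ε ^ 2 * ω ^ 2 + 1) ^ 2 = 4 * ε ^ 2 * ω ^ 2 + 1 := Real.sq_sqrt (by positivity)
  have h2 : |2 * ε * ω| < √(4 * ε ^ 2 * ω ^ 2 + 1) := by
    apply Real.lt_sqrt_of_sq_lt
    rw [sq_abs]; linarith
  refine ⟨_, by linarith [(abs_lt.1 h2).1], ?_, ?_, rfl⟩
  · rw [kap, waveNumber]; ring
  · rw [kap, waveNumber]; linear_combination h1

/-- With this identity the determinant on the mode `1` factors as `-4 κ ε² (1 - 16 ω²)`, which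
vanishes exactly at the ends of the existence interval. -/
theorem kap_sub_one_sq (ε ω : ℝ) : (kap ε ω - 1) ^ 2 = 16 * ε ^ 2 * ω ^ 2 * kap ε ω := by
  obtain ⟨w, -, h1, h2, -⟩ := kap_eq ε ω
  rw [h2, ← h1]; ring

theorem abs_kap_sub_one_le (h0 : 0 ≤ ε) (h1 : ε ≤ 1 / 4) (hω : |ω| ≤ 1 / 4) :
    |kap ε ω - 1| ≤ 2 * ε ∧ |kap ε ω - 1 - 4 * ε * ω| ≤ ε ^ 2 := by
  obtain ⟨w, hw0, -, h3, h4⟩ := kap_eq ε ω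
  have hω' := abs_le.1 hω
  have hx : |ε * ω| ≤ ε * (1 / 4) := by rw [abs_mul, abs_of_nonneg h0]; gcongr
  have hx' := abs_le.1 hx
  have s1 : 1 ≤ √(4 * ε ^ 2 * ω ^ 2 + 1) := Real.one_le_sqrt.2 (by nlinarith [sq_nonneg (ε * ω)])
  have s2 : √(4 * ε ^ 2 * ω ^ 2 + 1) ≤ 1 + ε / 2 := by
    apply Real.sqrt_le_iff.2 ⟨by linarith, ?_⟩
    nlinarith
  have hw1 : |w - 1| ≤ ε := by rw [abs_le]; constructor <;> nlinarith
  have hw1' := abs_le.1 hw1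
  constructor
  · rw [h3, show 4 * ε * ω * w = 4 * (ε * ω) * w by ring, abs_mul, abs_mul, abs_of_pos hw0,
      abs_of_pos (by norm_num : (0 : ℝ) < 4)]
    nlinarith [abs_nonneg (ε * ω)]
  · rw [h3, show 4 * ε * ω * w - 4 * ε * ω = 4 * (ε * ω) * (w - 1) by ring, abs_mul, abs_mul,
      abs_of_pos (by norm_num : (0 : ℝ) < 4)]
    nlinarith [abs_nonneg (ε * ω), abs_nonneg (w - 1)]

end Kap

/-- Data attached to a pattern: the amplitude `s`, with the leading order expansions. -/
structure PatternData (C ε ω s : ℝ) (u : Profile) : Prop where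
  even₁ : IsEven u.1
  even₂ : IsEven u.2
  s_nonneg : 0 ≤ s
  s_le : s ≤ ε
  leading : ‖u - s • critProfile (kap ε ω)‖ ≤ C * ε ^ 3
  amplitude : |24 * s ^ 2 - ε ^ 2 * (1 - 16 * ω ^ 2)| ≤ C * ε ^ 3
  coeff : cc 1 u.2 = -(1 + kap ε ω) * s
  degenerate : s = 0 → u = 0 ∧ ε ^ 2 * (1 - 16 * ω ^ 2) = 0

-- Existence comes from the intermediate value theorem for the scalar bifurcation equation,
-- uniqueness from its strict monotonicity, since every small even steady state is zero or slaved.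
-- The radius and the constant do not depend on `ω`.
set_option maxHeartbeats 1000000 in
theorem exists_patterns : ∃ r > (0 : ℝ), ∃ ε₀ > (0 : ℝ), ∃ u : ℝ → ℝ → Profile, ∃ C > (0 : ℝ),
    ∀ ε ∈ Set.Ico 0 ε₀, ∀ ω ∈ existInterval,
      (IsPattern r ε ω (u ε ω) ∧ ∀ v, IsPattern r ε ω v → v = u ε ω) ∧
      ∃ s, PatternData C ε ω s (u ε ω) := by
  have h0 := one_le_sumInv
  have ha := ampSmall_le
  have ha0 := ampSmall_pos
  -- By the Sobolev constant `sumInv`, an `H²` ball of this radius lies in the sup norm ball where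
  -- steady states are slaved.
  set r : ℝ := ampSmall / sumInv
  have hr : 0 < r := by positivity
  have hrle : sumInv * r = ampSmall := by simp only [r]; field_simp
  have hr1 : r ≤ ampSmall := by rw [← hrle]; exact le_mul_of_one_le_left hr.le h0
  suffices H : ∀ ε ω, ε ∈ Set.Ico 0 (r / 1000) → ω ∈ existInterval → ∃ u,
      (IsPattern r ε ω u ∧ ∀ v, IsPattern r ε ω v → v = u) ∧
      ∃ s, PatternData (80 * sumInv * 10 ^ 10) ε ω s u by
    choose! u hu using H
    exact ⟨r, hr, r / 1000, by positivity, u, _, by positivity, fun ε hε ω hω => hu ε ω hε hω⟩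
  rintro ε ω ⟨hε0, hε1⟩ hω
  have hω' : |ω| ≤ 1 / 4 := abs_le.2 hω
  obtain ⟨hk1, -⟩ := abs_kap_sub_one_le hε0 (by linarith) hω'
  have hkd := kap_sub_one_sq ε ω
  set κ := kap ε ω with hκdef
  have hb : |ε ^ 2| = ε ^ 2 := abs_of_nonneg (sq_nonneg ε)
  have hε2 : ε ^ 2 ≤ ε := by rw [sq]; exact mul_le_of_le_one_left hε0 (by linarith)
  have h : |ε ^ 2| + |κ - 1| ≤ 10 * ampSmall := by rw [hb]; linarith
  have hP := smallParam_of_le h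
  have hκ := abs_le.1 hP.κ_bd
  obtain ⟨Kop, hK⟩ := exists_solOp hP.κ_bd hP.b_bd
  have hω2 : 16 * ω ^ 2 ≤ 1 := by
    have : ω ^ 2 ≤ (1 / 4) ^ 2 := sq_le_sq' hω.1 hω.2
    linarith
  set g := 4 * κ * ε ^ 2 * (1 - 16 * ω ^ 2) with hg
  have hg0 : 0 ≤ g := by
    have : 0 ≤ 1 - 16 * ω ^ 2 := by linarith
    have : 0 ≤ κ := by linarith
    positivity
  have hg1 : g ≤ 95 * ε ^ 2 := by
    have h1 : κ * (1 - 16 * ω ^ 2) ≤ 2 * 1 := by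
      apply mul_le_mul <;> linarith [sq_nonneg ω]
    have h2 := mul_le_mul_of_nonneg_right h1 (sq_nonneg ε)
    rw [hg]
    linarith [sq_nonneg ε]
  have hdet : 4 * ((κ - 1) ^ 2 - ε ^ 2 * κ) = -g := by rw [hkd, hg]; ring
  obtain ⟨s, hs0, hsε, z, hz, hbif⟩ := bif_exists h hK hε0 (by linarith) hg0 hg1
  set u : Profile := s • (critProfile κ + s • z) with hu
  have hsA : |s| ≤ ampSmall := by rw [abs_of_nonneg hs0]; linarith
  obtain ⟨ev1, ev2, hfix, hsteady⟩ := hz.steady_iff h hK hu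
  rw [hbif, hdet, mul_comm (-g)] at hsteady
  have hH := hsteady.2 rfl
  have hun : ‖u‖ ≤ 20 * s := by
    rw [hu, norm_smul, Real.norm_eq_abs, abs_of_nonneg hs0, mul_comm]
    gcongr
    exact norm_critProfile_add_le hP.κ_bd (hsA.trans (by linarith)) hz.norm_le
  have hNn : ‖nonlin (ε ^ 2) u‖ ≤ 10 * (20 * s) ^ 2 := by
    refine (norm_nonlin_le (hP.b_bd.trans (by norm_num)) (by linarith)).trans ?_
    gcongr
  obtain ⟨⟨m1, n1⟩, m2, n2⟩ := normH2_add_solOp_le hP.κ_bd hP.b_bd hK ev1 ev2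
    (nonlin_even _ ev1 ev2) hfix
  have hn : ∀ x : ℝ, x ≤ 20 * |s| + 80 * ‖nonlin (ε ^ 2) u‖ → x ≤ r / 2 := fun x hx => by
    rw [abs_of_nonneg hs0] at hx
    have h1 : s * s ≤ r / 1000 * (r / 1000) :=
      mul_le_mul (by linarith) (by linarith) hs0 (by positivity)
    have h2 : r * r ≤ 1 * r := mul_le_mul_of_nonneg_right (by linarith) hr.le
    linarith
  -- The sign of `u₁(0)` is the sign of the amplitude, so the normalisation selects the positive one
  -- of the two amplitudes, which differ by a half period translation.
  have hpos : ∀ {t : ℝ} {w : Profile}, |t| ≤ ampSmall → ‖w‖ ≤ 1 →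
      ∃ c > 0, (t • (critProfile κ + t • w)).1 0 = t * c := fun {t w} ht hw => by
    refine ⟨8 * κ + t * w.1 0, ?_, ?_⟩
    · have h1 : |t * w.1 0| ≤ 1 * 1 := by
        rw [abs_mul]
        exact mul_le_mul (ht.trans (by linarith)) (norm_profile_le hw 0).1 (abs_nonneg _) (by norm_num)
      linarith [(abs_le.1 h1).1]
    · have : cosn 1 0 = 1 := by simp [cosn_apply]
      simp only [Prod.smul_fst, Prod.fst_add, ContinuousMap.smul_apply, ContinuousMap.add_apply,
        critProfile, smul_eq_mul, this]
      ring
  have hszero : ε = 0 ∨ |ω| = 1 / 4 → s = 0 := by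
    intro hdeg
    have hg' : g = 0 := by
      rcases hdeg with h1 | h1
      · rw [hg, h1]; ring
      · have : ω ^ 2 = (1 / 4) ^ 2 := by rw [← sq_abs, h1]
        rw [hg, this]; ring
    rw [hg', neg_zero] at hbif
    rcases mul_eq_zero.1 hbif with h1 | h1
    · exact pow_eq_zero_iff (two_ne_zero) |>.1 h1
    · linarith [(bifCoeff_bounds h hK hsA hz).2]
  refine ⟨u, ⟨⟨?_, ?_, fun x => ⟨ev1 x, ev2 x⟩, ?_, ?_⟩, ?_⟩, s, ev1, ev2, hs0, hsε, ?_, ?_, ?_, ?_⟩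
  · exact (isSteady_iff ev1 ev2).2 ⟨m1, m2, hH⟩
  · have a1 := hn _ n1
    have a2 := hn _ n2
    have b1 : 0 ≤ normH2 (toL2 u.1) := Real.sqrt_nonneg _
    have b2 : 0 ≤ normH2 (toL2 u.2) := Real.sqrt_nonneg _
    have c1 := pow_le_pow_left₀ b1 a1 2
    have c2 := pow_le_pow_left₀ b2 a2 2
    have c3 : 0 < r ^ 2 := by positivity
    linarith
  · intro e1 e2
    obtain ⟨c, hc, he⟩ := hpos hsA hz.norm_le
    rw [hu, he]
    refine mul_pos (lt_of_le_of_ne hs0 fun h1 => ?_) hc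
    have hg' : g ≠ 0 := by
      have h2 : 1 - 16 * ω ^ 2 ≠ 0 := by
        intro h3
        apply e2
        have h4 : |ω| ^ 2 = (1 / 4) ^ 2 := by rw [sq_abs]; linarith
        exact (pow_left_inj₀ (abs_nonneg _) (by norm_num) two_ne_zero).1 h4
      have h3 : κ ≠ 0 := by linarith [hκ.1]
      rw [hg]; positivity
    apply hg'
    rw [← h1] at hbif
    linarith
  · intro h1
    rw [hu, hszero h1, zero_smul]
  · intro v hv
    by_cases hdeg : ε = 0 ∨ |ω| = 1 / 4
    · rw [hv.degenerate hdeg, hu, hszero hdeg, zero_smul]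
    push Not at hdeg
    have w1 : IsEven v.1 := fun x => (hv.even x).1
    have w2 : IsEven v.2 := fun x => (hv.even x).2
    obtain ⟨p1, p2, hVH⟩ := (isSteady_iff w1 w2).1 hv.steady
    have b1 : 0 ≤ normH2 (toL2 v.1) := Real.sqrt_nonneg _
    have b2 : 0 ≤ normH2 (toL2 v.2) := Real.sqrt_nonneg _
    have hsm := hv.small
    have c1 : normH2 (toL2 v.1) ≤ r := (sq_le_sq₀ b1 hr.le).1 (by linarith [sq_nonneg (normH2 (toL2 v.2))])
    have c2 : normH2 (toL2 v.2) ≤ r := (sq_le_sq₀ b2 hr.le).1 (by linarith [sq_nonneg (normH2 (toL2 v.1))])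
    have hvn : ‖v‖ ≤ ampSmall := by
      rw [← hrle]
      exact max_le ((w1.norm_le_normH2 p1).trans (by gcongr)) ((w2.norm_le_normH2 p2).trans (by gcongr))
    have hvp := hv.pos hdeg.1 hdeg.2
    rcases exists_isSlaved_of_steady h hK w1 w2 hvn hVH with h1 | ⟨t, w, ht0, htA, hw, hvt⟩
    · rw [h1] at hvp; exact absurd hvp (by simp)
    · obtain ⟨c, hc, he⟩ := hpos htA hw.norm_le
      rw [hvt, he] at hvp
      have htp : 0 < t := pos_of_mul_pos_left hvp hc.le
      have hs2 := (hw.steady_iff h hK hvt).2.2.2.1 hVH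
      rw [hdet, mul_comm (-g)] at hs2
      have hs3 := mul_left_cancel₀ ht0 hs2
      obtain ⟨e1, e2⟩ := bif_unique h hK htp.le (by rwa [abs_of_pos htp] at htA) hs0
        (by rwa [abs_of_nonneg hs0] at hsA) hw hz (by rw [hbif, ← hs3])
      rw [hvt, hu, e1, e2]
  · have e : u - s • critProfile κ = (s ^ 2) • z := by rw [hu]; module
    rw [e, norm_smul, Real.norm_of_nonneg (sq_nonneg s)]
    have h1 := hz.norm_le' hP hK (hsA.trans ampSmall_le_ampMax)
    rw [abs_of_nonneg hs0, hb] at h1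
    have h2 : 20000 * s + 300 * (ε ^ 2 + |κ - 1|) ≤ 10 ^ 10 * ε := by linarith
    calc s ^ 2 * ‖z‖ ≤ ε ^ 2 * (80 * sumInv * (10 ^ 10 * ε)) := by
          gcongr
          exact h1.trans (mul_le_mul_of_nonneg_left h2 (by positivity))
      _ = _ := by ring
  · have h1 := abs_bifCoeff_add_le h hK hsA hz
    rw [abs_of_nonneg hs0, hb] at h1
    have h2 : 80 * sumInv * (10 ^ 9 * (s + (ε ^ 2 + |κ - 1|))) ≤ 80 * sumInv * (10 ^ 9 * (4 * ε)) := by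
      gcongr
      linarith
    have e : 24 * s ^ 2 - ε ^ 2 * (1 - 16 * ω ^ 2) =
        1 / 4 * (s ^ 2 * (bifCoeff κ (ε ^ 2) s z + 96)) +
          (κ - 1) * (ε ^ 2 * (1 - 16 * ω ^ 2)) := by
      rw [mul_add, hbif, hg]; ring
    have h3 : |s ^ 2 * (bifCoeff κ (ε ^ 2) s z + 96)| ≤ ε ^ 2 * (80 * sumInv * (10 ^ 9 * (4 * ε))) := by
      rw [abs_mul, abs_of_nonneg (sq_nonneg s)]
      have : s ^ 2 ≤ ε ^ 2 := by gcongr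
      exact mul_le_mul this (h1.trans h2) (abs_nonneg _) (sq_nonneg _)
    have h4 : |(κ - 1) * (ε ^ 2 * (1 - 16 * ω ^ 2))| ≤ 2 * ε * ε ^ 2 := by
      rw [abs_mul]
      refine mul_le_mul hk1 ?_ (abs_nonneg _) (by positivity)
      rw [abs_of_nonneg (mul_nonneg (sq_nonneg _) (by linarith))]
      exact mul_le_of_le_one_right (sq_nonneg ε) (by linarith [sq_nonneg ω])
    rw [e]
    refine (abs_add_le _ _).trans ?_
    rw [abs_mul (1 / 4)]
    have hε3 : 0 ≤ ε ^ 3 := by positivity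
    have h5 : 2 * ε * ε ^ 2 ≤ 80 * sumInv * ε ^ 3 := by linarith [le_mul_of_one_le_left hε3 h0]
    have h6 : |(1 / 4 : ℝ)| = 1 / 4 := abs_of_pos (by norm_num)
    rw [h6]
    refine (add_le_add (mul_le_mul_of_nonneg_left h3 (by norm_num)) (h4.trans h5)).trans ?_
    have h7 : 0 ≤ sumInv * ε ^ 3 := by positivity
    linarith
  · have hcz : cc 1 z.2 = 0 := by rw [hz.eq, hK.coeff₂, critMode, if_pos (Or.inl rfl)]; ring
    rw [hu, Prod.smul_snd, Prod.snd_add, Prod.smul_snd, map_smul, map_add, map_smul, hcz,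
      (cc_critProfile κ 1).2, critMode, if_pos (Or.inl rfl)]
    simp only [smul_eq_mul]; ring
  · intro h1
    refine ⟨by rw [hu, h1, zero_smul], ?_⟩
    rw [h1, hg] at hbif
    have h2 : κ * (ε ^ 2 * (1 - 16 * ω ^ 2)) = 0 := by linarith
    exact (mul_eq_zero.1 h2).resolve_left (by linarith [hκ.1])

/-! ### Differentiation of profiles -/

/-- `f'` is the derivative of the `2π`-periodic function `f`. -/
def HasCircDeriv (f f' : C(Circ, ℝ)) : Prop :=
  ∀ x : ℝ, HasDerivAt (fun y : ℝ => f (y : Circ)) (f' (x : Circ)) x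

namespace HasCircDeriv

variable {f f' g g' : C(Circ, ℝ)}

theorem add (hf : HasCircDeriv f f') (hg : HasCircDeriv g g') : HasCircDeriv (f + g) (f' + g') :=
  fun x => (hf x).add (hg x)

theorem smul (hf : HasCircDeriv f f') (c : ℝ) : HasCircDeriv (c • f) (c • f') :=
  fun x => (hf x).const_mul c

theorem mul (hf : HasCircDeriv f f') (hg : HasCircDeriv g g') :
    HasCircDeriv (f * g) (f' * g + f * g') :=
  fun x => (hf x).mul (hg x)

/-- Integration by parts over one period: the boundary terms cancel by periodicity. -/
theorem cf_eq (h : HasCircDeriv f f') (n : ℤ) :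
    cf n (toL2 f') = Complex.I * n * cf n (toL2 f) := by
  have hT : (2 * π : ℝ) ≠ 0 := Real.two_pi_pos.ne'
  have hF : ∀ x : ℝ, HasDerivAt (fun y : ℝ => fourier (-n) (y : Circ) * (f (y : Circ) : ℂ))
      (-(Complex.I * n) * (fourier (-n) (x : Circ) * (f (x : Circ) : ℂ)) +
        fourier (-n) (x : Circ) * (f' (x : Circ) : ℂ)) x := fun x => by
    have h1 := hasDerivAt_fourier_neg (2 * π) n x
    refine (h1.mul (h x).ofReal_comp).congr_deriv ?_
    have : (-2 * π * Complex.I * n / ((2 * π : ℝ) : ℂ)) = -(Complex.I * n) := by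
      have : (π : ℂ) ≠ 0 := by exact_mod_cast Real.pi_ne_zero
      push_cast; field_simp
    rw [this]; ring
  have c1 : Continuous fun x : ℝ => fourier (-n) (x : Circ) * (f (x : Circ) : ℂ) := by
    have := AddCircle.continuous_mk' (2 * π)
    exact ((fourier (-n)).continuous.comp this).mul
      (Complex.continuous_ofReal.comp (f.continuous.comp this))
  have c2 : Continuous fun x : ℝ => fourier (-n) (x : Circ) * (f' (x : Circ) : ℂ) := by
    have := AddCircle.continuous_mk' (2 * π)
    exact ((fourier (-n)).continuous.comp this).mul
      (Complex.continuous_ofReal.comp (f'.continuous.comp this))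
  have hint := intervalIntegral.integral_eq_sub_of_hasDerivAt (a := 0) (b := 0 + 2 * π)
    (fun x _ => hF x) (((c1.const_mul _).add c2).intervalIntegrable _ _)
  rw [intervalIntegral.integral_add ((c1.const_mul _).intervalIntegrable _ _)
    (c2.intervalIntegrable _ _), intervalIntegral.integral_const_mul] at hint
  have h0 : ((0 + 2 * π : ℝ) : Circ) = ((0 : ℝ) : Circ) := by
    rw [zero_add, AddCircle.coe_period]; rfl
  rw [h0, sub_self] at hint
  rw [cf_toL2, cf_toL2, fourierCoeff_eq_intervalIntegral _ n 0,
    fourierCoeff_eq_intervalIntegral _ n 0]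
  simp only [complexify, ContinuousMap.coe_mk, smul_eq_mul, Complex.real_smul]
  linear_combination ((1 / (2 * π) : ℝ) : ℂ) * hint

end HasCircDeriv

/-- The function `sin (n ξ)`. -/
def sinn (n : ℤ) : C(Circ, ℝ) :=
  ⟨fun x => (fourier n x).im, Complex.continuous_im.comp (fourier n).continuous⟩

theorem norm_sinn_le (n : ℤ) : ‖sinn n‖ ≤ 1 := by
  rw [ContinuousMap.norm_le _ zero_le_one]
  intro x
  change |(fourier n x).im| ≤ 1
  refine (Complex.abs_im_le_norm _).trans ?_
  exact ((fourier n).norm_coe_le_norm x).trans (fourier_norm n).le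

theorem hasCircDeriv_cosn (n : ℤ) : HasCircDeriv (cosn n) ((-(n : ℝ)) • sinn n) := fun x => by
  have h1 := hasDerivAt_fourier (2 * π) n x
  have h2 := Complex.reCLM.hasFDerivAt.comp_hasDerivAt x h1
  refine h2.congr_deriv ?_
  have : (2 * π * Complex.I * n / ((2 * π : ℝ) : ℂ)) = Complex.I * n := by
    have : (π : ℂ) ≠ 0 := by exact_mod_cast Real.pi_ne_zero
    push_cast; field_simp
  rw [this]
  simp [sinn]

/-- Termwise differentiation of the cosine series; an `H²` function has `∑ |n| |cₙ|` finite, so the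
differentiated series converges uniformly. -/
theorem IsEven.exists_deriv {f : C(Circ, ℝ)} (hf : IsEven f) (h : toL2 f ∈ H2) :
    ∃ f', HasCircDeriv f f' := by
  obtain ⟨w, hw⟩ := exists_cf_of_mem_H2 h
  have hcc : ∀ n : ℤ, ‖cf n w‖ = (1 + (n : ℝ) ^ 2) * |cc n f| := fun n => by
    have e2 : (1 + (n : ℂ) ^ 2) = ((1 + (n : ℝ) ^ 2 : ℝ) : ℂ) := by push_cast; rfl
    rw [hw, hf.cf_eq, e2, norm_mul, Complex.norm_real, Complex.norm_real,
      Real.norm_of_nonneg (by positivity), Real.norm_eq_abs]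
  have hs : Summable fun n : ℤ => 1 / (1 + (n : ℝ) ^ 2) + ‖cf n w‖ ^ 2 :=
    summable_one_div_one_add_sq.add (summable_sq_cf w)
  -- The inequality between the arithmetic and geometric means, with `y = (1 + n²) |cₙ|` as
  -- variable; the right side is summable because `y` is square summable.
  have hb : ∀ n : ℤ, (1 + |(n : ℝ)|) * |cc n f| ≤ 1 / (1 + (n : ℝ) ^ 2) + ‖cf n w‖ ^ 2 := fun n => by
    have hp : 0 < 1 + (n : ℝ) ^ 2 := by positivity
    rw [hcc, ← sub_nonneg]
    set m := |(n : ℝ)|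
    have hm : (n : ℝ) ^ 2 = m ^ 2 := (sq_abs _).symm
    set a := |cc n f|
    rw [hm] at hp ⊢
    have e : 1 / (1 + m ^ 2) + ((1 + m ^ 2) * a) ^ 2 - (1 + m) * a =
        (1 + ((1 + m ^ 2) * a) ^ 2 * (1 + m ^ 2) - (1 + m) * (a * (1 + m ^ 2))) / (1 + m ^ 2) := by
      field_simp
    rw [e]
    apply div_nonneg _ hp.le
    set y := (1 + m ^ 2) * a
    have e1 : a * (1 + m ^ 2) = y := by ring
    rw [e1]
    nlinarith [sq_nonneg (2 - (1 + m) * y), sq_nonneg ((m - 1) * y), sq_nonneg y, sq_nonneg (m * y)]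
  have s1 : Summable fun n : ℤ => |cc n f| :=
    Summable.of_nonneg_of_le (fun _ => abs_nonneg _)
      (fun n => le_trans (by nlinarith [abs_nonneg (n : ℝ), abs_nonneg (cc n f)]) (hb n)) hs
  have s2 : ∀ n : ℤ, ‖cc n f • ((-(n : ℝ)) • sinn n)‖ ≤
      1 / (1 + (n : ℝ) ^ 2) + ‖cf n w‖ ^ 2 := fun n => by
    refine le_trans ?_ (hb n)
    rw [norm_smul, norm_smul, norm_neg, Real.norm_eq_abs, Real.norm_eq_abs]
    have := norm_sinn_le n
    nlinarith [abs_nonneg (n : ℝ), abs_nonneg (cc n f),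
      mul_nonneg (abs_nonneg (cc n f)) (abs_nonneg (n : ℝ)),
      mul_le_mul_of_nonneg_left this (mul_nonneg (abs_nonneg (cc n f)) (abs_nonneg (n : ℝ)))]
  have hsum : Summable fun n : ℤ => cc n f • ((-(n : ℝ)) • sinn n) := Summable.of_norm_bounded hs s2
  have hfs : f = synth fun n => cc n f := hf.ext_cc (synth_even s1) fun n => by
    rw [cc_synth s1 fun k => cc_neg k f]
  refine ⟨∑' n : ℤ, cc n f • ((-(n : ℝ)) • sinn n), fun x => ?_⟩
  have hev : ∀ y : Circ, HasSum (fun n : ℤ => cc n f * cosn n y) (f y) := fun y => by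
    have := (hasSum_synth s1).mapL (ContinuousMap.evalCLM ℝ y)
    rw [← hfs] at this
    exact this
  have hev' := hsum.hasSum.mapL (ContinuousMap.evalCLM ℝ (x : Circ))
  have key := hasDerivAt_tsum (𝕜 := ℝ) (F := ℝ) hs
    (g := fun (n : ℤ) (y : ℝ) => cc n f * cosn n (y : Circ))
    (g' := fun (n : ℤ) (y : ℝ) => (cc n f • ((-(n : ℝ)) • sinn n)) (y : Circ))
    (fun n y => (hasCircDeriv_cosn n y).const_mul (cc n f))
    (fun n y => (ContinuousMap.norm_coe_le_norm _ _).trans (s2 n)) (hev ((0 : ℝ) : Circ)).summable x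
  have e1 : (fun y : ℝ => f (y : Circ)) = fun y : ℝ => ∑' n : ℤ, cc n f * cosn n (y : Circ) := by
    funext y; exact (hev _).tsum_eq.symm
  rw [e1]
  refine key.congr_deriv ?_
  exact hev'.tsum_eq

/-- The nonlinearity satisfies the chain rule. -/
theorem hasCircDeriv_nonlin (b : ℝ) {u u' : Profile} (h₁ : HasCircDeriv u.1 u'.1)
    (h₂ : HasCircDeriv u.2 u'.2) :
    HasCircDeriv (nonlin b u) (pot₁ b u * u'.1 + pot₂ u * u'.2) := by
  have h := (((h₁.mul h₁).smul (b / 2 + 2)).add ((h₁.mul h₂).smul 4)).add ((h₁.mul h₁).mul h₂)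
  have e : nonlin b u = (b / 2 + 2) • (u.1 * u.1) + (4 : ℝ) • (u.1 * u.2) + u.1 * u.1 * u.2 := by
    simp only [nonlin, pow_two]
  rw [e]
  convert h using 1
  ext x
  simp only [pot₁, pot₂, ContinuousMap.add_apply, ContinuousMap.smul_apply,
    ContinuousMap.mul_apply, ContinuousMap.pow_apply, smul_eq_mul]
  ring

/-- The derivative of a steady state lies in the kernel of the co-periodic linearisation; here in
terms of the inverse `R` of the shifted linearisation. -/
theorem kernel_of_steady {κ b : ℝ} (hκ : |κ - 1| ≤ 1 / 10) (hb : |b| ≤ 1 / 10) {u : Profile}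
    (h₁ : IsEven u.1) (h₂ : IsEven u.2) (m₁ : toL2 u.1 ∈ H2) (m₂ : toL2 u.2 ∈ H2)
    (H : ∀ n, (b + 3 - qv κ 0 n) * cc n u.1 + 4 * cc n u.2 + cc n (nonlin b u) = 0 ∧
      -(b + 4) * cc n u.1 - (4 + 4 * qv κ 0 n) * cc n u.2 - cc n (nonlin b u) = 0)
    {R : State →L[ℂ] State}
    (hR : IsInv (linOp κ b 0 + onDom dom shiftOp + onDom dom (potOp (pot₁ b u) (pot₂ u))) R)
    (h0 : cc 1 u.2 ≠ 0) : critOut (R (critIn ![1, -1])) = ![1, -1] := by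
  obtain ⟨u₁', d₁⟩ := h₁.exists_deriv m₁
  obtain ⟨u₂', d₂⟩ := h₂.exists_deriv m₂
  have dN := hasCircDeriv_nonlin b (u := u) (u' := (u₁', u₂')) d₁ d₂
  set V : State := (toL2 u₁', toL2 u₂')
  set U := potOp (pot₁ b u) (pot₂ u)
  have hUV : mulOp (pot₁ b u) V.1 + mulOp (pot₂ u) V.2 = toL2 (pot₁ b u * u₁' + pot₂ u * u₂') := by
    rw [mulOp_toL2, mulOp_toL2, toL2_add]
  have hA := admissible_shift hκ hb (σ := 0) (by norm_num)
  have hz : -((1 / 5 : ℝ) / 32) ≤ (0 : ℂ).re := by norm_num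
  have hw1 : ∀ n : ℤ, ‖(1 : ℤ → ℂ) n‖ ≤ 1 * (1 + qv κ 0 n) := fun n => by simp [hA.qv_nonneg n]
  have hI := isInv_shiftRes hκ hb (σ := 0) (by norm_num) (z := 0) (by norm_num)
  -- The derivative `V` is only known to be continuous, not to lie in the domain. So `v` is produced
  -- in the domain by the shifted resolvent and identified with `V` through Fourier coefficients,
  -- using the steady state equations multiplied by `i n`.
  obtain ⟨v, hv, hTv⟩ := hI.1 (shiftOp V - U V)
  have hc : ∀ n, cf n V.1 = Complex.I * n * cc n u.1 ∧ cf n V.2 = Complex.I * n * cc n u.2 :=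
    fun n => ⟨by rw [d₁.cf_eq, h₁.cf_eq], by rw [d₂.cf_eq, h₂.cf_eq]⟩
  have hN : ∀ n, cf n (mulOp (pot₁ b u) V.1 + mulOp (pot₂ u) V.2) =
      Complex.I * n * cc n (nonlin b u) := fun n => by
    rw [hUV, dN.cf_eq, (nonlin_even b h₁ h₂).cf_eq]
  have hvV : (v : State) = V := by
    rw [hv]
    have E : ∀ n, ((b : ℂ) + 3 - qv κ 0 n) * cf n V.1 + 4 * cf n V.2 +
        cf n (mulOp (pot₁ b u) V.1 + mulOp (pot₂ u) V.2) = 0 ∧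
        -((b : ℂ) + 4) * cf n V.1 - (4 + 4 * qv κ 0 n) * cf n V.2 -
        cf n (mulOp (pot₁ b u) V.1 + mulOp (pot₂ u) V.2) = 0 := fun n => by
      have e1 : (((b + 3 - qv κ 0 n) * cc n u.1 + 4 * cc n u.2 + cc n (nonlin b u) : ℝ) : ℂ) = 0 := by
        rw [(H n).1]; norm_num
      have e2 : ((-(b + 4) * cc n u.1 - (4 + 4 * qv κ 0 n) * cc n u.2 - cc n (nonlin b u) : ℝ) : ℂ)
          = 0 := by rw [(H n).2]; norm_num
      push_cast at e1 e2
      rw [(hc n).1, (hc n).2, hN]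
      exact ⟨by linear_combination Complex.I * n * e1, by linear_combination Complex.I * n * e2⟩
    refine State_ext (fun n => ?_) fun n => ?_
    · rw [shiftRes, cf_resMult_fst hA hz hw1, Prod.fst_sub, Prod.snd_sub, map_sub, map_sub,
        cf_shiftOp_fst, cf_shiftOp_snd, potOp_fst, potOp_snd, map_neg, Pi.one_apply, one_mul,
        div_eq_iff (hA.symDet_ne_zero hz n), symDet]
      obtain ⟨E1, E2⟩ := E n
      push_cast
      linear_combination (-(4 + 4 * (qv κ 0 n : ℂ) + critMode n)) * (-E1) - (4 + 2 * critMode n) * (-E2)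
    · rw [shiftRes, cf_resMult_snd hA hz hw1, Prod.fst_sub, Prod.snd_sub, map_sub, map_sub,
        cf_shiftOp_fst, cf_shiftOp_snd, potOp_fst, potOp_snd, map_neg, Pi.one_apply, one_mul,
        div_eq_iff (hA.symDet_ne_zero hz n), symDet]
      obtain ⟨E1, E2⟩ := E n
      push_cast
      linear_combination ((b : ℂ) + 4) * (-E1) + (b + 3 - (qv κ 0 n : ℂ)) * (-E2)
  -- `V` is annihilated by the unshifted linearisation, so the shifted one sends it to `shiftOp V`.
  have hRV : R (critIn (critOut V)) = V := by
    have h3 := hR.2 v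
    simp only [LinearMap.add_apply, onDom_apply, zero_smul, sub_zero] at h3 hTv
    rw [hTv, hvV, sub_add_cancel] at h3
    exact h3
  -- The derivative of an even function is odd, so its coefficients at `±1` are opposite; this
  -- singles out the vector `(1, -1)`.
  set a : ℂ := Complex.I * cc 1 u.2
  have ha : a ≠ 0 := mul_ne_zero Complex.I_ne_zero (by exact_mod_cast h0)
  have hout : critOut V = a • ![1, -1] := by
    funext j
    rw [critOut_apply, (hc _).2]
    fin_cases j
    · simp [a]
    · simp [a, cc_neg]
  have h5 := congrArg critOut hRV
  rw [hout, map_smul, map_smul, map_smul] at h5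
  exact smul_right_injective _ ha h5

/-! ### Functions with a quantitative first order expansion at `0` -/

/-- `F` has a first order expansion at `0` with all constants bounded by `C`. -/
def Jet {X : Type*} [NormedAddCommGroup X] [NormedSpace ℂ X] (C : ℝ) (F : ℝ → X) : Prop :=
  ‖F 0‖ ≤ C ∧ ∃ T : X, ‖T‖ ≤ C ∧ ∀ σ : ℝ, |σ| ≤ 1 / 2 → ‖F σ - F 0 - (σ : ℂ) • T‖ ≤ C * σ ^ 2

namespace Jet

variable {X : Type*} [NormedAddCommGroup X] [NormedSpace ℂ X] {C D : ℝ} {F G : ℝ → X}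

theorem nonneg (h : Jet C F) : 0 ≤ C := (norm_nonneg _).trans h.1

theorem mono (h : Jet C F) (hCD : C ≤ D) : Jet D F := by
  obtain ⟨h0, T, hT, h⟩ := h
  exact ⟨h0.trans hCD, T, hT.trans hCD, fun σ hσ =>
    (h σ hσ).trans (mul_le_mul_of_nonneg_right hCD (sq_nonneg _))⟩

theorem congr (h : Jet C F) (hFG : ∀ σ, |σ| ≤ 1 / 2 → F σ = G σ) : Jet C G := by
  obtain ⟨h0, T, hT, h⟩ := h
  have e0 := hFG 0 (by norm_num)
  exact ⟨by rwa [← e0], T, hT, fun σ hσ => by rw [← e0, ← hFG σ hσ]; exact h σ hσ⟩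

theorem const (x : X) : Jet ‖x‖ fun _ => x :=
  ⟨le_rfl, 0, by simp, fun σ _ => by simp; positivity⟩

theorem add (hF : Jet C F) (hG : Jet D G) : Jet (C + D) fun σ => F σ + G σ := by
  obtain ⟨f0, T, hT, f⟩ := hF
  obtain ⟨g0, S, hS, g⟩ := hG
  refine ⟨(norm_add_le _ _).trans (add_le_add f0 g0), T + S,
    (norm_add_le _ _).trans (add_le_add hT hS), fun σ hσ => ?_⟩
  have e : F σ + G σ - (F 0 + G 0) - (σ : ℂ) • (T + S) =
      (F σ - F 0 - (σ : ℂ) • T) + (G σ - G 0 - (σ : ℂ) • S) := by module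
  rw [e, add_mul]
  exact (norm_add_le _ _).trans (add_le_add (f σ hσ) (g σ hσ))

theorem map {Y : Type*} [NormedAddCommGroup Y] [NormedSpace ℂ Y] (h : Jet C F) (L : X →ₗ[ℂ] Y)
    {K : ℝ} (hK : 0 ≤ K) (hL : ∀ x, ‖L x‖ ≤ K * ‖x‖) : Jet (K * C) fun σ => L (F σ) := by
  obtain ⟨f0, T, hT, f⟩ := h
  refine ⟨(hL _).trans (by gcongr), L T, (hL _).trans (by gcongr), fun σ hσ => ?_⟩
  rw [← map_smul, ← map_sub, ← map_sub, mul_assoc]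
  exact (hL _).trans (mul_le_mul_of_nonneg_left (f σ hσ) hK)

theorem norm_sub_le (h : Jet C F) {σ : ℝ} (hσ : |σ| ≤ 1 / 2) : ‖F σ - F 0‖ ≤ 3 / 2 * C * |σ| := by
  have hC := h.nonneg
  obtain ⟨-, T, hT, f⟩ := h
  have h1 := norm_le_norm_sub_add (F σ - F 0) ((σ : ℂ) • T)
  have h2 : ‖(σ : ℂ) • T‖ ≤ |σ| * C := by
    rw [norm_smul, Complex.norm_real, Real.norm_eq_abs]
    gcongr
  have h3 : C * σ ^ 2 ≤ C * (|σ| * (1 / 2)) := by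
    rw [← sq_abs, pow_two]
    gcongr
  linarith [f σ hσ]

theorem norm_le (h : Jet C F) {σ : ℝ} (hσ : |σ| ≤ 1 / 2) : ‖F σ‖ ≤ 2 * C := by
  have h1 := h.norm_sub_le hσ
  have h2 := norm_le_norm_sub_add (F σ) (F 0)
  have h3 : 3 / 2 * C * |σ| ≤ 3 / 2 * C * (1 / 2) :=
    mul_le_mul_of_nonneg_left hσ (by linarith [h.nonneg])
  linarith [h.1, h.nonneg]

/-- The linear term cancels in the sum over `±σ`. Reflection symmetry brings the expansions below
into this form. -/
theorem norm_second_le (h : Jet C F) {σ : ℝ} (hσ : |σ| ≤ 1 / 2) :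
    ‖(F σ - F 0) + (F (-σ) - F 0)‖ ≤ 2 * C * σ ^ 2 := by
  obtain ⟨-, T, hT, f⟩ := h
  have e : (F σ - F 0) + (F (-σ) - F 0) =
      (F σ - F 0 - (σ : ℂ) • T) + (F (-σ) - F 0 - ((-σ : ℝ) : ℂ) • T) := by
    push_cast; module
  have h2 := f (-σ) (by rwa [abs_neg])
  rw [e]
  refine (norm_add_le _ _).trans ?_
  rw [neg_sq] at h2
  linarith [f σ hσ]

theorem mul {A : Type*} [NormedRing A] [NormedAlgebra ℂ A] {F G : ℝ → A} (hF : Jet C F)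
    (hG : Jet D G) : Jet (5 * C * D) fun σ => F σ * G σ := by
  have hC := hF.nonneg
  have hD := hG.nonneg
  have hF' := hF
  have hG' := hG
  obtain ⟨f0, T, hT, f⟩ := hF
  obtain ⟨g0, S, hS, g⟩ := hG
  have hCD : 0 ≤ C * D := mul_nonneg hC hD
  refine ⟨(norm_mul_le _ _).trans ?_, T * G 0 + F 0 * S, (norm_add_le _ _).trans ?_,
    fun σ hσ => ?_⟩
  · nlinarith [mul_le_mul f0 g0 (norm_nonneg _) hC]
  · have h1 := (norm_mul_le T (G 0)).trans (mul_le_mul hT g0 (norm_nonneg _) hC)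
    have h2 := (norm_mul_le (F 0) S).trans (mul_le_mul f0 hS (norm_nonneg _) hC)
    linarith
  · have e : F σ * G σ - F 0 * G 0 - (σ : ℂ) • (T * G 0 + F 0 * S) =
        (F σ - F 0 - (σ : ℂ) • T) * G σ + F 0 * (G σ - G 0 - (σ : ℂ) • S) +
          (σ : ℂ) • (T * (G σ - G 0)) := by
      simp only [sub_mul, mul_sub, smul_add, smul_mul_assoc, mul_smul_comm, smul_sub]
      abel
    rw [e]
    have h1 := (norm_mul_le (F σ - F 0 - (σ : ℂ) • T) (G σ)).trans
      (mul_le_mul (f σ hσ) (hG'.norm_le hσ) (norm_nonneg _) (by positivity))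
    have h2 := (norm_mul_le (F 0) (G σ - G 0 - (σ : ℂ) • S)).trans
      (mul_le_mul f0 (g σ hσ) (norm_nonneg _) hC)
    have h3 : ‖(σ : ℂ) • (T * (G σ - G 0))‖ ≤ |σ| * (C * (3 / 2 * D * |σ|)) := by
      rw [norm_smul, Complex.norm_real, Real.norm_eq_abs]
      gcongr
      exact (norm_mul_le _ _).trans (mul_le_mul hT (hG'.norm_sub_le hσ) (norm_nonneg _) hC)
    have h4 : |σ| * (C * (3 / 2 * D * |σ|)) = 3 / 2 * (C * D) * σ ^ 2 := by
      rw [← sq_abs σ]; ring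
    refine (norm_add₃_le).trans ?_
    nlinarith [mul_nonneg hCD (sq_nonneg σ)]

/-- A resolvent identity with polynomial perturbation, iterated once, gives the first order
expansion with quadratic remainder; only a uniform bound on `R` is needed. -/
theorem of_inverse {A : Type*} [NormedRing A] [NormedAlgebra ℂ A] {R : ℝ → A} {Y₁ Y₂ : A}
    (hC : 1 ≤ C) (hR : ∀ σ, |σ| ≤ 1 / 2 → ‖R σ‖ ≤ C) (h₁ : ‖Y₁‖ ≤ C) (h₂ : ‖Y₂‖ ≤ C)
    (h : ∀ σ, |σ| ≤ 1 / 2 → R σ = R 0 - R σ * ((σ : ℂ) • Y₁ + (σ : ℂ) ^ 2 • Y₂)) :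
    Jet (4 * C ^ 3) R := by
  have h0 := hR 0 (by norm_num)
  have hC0 : 0 ≤ C := by linarith
  have hC3 : C ^ 2 ≤ C ^ 3 := pow_le_pow_right₀ hC (by norm_num)
  have hC2 : C ≤ C ^ 2 := by nlinarith
  refine ⟨by linarith, -(R 0 * Y₁), ?_, fun σ hσ => ?_⟩
  · rw [norm_neg]
    have := (norm_mul_le (R 0) Y₁).trans (mul_le_mul h0 h₁ (norm_nonneg _) hC0)
    nlinarith
  · set Z := (σ : ℂ) • Y₁ + (σ : ℂ) ^ 2 • Y₂ with hZ
    have hZn : ‖Z‖ ≤ 3 / 2 * C * |σ| := by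
      refine (norm_add_le _ _).trans ?_
      rw [norm_smul, norm_smul, norm_pow, Complex.norm_real, Real.norm_eq_abs]
      have e1 : |σ| * ‖Y₁‖ ≤ |σ| * C := by gcongr
      have e2 : |σ| ^ 2 * ‖Y₂‖ ≤ |σ| * (1 / 2) * C := by rw [pow_two]; gcongr
      linarith
    -- Inserting the identity into itself gives `R σ = R 0 - R 0 * Z + R σ * Z * Z`.
    have e : R σ - R 0 - (σ : ℂ) • -(R 0 * Y₁) = R σ * Z * Z - (σ : ℂ) ^ 2 • (R 0 * Y₂) := by
      have h5 := h σ hσ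
      have h6 : R σ * Z = R 0 - R σ := by rw [sub_eq_iff_eq_add.1 h5.symm]; abel
      have h7 : R σ = R 0 - (R 0 - R σ * Z) * Z := by rw [← h5]; exact h5
      conv_lhs => rw [h7]
      rw [sub_mul, hZ]
      simp only [mul_add, mul_smul_comm]
      module
    rw [e]
    refine (_root_.norm_sub_le _ _).trans ?_
    have n1 : ‖R σ * Z * Z‖ ≤ C * (3 / 2 * C * |σ|) * (3 / 2 * C * |σ|) := by
      refine (norm_mul_le _ _).trans (mul_le_mul ((norm_mul_le _ _).trans ?_) hZn (norm_nonneg _)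
        (by positivity))
      exact mul_le_mul (hR σ hσ) hZn (norm_nonneg _) hC0
    have n2 : ‖(σ : ℂ) ^ 2 • (R 0 * Y₂)‖ ≤ |σ| ^ 2 * (C * C) := by
      rw [norm_smul, norm_pow, Complex.norm_real, Real.norm_eq_abs]
      gcongr
      exact (norm_mul_le _ _).trans (mul_le_mul h0 h₂ (norm_nonneg _) hC0)
    have n3 : C * (3 / 2 * C * |σ|) * (3 / 2 * C * |σ|) = 9 / 4 * C ^ 3 * σ ^ 2 := by
      rw [← sq_abs σ]; ring
    rw [sq_abs] at n2
    nlinarith [sq_nonneg σ, mul_le_mul_of_nonneg_right hC3 (sq_nonneg σ),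
      mul_nonneg (pow_nonneg hC0 3) (sq_nonneg σ)]

end Jet

/-! ### Dependence of the resolvents on the Floquet exponent -/

/-- The matrix `diag(1, 4)` composed with the weighted resolvent at `σ = 0`. -/
def derRes (w : ℤ → ℂ) (κ b : ℝ) : State →L[ℂ] State :=
  (ContinuousLinearMap.fst ℂ L2 L2 ∘L resMult w κ b 0 critMode 0).prod
    ((4 : ℂ) • (ContinuousLinearMap.snd ℂ L2 L2 ∘L resMult w κ b 0 critMode 0))

section DerRes

variable {κ b : ℝ} (hκ : |κ - 1| ≤ 1 / 10) (hb : |b| ≤ 1 / 10)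
include hκ hb

theorem norm_derRes_le {w : ℤ → ℂ} {K : ℝ} (hK : 0 ≤ K) (hw : ∀ n, ‖w n‖ ≤ K * (1 + qv κ 0 n)) :
    ‖derRes w κ b‖ ≤ 122880 * K := by
  have hA := admissible_shift hκ hb (σ := 0) (by norm_num)
  have h1 := norm_resMult_le hA (z := 0) (by norm_num) hw
  refine ContinuousLinearMap.opNorm_le_bound _ (by positivity) fun f => ?_
  have h0 : 0 ≤ K * ‖f‖ := by positivity
  have h2 := (resMult w κ b 0 critMode 0).le_of_opNorm_le h1 f
  have h3 : ‖(resMult w κ b 0 critMode 0 f).1‖ ≤ _ := (norm_fst_le _).trans h2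
  have h4 : ‖(resMult w κ b 0 critMode 0 f).2‖ ≤ _ := (norm_snd_le _).trans h2
  refine max_le ?_ ?_
  · change ‖(resMult w κ b 0 critMode 0 f).1‖ ≤ _
    linarith
  · change ‖(4 : ℂ) • (resMult w κ b 0 critMode 0 f).2‖ ≤ _
    rw [norm_smul, Complex.norm_ofNat]
    linarith

omit hb in
theorem linear_weight_le (n : ℤ) : ‖((-(2 * κ * n) : ℝ) : ℂ)‖ ≤ 2 * (1 + qv κ 0 n) := by
  have hκ' := abs_le.1 hκ
  rw [Complex.norm_real, Real.norm_eq_abs, abs_neg, abs_mul, abs_of_pos (by linarith), qv, add_zero,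
    ← sq_abs (n : ℝ)]
  nlinarith [sq_nonneg (|(n : ℝ)| - 1)]

theorem const_weight_le (n : ℤ) : ‖((-κ : ℝ) : ℂ)‖ ≤ 2 * (1 + qv κ 0 n) := by
  have hκ' := abs_le.1 hκ
  have hA := (admissible_shift hκ hb (σ := 0) (by norm_num)).qv_nonneg n
  rw [Complex.norm_real, Real.norm_eq_abs, abs_neg, abs_of_pos (by linarith)]
  linarith

/-- The first order part of the dependence of `linOp` on `σ`, composed with the resolvent. -/
theorem linOp_expand (σ : ℝ) {f : State} {v : dom} (hv : (v : State) = shiftRes κ b 0 0 f) :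
    linOp κ b σ v = linOp κ b 0 v + ((σ : ℂ) • derRes (fun n => ((-(2 * κ * n) : ℝ) : ℂ)) κ b +
      (σ : ℂ) ^ 2 • derRes (fun _ => ((-κ : ℝ) : ℂ)) κ b) f := by
  have hA := admissible_shift hκ hb (σ := 0) (by norm_num)
  have hz : -((1 / 5 : ℝ) / 32) ≤ (0 : ℂ).re := by norm_num
  have hw0 : ∀ n : ℤ, ‖(1 : ℤ → ℂ) n‖ ≤ 1 * (1 + qv κ 0 n) := fun n => by simp [hA.qv_nonneg n]
  have hw1 := linear_weight_le hκ
  have hw2 := const_weight_le hκ hb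
  have e : ∀ n, (qv κ σ n : ℂ) = qv κ 0 n + σ * (2 * κ * n) + σ ^ 2 * κ := fun n => by
    simp only [qv]; push_cast; ring
  refine State_ext (fun n => ?_) fun n => ?_
  · change _ = cf n ((linOp κ b 0 v).1 + ((σ : ℂ) • (resMult _ κ b 0 critMode 0 f).1 +
      (σ : ℂ) ^ 2 • (resMult _ κ b 0 critMode 0 f).1))
    rw [map_add, map_add, map_smul, map_smul, cf_linOp_fst, cf_linOp_fst, hv, shiftRes,
      cf_resMult_fst hA hz hw0, cf_resMult_snd hA hz hw0, cf_resMult_fst hA hz hw1,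
      cf_resMult_fst hA hz hw2, e, Pi.one_apply, smul_eq_mul, smul_eq_mul]
    push_cast; ring
  · change _ = cf n ((linOp κ b 0 v).2 + ((σ : ℂ) • (4 : ℂ) • (resMult _ κ b 0 critMode 0 f).2 +
      (σ : ℂ) ^ 2 • (4 : ℂ) • (resMult _ κ b 0 critMode 0 f).2))
    rw [map_add, map_add, map_smul, map_smul, map_smul, map_smul, cf_linOp_snd, cf_linOp_snd, hv,
      shiftRes, cf_resMult_fst hA hz hw0, cf_resMult_snd hA hz hw0, cf_resMult_snd hA hz hw1,
      cf_resMult_snd hA hz hw2, e, Pi.one_apply]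
    simp only [smul_eq_mul]
    push_cast; ring

/-- The dependence of the operator on `σ` is unbounded, but `n σ` and `σ²` are of lower order than
the operator, so they become bounded after composition with the resolvent at `σ = 0`. -/
theorem jet_resolvent {U : State →L[ℂ] State} (hU : ‖U‖ ≤ 1 / 10 ^ 6) {R : ℝ → State →L[ℂ] State}
    (hR : ∀ σ, |σ| ≤ 1 / 2 → IsInv (linOp κ b σ + onDom dom shiftOp + onDom dom U) (R σ))
    (hRn : ∀ σ, |σ| ≤ 1 / 2 → ‖R σ‖ ≤ 61440) : Jet (4 * (10 ^ 6) ^ 3) R := by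
  have h0 : |(0 : ℝ)| ≤ 1 / 2 := by norm_num
  have hn : ‖(1 : State →L[ℂ] State) - U * R 0‖ ≤ 2 := by
    refine (norm_sub_le _ _).trans ?_
    have h1 := (norm_mul_le U (R 0)).trans (mul_le_mul hU (hRn 0 h0) (norm_nonneg _) (by norm_num))
    have h2 : ‖(1 : State →L[ℂ] State)‖ ≤ 1 := ContinuousLinearMap.norm_id_le
    linarith
  have hd : ∀ w : ℤ → ℂ, (∀ n, ‖w n‖ ≤ 2 * (1 + qv κ 0 n)) →
      ‖derRes w κ b * (1 - U * R 0)‖ ≤ 10 ^ 6 := fun w hw => by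
    refine (norm_mul_le _ _).trans ?_
    exact (mul_le_mul (norm_derRes_le hκ hb zero_le_two hw) hn (norm_nonneg _) (by norm_num)).trans (by norm_num)
  refine Jet.of_inverse (by norm_num) (fun σ hσ => (hRn σ hσ).trans (by norm_num))
    (hd _ (linear_weight_le hκ)) (hd _ (const_weight_le hκ hb)) fun σ hσ => ?_
  refine ContinuousLinearMap.ext fun f => ?_
  obtain ⟨v, hv, hTv⟩ := (hR 0 h0).1 f
  have hI := isInv_shiftRes hκ hb (σ := 0) h0 (z := 0) (by norm_num)
  rw [zero_smul, sub_zero] at hI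
  -- Writes `R 0 f` as the unperturbed resolvent applied to `f - U (R 0 f)`, the form required by
  -- `linOp_expand`.
  have h1 := hI.resolvent_right (hR 0 h0) f
  rw [← map_sub] at h1
  have h2 := linOp_expand hκ hb σ (hv.trans h1)
  have h3 := (hR σ hσ).2 v
  simp only [LinearMap.add_apply, onDom_apply] at h3 hTv
  rw [h2] at h3
  have h4 : linOp κ b 0 v + ((σ : ℂ) • derRes (fun n => ((-(2 * κ * n) : ℝ) : ℂ)) κ b +
      (σ : ℂ) ^ 2 • derRes (fun _ => ((-κ : ℝ) : ℂ)) κ b) (f - U (R 0 f)) + shiftOp v + U v =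
      f + ((σ : ℂ) • derRes (fun n => ((-(2 * κ * n) : ℝ) : ℂ)) κ b +
      (σ : ℂ) ^ 2 • derRes (fun _ => ((-κ : ℝ) : ℂ)) κ b) (f - U (R 0 f)) := by
    rw [← hTv]; abel
  rw [h4, map_add, hv] at h3
  rw [← smul_mul_assoc, ← smul_mul_assoc, ← add_mul]
  exact eq_sub_of_add_eq h3

end DerRes

/-! ### Reflection symmetry -/

/-- Reflection of both components. -/
def reflS : State →L[ℂ] State :=
  reflL.toContinuousLinearMap.prodMap reflL.toContinuousLinearMap

theorem reflS_fst (V : State) : (reflS V).1 = reflL V.1 := rfl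

theorem reflS_snd (V : State) : (reflS V).2 = reflL V.2 := rfl

theorem reflL_mem_H2 {v : L2} (hv : v ∈ H2) : reflL v ∈ H2 := by
  obtain ⟨w, hw⟩ := exists_cf_of_mem_H2 hv
  refine mem_H2_of_cf (w := reflL w) fun n => ?_
  rw [cf_reflL, cf_reflL, hw]; push_cast; ring

theorem reflS_mem_dom (v : dom) : reflS v ∈ dom :=
  ⟨reflL_mem_H2 v.2.1, reflL_mem_H2 v.2.2⟩

theorem reflS_reflS (V : State) : reflS (reflS V) = V :=
  State_ext (fun n => by rw [reflS_fst, reflS_fst, cf_reflL, cf_reflL, neg_neg])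
    fun n => by rw [reflS_snd, reflS_snd, cf_reflL, cf_reflL, neg_neg]

theorem reflS_linOp (κ b σ : ℝ) (v : dom) :
    linOp κ b (-σ) ⟨reflS v, reflS_mem_dom v⟩ = reflS (linOp κ b σ v) := by
  have e : ∀ n, qv κ (-σ) n = qv κ σ (-n) := fun n => by simp only [qv]; push_cast; ring
  refine State_ext (fun n => ?_) fun n => ?_
  · rw [reflS_fst, cf_reflL, cf_linOp_fst, cf_linOp_fst, reflS_fst, reflS_snd, cf_reflL, cf_reflL, e]
  · rw [reflS_snd, cf_reflL, cf_linOp_snd, cf_linOp_snd, reflS_fst, reflS_snd, cf_reflL, cf_reflL, e]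

theorem reflS_shiftOp (V : State) : shiftOp (reflS V) = reflS (shiftOp V) := by
  refine State_ext (fun n => ?_) fun n => ?_
  · rw [reflS_fst, cf_reflL, cf_shiftOp_fst, cf_shiftOp_fst, reflS_snd, cf_reflL, critMode_neg]
  · rw [reflS_snd, cf_reflL, cf_shiftOp_snd, cf_shiftOp_snd, reflS_snd, cf_reflL, critMode_neg]

theorem reflS_potOp {g₁ g₂ : C(Circ, ℝ)} (h₁ : IsEven g₁) (h₂ : IsEven g₂) (V : State) :
    potOp g₁ g₂ (reflS V) = reflS (potOp g₁ g₂ V) := by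
  refine Prod.ext ?_ ?_
  · rw [reflS_fst, potOp_fst, potOp_fst, reflS_fst, reflS_snd, mulOp_reflL h₁, mulOp_reflL h₂,
      map_add]
  · rw [reflS_snd, potOp_snd, potOp_snd, reflS_fst, reflS_snd, mulOp_reflL h₁, mulOp_reflL h₂,
      map_neg, map_add]

/-- Reflection sends the mode `n` to `-n`, hence the Floquet exponent `σ` to `-σ`, and commutes with
even potentials and with the shift. -/
theorem resolvent_neg {κ b σ : ℝ} {g₁ g₂ : C(Circ, ℝ)} (h₁ : IsEven g₁) (h₂ : IsEven g₂)
    {R R' : State →L[ℂ] State}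
    (hR : IsInv (linOp κ b σ + onDom dom shiftOp + onDom dom (potOp g₁ g₂)) R)
    (hR' : IsInv (linOp κ b (-σ) + onDom dom shiftOp + onDom dom (potOp g₁ g₂)) R') (f : State) :
    R' f = reflS (R (reflS f)) := by
  obtain ⟨v, hv, hTv⟩ := hR.1 (reflS f)
  have h3 := hR'.2 ⟨reflS v, reflS_mem_dom v⟩
  simp only [LinearMap.add_apply, onDom_apply] at h3 hTv
  rw [reflS_linOp, reflS_shiftOp, reflS_potOp h₁ h₂, ← map_add, ← map_add, hTv, reflS_reflS, hv] at h3
  exact h3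

/-- The entries of the compression of an operator to the critical modes. -/
def entry (j k : Fin 2) : (State →L[ℂ] State) →ₗ[ℂ] ℂ where
  toFun X := critOut (X (critIn (Pi.single k 1))) j
  map_add' X Y := by simp
  map_smul' c X := by simp

theorem entry_apply (j k : Fin 2) (X : State →L[ℂ] State) :
    entry j k X = critOut (X (critIn (Pi.single k 1))) j := rfl

theorem norm_entry_le (j k : Fin 2) (X : State →L[ℂ] State) : ‖entry j k X‖ ≤ 4 * ‖X‖ := by
  rw [entry_apply]
  have h1 : ‖(Pi.single k 1 : Fin 2 → ℂ)‖ ≤ 1 := by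
    rw [pi_norm_le_iff_of_nonneg zero_le_one]
    intro i
    by_cases h : i = k
    · subst h; simp
    · simp [Pi.single_eq_of_ne h]
  have h2 : ‖critIn (Pi.single k 1 : Fin 2 → ℂ)‖ ≤ 4 * 1 :=
    (critIn.le_of_opNorm_le norm_critIn_le _).trans (by gcongr)
  calc _ ≤ ‖critOut (X (critIn (Pi.single k 1)))‖ := norm_le_pi_norm _ _
    _ ≤ 1 * ‖X (critIn (Pi.single k 1))‖ := critOut.le_of_opNorm_le norm_critOut_le _
    _ ≤ 1 * (‖X‖ * (4 * 1)) := by gcongr; exact X.le_opNorm_of_le h2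
    _ = _ := by ring

/-- Reflection exchanges the two critical modes, so the second row of the reduced matrix follows
from the first at the opposite exponent. -/
theorem entry_reflS {R R' : State →L[ℂ] State} (h : ∀ f, R' f = reflS (R (reflS f))) (j k : Fin 2) :
    entry j k R' = entry (1 - j) (1 - k) R := by
  have e1 : ∀ j, modeOf (1 - j) = -modeOf j := fun j => by fin_cases j <;> simp
  have e2 : ∀ m, reflL (fb m) = fb (-m) := fun m => L2_ext fun n => by
    rw [cf_reflL, cf_fb, cf_fb]
    congr 1
    apply propext; constructor <;> intro h <;> omega
  have e3 : reflS (critIn (Pi.single k 1)) = critIn (Pi.single (1 - k) 1) := by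
    rw [critIn_single, critIn_single, e1]
    refine Prod.ext ?_ ?_
    · rw [reflS_fst, map_smul, e2]
    · rw [reflS_snd, map_neg, e2]
  rw [entry_apply, entry_apply, h, e3, critOut_apply, critOut_apply, reflS_snd, cf_reflL, e1]

/-! ### Size of the potential along the branch -/

/-- Leading order information on the potential `(g₁, g₂)` of the linearisation. -/
structure PotData (K ε s κ b : ℝ) (g₁ g₂ : C(Circ, ℝ)) : Prop where
  κ_bd : |κ - 1| ≤ 2 * ε
  b_bd : |b| ≤ ε
  s_nonneg : 0 ≤ s
  s_le : s ≤ ε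
  even₁ : IsEven g₁
  even₂ : IsEven g₂
  norm₁ : ‖g₁‖ ≤ K * ε
  norm₂ : ‖g₂‖ ≤ K * ε
  leading : ∃ γ₁ γ₂ : ℝ, ‖g₁ - γ₁ • cosn 1‖ ≤ K * ε ^ 2 ∧ ‖g₂ - γ₂ • cosn 1‖ ≤ K * ε ^ 2
  comb : ‖g₂ - (2 : ℝ) • g₁‖ ≤ K * ε ^ 2
  coeff₁ : |cc 2 g₁ + 16 * s ^ 2| ≤ K * ε ^ 3
  coeff₂ : |cc 2 g₂ - 16 * s ^ 2| ≤ K * ε ^ 3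

theorem cc_two_cosn_sq : cc 2 (cosn 1 * cosn 1) = 1 / 4 := by
  rw [cosn_mul, map_smul, map_add, cc_cosn, cc_cosn]
  norm_num

theorem cc_two_cosn : cc 2 (cosn 1) = 0 := by
  rw [cc_cosn]; norm_num

/-- The potential in terms of the deviation `(v, w)` from the critical mode. -/
theorem pot_eq (b κ s : ℝ) (v w : C(Circ, ℝ)) (u : Profile) (h₁ : u.1 = (8 * κ * s) • cosn 1 + v)
    (h₂ : u.2 = (-(2 * (1 + κ) * s)) • cosn 1 + w) :
    pot₁ b u = ((24 * κ - 8) * s) • cosn 1 + (b • u.1 + (4 : ℝ) • v + (4 : ℝ) • w +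
      (2 : ℝ) • (u.1 * u.2)) ∧
    pot₂ u = (32 * κ * s) • cosn 1 + ((4 : ℝ) • v + u.1 * u.1) ∧
    pot₂ u - (2 : ℝ) • pot₁ b u = (16 * (1 - κ) * s) • cosn 1 + ((-2 * b) • u.1 + (-4 : ℝ) • v +
      (-8 : ℝ) • w + u.1 * u.1 + (-4 : ℝ) • (u.1 * u.2)) ∧
    u.1 * u.2 = (-(16 * κ * (1 + κ) * s ^ 2)) • (cosn 1 * cosn 1) + (v * u.2 +
      (8 * κ * s) • (cosn 1 * w)) ∧
    u.1 * u.1 = (64 * κ ^ 2 * s ^ 2) • (cosn 1 * cosn 1) + (v * u.1 +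
      (8 * κ * s) • (cosn 1 * v)) := by
  have e1 : ∀ x, u.1 x = 8 * κ * s * cosn 1 x + v x := fun x => by
    rw [h₁]; simp
  have e2 : ∀ x, u.2 x = -(2 * (1 + κ) * s) * cosn 1 x + w x := fun x => by
    rw [h₂]; simp
  refine ⟨?_, ?_, ?_, ?_, ?_⟩ <;> ext x <;>
  simp only [pot₁, pot₂, ContinuousMap.add_apply, ContinuousMap.sub_apply,
    ContinuousMap.smul_apply, ContinuousMap.mul_apply, ContinuousMap.pow_apply, smul_eq_mul, e1,
    e2] <;> ring

theorem norm_mul_le_of {f g : C(Circ, ℝ)} {a c : ℝ} (hf : ‖f‖ ≤ a) (hg : ‖g‖ ≤ c) :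
    ‖f * g‖ ≤ a * c :=
  (norm_mul_le f g).trans (mul_le_mul hf hg (norm_nonneg _) ((norm_nonneg _).trans hf))

theorem norm_smul_le_of (c : ℝ) {f : C(Circ, ℝ)} {a : ℝ} (hf : ‖f‖ ≤ a) : ‖c • f‖ ≤ |c| * a := by
  rw [norm_smul, Real.norm_eq_abs]; gcongr

-- Insert `u = s e + O(ε³)` into the potential. The first harmonics `(24κ - 8) s` and `32 κ s` have
-- ratio `2` at `κ = 1`, so `2 g₁ - g₂`, the action on the null vector, is only `O(ε²)`; the second
-- harmonics come from `2 u₁ u₂` and `u₁²`, as the correction to `s e` is of third order.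
set_option maxHeartbeats 400000 in
theorem exists_potData {C : ℝ} (hC : 0 < C) : ∃ K > 0, ∀ ε ω s : ℝ, ∀ u : Profile, ε ≤ 1 / 20 →
    |ω| ≤ 1 / 4 → PatternData C ε ω s u →
      PotData K ε s (kap ε ω) (ε ^ 2) (pot₁ (ε ^ 2) u) (pot₂ u) := by
  refine ⟨1000 * (10 + C) ^ 2, by positivity, fun ε ω s u hε hω h => ?_⟩
  have hε0 : 0 ≤ ε := h.s_nonneg.trans h.s_le
  obtain ⟨hk, -⟩ := abs_kap_sub_one_le hε0 (by linarith) hω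
  have hL := h.leading
  set κ := kap ε ω
  have hk' := abs_le.1 hk
  set v := u.1 - s • (critProfile κ).1
  set w := u.2 - s • (critProfile κ).2
  have hv : ‖v‖ ≤ C * ε ^ 3 := (norm_fst_le _).trans hL
  have hw : ‖w‖ ≤ C * ε ^ 3 := (norm_snd_le _).trans hL
  have hu1 : u.1 = (8 * κ * s) • cosn 1 + v := by
    simp only [v, critProfile]; module
  have hu2 : u.2 = (-(2 * (1 + κ) * s)) • cosn 1 + w := by
    simp only [w, critProfile]; module
  have hc : ‖cosn 1‖ ≤ 1 := norm_cosn_le 1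
  have hs0 := h.s_nonneg
  have hs := h.s_le
  have he2 : ε ^ 2 ≤ ε / 20 := by nlinarith
  have he3 : ε ^ 3 ≤ ε ^ 2 / 20 := by nlinarith [sq_nonneg ε]
  have he30 : 0 ≤ ε ^ 3 := by positivity
  have hCε : C * ε ^ 3 ≤ C * ε := by
    apply mul_le_mul_of_nonneg_left _ hC.le; nlinarith
  have hκs0 : 0 ≤ κ * s := mul_nonneg (by linarith) hs0
  have hκs1 : κ * s ≤ 11 / 10 * ε := by
    calc κ * s ≤ 11 / 10 * s := mul_le_mul_of_nonneg_right (by linarith) hs0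
      _ ≤ _ := by linarith
  have hκs2 : 9 / 10 * s ≤ κ * s := mul_le_mul_of_nonneg_right (by linarith) hs0
  have hm : ‖u.1‖ ≤ (10 + C) * ε ∧ ‖u.2‖ ≤ (10 + C) * ε := by
    constructor
    · rw [hu1]
      refine (norm_add_le _ _).trans ?_
      have := norm_smul_le_of (8 * κ * s) hc
      rw [abs_of_nonneg (by linarith)] at this
      linarith
    · rw [hu2]
      refine (norm_add_le _ _).trans ?_
      have := norm_smul_le_of (-(2 * (1 + κ) * s)) hc
      rw [abs_neg, abs_of_nonneg (by linarith)] at this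
      linarith
  obtain ⟨n1, n2⟩ := hm
  set M := 10 + C with hM
  have hM10 : 10 ≤ M := by linarith
  have hCM : C ≤ M := by linarith
  obtain ⟨p1, p2, p3, p4, p5⟩ := pot_eq (ε ^ 2) κ s v w u hu1 hu2
  have hM2 : 0 ≤ M ^ 2 * ε ^ 2 := by positivity
  have hM3 : 0 ≤ M ^ 2 * ε ^ 3 := by positivity
  have hb1 : ‖(ε ^ 2) • u.1‖ ≤ M ^ 2 * ε ^ 3 := by
    refine (norm_smul_le_of _ n1).trans ?_
    rw [abs_of_nonneg (sq_nonneg ε)]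
    have : M * ε ^ 3 ≤ M ^ 2 * ε ^ 3 := mul_le_mul_of_nonneg_right (by nlinarith) he30
    linarith
  have hCM' : C * ε ^ 3 ≤ M ^ 2 * ε ^ 3 := mul_le_mul_of_nonneg_right (by nlinarith) he30
  have hv' := hv.trans hCM'
  have hw' := hw.trans hCM'
  have h12 : ‖u.1 * u.2‖ ≤ M ^ 2 * ε ^ 2 := (norm_mul_le_of n1 n2).trans (le_of_eq (by ring))
  have h11 : ‖u.1 * u.1‖ ≤ M ^ 2 * ε ^ 2 := (norm_mul_le_of n1 n1).trans (le_of_eq (by ring))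
  have h32 : M ^ 2 * ε ^ 3 ≤ M ^ 2 * ε ^ 2 / 20 := by
    rw [mul_div_assoc]; exact mul_le_mul_of_nonneg_left he3 (sq_nonneg M)
  have hs2 : s ^ 2 ≤ ε ^ 2 := by gcongr
  have r1 : ‖(ε ^ 2) • u.1 + (4 : ℝ) • v + (4 : ℝ) • w‖ ≤ 9 * (M ^ 2 * ε ^ 3) := by
    refine norm_add₃_le.trans ?_
    have a1 := norm_smul_le_of 4 hv'
    have a2 := norm_smul_le_of 4 hw'
    norm_num at a1 a2
    linarith
  have q1 : ‖pot₁ (ε ^ 2) u - ((24 * κ - 8) * s) • cosn 1‖ ≤ 3 * (M ^ 2 * ε ^ 2) := by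
    rw [p1, add_sub_cancel_left]
    refine (norm_add_le _ _).trans ?_
    have a1 := norm_smul_le_of 2 h12
    norm_num at a1
    linarith
  have q2 : ‖pot₂ u - (32 * κ * s) • cosn 1‖ ≤ 3 * (M ^ 2 * ε ^ 2) := by
    rw [p2, add_sub_cancel_left]
    refine (norm_add_le _ _).trans ?_
    have a1 := norm_smul_le_of 4 hv'
    norm_num at a1
    linarith
  have hMe : M ^ 2 * ε ^ 2 ≤ M ^ 2 * ε / 20 := by
    rw [mul_div_assoc]; exact mul_le_mul_of_nonneg_left he2 (sq_nonneg M)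
  have hMsq : 100 ≤ M ^ 2 := by nlinarith
  have hM1 : ε ≤ M ^ 2 * ε / 100 := by linarith [mul_le_mul_of_nonneg_right hMsq hε0]
  have hMb2 : ε ^ 2 ≤ M ^ 2 * ε ^ 2 / 100 := by
    linarith [mul_le_mul_of_nonneg_right hMsq (sq_nonneg ε)]
  have hMb3 : ε ^ 3 ≤ M ^ 2 * ε ^ 3 / 100 := by linarith [mul_le_mul_of_nonneg_right hMsq he30]
  refine ⟨hk, ?_, hs0, hs, ?_, ?_, ?_, ?_, ⟨(24 * κ - 8) * s, 32 * κ * s, q1.trans (by linarith),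
    q2.trans (by linarith)⟩, ?_, ?_, ?_⟩
  · rw [abs_of_nonneg (sq_nonneg ε)]; linarith
  · exact ((h.even₁.smul _).add (h.even₂.smul _)).add ((h.even₁.mul h.even₂).smul _)
  · exact (h.even₁.smul _).add (h.even₁.pow 2)
  · have a1 := norm_le_norm_sub_add (pot₁ (ε ^ 2) u) (((24 * κ - 8) * s) • cosn 1)
    have a2 := norm_smul_le_of ((24 * κ - 8) * s) hc
    rw [abs_of_nonneg (by linarith)] at a2
    linarith
  · have a1 := norm_le_norm_sub_add (pot₂ u) ((32 * κ * s) • cosn 1)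
    have a2 := norm_smul_le_of (32 * κ * s) hc
    rw [abs_of_nonneg (by linarith)] at a2
    linarith
  · rw [p3]
    refine (norm_add_le _ _).trans ?_
    have a0 := norm_smul_le_of (16 * (1 - κ) * s) hc
    have a0' : |16 * (1 - κ) * s| ≤ 32 * ε ^ 2 := by
      rw [abs_mul, abs_mul, abs_sub_comm 1 κ, abs_of_nonneg hs0, abs_of_pos (by norm_num : (0 : ℝ) < 16)]
      have := mul_le_mul hk hs hs0 (by linarith)
      linarith
    have a1 : ‖(-2 * ε ^ 2) • u.1‖ ≤ 2 * (M ^ 2 * ε ^ 3) := by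
      rw [mul_smul]
      have := norm_smul_le_of (-2) hb1
      norm_num at this ⊢
      linarith
    have a2 := norm_smul_le_of (-4) hv'
    have a3 := norm_smul_le_of (-8) hw'
    have a4 := norm_smul_le_of (-4) h12
    rw [show |(-4 : ℝ)| = 4 by norm_num] at a2 a4
    rw [show |(-8 : ℝ)| = 8 by norm_num] at a3
    have a5 := norm_add_le ((-2 * ε ^ 2) • u.1 + (-4 : ℝ) • v + (-8 : ℝ) • w + u.1 * u.1)
      ((-4 : ℝ) • (u.1 * u.2))
    have a6 := norm_add_le ((-2 * ε ^ 2) • u.1 + (-4 : ℝ) • v + (-8 : ℝ) • w) (u.1 * u.1)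
    have a7 := norm_add₃_le (a := (-2 * ε ^ 2) • u.1) (b := (-4 : ℝ) • v) (c := (-8 : ℝ) • w)
    linarith
  · have hcp : |8 * κ * s| ≤ M * ε := by
      rw [abs_of_nonneg (by linarith)]
      have := mul_le_mul_of_nonneg_right hM10 hε0
      linarith
    have b1 : ‖v * u.2 + (8 * κ * s) • (cosn 1 * w)‖ ≤ 2 * (M ^ 2 * ε ^ 3) := by
      refine (norm_add_le _ _).trans ?_
      have c1 := norm_mul_le_of hv n2
      have c2 := norm_smul_le_of (8 * κ * s) (norm_mul_le_of hc hw)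
      rw [one_mul] at c2
      have c3 : |8 * κ * s| * (C * ε ^ 3) ≤ M * ε * (C * ε ^ 3) := by gcongr
      have c4 : M * ε * (C * ε ^ 3) ≤ M * 1 * (M * ε ^ 3) := by gcongr; linarith
      have c5 : C * ε ^ 3 * (M * ε) = M * ε * (C * ε ^ 3) := by ring
      linarith
    have b2 := (abs_cc_le 2 _).trans r1
    have b3 := (abs_cc_le 2 _).trans b1
    have e : cc 2 (pot₁ (ε ^ 2) u) + 16 * s ^ 2 = cc 2 ((ε ^ 2) • u.1 + (4 : ℝ) • v + (4 : ℝ) • w) +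
        2 * cc 2 (v * u.2 + (8 * κ * s) • (cosn 1 * w)) + 8 * s ^ 2 * (1 - κ) * (κ + 2) := by
      rw [p1, p4]
      simp only [map_add, map_smul, smul_eq_mul, cc_two_cosn, cc_two_cosn_sq]
      ring
    have b4 : |8 * s ^ 2 * (1 - κ) * (κ + 2)| ≤ 8 * ε ^ 2 * (2 * ε) * 4 := by
      rw [abs_mul, abs_mul, abs_sub_comm 1 κ, abs_of_nonneg (by positivity : 0 ≤ 8 * s ^ 2),
        abs_of_nonneg (by linarith : 0 ≤ κ + 2)]
      gcongr <;> linarith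
    rw [e]
    refine (abs_add_three _ _ _).trans ?_
    rw [abs_mul, abs_of_pos (by norm_num : (0 : ℝ) < 2)]
    linarith
  · have hcp : |8 * κ * s| ≤ M * ε := by
      rw [abs_of_nonneg (by linarith)]
      have := mul_le_mul_of_nonneg_right hM10 hε0
      linarith
    have b1 : ‖v * u.1 + (8 * κ * s) • (cosn 1 * v)‖ ≤ 2 * (M ^ 2 * ε ^ 3) := by
      refine (norm_add_le _ _).trans ?_
      have c1 := norm_mul_le_of hv n1
      have c2 := norm_smul_le_of (8 * κ * s) (norm_mul_le_of hc hv)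
      rw [one_mul] at c2
      have c3 : |8 * κ * s| * (C * ε ^ 3) ≤ M * ε * (C * ε ^ 3) := by gcongr
      have c4 : M * ε * (C * ε ^ 3) ≤ M * 1 * (M * ε ^ 3) := by gcongr; linarith
      have c5 : C * ε ^ 3 * (M * ε) = M * ε * (C * ε ^ 3) := by ring
      linarith
    have b3 := (abs_cc_le 2 _).trans b1
    have b2 := (abs_cc_le 2 _).trans hv'
    have e : cc 2 (pot₂ u) - 16 * s ^ 2 = 4 * cc 2 v +
        cc 2 (v * u.1 + (8 * κ * s) • (cosn 1 * v)) + 16 * s ^ 2 * (κ - 1) * (κ + 1) := by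
      rw [p2, p5]
      simp only [map_add, map_smul, smul_eq_mul, cc_two_cosn, cc_two_cosn_sq]
      ring
    have b4 : |16 * s ^ 2 * (κ - 1) * (κ + 1)| ≤ 16 * ε ^ 2 * (2 * ε) * 4 := by
      rw [abs_mul, abs_mul, abs_of_nonneg (by positivity : 0 ≤ 16 * s ^ 2),
        abs_of_nonneg (by linarith : 0 ≤ κ + 1)]
      gcongr <;> linarith
    rw [e]
    refine (abs_add_three _ _ _).trans ?_
    rw [abs_mul, abs_of_pos (by norm_num : (0 : ℝ) < 4)]
    linarith

/-! ### The compressed resolvent -/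

/-- The determinant of the linearisation at the equilibrium on the mode `1`. -/
def critDet (κ b σ : ℝ) : ℝ :=
  4 * ((κ * (1 + σ) ^ 2 - 1) ^ 2 - b * (κ * (1 + σ) ^ 2))

/-- The determinant of the shifted linearisation on the mode `1`. -/
def shiftDet (κ b σ : ℝ) : ℝ := critDet κ b σ + (κ * (1 + σ) ^ 2 + b + 5)

theorem critMode_modeOf (j : Fin 2) : critMode (modeOf j) = 1 := by
  fin_cases j <;> simp [critMode]

theorem symDet_modeOf_zero (κ b σ : ℝ) : symDet κ b σ critMode 0 (modeOf 0) = shiftDet κ b σ := by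
  rw [symDet, critMode_modeOf]
  simp only [qv, modeOf_zero, shiftDet, critDet]
  push_cast; ring

theorem symDet_modeOf_one (κ b : ℝ) : symDet κ b 0 critMode 0 (modeOf 1) = shiftDet κ b 0 := by
  rw [symDet, critMode_modeOf]
  simp only [qv, modeOf_one, shiftDet, critDet]
  push_cast; ring

section Entries

variable {κ b σ : ℝ} (hκ : |κ - 1| ≤ 1 / 10) (hb : |b| ≤ 1 / 10) (hσ : |σ| ≤ 1 / 2)
include hκ hb hσ

theorem shiftRes_critIn_single (k : Fin 2) :
    shiftRes κ b σ 0 (critIn (Pi.single k 1)) =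
      (((-4 - 8 * qv κ σ (modeOf k)) / symDet κ b σ critMode 0 (modeOf k) : ℂ) • fb (modeOf k),
        (((b + 5 + qv κ σ (modeOf k)) / symDet κ b σ critMode 0 (modeOf k) : ℂ) •
          fb (modeOf k))) := by
  have hA := admissible_shift hκ hb hσ
  have hz : -((1 / 5 : ℝ) / 32) ≤ (0 : ℂ).re := by norm_num
  have hw1 : ∀ n : ℤ, ‖(1 : ℤ → ℂ) n‖ ≤ 1 * (1 + qv κ σ n) := fun n => by simp [hA.qv_nonneg n]
  have hm := critMode_modeOf k
  rw [critIn_single]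
  generalize modeOf k = m at hm ⊢
  refine State_ext (fun n => ?_) fun n => ?_
  · rw [shiftRes, cf_resMult_fst hA hz hw1]
    simp only [map_smul, map_neg, cf_fb, Pi.one_apply, smul_eq_mul]
    by_cases h : n = m
    · subst h; rw [hm]; simp; ring
    · simp [h]
  · rw [shiftRes, cf_resMult_snd hA hz hw1]
    simp only [map_smul, map_neg, cf_fb, Pi.one_apply, smul_eq_mul]
    by_cases h : n = m
    · subst h; simp; ring
    · simp [h]

theorem critOut_shiftRes_pot (h : L2) (j : Fin 2) :
    critOut (shiftRes κ b σ 0 (h, -h)) j =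
      (1 + qv κ σ (modeOf j)) / symDet κ b σ critMode 0 (modeOf j) * cf (modeOf j) h := by
  have hA := admissible_shift hκ hb hσ
  have hz : -((1 / 5 : ℝ) / 32) ≤ (0 : ℂ).re := by norm_num
  have hw1 : ∀ n : ℤ, ‖(1 : ℤ → ℂ) n‖ ≤ 1 * (1 + qv κ σ n) := fun n => by simp [hA.qv_nonneg n]
  rw [critOut_apply, shiftRes, cf_resMult_snd hA hz hw1]
  simp only [map_neg, Pi.one_apply]
  ring

theorem entry_shiftRes (k : Fin 2) : entry 0 k (shiftRes κ b σ 0) =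
    if k = 0 then (((κ * (1 + σ) ^ 2 + b + 5) / shiftDet κ b σ : ℝ) : ℂ) else 0 := by
  rw [entry_apply, shiftRes_critIn_single hκ hb hσ, critOut_apply, map_smul, cf_fb]
  by_cases hk : k = 0
  · subst hk
    rw [symDet_modeOf_zero, if_pos rfl, if_pos rfl]
    simp [qv]; ring_nf
  · have h1 : k = 1 := by omega
    subst h1
    simp

theorem entry_shiftRes_pot (g₁ g₂ : C(Circ, ℝ)) (j k : Fin 2) :
    entry j k (shiftRes κ b σ 0 * potOp g₁ g₂ * shiftRes κ b σ 0) =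
      (1 + qv κ σ (modeOf j)) / symDet κ b σ critMode 0 (modeOf j) *
      ((-4 - 8 * qv κ σ (modeOf k)) / symDet κ b σ critMode 0 (modeOf k) *
        cf (modeOf j - modeOf k) (toL2 g₁) +
      (b + 5 + qv κ σ (modeOf k)) / symDet κ b σ critMode 0 (modeOf k) *
        cf (modeOf j - modeOf k) (toL2 g₂)) := by
  rw [entry_apply, mul_assoc]
  change critOut (shiftRes κ b σ 0 (potOp g₁ g₂ (shiftRes κ b σ 0 (critIn (Pi.single k 1))))) j = _
  rw [shiftRes_critIn_single hκ hb hσ]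
  set V : State := (_, _)
  have e : potOp g₁ g₂ V = (mulOp g₁ V.1 + mulOp g₂ V.2, -(mulOp g₁ V.1 + mulOp g₂ V.2)) := rfl
  rw [e, critOut_shiftRes_pot hκ hb hσ]
  simp only [V, map_smul, map_add, cf_mulOp_fb, smul_eq_mul]

/-- A first harmonic moves a mode by one, whereas the critical modes differ by zero or two.
Contributions of first order in the amplitude therefore vanish. -/
theorem entry_shiftRes_cosn (γ₁ γ₂ : ℝ) (k : Fin 2) :
    entry 0 k (shiftRes κ b σ 0 * potOp (γ₁ • cosn 1) (γ₂ • cosn 1) * shiftRes κ b σ 0) = 0 := by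
  rw [entry_shiftRes_pot hκ hb hσ, toL2_smul, toL2_smul, map_smul, map_smul, cf_cosn]
  fin_cases k <;> norm_num

theorem shiftDet_ge : 1 / 5 ≤ shiftDet κ b σ := by
  have hA := admissible_shift hκ hb hσ
  have h1 := hA.det_bd 1
  have hq := hA.qv_nonneg 1
  have e : 4 * ((qv κ σ 1 - 1) ^ 2 - b * qv κ σ 1) + critMode 1 * (qv κ σ 1 + b + 5) =
      shiftDet κ b σ := by
    simp only [qv, critMode, shiftDet, critDet]; push_cast; simp
  rw [e] at h1
  nlinarith

end Entries

theorem potOp_sub (f₁ f₂ g₁ g₂ : C(Circ, ℝ)) :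
    potOp (f₁ - g₁) (f₂ - g₂) = potOp f₁ f₂ - potOp g₁ g₂ := by
  refine ContinuousLinearMap.ext fun V => Prod.ext ?_ ?_
  · change mulOp (f₁ - g₁) V.1 + mulOp (f₂ - g₂) V.2 =
      (mulOp f₁ V.1 + mulOp f₂ V.2) - (mulOp g₁ V.1 + mulOp g₂ V.2)
    rw [mulOp_sub, mulOp_sub, sub_apply, sub_apply]; abel
  · change -(mulOp (f₁ - g₁) V.1 + mulOp (f₂ - g₂) V.2) =
      -(mulOp f₁ V.1 + mulOp f₂ V.2) - -(mulOp g₁ V.1 + mulOp g₂ V.2)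
    rw [mulOp_sub, mulOp_sub, sub_apply, sub_apply]; abel

theorem jet_id : Jet 1 fun σ : ℝ => (σ : ℂ) :=
  ⟨by simp, 1, by simp, fun σ _ => by simp; positivity⟩

theorem exists_jet_shiftDet : ∃ C > 0, ∀ κ b : ℝ, |κ - 1| ≤ 1 / 10 → |b| ≤ 1 / 10 →
    Jet C fun σ => (shiftDet κ b σ : ℂ) := by
  have hc : ∀ x : ℝ, |x| ≤ 100 → Jet 100 fun _ => (x : ℂ) := fun x hx =>
    (Jet.const (x : ℂ)).mono (by rwa [Complex.norm_real, Real.norm_eq_abs])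
  have hp : Jet 101 fun σ : ℝ => ((1 : ℝ) : ℂ) + (σ : ℂ) :=
    ((hc 1 (by norm_num)).add jet_id).mono (by norm_num)
  obtain ⟨C, hC⟩ : ∃ C, C = 5 * 100 * (5 * 101 * 101 : ℝ) := ⟨_, rfl⟩
  have hq : ∀ κ : ℝ, |κ - 1| ≤ 1 / 10 →
      Jet C fun σ : ℝ => (κ : ℂ) * ((((1 : ℝ) : ℂ) + σ) * (((1 : ℝ) : ℂ) + σ)) := fun κ hκ => by
    have hκ' := abs_le.1 hκ
    rw [hC]
    exact (hc κ (by rw [abs_le]; constructor <;> linarith)).mul (hp.mul hp)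
  refine ⟨5 * 100 * (5 * C * C) + (5 * 100 * C + 100), by rw [hC]; norm_num, fun κ b hκ hb => ?_⟩
  have hb' := abs_le.1 hb
  have h1 := (hc 4 (by norm_num)).mul ((hq κ hκ).mul (hq κ hκ))
  have h2 := (hc (-7 - 4 * b) (by rw [abs_le]; constructor <;> linarith)).mul (hq κ hκ)
  have h3 := h1.add (h2.add (hc (9 + b) (by rw [abs_le]; constructor <;> linarith)))
  refine h3.congr fun σ _ => ?_
  simp only [shiftDet, critDet]
  push_cast; ring

/-- Expansion in `σ` of the first row of the reduced matrix, multiplied by `shiftDet`. -/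
theorem exists_jet_row : ∃ C > 0, ∀ K ε s κ b : ℝ, ∀ g₁ g₂ : C(Circ, ℝ), 1 ≤ K →
    |κ - 1| ≤ 1 / 10 → |b| ≤ 1 / 10 → ‖potOp g₁ g₂‖ ≤ 1 / 10 ^ 6 → PotData K ε s κ b g₁ g₂ →
    ∀ R : ℝ → State →L[ℂ] State,
    (∀ σ, |σ| ≤ 1 / 2 → IsInv (linOp κ b σ + onDom dom shiftOp + onDom dom (potOp g₁ g₂)) (R σ)) →
    (∀ σ, |σ| ≤ 1 / 2 → ‖R σ‖ ≤ 61440) →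
    Jet (C * (K ^ 2 * ε ^ 2)) (fun σ =>
      (shiftDet κ b σ : ℂ) * (1 - entry 0 0 (R σ)) - critDet κ b σ) ∧
    Jet (C * (K ^ 2 * ε ^ 2)) (fun σ => (shiftDet κ b σ : ℂ) * (-entry 0 1 (R σ))) := by
  obtain ⟨D, hD0, hD⟩ := exists_jet_shiftDet
  set J : ℝ := 4 * (10 ^ 6) ^ 3 with hJ
  set M : ℝ := 4 * (5 * (5 * J * 1) * J) + 4 * (5 * (5 * (5 * (5 * J * 1) * J) * 1) * J) with hM
  refine ⟨5 * D * (4 * M), by simp only [M, J]; positivity,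
    fun K ε s κ b g₁ g₂ hK hκ hb hU hP R hR hRn => ?_⟩
  have hε : 0 ≤ ε := hP.s_nonneg.trans hP.s_le
  obtain ⟨γ₁, γ₂, hγ₁, hγ₂⟩ := hP.leading
  set U := potOp g₁ g₂ with hUdef
  set U₁ := potOp (γ₁ • cosn 1) (γ₂ • cosn 1) with hU₁
  set U₂ := potOp (g₁ - γ₁ • cosn 1) (g₂ - γ₂ • cosn 1) with hU₂
  have hsub : U₂ = U - U₁ := potOp_sub _ _ _ _
  have hU₂n : ‖U₂‖ ≤ 2 * (K ^ 2 * ε ^ 2) := by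
    refine (norm_potOp_le _ _).trans ?_
    have : K * ε ^ 2 ≤ K ^ 2 * ε ^ 2 := mul_le_mul_of_nonneg_right (by nlinarith) (sq_nonneg _)
    linarith
  have hUn : ‖U‖ ≤ 2 * K * ε := by
    refine (norm_potOp_le _ _).trans ?_
    linarith [hP.norm₁, hP.norm₂]
  have jR : Jet J R := jet_resolvent hκ hb hU hR hRn
  have jS : Jet J fun σ => shiftRes κ b σ 0 := by
    refine jet_resolvent hκ hb (U := 0) (by simp) (fun σ hσ => ?_) fun σ hσ => ?_
    · have := isInv_shiftRes hκ hb hσ (z := 0) (by norm_num)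
      rw [zero_smul, sub_zero] at this
      have e : onDom dom (0 : State →L[ℂ] State) = 0 := by ext v <;> simp
      rwa [e, add_zero]
    · exact (norm_shiftRes_le hκ hb hσ (by norm_num)).trans (by norm_num)
  have j1 : ∀ k, Jet (4 * (5 * (5 * J * ‖U₂‖) * J)) fun σ =>
      entry 0 k (shiftRes κ b σ 0 * U₂ * shiftRes κ b σ 0) := fun k =>
    ((jS.mul (Jet.const U₂)).mul jS).map (entry 0 k) (by norm_num) (norm_entry_le 0 k)
  have j2 : ∀ k, Jet (4 * (5 * (5 * (5 * (5 * J * ‖U‖) * J) * ‖-U‖) * J)) fun σ =>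
      entry 0 k (shiftRes κ b σ 0 * U * R σ * (-U) * shiftRes κ b σ 0) := fun k =>
    ((((jS.mul (Jet.const U)).mul jR).mul (Jet.const (-U))).mul jS).map (entry 0 k) (by norm_num)
      (norm_entry_le 0 k)
  have hU2 : ‖U‖ * ‖U‖ ≤ 4 * (K ^ 2 * ε ^ 2) := by
    calc ‖U‖ * ‖U‖ ≤ (2 * K * ε) * (2 * K * ε) := by gcongr
      _ = _ := by ring
  have hJ0 : 0 < J := by rw [hJ]; norm_num
  have j3 : ∀ k, Jet (4 * M * (K ^ 2 * ε ^ 2)) fun σ =>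
      entry 0 k (shiftRes κ b σ 0 * U₂ * shiftRes κ b σ 0) +
      entry 0 k (shiftRes κ b σ 0 * U * R σ * (-U) * shiftRes κ b σ 0) := fun k => by
    refine ((j1 k).add (j2 k)).mono ?_
    rw [norm_neg]
    calc 4 * (5 * (5 * J * ‖U₂‖) * J) + 4 * (5 * (5 * (5 * (5 * J * ‖U‖) * J) * ‖U‖) * J)
        = 4 * (5 * (5 * J) * J) * ‖U₂‖ + 4 * (5 * (5 * (5 * (5 * J) * J)) * J) * (‖U‖ * ‖U‖) := by
          ring
      _ ≤ 4 * (5 * (5 * J) * J) * (4 * (K ^ 2 * ε ^ 2)) +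
          4 * (5 * (5 * (5 * (5 * J) * J)) * J) * (4 * (K ^ 2 * ε ^ 2)) := by
          have : ‖U₂‖ ≤ 4 * (K ^ 2 * ε ^ 2) := hU₂n.trans (by nlinarith [sq_nonneg (K * ε)])
          gcongr
      _ = 4 * M * (K ^ 2 * ε ^ 2) := by rw [hM]; ring
  -- The resolvent identity is applied twice. The term linear in the first harmonic drops out, the
  -- rest of the linear term is `O(ε²)` because `U₂` is, and the remainder is quadratic in `U`.
  have hexp : ∀ σ, |σ| ≤ 1 / 2 → ∀ k, entry 0 k (R σ) = entry 0 k (shiftRes κ b σ 0) -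
      (entry 0 k (shiftRes κ b σ 0 * U₂ * shiftRes κ b σ 0) +
      entry 0 k (shiftRes κ b σ 0 * U * R σ * (-U) * shiftRes κ b σ 0)) := fun σ hσ k => by
    have hI := isInv_shiftRes hκ hb hσ (z := 0) (by norm_num)
    rw [zero_smul, sub_zero] at hI
    have e : R σ = shiftRes κ b σ 0 - (shiftRes κ b σ 0 * (U₂ + U₁) * shiftRes κ b σ 0 +
        shiftRes κ b σ 0 * U * R σ * (-U) * shiftRes κ b σ 0) := by
      rw [hsub, sub_add_cancel]
      refine ContinuousLinearMap.ext fun f => ?_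
      have e1 := hI.resolvent_left (hR σ hσ) f
      have e2 := hI.resolvent_right (hR σ hσ) (U (shiftRes κ b σ 0 f))
      rw [e2] at e1
      rw [e1]
      change _ = shiftRes κ b σ 0 f - (shiftRes κ b σ 0 (U (shiftRes κ b σ 0 f)) +
        shiftRes κ b σ 0 (U (R σ (-(U (shiftRes κ b σ 0 f))))))
      rw [map_neg, map_neg, map_neg]
      abel
    have h0 := entry_shiftRes_cosn hκ hb hσ γ₁ γ₂ k
    rw [← hU₁] at h0
    conv_lhs => rw [e]
    rw [mul_add, add_mul, map_sub, map_add, map_add, h0, add_zero]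
  have hne : ∀ σ, |σ| ≤ 1 / 2 → (shiftDet κ b σ : ℂ) ≠ 0 := fun σ hσ => by
    have := shiftDet_ge hκ hb hσ
    exact_mod_cast (by linarith : (0 : ℝ) < shiftDet κ b σ).ne'
  constructor
  · refine (((hD κ b hκ hb).mul (j3 0)).mono (le_of_eq (by ring))).congr fun σ hσ => ?_
    rw [hexp σ hσ 0, entry_shiftRes hκ hb hσ, if_pos rfl]
    have := hne σ hσ
    have e : (critDet κ b σ : ℂ) = shiftDet κ b σ - (κ * (1 + σ) ^ 2 + b + 5) := by
      rw [shiftDet]; push_cast; ring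
    rw [e]
    push_cast
    field_simp
    ring
  · refine (((hD κ b hκ hb).mul (j3 1)).mono (le_of_eq (by ring))).congr fun σ hσ => ?_
    rw [hexp σ hσ 1, entry_shiftRes hκ hb hσ, if_neg (by norm_num)]
    ring

/-- The leading value is `2 (-2 · (-16 s²) + 16 s²) = 96 s²`; every deviation carries an additional
factor `ε`. -/
theorem offDiag_real_bound {K ε s κ α β p q : ℝ} (hK : 1 ≤ K) (hs0 : 0 ≤ s) (hs : s ≤ ε)
    (hε1 : ε ≤ 1 / 20) (hk : |κ - 1| ≤ 2 * ε) (hα2 : |α + 2| ≤ 10 * ε) (hβ1 : |β - 1| ≤ 10 * ε)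
    (c1 : |p + 16 * s ^ 2| ≤ K * ε ^ 3) (c2 : |q - 16 * s ^ 2| ≤ K * ε ^ 3) :
    |(1 + κ) * (α * p + β * q) - 96 * s ^ 2| ≤ 10 ^ 3 * (K ^ 2 * ε ^ 3) := by
  have hε : 0 ≤ ε := hs0.trans hs
  have hk' := abs_le.1 hk
  set A := p + 16 * s ^ 2
  set B := q - 16 * s ^ 2
  have e5 : (1 + κ) * (α * p + β * q) - 96 * s ^ 2 =
      (1 + κ) * ((α * A + β * B) + (16 * s ^ 2) * ((β - 1) - (α + 2))) + 48 * s ^ 2 * (κ - 1) := by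
    simp only [A, B]; ring
  have hs2 : s ^ 2 ≤ ε ^ 2 := pow_le_pow_left₀ hs0 hs 2
  have hα3 : |α| ≤ 3 := by
    have := abs_le.1 hα2
    rw [abs_le]; constructor <;> linarith
  have hβ3 : |β| ≤ 3 := by
    have := abs_le.1 hβ1
    rw [abs_le]; constructor <;> linarith
  have n1 : |α * A| ≤ 3 * (K * ε ^ 3) := by
    rw [abs_mul]; exact mul_le_mul hα3 c1 (abs_nonneg _) (by norm_num)
  have n2 : |β * B| ≤ 3 * (K * ε ^ 3) := by
    rw [abs_mul]; exact mul_le_mul hβ3 c2 (abs_nonneg _) (by norm_num)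
  have n3 : |(16 * s ^ 2) * ((β - 1) - (α + 2))| ≤ (16 * ε ^ 2) * (20 * ε) := by
    rw [abs_mul, abs_of_nonneg (by positivity : 0 ≤ 16 * s ^ 2)]
    have := abs_sub (β - 1) (α + 2)
    exact mul_le_mul (by linarith) (by linarith) (abs_nonneg _) (by positivity)
  have n4 : |48 * s ^ 2 * (κ - 1)| ≤ (48 * ε ^ 2) * (2 * ε) := by
    rw [abs_mul, abs_of_nonneg (by positivity : 0 ≤ 48 * s ^ 2)]
    exact mul_le_mul (by linarith) hk (abs_nonneg _) (by positivity)
  have n5 : |(1 + κ) * ((α * A + β * B) + (16 * s ^ 2) * ((β - 1) - (α + 2)))| ≤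
      (21 / 10) * (3 * (K * ε ^ 3) + 3 * (K * ε ^ 3) + (16 * ε ^ 2) * (20 * ε)) := by
    rw [abs_mul, abs_of_pos (by linarith : 0 < 1 + κ)]
    exact mul_le_mul (by linarith) ((abs_add_three _ _ _).trans (by linarith)) (abs_nonneg _)
      (by norm_num)
  rw [e5]
  refine (abs_add_le _ _).trans ((add_le_add n5 n4).trans ?_)
  have hε3 : 0 ≤ ε ^ 3 := by positivity
  have k1 : K * ε ^ 3 ≤ K ^ 2 * ε ^ 3 := mul_le_mul_of_nonneg_right (by nlinarith) hε3
  have k2 : ε ^ 3 ≤ K * ε ^ 3 := by nlinarith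
  linarith

/-- The leading order of the off-diagonal entry at `σ = 0`. -/
theorem exists_offDiag_bound : ∃ C > 0, ∀ K ε s κ b : ℝ, ∀ g₁ g₂ : C(Circ, ℝ), 1 ≤ K → ε ≤ 1 / 20 →
    PotData K ε s κ b g₁ g₂ → ∀ R : State →L[ℂ] State,
    IsInv (linOp κ b 0 + onDom dom shiftOp + onDom dom (potOp g₁ g₂)) R → ‖R‖ ≤ 61440 →
    ‖(shiftDet κ b 0 : ℂ) * (-entry 0 1 R) - 96 * s ^ 2‖ ≤ C * (K ^ 2 * ε ^ 3) := by
  refine ⟨10 ^ 18, by norm_num, fun K ε s κ b g₁ g₂ hK hε1 hP R hR hRn => ?_⟩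
  have hε : 0 ≤ ε := hP.s_nonneg.trans hP.s_le
  have hk := hP.κ_bd
  have hb := hP.b_bd
  have hκ10 : |κ - 1| ≤ 1 / 10 := by linarith
  have hb10 : |b| ≤ 1 / 10 := by linarith
  have h0 : |(0 : ℝ)| ≤ 1 / 2 := by norm_num
  have hk' := abs_le.1 hk
  have hb' := abs_le.1 hb
  set d := shiftDet κ b 0 with hd
  have hdval : d = 4 * ((κ - 1) ^ 2 - b * κ) + κ + b + 5 := by
    rw [hd, shiftDet, critDet]; ring
  have hsq : 0 ≤ (κ - 1) ^ 2 ∧ (κ - 1) ^ 2 ≤ ε / 5 := by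
    refine ⟨sq_nonneg _, ?_⟩
    rw [← sq_abs]; nlinarith [abs_nonneg (κ - 1)]
  have hbκ : |b * κ| ≤ 2 * ε := by
    rw [abs_mul, abs_of_pos (by linarith : 0 < κ)]; nlinarith [abs_nonneg b]
  have hbκ' := abs_le.1 hbκ
  have hd5 : 5 ≤ d := by rw [hdval]; linarith
  have hd8 : d ≤ 8 := by rw [hdval]; linarith
  have hdne : (d : ℂ) ≠ 0 := by exact_mod_cast (by linarith : (0 : ℝ) < d).ne'
  set α : ℝ := (-4 - 8 * κ) / d with hα
  set β : ℝ := (b + 5 + κ) / d with hβ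
  have hα2 : |α + 2| ≤ 10 * ε := by
    have e : α + 2 = (6 * (1 - κ) + 2 * b + 8 * ((κ - 1) ^ 2 - b * κ)) / d := by
      rw [hα, div_add' _ _ _ (by linarith)]; congr 1; rw [hdval]; ring
    rw [e, abs_div, abs_of_pos (by linarith : 0 < d), div_le_iff₀ (by linarith), abs_le]
    constructor <;> nlinarith
  have hβ1 : |β - 1| ≤ 10 * ε := by
    have e : β - 1 = (-4 * ((κ - 1) ^ 2 - b * κ)) / d := by
      rw [hβ, div_sub' (by linarith)]; congr 1; rw [hdval]; ring
    rw [e, abs_div, abs_of_pos (by linarith : 0 < d), div_le_iff₀ (by linarith), abs_le]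
    constructor <;> nlinarith
  set U := potOp g₁ g₂ with hU
  set S := shiftRes κ b 0 0 with hS
  have hSn : ‖S‖ ≤ 30720 := norm_shiftRes_le hκ10 hb10 h0 (by norm_num)
  have hUn : ‖U‖ ≤ 2 * K * ε := by
    refine (norm_potOp_le _ _).trans ?_
    linarith [hP.norm₁, hP.norm₂]
  have hI := isInv_shiftRes hκ10 hb10 h0 (z := 0) (by norm_num)
  rw [zero_smul, sub_zero] at hI
  set f := critIn (Pi.single 1 1) with hf
  have hq1 : (qv κ 0 (modeOf 1) : ℝ) = κ := by simp [qv]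
  have hq0 : (qv κ 0 (modeOf 0) : ℝ) = κ := by simp [qv]
  have hSf : S f = ((α : ℂ) • fb (-1), (β : ℂ) • fb (-1)) := by
    rw [hS, hf, shiftRes_critIn_single hκ10 hb10 h0, symDet_modeOf_one, hq1, ← hd, modeOf_one, hα, hβ]
    push_cast; rfl
  -- `S f` is close to minus the null vector, on which the first harmonics of the potential cancel;
  -- hence `O(ε²)` instead of `O(ε)`.
  have hUS : ‖U (S f)‖ ≤ 30 * (K * ε ^ 2) := by
    set h := mulOp g₁ ((α : ℂ) • fb (-1)) + mulOp g₂ ((β : ℂ) • fb (-1)) with hh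
    have e : h = ((α + 2 : ℝ) : ℂ) • mulOp g₁ (fb (-1)) + ((β - 1 : ℝ) : ℂ) • mulOp g₂ (fb (-1)) +
        mulOp (g₂ - (2 : ℝ) • g₁) (fb (-1)) := by
      rw [hh, map_smul, map_smul, mulOp_sub, mulOp_smul, sub_apply, smul_apply]
      push_cast; module
    have hn : ∀ g : C(Circ, ℝ), ‖mulOp g (fb (-1))‖ ≤ ‖g‖ := fun g => by
      have := norm_mulOp_apply_le g (fb (-1))
      rwa [norm_fb, mul_one] at this
    have hhn : ‖h‖ ≤ 30 * (K * ε ^ 2) := by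
      rw [e]
      refine norm_add₃_le.trans ?_
      rw [norm_smul, norm_smul, Complex.norm_real, Complex.norm_real, Real.norm_eq_abs,
        Real.norm_eq_abs]
      have a1 := mul_le_mul hα2 ((hn g₁).trans hP.norm₁) (norm_nonneg _) (by positivity)
      have a2 := mul_le_mul hβ1 ((hn g₂).trans hP.norm₂) (norm_nonneg _) (by positivity)
      have a3 := (hn (g₂ - (2 : ℝ) • g₁)).trans hP.comb
      linarith [mul_nonneg (by linarith : 0 ≤ K) (sq_nonneg ε)]
    rw [hSf]
    exact max_le hhn (by rw [potOp_snd, norm_neg]; exact hhn)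
  have e1 := hI.resolvent_left hR f
  have e2 := hI.resolvent_right hR (U (S f))
  rw [e2] at e1
  -- The term of second order in the potential: one factor `U` costs `ε`, and the other, acting on
  -- `S f`, costs `ε²`.
  set Q : ℂ := critOut (S (U (R (U (S f))))) 0 with hQ
  have hQn : ‖Q‖ ≤ 10 ^ 15 * (K ^ 2 * ε ^ 3) := by
    calc ‖Q‖ ≤ ‖critOut (S (U (R (U (S f)))))‖ :=
          norm_le_pi_norm (critOut (S (U (R (U (S f)))))) 0
      _ ≤ 1 * ‖S (U (R (U (S f))))‖ := critOut.le_of_opNorm_le norm_critOut_le _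
      _ ≤ 1 * (30720 * (2 * K * ε * (61440 * (30 * (K * ε ^ 2))))) := by
        gcongr
        refine S.le_of_opNorm_le_of_le hSn (U.le_of_opNorm_le_of_le hUn ?_)
        exact R.le_of_opNorm_le_of_le hRn hUS
      _ = (30720 * 2 * 61440 * 30) * (K ^ 2 * ε ^ 3) := by ring
      _ ≤ _ := by gcongr; norm_num
  have hent : entry 0 1 R = -entry 0 1 (S * U * S) + Q := by
    have h3 : entry 0 1 S = 0 := by rw [hS, entry_shiftRes hκ10 hb10 h0, if_neg (by norm_num)]
    rw [entry_apply, ← hf, e1, map_sub, map_sub, Pi.sub_apply, Pi.sub_apply]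
    have h4 : critOut (S f) 0 = 0 := h3
    have h5 : critOut (S (U (S f))) 0 = entry 0 1 (S * U * S) := rfl
    have h6 : critOut (S (U (R (U (S f))))) 0 = Q := rfl
    rw [h4, h5, h6]; ring
  -- The first order term sees only the second harmonics, which connect the modes `-1` and `1`.
  have hmain : (d : ℂ) * entry 0 1 (S * U * S) =
      (((1 + κ) * (α * cc 2 g₁ + β * cc 2 g₂) : ℝ) : ℂ) := by
    rw [hS, hU, entry_shiftRes_pot hκ10 hb10 h0, symDet_modeOf_one, symDet_modeOf_zero, hq1, hq0,
      ← hd]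
    have e4 : modeOf 0 - modeOf 1 = 2 := by norm_num
    rw [e4, hP.even₁.cf_eq, hP.even₂.cf_eq, hα, hβ]
    push_cast
    field_simp
  have hreal := offDiag_real_bound hK hP.s_nonneg hP.s_le hε1 hk hα2 hβ1 hP.coeff₁ hP.coeff₂
  have efin : (d : ℂ) * (-entry 0 1 R) - 96 * s ^ 2 =
      (((1 + κ) * (α * cc 2 g₁ + β * cc 2 g₂) - 96 * s ^ 2 : ℝ) : ℂ) - d * Q := by
    rw [hent]
    have := hmain
    push_cast at this ⊢
    linear_combination this
  rw [efin]
  refine (norm_sub_le _ _).trans ?_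
  rw [Complex.norm_real, Real.norm_eq_abs, norm_mul, Complex.norm_real, Real.norm_eq_abs,
    abs_of_pos (by linarith : 0 < d)]
  have := mul_le_mul hd8 hQn (norm_nonneg _) (by norm_num)
  have hp : 0 ≤ K ^ 2 * ε ^ 3 := by positivity
  linarith

/-! ### Expansion of the trace and the determinant of the reduced matrix -/

/-- The increment of `critDet` in `σ`. -/
def detInc (κ b σ : ℝ) : ℝ := critDet κ b σ - critDet κ b 0

section Increment

variable {ε ω κ σ : ℝ} (hε0 : 0 ≤ ε) (hε : ε ≤ 1 / 20) (hω : |ω| ≤ 1 / 4)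
  (hk : |κ - 1| ≤ 2 * ε) (hk2 : |κ - 1 - 4 * ε * ω| ≤ ε ^ 2) (hσ : |σ| ≤ 1 / 2)
include hε0 hε hω hk hk2 hσ

/-- To leading order `critDet` is `4 (4 ε ω + 2 σ)²`, since `κ - 1` is `4 ε ω` up to `O(ε²)`; the
part depending on `σ` is `64 ε ω σ + 16 σ²`. -/
theorem detInc_bound :
    |detInc κ (ε ^ 2) σ - (64 * ε * ω * σ + 16 * σ ^ 2)| ≤ 100 * |σ| * (ε + |σ|) ^ 2 := by
  have hk' := abs_le.1 hk
  have hσ' := abs_le.1 hσ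
  have hs0 := abs_nonneg σ
  set ρ := ε + |σ| with hρ
  have hρ0 : 0 ≤ ρ := by positivity
  have hερ : ε ≤ ρ := by linarith
  have hσρ : |σ| ≤ ρ := by linarith
  have hωe : |8 * ε * ω| ≤ 2 * ε := by
    rw [abs_mul, abs_of_nonneg (by positivity)]; nlinarith
  set L := 8 * ε * ω + 2 * σ
  set m := κ * (2 + σ)
  set t := 2 * (κ - 1) - ε ^ 2 + m * σ
  have hL : |L| ≤ 2 * ρ := by
    refine (abs_add_le _ _).trans ?_
    rw [abs_mul 2 σ, abs_of_pos (by norm_num : (0 : ℝ) < 2)]; linarith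
  have hm : |m| ≤ 3 := by
    simp only [m]
    rw [abs_of_nonneg (mul_nonneg (by linarith) (by linarith))]; nlinarith
  have hm2 : |m - 2| ≤ 5 * ρ := by
    have e : m - 2 = (κ - 1) * (2 + σ) + σ := by simp only [m]; ring
    rw [e]
    refine (abs_add_le _ _).trans ?_
    rw [abs_mul, abs_of_pos (by linarith : 0 < 2 + σ)]
    nlinarith [abs_nonneg (κ - 1)]
  have ht : |t - L| ≤ 5 * ρ ^ 2 := by
    have e : t - L = 2 * (κ - 1 - 4 * ε * ω) + (-(ε ^ 2)) + ((κ - 1) * (2 + σ) * σ + σ ^ 2) := by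
      simp only [t, L, m]; ring
    rw [e]
    refine (abs_add_three _ _ _).trans ?_
    have h5 : |(κ - 1) * (2 + σ) * σ + σ ^ 2| ≤ 2 * ε * (5 / 2) * |σ| + |σ| ^ 2 := by
      refine (abs_add_le _ _).trans ?_
      rw [abs_mul, abs_mul, abs_of_pos (by linarith : 0 < 2 + σ), abs_pow]
      have h6 : |κ - 1| * (2 + σ) ≤ 2 * ε * (5 / 2) :=
        mul_le_mul hk (by linarith) (by linarith) (by positivity)
      nlinarith
    rw [abs_mul 2, abs_of_pos (by norm_num : (0 : ℝ) < 2), abs_neg, abs_of_nonneg (sq_nonneg ε)]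
    have h7 : ρ ^ 2 = ε ^ 2 + 2 * ε * |σ| + |σ| ^ 2 := by rw [hρ]; ring
    nlinarith [mul_nonneg hε0 hs0]
  have e : detInc κ (ε ^ 2) σ - (64 * ε * ω * σ + 16 * σ ^ 2) =
      4 * σ * (m * (t - L) + (m - 2) * L) := by
    simp only [detInc, critDet, m, t, L]; ring
  rw [e, abs_mul, abs_mul, abs_of_pos (by norm_num : (0 : ℝ) < 4)]
  have h4 : |m * (t - L) + (m - 2) * L| ≤ 25 * ρ ^ 2 := by
    refine (abs_add_le _ _).trans ?_
    rw [abs_mul m, abs_mul (m - 2)]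
    have h1 := mul_le_mul hm ht (abs_nonneg _) (by norm_num)
    have h2 := mul_le_mul hm2 hL (abs_nonneg _) (by positivity)
    linarith
  calc 4 * |σ| * |m * (t - L) + (m - 2) * L| ≤ 4 * |σ| * (25 * ρ ^ 2) := by gcongr
    _ = _ := by ring

-- The odd part cancels, so the error has the factor `σ²` and not just `|σ|`. The sharp form of the
-- trace and determinant errors depends on this.
omit hω hk2 in
theorem detInc_even_bound :
    |detInc κ (ε ^ 2) σ + detInc κ (ε ^ 2) (-σ) - 32 * σ ^ 2| ≤ 200 * σ ^ 2 * (ε + |σ|) := by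
  have hk' := abs_le.1 hk
  have hσ' := abs_le.1 hσ
  have hs0 := abs_nonneg σ
  have e : detInc κ (ε ^ 2) σ + detInc κ (ε ^ 2) (-σ) - 32 * σ ^ 2 =
      4 * σ ^ 2 * ((2 * (κ - 1) - ε ^ 2) * (2 * κ) + (κ - 1) * (8 * (κ + 1)) + 2 * κ ^ 2 * σ ^ 2) := by
    simp only [detInc, critDet]; ring
  rw [e, abs_mul, abs_of_nonneg (by positivity : 0 ≤ 4 * σ ^ 2)]
  have h1 : |(2 * (κ - 1) - ε ^ 2) * (2 * κ)| ≤ 5 * ε * 3 := by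
    rw [abs_mul, abs_of_nonneg (by linarith : 0 ≤ 2 * κ)]
    refine mul_le_mul ?_ (by linarith) (by linarith) (by positivity)
    rw [abs_le]; constructor <;> nlinarith
  have h2 : |(κ - 1) * (8 * (κ + 1))| ≤ 2 * ε * 17 := by
    rw [abs_mul, abs_of_nonneg (by linarith : 0 ≤ 8 * (κ + 1))]
    exact mul_le_mul hk (by linarith) (by linarith) (by positivity)
  have h3 : |2 * κ ^ 2 * σ ^ 2| ≤ 3 * |σ| := by
    rw [abs_of_nonneg (by positivity), ← sq_abs σ]
    have : κ ^ 2 ≤ 5 / 4 := by nlinarith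
    have h4 : |σ| ^ 2 ≤ 1 / 2 * |σ| := by nlinarith
    calc 2 * κ ^ 2 * |σ| ^ 2 ≤ 2 * (5 / 4) * (1 / 2 * |σ|) := by gcongr
      _ ≤ _ := by linarith
  have h5 := (abs_add_three ((2 * (κ - 1) - ε ^ 2) * (2 * κ)) ((κ - 1) * (8 * (κ + 1)))
    (2 * κ ^ 2 * σ ^ 2))
  calc _ ≤ 4 * σ ^ 2 * (50 * (ε + |σ|)) := by gcongr; linarith
    _ = _ := by ring

end Increment

/-! ### Trace and determinant of the rescaled reduced matrix from its first row. -/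

section Scalar

variable {ε ω κ σ Q : ℝ} {A B : ℝ → ℂ} (hε0 : 0 ≤ ε) (hε : ε ≤ 1 / 20) (hω : |ω| ≤ 1 / 4)
  (hk : |κ - 1| ≤ 2 * ε) (hk2 : |κ - 1 - 4 * ε * ω| ≤ ε ^ 2) (hσ : |σ| ≤ 1 / 2) (hQ : 1 ≤ Q)
  (hA : Jet (Q * ε ^ 2) A) (hB : Jet (Q * ε ^ 2) B) (hker : critDet κ (ε ^ 2) 0 + A 0 = B 0)
  (hB0 : ‖B 0 - ((4 * (ε ^ 2 * (1 - 16 * ω ^ 2)) : ℝ) : ℂ)‖ ≤ Q * ε ^ 3)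
include hε0 hε hω hk hk2 hσ hQ hA hB hker hB0

omit hk hk2 hσ hA hB hker in
theorem norm_jet_base_le : ‖B 0‖ ≤ (4 + Q) * ε ^ 2 := by
  have h1 := norm_le_norm_sub_add (B 0) ((4 * (ε ^ 2 * (1 - 16 * ω ^ 2)) : ℝ) : ℂ)
  have hω2 : ω ^ 2 ≤ (1 / 4) ^ 2 := by rw [← sq_abs]; gcongr
  rw [Complex.norm_real, Real.norm_eq_abs, abs_of_nonneg
    (mul_nonneg (by norm_num) (mul_nonneg (sq_nonneg _) (by linarith)))] at h1
  have h2 : Q * ε ^ 3 ≤ Q * ε ^ 2 := mul_le_mul_of_nonneg_left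
    (pow_le_pow_of_le_one hε0 (by linarith) (by norm_num)) (by linarith)
  nlinarith [mul_nonneg (sq_nonneg ε) (sq_nonneg ω)]

-- By the kernel condition the diagonal entry at `σ = 0` is `B 0`, whose size is known; the
-- remaining terms are sums over `±σ`, of which only the even part survives.
omit hω hk2 hB in
theorem reduced_trace_bound :
    ‖(critDet κ (ε ^ 2) σ + A σ) + (critDet κ (ε ^ 2) (-σ) + A (-σ)) -
      ((8 * (ε ^ 2 * (1 - 16 * ω ^ 2)) + 32 * σ ^ 2 : ℝ) : ℂ)‖ ≤
      (200 + 4 * Q) * (ε + |σ|) ^ 3 := by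
  have hs0 := abs_nonneg σ
  have e : (critDet κ (ε ^ 2) σ + A σ) + (critDet κ (ε ^ 2) (-σ) + A (-σ)) -
      ((8 * (ε ^ 2 * (1 - 16 * ω ^ 2)) + 32 * σ ^ 2 : ℝ) : ℂ) =
      2 * (B 0 - ((4 * (ε ^ 2 * (1 - 16 * ω ^ 2)) : ℝ) : ℂ)) +
      ((detInc κ (ε ^ 2) σ + detInc κ (ε ^ 2) (-σ) - 32 * σ ^ 2 : ℝ) : ℂ) +
      ((A σ - A 0) + (A (-σ) - A 0)) := by
    rw [← hker]
    simp only [detInc]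
    push_cast; ring
  rw [e]
  refine norm_add₃_le.trans ?_
  have h1 := detInc_even_bound hε0 hε hk hσ
  have h2 := hA.norm_second_le hσ
  rw [norm_mul, Complex.norm_ofNat, Complex.norm_real, Real.norm_eq_abs]
  have p1 : ε ^ 3 ≤ (ε + |σ|) ^ 3 := pow_le_pow_left₀ hε0 (by linarith) 3
  have p2 : σ ^ 2 * (ε + |σ|) ≤ (ε + |σ|) ^ 3 := by
    rw [← sq_abs, pow_succ (ε + |σ|) 2]; gcongr; linarith
  have p3 : ε ^ 2 * σ ^ 2 ≤ (ε + |σ|) ^ 3 := by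
    have : ε ^ 2 ≤ ε + |σ| := by nlinarith
    calc ε ^ 2 * σ ^ 2 ≤ (ε + |σ|) * σ ^ 2 := by gcongr
      _ = σ ^ 2 * (ε + |σ|) := mul_comm _ _
      _ ≤ _ := p2
  have q1 : Q * ε ^ 3 ≤ Q * (ε + |σ|) ^ 3 := by gcongr
  have q3 : Q * (ε ^ 2 * σ ^ 2) ≤ Q * (ε + |σ|) ^ 3 := by gcongr
  linarith

theorem reduced_entry_bound :
    ‖(critDet κ (ε ^ 2) σ : ℂ) + A σ‖ ≤ (200 + 4 * Q) * (ε + |σ|) ^ 2 ∧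
    ‖B σ‖ ≤ (200 + 4 * Q) * (ε + |σ|) ^ 2 := by
  have hs0 := abs_nonneg σ
  have h0 := norm_jet_base_le hε0 hε hω hQ hB0
  have hρ1 : ε + |σ| ≤ 1 := by linarith
  have p1 : ε ^ 2 ≤ (ε + |σ|) ^ 2 := pow_le_pow_left₀ hε0 (by linarith) 2
  have p2 : ε ^ 2 * |σ| ≤ (ε + |σ|) ^ 2 := by
    calc ε ^ 2 * |σ| ≤ ε ^ 2 * 1 := by gcongr; linarith
      _ ≤ _ := by linarith
  have q1 : (4 + Q) * ε ^ 2 ≤ (4 + Q) * (ε + |σ|) ^ 2 := by gcongr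
  have q2 : Q * (ε ^ 2 * |σ|) ≤ Q * (ε + |σ|) ^ 2 := by gcongr
  have hp : 0 ≤ Q * (ε + |σ|) ^ 2 := by positivity
  constructor
  · have e : (critDet κ (ε ^ 2) σ : ℂ) + A σ = B 0 + (detInc κ (ε ^ 2) σ : ℝ) + (A σ - A 0) := by
      rw [← hker, detInc]; push_cast; ring
    rw [e]
    refine norm_add₃_le.trans ?_
    rw [Complex.norm_real, Real.norm_eq_abs]
    have h1 := detInc_bound hε0 hε hω hk hk2 hσ
    have h2 := hA.norm_sub_le hσ
    have h3 : |64 * ε * ω * σ + 16 * σ ^ 2| ≤ 16 * (ε + |σ|) ^ 2 := by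
      refine (abs_add_le _ _).trans ?_
      rw [abs_mul, abs_mul, abs_of_nonneg (by positivity : 0 ≤ 64 * ε),
        abs_of_nonneg (by positivity : 0 ≤ 16 * σ ^ 2), ← sq_abs σ]
      have : 64 * ε * |ω| ≤ 16 * ε := by nlinarith
      nlinarith [mul_le_mul_of_nonneg_right this hs0, mul_nonneg hε0 hs0]
    have h4 := abs_sub_abs_le_abs_sub (detInc κ (ε ^ 2) σ) (64 * ε * ω * σ + 16 * σ ^ 2)
    have h5 : |σ| * (ε + |σ|) ^ 2 ≤ 1 / 2 * (ε + |σ|) ^ 2 := by gcongr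
    linarith [sq_nonneg (ε + |σ|)]
  · have e : B σ = B 0 + (B σ - B 0) := by ring
    rw [e]
    refine (norm_add_le _ _).trans ?_
    have h2 := hB.norm_sub_le hσ
    linarith [sq_nonneg (ε + |σ|)]

/-- The determinant vanishes at `σ = 0`. With `g = 4 ε² (1 - 16 ω²)` and `L = 64 ε ω σ + 16 σ²`, `L'
= L(-σ)`, the leading part is `g (L + L') + L L'`; the product contributes `-(64 ε ω σ)²`, which
turns the factor `1 - 16 ω²` into `1 - 48 ω²`. -/
theorem reduced_det_bound :
    ‖(critDet κ (ε ^ 2) σ + A σ) * (critDet κ (ε ^ 2) (-σ) + A (-σ)) - B σ * B (-σ) -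
      ((σ ^ 2 * (256 * σ ^ 2 + 128 * ε ^ 2 * (1 - 48 * ω ^ 2)) : ℝ) : ℂ)‖ ≤
      10 * (100 + 2 * Q) ^ 2 * (σ ^ 2 * (ε + |σ|) ^ 3) := by
  have hs0 := abs_nonneg σ
  have hσn : |(-σ)| ≤ 1 / 2 := by rwa [abs_neg]
  have h0 := norm_jet_base_le hε0 hε hω hQ hB0
  set ρ := ε + |σ| with hρ
  have hρ0 : 0 ≤ ρ := by positivity
  have hρ1 : ρ ≤ 1 := by linarith
  have hερ : ε ≤ ρ := by linarith
  have hσρ : |σ| ≤ ρ := by linarith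
  set g : ℝ := 4 * (ε ^ 2 * (1 - 16 * ω ^ 2)) with hg
  set L : ℝ := 64 * ε * ω * σ + 16 * σ ^ 2 with hL
  set L' : ℝ := 64 * ε * ω * (-σ) + 16 * (-σ) ^ 2 with hL'
  set N := 100 + 2 * Q with hN
  set r : ℂ := ((detInc κ (ε ^ 2) σ - L : ℝ) : ℂ) + (A σ - A 0) with hr
  set r' : ℂ := ((detInc κ (ε ^ 2) (-σ) - L' : ℝ) : ℂ) + (A (-σ) - A 0) with hr'
  set X : ℂ := ((detInc κ (ε ^ 2) σ + detInc κ (ε ^ 2) (-σ) - 32 * σ ^ 2 : ℝ) : ℂ) +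
    ((A σ - A 0) + (A (-σ) - A 0)) - ((B σ - B 0) + (B (-σ) - B 0)) with hX
  have hω16 : 64 * ε * |ω| ≤ 16 * ε := by nlinarith
  have hLn : ∀ τ : ℝ, |τ| = |σ| → |64 * ε * ω * τ + 16 * τ ^ 2| ≤ 16 * (|σ| * ρ) := fun τ hτ => by
    refine (abs_add_le _ _).trans ?_
    rw [abs_mul, abs_mul, abs_of_nonneg (by positivity : 0 ≤ 64 * ε),
      abs_of_nonneg (by positivity : 0 ≤ 16 * τ ^ 2), ← sq_abs τ, hτ]
    nlinarith [mul_le_mul_of_nonneg_right hω16 hs0]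
  have hrn : ∀ τ : ℝ, |τ| = |σ| → ‖((detInc κ (ε ^ 2) τ - (64 * ε * ω * τ + 16 * τ ^ 2) : ℝ) : ℂ) +
      (A τ - A 0)‖ ≤ N * (|σ| * ρ ^ 2) := fun τ hτ => by
    refine (norm_add_le _ _).trans ?_
    have hτ2 : |τ| ≤ 1 / 2 := by rwa [hτ]
    have h1 := detInc_bound hε0 hε hω hk hk2 hτ2
    have h2 := hA.norm_sub_le hτ2
    rw [Complex.norm_real, Real.norm_eq_abs]
    rw [hτ] at h1 h2
    have h3 : Q * ε ^ 2 * |σ| ≤ Q * ρ ^ 2 * |σ| := by gcongr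
    have h4 : 0 ≤ Q * ρ ^ 2 * |σ| := by positivity
    rw [hN]
    linarith
  have hXn : ‖X‖ ≤ 200 * σ ^ 2 * ρ + 4 * (Q * ε ^ 2) * σ ^ 2 := by
    refine (norm_sub_le _ _).trans ?_
    have h1 := detInc_even_bound hε0 hε hk hσ
    have h2 := hA.norm_second_le hσ
    have h3 := hB.norm_second_le hσ
    have h4 := norm_add_le (((detInc κ (ε ^ 2) σ + detInc κ (ε ^ 2) (-σ) - 32 * σ ^ 2 : ℝ) : ℂ))
      ((A σ - A 0) + (A (-σ) - A 0))
    rw [Complex.norm_real, Real.norm_eq_abs] at h4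
    linarith
  -- Increments enter linearly only through their sums over `±σ`, which are `O(σ²)`, or in products
  -- of two factors `O(|σ|)`; so the factor `σ²` can be split off every error.
  have e : (critDet κ (ε ^ 2) σ + A σ) * (critDet κ (ε ^ 2) (-σ) + A (-σ)) - B σ * B (-σ) -
      ((σ ^ 2 * (256 * σ ^ 2 + 128 * ε ^ 2 * (1 - 48 * ω ^ 2)) : ℝ) : ℂ) =
      (B 0 - (g : ℂ)) * ((32 * σ ^ 2 : ℝ) : ℂ) + B 0 * X + (r * L' + L * r' + r * r') -
        (B σ - B 0) * (B (-σ) - B 0) := by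
    have e1 : (critDet κ (ε ^ 2) σ : ℂ) = B 0 - A 0 + detInc κ (ε ^ 2) σ := by
      rw [← hker, detInc]; push_cast; ring
    have e2 : (critDet κ (ε ^ 2) (-σ) : ℂ) = B 0 - A 0 + detInc κ (ε ^ 2) (-σ) := by
      rw [← hker, detInc]; push_cast; ring
    rw [e1, e2]
    simp only [hr, hr', hX, hL, hL', hg]
    push_cast
    ring
  rw [e]
  have t1 : ‖(B 0 - (g : ℂ)) * ((32 * σ ^ 2 : ℝ) : ℂ)‖ ≤ 32 * Q * (σ ^ 2 * ρ ^ 3) := by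
    rw [norm_mul, Complex.norm_real, Real.norm_of_nonneg (by positivity)]
    calc _ ≤ Q * ε ^ 3 * (32 * σ ^ 2) := by gcongr
      _ ≤ Q * ρ ^ 3 * (32 * σ ^ 2) := by gcongr
      _ = _ := by ring
  have t2 : ‖B 0 * X‖ ≤ (4 + Q) * (200 + 4 * Q) * (σ ^ 2 * ρ ^ 3) := by
    rw [norm_mul]
    have h1 : ‖X‖ ≤ (200 + 4 * Q) * (σ ^ 2 * ρ) := by
      refine hXn.trans ?_
      have : Q * ε ^ 2 * σ ^ 2 ≤ Q * ρ * σ ^ 2 := by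
        gcongr; nlinarith
      linarith
    calc ‖B 0‖ * ‖X‖ ≤ (4 + Q) * ρ ^ 2 * ((200 + 4 * Q) * (σ ^ 2 * ρ)) := by
          refine mul_le_mul (h0.trans ?_) h1 (norm_nonneg _) (by positivity)
          gcongr
      _ = _ := by ring
  have hN0 : 0 ≤ N := by positivity
  have hrb : ‖r‖ ≤ N * (|σ| * ρ ^ 2) := hrn σ rfl
  have hrb' : ‖r'‖ ≤ N * (|σ| * ρ ^ 2) := hrn (-σ) (abs_neg σ)
  have hLb : |L| ≤ 16 * (|σ| * ρ) := hLn σ rfl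
  have hLb' : |L'| ≤ 16 * (|σ| * ρ) := hLn (-σ) (abs_neg σ)
  have t3 : ‖r * L' + L * r' + r * r'‖ ≤ (32 * N + N ^ 2) * (σ ^ 2 * ρ ^ 3) := by
    refine norm_add₃_le.trans ?_
    rw [norm_mul, norm_mul, norm_mul, Complex.norm_real, Complex.norm_real, Real.norm_eq_abs,
      Real.norm_eq_abs]
    have b1 := mul_le_mul hrb hLb' (abs_nonneg _) (by positivity)
    have b2 := mul_le_mul hLb hrb' (norm_nonneg _) (by positivity)
    have b3 := mul_le_mul hrb hrb' (norm_nonneg _) (by positivity)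
    have b4 : N * (|σ| * ρ ^ 2) * (N * (|σ| * ρ ^ 2)) ≤ N ^ 2 * (σ ^ 2 * ρ ^ 3) := by
      calc N * (|σ| * ρ ^ 2) * (N * (|σ| * ρ ^ 2)) = N ^ 2 * (|σ| ^ 2 * (ρ ^ 3 * ρ)) := by ring
        _ ≤ N ^ 2 * (|σ| ^ 2 * (ρ ^ 3 * 1)) := by gcongr
        _ = _ := by rw [sq_abs]; ring
    have b5 : N * (|σ| * ρ ^ 2) * (16 * (|σ| * ρ)) = 16 * N * (σ ^ 2 * ρ ^ 3) := by
      rw [← sq_abs σ]; ring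
    have b6 : 16 * (|σ| * ρ) * (N * (|σ| * ρ ^ 2)) = 16 * N * (σ ^ 2 * ρ ^ 3) := by
      rw [← sq_abs σ]; ring
    linarith
  have t4 : ‖(B σ - B 0) * (B (-σ) - B 0)‖ ≤ N ^ 2 * (σ ^ 2 * ρ ^ 3) := by
    rw [norm_mul]
    have hb : ∀ τ : ℝ, |τ| = |σ| → ‖B τ - B 0‖ ≤ N * (|σ| * ρ ^ 2) := fun τ hτ => by
      have h2 := hB.norm_sub_le (by rwa [hτ] : |τ| ≤ 1 / 2)
      rw [hτ] at h2
      have h3 : Q * ε ^ 2 * |σ| ≤ Q * ρ ^ 2 * |σ| := by gcongr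
      have h4 : 0 ≤ Q * ρ ^ 2 * |σ| := by positivity
      have h5 : 0 ≤ ρ ^ 2 * |σ| := by positivity
      rw [hN]; linarith
    calc _ ≤ N * (|σ| * ρ ^ 2) * (N * (|σ| * ρ ^ 2)) :=
          mul_le_mul (hb σ rfl) (hb (-σ) (abs_neg σ)) (norm_nonneg _) (by positivity)
      _ = N ^ 2 * (|σ| ^ 2 * (ρ ^ 3 * ρ)) := by ring
      _ ≤ N ^ 2 * (|σ| ^ 2 * (ρ ^ 3 * 1)) := by gcongr
      _ = _ := by rw [sq_abs]; ring
  refine (norm_sub_le _ _).trans ?_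
  have t5 := norm_add₃_le (a := (B 0 - (g : ℂ)) * ((32 * σ ^ 2 : ℝ) : ℂ)) (b := B 0 * X)
    (c := r * L' + L * r' + r * r')
  have hp : 0 ≤ σ ^ 2 * ρ ^ 3 := by positivity
  have hcoef : 32 * Q + (4 + Q) * (200 + 4 * Q) + (32 * N + N ^ 2) + N ^ 2 ≤ 10 * N ^ 2 := by
    rw [hN]; linarith [sq_nonneg Q]
  calc _ ≤ 32 * Q * (σ ^ 2 * ρ ^ 3) + (4 + Q) * (200 + 4 * Q) * (σ ^ 2 * ρ ^ 3) +
        (32 * N + N ^ 2) * (σ ^ 2 * ρ ^ 3) + N ^ 2 * (σ ^ 2 * ρ ^ 3) := by linarith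
    _ = (32 * Q + (4 + Q) * (200 + 4 * Q) + (32 * N + N ^ 2) + N ^ 2) * (σ ^ 2 * ρ ^ 3) := by ring
    _ ≤ _ := mul_le_mul_of_nonneg_right hcoef hp

end Scalar

theorem shiftDet_sub_le {ε ω κ σ : ℝ} (hε0 : 0 ≤ ε) (hε : ε ≤ 1 / 20) (hω : |ω| ≤ 1 / 4)
    (hk : |κ - 1| ≤ 2 * ε) (hk2 : |κ - 1 - 4 * ε * ω| ≤ ε ^ 2) (hσ : |σ| ≤ 1 / 2) :
    |shiftDet κ (ε ^ 2) σ - 6| ≤ 100 * (ε + |σ|) := by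
  have hs0 := abs_nonneg σ
  have hk' := abs_le.1 hk
  have hσ' := abs_le.1 hσ
  have h1 := detInc_bound hε0 hε hω hk hk2 hσ
  have e : shiftDet κ (ε ^ 2) σ - 6 = (detInc κ (ε ^ 2) σ - (64 * ε * ω * σ + 16 * σ ^ 2)) +
      (64 * ε * ω * σ + 16 * σ ^ 2) + (4 * (κ - 1) ^ 2 + (1 - 4 * κ) * ε ^ 2 +
        ((κ - 1) * (1 + σ) ^ 2 + σ * (2 + σ))) := by
    simp only [shiftDet, detInc, critDet]; ring
  rw [e]
  refine (abs_add_three _ _ _).trans ?_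
  set ρ := ε + |σ| with hρ
  have hρ0 : 0 ≤ ρ := by positivity
  have hρ1 : ρ ≤ 11 / 20 := by linarith
  have h2 : 100 * |σ| * ρ ^ 2 ≤ 100 * (1 / 2) * (11 / 20 * ρ) := by
    rw [pow_two]; gcongr
  have h3 : |64 * ε * ω * σ + 16 * σ ^ 2| ≤ 16 * (1 / 2) * ρ := by
    refine (abs_add_le _ _).trans ?_
    rw [abs_mul, abs_mul, abs_of_nonneg (by positivity : 0 ≤ 64 * ε),
      abs_of_nonneg (by positivity : 0 ≤ 16 * σ ^ 2), ← sq_abs σ]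
    have h4 : 64 * ε * |ω| ≤ 16 * ε := by nlinarith
    have h5 : 64 * ε * |ω| * |σ| ≤ 16 * ε * (1 / 2) :=
      mul_le_mul h4 hσ hs0 (by positivity)
    have h6 : |σ| ^ 2 ≤ 1 / 2 * |σ| := by rw [pow_two]; gcongr
    linarith
  have h7 : |4 * (κ - 1) ^ 2 + (1 - 4 * κ) * ε ^ 2 + ((κ - 1) * (1 + σ) ^ 2 + σ * (2 + σ))| ≤
      20 * ρ := by
    refine (abs_add_three _ _ _).trans ?_
    have a1 : |4 * (κ - 1) ^ 2| ≤ ε := by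
      rw [abs_of_nonneg (by positivity), ← sq_abs]
      nlinarith [abs_nonneg (κ - 1)]
    have a2 : |(1 - 4 * κ) * ε ^ 2| ≤ ε := by
      rw [abs_mul, abs_of_nonneg (sq_nonneg ε)]
      have : |1 - 4 * κ| ≤ 4 := by rw [abs_le]; constructor <;> linarith
      nlinarith [sq_nonneg ε, mul_le_mul_of_nonneg_right this (sq_nonneg ε)]
    have a3 : |(κ - 1) * (1 + σ) ^ 2 + σ * (2 + σ)| ≤ 2 * ε * (9 / 4) + |σ| * (5 / 2) := by
      refine (abs_add_le _ _).trans ?_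
      rw [abs_mul, abs_mul, abs_of_nonneg (sq_nonneg (1 + σ)), abs_of_pos (by linarith : 0 < 2 + σ)]
      refine add_le_add (mul_le_mul hk ?_ (sq_nonneg _) (by positivity))
        (mul_le_mul_of_nonneg_left (by linarith) hs0)
      nlinarith
    linarith
  linarith

/-- Passing from the rescaled entries `p W` to the entries of `W`. -/
theorem unscale_bounds {p p' σ ε T X M : ℝ} {w w' v v' : ℂ} (hε : 0 ≤ ε) (hρ1 : ε + |σ| ≤ 1)
    (hM : 0 ≤ M) (hp : 1 / 5 ≤ p) (hp' : 1 / 5 ≤ p') (hp6 : |p - 6| ≤ 100 * (ε + |σ|))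
    (hp6' : |p' - 6| ≤ 100 * (ε + |σ|)) (hX : |X| ≤ 256 * (σ ^ 2 * (ε + |σ|) ^ 2))
    (h1 : ‖p * w‖ ≤ M * (ε + |σ|) ^ 2) (h2 : ‖p' * w'‖ ≤ M * (ε + |σ|) ^ 2)
    (h3 : ‖p * v‖ ≤ M * (ε + |σ|) ^ 2) (h4 : ‖p' * v'‖ ≤ M * (ε + |σ|) ^ 2)
    (hT : ‖p * w + p' * w' - (T : ℂ)‖ ≤ M * (ε + |σ|) ^ 3)
    (hD : ‖(p * w) * (p' * w') - (p * v) * (p' * v') - (X : ℂ)‖ ≤ M * (σ ^ 2 * (ε + |σ|) ^ 3)) :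
    (‖w‖ ≤ 5 * M * (ε + |σ|) ^ 2 ∧ ‖w'‖ ≤ 5 * M * (ε + |σ|) ^ 2 ∧ ‖v‖ ≤ 5 * M * (ε + |σ|) ^ 2 ∧
      ‖v'‖ ≤ 5 * M * (ε + |σ|) ^ 2) ∧
    ‖6 * (w + w') - (T : ℂ)‖ ≤ 1001 * M * (ε + |σ|) ^ 3 ∧
    ‖36 * (w * w' - v * v') - (X : ℂ)‖ ≤ 10 ^ 8 * (1 + M) * (σ ^ 2 * (ε + |σ|) ^ 3) := by
  set ρ := ε + |σ|
  have hρ0 : 0 ≤ ρ := by positivity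
  have key : ∀ (p : ℝ) (w : ℂ), 1 / 5 ≤ p → ‖p * w‖ ≤ M * ρ ^ 2 → ‖w‖ ≤ 5 * M * ρ ^ 2 :=
    fun p w hp h => by
      rw [norm_mul, Complex.norm_real, Real.norm_of_nonneg (by linarith)] at h
      nlinarith [norm_nonneg w]
  have k1 := key p w hp h1
  have k2 := key p' w' hp' h2
  refine ⟨⟨k1, k2, key p v hp h3, key p' v' hp' h4⟩, ?_, ?_⟩
  · have e : 6 * (w + w') - (T : ℂ) = (p * w + p' * w' - (T : ℂ)) + (-((p - 6 : ℝ) : ℂ) * w) +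
        (-((p' - 6 : ℝ) : ℂ) * w') := by push_cast; ring
    rw [e]
    refine norm_add₃_le.trans ?_
    rw [norm_mul, norm_mul, norm_neg, norm_neg, Complex.norm_real, Complex.norm_real,
      Real.norm_eq_abs, Real.norm_eq_abs]
    have b1 := mul_le_mul hp6 k1 (norm_nonneg _) (by positivity)
    have b2 := mul_le_mul hp6' k2 (norm_nonneg _) (by positivity)
    have e1 : 100 * ρ * (5 * M * ρ ^ 2) = 500 * M * ρ ^ 3 := by ring
    linarith
  · set Δ := (p * w) * (p' * w') - (p * v) * (p' * v') with hΔ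
    have hΔn : ‖Δ‖ ≤ (256 + M) * (σ ^ 2 * ρ ^ 2) := by
      have := norm_le_norm_sub_add Δ (X : ℂ)
      rw [Complex.norm_real, Real.norm_eq_abs] at this
      have h5 : σ ^ 2 * ρ ^ 3 ≤ σ ^ 2 * ρ ^ 2 := by
        gcongr 1
        exact pow_le_pow_of_le_one hρ0 hρ1 (by norm_num)
      nlinarith
    set δ := w * w' - v * v' with hδ
    have hδe : Δ = ((p * p' : ℝ) : ℂ) * δ := by rw [hΔ, hδ]; push_cast; ring
    have hpp : 1 / 25 ≤ p * p' := by nlinarith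
    have hδn : ‖δ‖ ≤ 25 * ((256 + M) * (σ ^ 2 * ρ ^ 2)) := by
      have : ‖Δ‖ = p * p' * ‖δ‖ := by
        rw [hδe, norm_mul, Complex.norm_real, Real.norm_of_nonneg (by linarith)]
      nlinarith [norm_nonneg δ]
    -- The two scale factors are near `6`, so their product is near `36`; the deviation multiplies
    -- `δ`, which already carries `σ²`.
    have e : 36 * δ - (X : ℂ) = (Δ - X) - ((p * (p' - 6) + 6 * (p - 6) : ℝ) : ℂ) * δ := by
      rw [hδe]; push_cast; ring
    rw [e]
    refine (norm_sub_le _ _).trans ?_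
    rw [norm_mul, Complex.norm_real, Real.norm_eq_abs]
    have hpb : |p| ≤ 106 := by
      have := abs_le.1 hp6
      rw [abs_le]; constructor <;> linarith
    have hc : |p * (p' - 6) + 6 * (p - 6)| ≤ 11200 * ρ := by
      refine (abs_add_le _ _).trans ?_
      rw [abs_mul, abs_mul, abs_of_pos (by norm_num : (0 : ℝ) < 6)]
      have := mul_le_mul hpb hp6' (abs_nonneg _) (by norm_num)
      linarith
    have b := mul_le_mul hc hδn (norm_nonneg _) (by positivity)
    have e2 : 11200 * ρ * (25 * ((256 + M) * (σ ^ 2 * ρ ^ 2))) =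
        280000 * (256 + M) * (σ ^ 2 * ρ ^ 3) := by ring
    have hq : 0 ≤ σ ^ 2 * ρ ^ 3 := by positivity
    have hq2 : 0 ≤ M * (σ ^ 2 * ρ ^ 3) := by positivity
    nlinarith

/-! ### The reduced matrix and its invariants. -/

/-- The compression `1 - Ψ R Φ` of an operator to the critical modes. -/
def redMat (R : State →L[ℂ] State) : Matrix (Fin 2) (Fin 2) ℂ :=
  fun j k => (if j = k then 1 else 0) - entry j k R

/-- Expansions of the entries, the trace and the determinant of the reduced matrix. -/
structure RedBounds (C ε ω σ : ℝ) (W : Matrix (Fin 2) (Fin 2) ℂ) : Prop where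
  entry : ∀ j k, ‖W j k‖ ≤ C * (ε + |σ|) ^ 2
  trace : ‖6 * (W 0 0 + W 1 1) - ((8 * (ε ^ 2 * (1 - 16 * ω ^ 2)) + 32 * σ ^ 2 : ℝ) : ℂ)‖ ≤
    C * (ε + |σ|) ^ 3
  det : ‖36 * (W 0 0 * W 1 1 - W 0 1 * W 1 0) -
    ((σ ^ 2 * (256 * σ ^ 2 + 128 * ε ^ 2 * (1 - 48 * ω ^ 2)) : ℝ) : ℂ)‖ ≤
    C * (σ ^ 2 * (ε + |σ|) ^ 3)

/-- The reduced matrix at `σ = 0` annihilates `(1, -1)`. -/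
theorem redMat_kernel {C ε ω s : ℝ} {u : Profile} (hε0 : 0 ≤ ε) (hε : ε ≤ 1 / 20)
    (hω : |ω| ≤ 1 / 4) (hP : PatternData C ε ω s u) (hu : IsSteady ε ω u) {R : State →L[ℂ] State}
    (hR : IsInv (linOp (kap ε ω) (ε ^ 2) 0 + onDom dom shiftOp +
      onDom dom (potOp (pot₁ (ε ^ 2) u) (pot₂ u))) R) :
    1 - entry 0 0 R = -entry 0 1 R := by
  obtain ⟨hk, -⟩ := abs_kap_sub_one_le hε0 (by linarith) hω
  have hkd := kap_sub_one_sq ε ω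
  have hk' := abs_le.1 hk
  have hκ10 : |kap ε ω - 1| ≤ 1 / 10 := by linarith
  have hb10 : |ε ^ 2| ≤ 1 / 10 := by rw [abs_of_nonneg (sq_nonneg ε)]; nlinarith
  have h0 : |(0 : ℝ)| ≤ 1 / 2 := by norm_num
  -- For the trivial pattern there is no derivative to use, but then `ε² (1 - 16 ω²) = 0`, the
  -- determinant on the critical mode vanishes, and both sides are `0`. Otherwise the relation is
  -- translation invariance.
  by_cases hs : s = 0
  · obtain ⟨hu0, hdeg⟩ := hP.degenerate hs
    have hpot : potOp (pot₁ (ε ^ 2) u) (pot₂ u) = 0 := by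
      have e1 : pot₁ (ε ^ 2) u = 0 := by simp [pot₁, hu0]
      have e2 : pot₂ u = 0 := by simp [pot₂, hu0]
      have := norm_potOp_le (pot₁ (ε ^ 2) u) (pot₂ u)
      rw [e1, e2, norm_zero, add_zero] at this
      rw [e1, e2]
      exact norm_le_zero_iff.1 this
    have e : onDom dom (0 : State →L[ℂ] State) = 0 := by ext v <;> simp
    rw [hpot, e, add_zero] at hR
    have hI := isInv_shiftRes hκ10 hb10 h0 (z := 0) (by norm_num)
    rw [zero_smul, sub_zero] at hI
    rw [hR.unique hI, entry_shiftRes hκ10 hb10 h0, entry_shiftRes hκ10 hb10 h0, if_pos rfl,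
      if_neg (by norm_num)]
    have hc : critDet (kap ε ω) (ε ^ 2) 0 = 0 := by
      have : critDet (kap ε ω) (ε ^ 2) 0 = -4 * kap ε ω * (ε ^ 2 * (1 - 16 * ω ^ 2)) := by
        rw [critDet]; linear_combination 4 * hkd
      rw [this, hdeg, mul_zero]
    have hne := shiftDet_ge hκ10 hb10 h0
    have hq : kap ε ω * (1 + 0) ^ 2 + ε ^ 2 + 5 = shiftDet (kap ε ω) (ε ^ 2) 0 := by
      rw [shiftDet, hc, zero_add]
    rw [hq, div_self (by linarith)]
    simp
  · obtain ⟨m1, m2, hH⟩ := (isSteady_iff hP.even₁ hP.even₂).1 hu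
    have hcc : cc 1 u.2 ≠ 0 := by
      rw [hP.coeff]
      exact mul_ne_zero (by linarith [hk'.1]) hs
    have h1 := kernel_of_steady hκ10 hb10 hP.even₁ hP.even₂ m1 m2 hH hR hcc
    have h2 : (![1, -1] : Fin 2 → ℂ) = Pi.single 0 1 - Pi.single 1 1 := by
      funext j; fin_cases j <;> simp
    have h3 := congrFun h1 0
    rw [h2, map_sub, map_sub, map_sub, Pi.sub_apply, ← entry_apply, ← entry_apply] at h3
    simp at h3
    linear_combination -h3

theorem abs_leading_det_le {ε ω σ : ℝ} (hε : 0 ≤ ε) (hω : |ω| ≤ 1 / 4) :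
    |σ ^ 2 * (256 * σ ^ 2 + 128 * ε ^ 2 * (1 - 48 * ω ^ 2))| ≤ 256 * (σ ^ 2 * (ε + |σ|) ^ 2) := by
  have hω2 : ω ^ 2 ≤ (1 / 4) ^ 2 := by rw [← sq_abs]; gcongr
  have h1 : |1 - 48 * ω ^ 2| ≤ 2 := by
    rw [abs_le]; constructor <;> linarith [sq_nonneg ω]
  rw [abs_mul, abs_of_nonneg (sq_nonneg σ)]
  have h2 : |256 * σ ^ 2 + 128 * ε ^ 2 * (1 - 48 * ω ^ 2)| ≤ 256 * (ε + |σ|) ^ 2 := by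
    refine (abs_add_le _ _).trans ?_
    rw [abs_mul (128 * ε ^ 2), abs_of_nonneg (by positivity : 0 ≤ 256 * σ ^ 2),
      abs_of_nonneg (by positivity : 0 ≤ 128 * ε ^ 2), ← sq_abs σ]
    have h3 : 128 * ε ^ 2 * |1 - 48 * ω ^ 2| ≤ 128 * ε ^ 2 * 2 := by gcongr
    have h4 : 0 ≤ ε * |σ| := by positivity
    have h5 : 256 * (ε + |σ|) ^ 2 = 256 * |σ| ^ 2 + 128 * ε ^ 2 * 2 + 512 * (ε * |σ|) := by ring
    linarith
  calc σ ^ 2 * |256 * σ ^ 2 + 128 * ε ^ 2 * (1 - 48 * ω ^ 2)| ≤ σ ^ 2 * (256 * (ε + |σ|) ^ 2) := by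
        gcongr
    _ = _ := by ring

-- Combines the kernel relation, the off-diagonal value at `σ = 0`, the jets of the first row and
-- the reflection symmetry; the factor `shiftDet` is removed at the end.
set_option maxHeartbeats 1000000 in
theorem exists_redBounds {C₀ : ℝ} (hC₀ : 0 < C₀) : ∃ C > 0, ∃ ε₁ > 0, ε₁ ≤ 1 / 20 ∧
    ∀ ε ω s : ℝ, ∀ u : Profile, 0 ≤ ε → ε < ε₁ → |ω| ≤ 1 / 4 → PatternData C₀ ε ω s u →
    IsSteady ε ω u → ‖potOp (pot₁ (ε ^ 2) u) (pot₂ u)‖ ≤ C * ε ∧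
    ∃ R : ℝ → State →L[ℂ] State, ∀ σ, |σ| ≤ 1 / 2 →
      IsInv (linOp (kap ε ω) (ε ^ 2) σ + onDom dom shiftOp +
        onDom dom (potOp (pot₁ (ε ^ 2) u) (pot₂ u))) (R σ) ∧
      ‖R σ - shiftRes (kap ε ω) (ε ^ 2) σ 0‖ ≤ C * ε ∧ RedBounds C ε ω σ (redMat (R σ)) := by
  obtain ⟨K', hK'0, hK'⟩ := exists_potData hC₀
  obtain ⟨C₁, hC₁, hrow⟩ := exists_jet_row
  obtain ⟨C₂, hC₂, hoff⟩ := exists_offDiag_bound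
  set K := 1 + K' with hK
  have hK1 : 1 ≤ K := by linarith
  set Q := 1 + C₁ * K ^ 2 + C₂ * K ^ 2 + 4 * C₀ with hQ
  have hQ1 : 1 ≤ Q := by
    have : 0 ≤ C₁ * K ^ 2 + C₂ * K ^ 2 + 4 * C₀ := by positivity
    linarith
  set M := 200 + 4 * Q + 10 * (100 + 2 * Q) ^ 2 with hM
  have hM0 : 0 ≤ M := by positivity
  set C := 10 ^ 8 * (1 + M) + 10 ^ 10 * K with hC
  have hCpos : 0 < C := by positivity
  refine ⟨C, hCpos, 1 / (10 ^ 8 * K), by positivity, ?_, fun ε ω s u hε0 hε hω hP hu => ?_⟩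
  · rw [div_le_div_iff₀ (by positivity) (by norm_num)]; linarith
  have hεK : K * ε ≤ 1 / 10 ^ 8 := by
    rw [lt_div_iff₀ (by positivity)] at hε
    linarith
  have hε20 : ε ≤ 1 / 20 := by linarith [le_mul_of_one_le_left hε0 hK1]
  obtain ⟨hk, hk2⟩ := abs_kap_sub_one_le hε0 (by linarith) hω
  have hPot' := hK' ε ω s u hε20 hω hP
  set κ := kap ε ω with hκ
  set b := ε ^ 2 with hb
  set g₁ := pot₁ b u with hg₁
  set g₂ := pot₂ u with hg₂
  have hPot : PotData K ε s κ b g₁ g₂ := by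
    have hKK : K' ≤ K := by linarith
    obtain ⟨γ₁, γ₂, l1, l2⟩ := hPot'.leading
    exact ⟨hPot'.κ_bd, hPot'.b_bd, hPot'.s_nonneg, hPot'.s_le, hPot'.even₁, hPot'.even₂,
      hPot'.norm₁.trans (by gcongr), hPot'.norm₂.trans (by gcongr),
      ⟨γ₁, γ₂, l1.trans (by gcongr), l2.trans (by gcongr)⟩, hPot'.comb.trans (by gcongr),
      hPot'.coeff₁.trans (by gcongr), hPot'.coeff₂.trans (by gcongr)⟩
  have hκ10 : |κ - 1| ≤ 1 / 10 := by linarith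
  have hb10 : |b| ≤ 1 / 10 := by linarith [hPot.b_bd]
  set U := potOp g₁ g₂ with hU
  have hUn : ‖U‖ ≤ 2 * K * ε := by
    refine (norm_potOp_le _ _).trans ?_
    linarith [hPot.norm₁, hPot.norm₂]
  have hU6 : ‖U‖ ≤ 1 / 10 ^ 6 := hUn.trans (by linarith)
  have hex : ∀ σ : ℝ, |σ| ≤ 1 / 2 → ∃ R', IsInv (linOp κ b σ + onDom dom shiftOp + onDom dom U) R' ∧
      ‖R'‖ ≤ 2 * 30720 ∧ ‖R' - shiftRes κ b σ 0‖ ≤ 2 * 30720 ^ 2 * ‖U‖ := fun σ hσ => by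
    have hI := isInv_shiftRes hκ10 hb10 hσ (z := 0) (by norm_num)
    rw [zero_smul, sub_zero] at hI
    exact hI.perturb U (norm_shiftRes_le hκ10 hb10 hσ (by norm_num)) (by linarith)
  choose! R hRi hRn hRd using hex
  have hRn' : ∀ σ, |σ| ≤ 1 / 2 → ‖R σ‖ ≤ 61440 := fun σ hσ => (hRn σ hσ).trans (by norm_num)
  have h00 : |(0 : ℝ)| ≤ 1 / 2 := by norm_num
  obtain ⟨jA, jB⟩ := hrow K ε s κ b g₁ g₂ hK1 hκ10 hb10 hU6 hPot R hRi hRn'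
  have hoff0 := hoff K ε s κ b g₁ g₂ hK1 hε20 hPot (R 0) (hRi 0 h00) (hRn' 0 h00)
  have hker := redMat_kernel hε0 hε20 hω hP hu (hRi 0 h00)
  set A : ℝ → ℂ := fun σ => (shiftDet κ b σ : ℂ) * (1 - entry 0 0 (R σ)) - critDet κ b σ with hA
  set B : ℝ → ℂ := fun σ => (shiftDet κ b σ : ℂ) * (-entry 0 1 (R σ)) with hB
  have hQC : ∀ {F : ℝ → ℂ}, Jet (C₁ * (K ^ 2 * ε ^ 2)) F → Jet (Q * ε ^ 2) F := fun h =>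
    h.mono (by
      have h1 : C₁ * K ^ 2 ≤ Q := by
        have : 0 ≤ C₂ * K ^ 2 + 4 * C₀ := by positivity
        linarith
      calc C₁ * (K ^ 2 * ε ^ 2) = C₁ * K ^ 2 * ε ^ 2 := by ring
        _ ≤ _ := by gcongr)
  have jA' := hQC jA
  have jB' := hQC jB
  have hker' : critDet κ (ε ^ 2) 0 + A 0 = B 0 := by
    simp only [hA, hB, ← hb, hker]; ring
  -- `96 s²` is four times `24 s²`, which the amplitude expansion replaces by `ε² (1 - 16 ω²)`.
  have hB0 : ‖B 0 - ((4 * (ε ^ 2 * (1 - 16 * ω ^ 2)) : ℝ) : ℂ)‖ ≤ Q * ε ^ 3 := by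
    have e : B 0 - ((4 * (ε ^ 2 * (1 - 16 * ω ^ 2)) : ℝ) : ℂ) = (B 0 - 96 * s ^ 2) +
        ((4 * (24 * s ^ 2 - ε ^ 2 * (1 - 16 * ω ^ 2)) : ℝ) : ℂ) := by push_cast; ring
    rw [e]
    refine (norm_add_le _ _).trans ?_
    rw [Complex.norm_real, Real.norm_eq_abs, abs_mul, abs_of_pos (by norm_num : (0 : ℝ) < 4)]
    have h1 := hP.amplitude
    have h2 : 0 ≤ (1 + C₁ * K ^ 2) * ε ^ 3 := by positivity
    have h3 : Q * ε ^ 3 = (1 + C₁ * K ^ 2) * ε ^ 3 + C₂ * (K ^ 2 * ε ^ 3) + 4 * (C₀ * ε ^ 3) := by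
      rw [hQ]; ring
    rw [h3]
    linarith
  refine ⟨hUn.trans ?_, R, fun σ hσ => ⟨hRi σ hσ, (hRd σ hσ).trans ?_, ?_⟩⟩
  · have : 2 * K ≤ C := by rw [hC]; linarith
    gcongr
  · have : 2 * 30720 ^ 2 * (2 * K) ≤ C := by rw [hC]; linarith
    calc 2 * 30720 ^ 2 * ‖U‖ ≤ 2 * 30720 ^ 2 * (2 * K * ε) := by gcongr
      _ = 2 * 30720 ^ 2 * (2 * K) * ε := by ring
      _ ≤ _ := by gcongr
  have hσn : |(-σ)| ≤ 1 / 2 := by rwa [abs_neg]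
  have hs0 := abs_nonneg σ
  have hrefl := resolvent_neg hPot.even₁ hPot.even₂ (hRi σ hσ) (hRi (-σ) hσn)
  have e11 : entry 1 1 (R σ) = entry 0 0 (R (-σ)) := (entry_reflS hrefl 0 0).symm
  have e10 : entry 1 0 (R σ) = entry 0 1 (R (-σ)) := (entry_reflS hrefl 0 1).symm
  obtain ⟨n1, n3⟩ := reduced_entry_bound hε0 hε20 hω hk hk2 hσ hQ1 jA' jB' hker' hB0
  obtain ⟨n2, n4⟩ := reduced_entry_bound hε0 hε20 hω hk hk2 hσn hQ1 jA' jB' hker' hB0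
  have nT := reduced_trace_bound hε0 hε20 hk hσ hQ1 jA' hker' hB0
  have nD := reduced_det_bound hε0 hε20 hω hk hk2 hσ hQ1 jA' jB' hker' hB0
  have p6 := shiftDet_sub_le hε0 hε20 hω hk hk2 hσ
  have p6' := shiftDet_sub_le hε0 hε20 hω hk hk2 hσn
  rw [abs_neg] at n2 n4 p6'
  have ea : ∀ τ, (critDet κ (ε ^ 2) τ : ℂ) + A τ = shiftDet κ b τ * (1 - entry 0 0 (R τ)) :=
    fun τ => by simp only [hA, ← hb]; ring
  rw [ea] at n1 n2 nT nD
  rw [ea] at nT nD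
  have hX := abs_leading_det_le (σ := σ) hε0 hω
  have hρ0 : 0 ≤ ε + |σ| := by positivity
  have hM2 : 200 + 4 * Q ≤ M := by rw [hM]; linarith [sq_nonneg (100 + 2 * Q)]
  have hM3 : 10 * (100 + 2 * Q) ^ 2 ≤ M := by rw [hM]; linarith
  have q2 : ∀ x, x ≤ (200 + 4 * Q) * (ε + |σ|) ^ 2 → x ≤ M * (ε + |σ|) ^ 2 := fun x hx =>
    hx.trans (by gcongr)
  obtain ⟨⟨w1, w2, w3, w4⟩, wT, wD⟩ := unscale_bounds (p := shiftDet κ b σ) (p' := shiftDet κ b (-σ))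
    (σ := σ) (M := M) hε0 (by linarith) hM0 (shiftDet_ge hκ10 hb10 hσ)
    (shiftDet_ge hκ10 hb10 hσn) p6 p6' hX (q2 _ n1) (q2 _ n2) (q2 _ n3) (q2 _ n4)
    (nT.trans (by gcongr)) (nD.trans (by gcongr))
  have hC5 : 5 * M ≤ C := by rw [hC]; linarith
  have hC1 : 1001 * M ≤ C := by rw [hC]; linarith
  have hC8 : 10 ^ 8 * (1 + M) ≤ C := by rw [hC]; linarith
  have r00 : redMat (R σ) 0 0 = 1 - entry 0 0 (R σ) := by simp [redMat]
  have r01 : redMat (R σ) 0 1 = -entry 0 1 (R σ) := by simp [redMat]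
  have r10 : redMat (R σ) 1 0 = -entry 0 1 (R (-σ)) := by simp [redMat, e10]
  have r11 : redMat (R σ) 1 1 = 1 - entry 0 0 (R (-σ)) := by simp [redMat, e11]
  have q5 : ∀ x, x ≤ 5 * M * (ε + |σ|) ^ 2 → x ≤ C * (ε + |σ|) ^ 2 := fun x hx =>
    hx.trans (by gcongr)
  refine ⟨fun j k => ?_, ?_, ?_⟩
  · fin_cases j <;> fin_cases k
    · change ‖redMat (R σ) 0 0‖ ≤ _
      rw [r00]; exact q5 _ w1
    · change ‖redMat (R σ) 0 1‖ ≤ _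
      rw [r01]; exact q5 _ w3
    · change ‖redMat (R σ) 1 0‖ ≤ _
      rw [r10]; exact q5 _ w4
    · change ‖redMat (R σ) 1 1‖ ≤ _
      rw [r11]; exact q5 _ w2
  · rw [r00, r11]
    exact wT.trans (by gcongr)
  · rw [r00, r11, r01, r10]
    exact wD.trans (by gcongr)

/-! ### Continuity of the shifted resolvent at the bifurcation point -/

/-- The bounded part of the dependence of `linOp` on `b`. -/
def parOp : State →L[ℂ] State := (ContinuousLinearMap.fst ℂ L2 L2).prod (-ContinuousLinearMap.fst ℂ L2 L2)

theorem norm_parOp_le : ‖parOp‖ ≤ 1 := by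
  refine ContinuousLinearMap.opNorm_le_bound _ zero_le_one fun f => ?_
  rw [one_mul]
  refine max_le (norm_fst_le f) ?_
  change ‖-f.1‖ ≤ _
  rw [norm_neg]
  exact norm_fst_le f

theorem qv_sub_le {κ σ : ℝ} (hκ : |κ - 1| ≤ 1 / 10) (hσ : |σ| ≤ 1 / 2) (n : ℤ) :
    ‖((qv 1 0 n - qv κ σ n : ℝ) : ℂ)‖ ≤ 4 * (|κ - 1| + |σ|) * (1 + qv 1 0 n) := by
  rw [Complex.norm_real, Real.norm_eq_abs]
  have e : qv 1 0 n - qv κ σ n = -((κ - 1) * (n : ℝ) ^ 2) - κ * (2 * n * σ + σ ^ 2) := by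
    simp only [qv]; ring
  have hκ' := abs_le.1 hκ
  have h1 : |κ * (2 * n * σ + σ ^ 2)| ≤ 2 * (|σ| * (2 + (n : ℝ) ^ 2)) := by
    rw [abs_mul, abs_of_pos (by linarith : 0 < κ)]
    have h2 : |2 * n * σ + σ ^ 2| ≤ |σ| * (2 + (n : ℝ) ^ 2) := by
      have e2 : 2 * n * σ + σ ^ 2 = σ * (2 * n + σ) := by ring
      rw [e2, abs_mul]
      gcongr
      refine (abs_add_le _ _).trans ?_
      rw [abs_mul, abs_two, ← sq_abs (n : ℝ)]
      nlinarith [sq_nonneg (|(n : ℝ)| - 1)]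
    exact mul_le_mul (by linarith) h2 (abs_nonneg _) (by norm_num)
  have h3 : |(-((κ - 1) * (n : ℝ) ^ 2))| = |κ - 1| * (n : ℝ) ^ 2 := by
    rw [abs_neg, abs_mul, abs_of_nonneg (sq_nonneg (n : ℝ))]
  have h4 : 0 ≤ |κ - 1| * (n : ℝ) ^ 2 := by positivity
  have h5 : 0 ≤ |σ| * (n : ℝ) ^ 2 := by positivity
  rw [e]
  refine (abs_sub _ _).trans ?_
  have e4 : qv 1 0 n = (n : ℝ) ^ 2 := by simp [qv]
  rw [h3, e4]
  linarith [abs_nonneg (κ - 1), abs_nonneg σ]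

/-- The parameters multiply second derivatives, so the operators do not depend continuously on them
in norm; composed with the resolvent at the bifurcation point the difference is bounded and small.
-/
theorem norm_shiftRes_sub_le {κ b σ : ℝ} (hκ : |κ - 1| ≤ 1 / 10) (hb : |b| ≤ 1 / 10)
    (hσ : |σ| ≤ 1 / 2) :
    ‖shiftRes κ b σ 0 - shiftRes 1 0 0 0‖ ≤ 10 ^ 11 * (|κ - 1| + |b| + |σ|) := by
  have k0 : |(1 : ℝ) - 1| ≤ 1 / 10 := by norm_num
  have b0 : |(0 : ℝ)| ≤ 1 / 10 := by norm_num
  have s0 : |(0 : ℝ)| ≤ 1 / 2 := by norm_num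
  have hA := admissible_shift k0 b0 s0
  have hz : -((1 / 5 : ℝ) / 32) ≤ (0 : ℂ).re := by norm_num
  have hw0 : ∀ n : ℤ, ‖(1 : ℤ → ℂ) n‖ ≤ 1 * (1 + qv 1 0 n) := fun n => by simp [hA.qv_nonneg n]
  have hw := qv_sub_le hκ hσ
  set D := derRes (fun n => ((qv 1 0 n - qv κ σ n : ℝ) : ℂ)) 1 0 with hD
  set G := D + (b : ℂ) • (parOp ∘L shiftRes 1 0 0 0) with hG
  have hexp : ∀ {f : State} {v : dom}, (v : State) = shiftRes 1 0 0 0 f →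
      linOp κ b σ v = linOp 1 0 0 v + G f := fun {f v} hv => by
    refine State_ext (fun n => ?_) fun n => ?_
    · change _ = cf n ((linOp 1 0 0 v).1 + ((resMult _ 1 0 0 critMode 0 f).1 +
        (b : ℂ) • (shiftRes 1 0 0 0 f).1))
      rw [map_add, map_add, map_smul, cf_linOp_fst, cf_linOp_fst, hv, shiftRes,
        cf_resMult_fst hA hz hw0, cf_resMult_snd hA hz hw0, cf_resMult_fst hA hz hw, Pi.one_apply,
        smul_eq_mul]
      push_cast; ring
    · change _ = cf n ((linOp 1 0 0 v).2 + ((4 : ℂ) • (resMult _ 1 0 0 critMode 0 f).2 +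
        (b : ℂ) • -(shiftRes 1 0 0 0 f).1))
      rw [map_add, map_add, map_smul, map_smul, map_neg, cf_linOp_snd, cf_linOp_snd, hv, shiftRes,
        cf_resMult_fst hA hz hw0, cf_resMult_snd hA hz hw0, cf_resMult_snd hA hz hw, Pi.one_apply,
        smul_eq_mul, smul_eq_mul]
      push_cast; ring
  have hDn : ‖D‖ ≤ 122880 * (4 * (|κ - 1| + |σ|)) := norm_derRes_le k0 b0 (by positivity) hw
  have hPn : ‖parOp ∘L shiftRes 1 0 0 0‖ ≤ 1 * 30720 :=
    (ContinuousLinearMap.opNorm_comp_le _ _).trans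
      (mul_le_mul norm_parOp_le (norm_shiftRes_le k0 b0 s0 (by norm_num)) (norm_nonneg _) zero_le_one)
  have hGn : ‖G‖ ≤ 10 ^ 6 * (|κ - 1| + |b| + |σ|) := by
    refine (norm_add_le _ _).trans ?_
    rw [norm_smul, Complex.norm_real, Real.norm_eq_abs]
    have := mul_le_mul_of_nonneg_left hPn (abs_nonneg b)
    linarith [abs_nonneg (κ - 1), abs_nonneg σ, abs_nonneg b]
  have hI := isInv_shiftRes hκ hb hσ (z := 0) (by norm_num)
  have hI0 := isInv_shiftRes k0 b0 s0 (z := 0) (by norm_num)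
  rw [zero_smul, sub_zero] at hI hI0
  have key : shiftRes κ b σ 0 - shiftRes 1 0 0 0 = -(shiftRes κ b σ 0 ∘L G) := by
    refine ContinuousLinearMap.ext fun f => ?_
    obtain ⟨v, hv, hTv⟩ := hI0.1 f
    have h1 := hI.2 v
    simp only [LinearMap.add_apply, onDom_apply] at h1 hTv
    have h2 : linOp κ b σ v + shiftOp v = f + G f := by rw [hexp hv, ← hTv]; abel
    rw [h2, map_add, hv] at h1
    rw [sub_apply, neg_apply, ContinuousLinearMap.comp_apply, ← h1]
    abel
  rw [key, norm_neg]
  calc _ ≤ 30720 * (10 ^ 6 * (|κ - 1| + |b| + |σ|)) :=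
        (ContinuousLinearMap.opNorm_comp_le _ _).trans
          (mul_le_mul (norm_shiftRes_le hκ hb hσ (by norm_num)) hGn (norm_nonneg _) (by norm_num))
    _ ≤ _ := by linarith [abs_nonneg (κ - 1), abs_nonneg σ, abs_nonneg b]

/-! ### Conjugation symmetry of the eigenvalues -/

theorem conjL_mem_H2 {v : L2} (hv : v ∈ H2) : conjL v ∈ H2 := by
  obtain ⟨w, hw⟩ := exists_cf_of_mem_H2 hv
  refine mem_H2_of_cf (w := conjL w) fun n => ?_
  rw [cf_conjL, cf_conjL, hw]; simp

theorem conjL_eq_zero {v : L2} (h : conjL v = 0) : v = 0 := L2_ext fun n => by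
  have := congrArg (cf n) h
  rw [cf_conjL, map_zero, map_eq_zero] at this
  rw [this, map_zero]

/-- The map `v ↦ conj v(-ξ)` conjugates Fourier coefficients without changing the mode. It therefore
preserves `σ` and commutes with the operator, whose symbol and even potentials are real. -/
theorem eigenvector_conj {κ b σ : ℝ} {g₁ g₂ : C(Circ, ℝ)} (h₁ : IsEven g₁) (h₂ : IsEven g₂) {z : ℂ}
    {v : dom} (hv0 : (v : State) ≠ 0)
    (hv : (linOp κ b σ + onDom dom (potOp g₁ g₂)) v = z • (v : State)) :
    ∃ w : dom, (w : State) ≠ 0 ∧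
      (linOp κ b σ + onDom dom (potOp g₁ g₂)) w = (starRingEnd ℂ) z • (w : State) := by
  refine ⟨⟨(conjL (v : State).1, conjL (v : State).2), conjL_mem_H2 v.2.1, conjL_mem_H2 v.2.2⟩,
    fun h => hv0 ?_, ?_⟩
  · exact Prod.ext (conjL_eq_zero (congrArg Prod.fst h)) (conjL_eq_zero (congrArg Prod.snd h))
  have hv1 := congrArg Prod.fst hv
  have hv2 := congrArg Prod.snd hv
  simp only [LinearMap.add_apply, onDom_apply, Prod.fst_add, Prod.snd_add, potOp_fst, potOp_snd,
    Prod.smul_fst, Prod.smul_snd] at hv1 hv2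
  refine State_ext (fun n => ?_) fun n => ?_
  · have := congrArg (fun x => (starRingEnd ℂ) (cf n x)) hv1
    simp only [map_add, cf_linOp_fst, map_smul, smul_eq_mul, map_mul, map_sub, Complex.conj_ofReal,
      Complex.conj_ofNat] at this
    simp only [LinearMap.add_apply, onDom_apply, Prod.fst_add, potOp_fst, Prod.smul_fst, map_add,
      cf_linOp_fst, mulOp_conjL h₁, mulOp_conjL h₂, cf_conjL, map_smul, smul_eq_mul]
    exact this
  · have := congrArg (fun x => (starRingEnd ℂ) (cf n x)) hv2
    simp only [map_add, cf_linOp_snd, map_smul, smul_eq_mul, map_mul, map_sub, Complex.conj_ofReal,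
      Complex.conj_ofNat, map_neg] at this
    simp only [LinearMap.add_apply, onDom_apply, Prod.snd_add, potOp_snd, Prod.smul_snd, map_add,
      cf_linOp_snd, mulOp_conjL h₁, mulOp_conjL h₂, cf_conjL, map_smul, smul_eq_mul, map_neg]
    exact this

/-! ### Two by two matrices -/

/-- The matrix of an operator on `ℂ²`. -/
def opMat (A : (Fin 2 → ℂ) →L[ℂ] (Fin 2 → ℂ)) : Matrix (Fin 2) (Fin 2) ℂ :=
  fun j k => A (Pi.single k 1) j

theorem opMat_mulVec (A : (Fin 2 → ℂ) →L[ℂ] (Fin 2 → ℂ)) (c : Fin 2 → ℂ) (j : Fin 2) :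
    A c j = opMat A j 0 * c 0 + opMat A j 1 * c 1 := by
  have : c = c 0 • Pi.single 0 1 + c 1 • Pi.single 1 1 := by
    funext j; fin_cases j <;> simp
  conv_lhs => rw [this]
  rw [map_add, map_smul, map_smul]
  simp only [Pi.add_apply, Pi.smul_apply, smul_eq_mul, opMat]
  ring

theorem norm_opMat_le (A : (Fin 2 → ℂ) →L[ℂ] (Fin 2 → ℂ)) (j k : Fin 2) : ‖opMat A j k‖ ≤ ‖A‖ := by
  have h1 : ‖(Pi.single k 1 : Fin 2 → ℂ)‖ ≤ 1 := by
    rw [pi_norm_le_iff_of_nonneg zero_le_one]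
    intro i
    by_cases h : i = k
    · subst h; simp
    · simp [Pi.single_eq_of_ne h]
  calc _ ≤ ‖A (Pi.single k 1)‖ := norm_le_pi_norm _ _
    _ ≤ ‖A‖ * 1 := A.le_opNorm_of_le h1
    _ = _ := mul_one _

theorem norm_le_of_opMat_le {A : (Fin 2 → ℂ) →L[ℂ] (Fin 2 → ℂ)} {C : ℝ}
    (h : ∀ j k, ‖opMat A j k‖ ≤ C) : ‖A‖ ≤ 2 * C := by
  have hC : 0 ≤ C := (norm_nonneg _).trans (h 0 0)
  refine ContinuousLinearMap.opNorm_le_bound _ (by positivity) fun c => ?_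
  rw [pi_norm_le_iff_of_nonneg (by positivity)]
  intro j
  rw [opMat_mulVec]
  calc _ ≤ ‖opMat A j 0‖ * ‖c 0‖ + ‖opMat A j 1‖ * ‖c 1‖ :=
        (norm_add_le _ _).trans_eq (by rw [norm_mul, norm_mul])
    _ ≤ C * ‖c‖ + C * ‖c‖ := by
        gcongr
        · exact h j 0
        · exact norm_le_pi_norm _ _
        · exact h j 1
        · exact norm_le_pi_norm _ _
    _ = _ := by ring

/-- The trace of an operator on `ℂ²`. -/
def tr₂ (A : (Fin 2 → ℂ) →L[ℂ] (Fin 2 → ℂ)) : ℂ := opMat A 0 0 + opMat A 1 1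

/-- The determinant of an operator on `ℂ²`. -/
def det₂ (A : (Fin 2 → ℂ) →L[ℂ] (Fin 2 → ℂ)) : ℂ :=
  opMat A 0 0 * opMat A 1 1 - opMat A 0 1 * opMat A 1 0

theorem opMat_comp (N A : (Fin 2 → ℂ) →L[ℂ] (Fin 2 → ℂ)) (j k : Fin 2) :
    opMat (N ∘L A) j k = opMat N j 0 * opMat A 0 k + opMat N j 1 * opMat A 1 k :=
  opMat_mulVec N _ j

theorem det₂_comp (N A : (Fin 2 → ℂ) →L[ℂ] (Fin 2 → ℂ)) : det₂ (N ∘L A) = det₂ N * det₂ A := by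
  simp only [det₂, opMat_comp]; ring

/-- Roots of the characteristic polynomial are eigenvalues. -/
theorem exists_eigenvector {A : (Fin 2 → ℂ) →L[ℂ] (Fin 2 → ℂ)} {z : ℂ}
    (hz : z ^ 2 - tr₂ A * z + det₂ A = 0) : ∃ c : Fin 2 → ℂ, c ≠ 0 ∧ A c = z • c := by
  simp only [tr₂, det₂] at hz
  set a := opMat A 0 0 with ha
  set b := opMat A 0 1 with hb
  set c := opMat A 1 0 with hc
  set d := opMat A 1 1 with hd
  have key : ∀ x y : ℂ, a * x + b * y = z * x → c * x + d * y = z * y → A ![x, y] = z • ![x, y] := by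
    intro x y h1 h2
    funext j
    rw [opMat_mulVec]
    fin_cases j
    · simpa using h1
    · simpa using h2
  by_cases hbz : b = 0
  · by_cases hd' : z - d = 0
    · refine ⟨![0, 1], fun h => one_ne_zero (congrFun h 1), key _ _ ?_ ?_⟩
      · rw [hbz]; ring
      · linear_combination -hd'
    · refine ⟨![z - d, c], fun h => hd' (congrFun h 0), key _ _ ?_ ?_⟩
      · linear_combination -hz
      · ring
  · refine ⟨![b, z - a], fun h => hbz (congrFun h 0), key _ _ ?_ ?_⟩
    · ring
    · linear_combination -hz

/-- Off the roots of the characteristic polynomial, `z - A` is invertible. -/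
theorem exists_inverse {A : (Fin 2 → ℂ) →L[ℂ] (Fin 2 → ℂ)} {z : ℂ}
    (hz : z ^ 2 - tr₂ A * z + det₂ A ≠ 0) : ∃ S : (Fin 2 → ℂ) →L[ℂ] (Fin 2 → ℂ),
    (∀ c, z • S c - A (S c) = c) ∧ ∀ c, S (z • c - A c) = c := by
  set p := z ^ 2 - tr₂ A * z + det₂ A with hp
  have hp' : p = (z - opMat A 0 0) * (z - opMat A 1 1) - opMat A 0 1 * opMat A 1 0 := by
    rw [hp, tr₂, det₂]; ring
  -- The adjugate of `z - A` divided by its determinant; `hCH` is the Cayley-Hamilton identity.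
  let S : (Fin 2 → ℂ) →L[ℂ] (Fin 2 → ℂ) :=
    p⁻¹ • ((z - tr₂ A) • ContinuousLinearMap.id ℂ (Fin 2 → ℂ) + A)
  have hCH : ∀ c, A (A c) = tr₂ A • A c - det₂ A • c := fun c => by
    funext j
    simp only [opMat_mulVec A, Pi.sub_apply, Pi.smul_apply, smul_eq_mul, tr₂, det₂]
    fin_cases j <;> simp <;> ring
  have hcomm : ∀ c, S (z • c - A c) = z • S c - A (S c) := fun c => by
    simp only [S, smul_apply, add_apply, ContinuousLinearMap.id_apply, map_sub, map_smul, map_add]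
  have hS : ∀ c, z • S c - A (S c) = c := fun c => by
    simp only [S, smul_apply, add_apply, ContinuousLinearMap.id_apply, map_smul, map_add, hCH]
    have : p⁻¹ • p • c = c := inv_smul_smul₀ hz c
    rw [hp] at this ⊢
    linear_combination (norm := module) this
  exact ⟨S, hS, fun c => (hcomm c).trans (hS c)⟩

theorem exists_roots (T D : ℂ) : ∃ x y : ℂ, x.re ≤ y.re ∧ x + y = T ∧ x * y = D := by
  obtain ⟨w, hw⟩ := IsAlgClosed.exists_pow_nat_eq (T ^ 2 - 4 * D) zero_lt_two
  have h : (T + w) / 2 * ((T - w) / 2) = D := by linear_combination -(1 / 4 : ℂ) * hw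
  rcases le_total ((T + w) / 2).re ((T - w) / 2).re with h' | h'
  · exact ⟨_, _, h', by ring, h⟩
  · exact ⟨_, _, h', by ring, by rw [mul_comm]; exact h⟩

/-! ### The two critical eigenvalues -/

/-- `Θ` parametrizes an invariant subspace of `B` on which `B` acts as `A`; moving this part of the
spectrum to `-1` leaves an operator without spectrum in a half plane containing `0`. -/
structure ReducedPair (B : dom →ₗ[ℂ] State) (Θ : (Fin 2 → ℂ) →L[ℂ] State)
    (A : (Fin 2 → ℂ) →L[ℂ] (Fin 2 → ℂ)) : Prop where
  inv : ∀ c, ∃ v : dom, (v : State) = Θ c ∧ B v = Θ (A c)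
  left : ∀ c, critOut (Θ c) = c
  res : ∀ z : ℂ, -(1 / 160) ≤ z.re →
    ∃ R, IsInv (B - z • dom.subtype - onDom dom (Θ ∘L (A + 1) ∘L critOut)) R

namespace ReducedPair

variable {B : dom →ₗ[ℂ] State} {Θ : (Fin 2 → ℂ) →L[ℂ] State} {A : (Fin 2 → ℂ) →L[ℂ] (Fin 2 → ℂ)}
  (h : ReducedPair B Θ A)
include h

theorem apply_ne_zero {c : Fin 2 → ℂ} (hc : c ≠ 0) : Θ c ≠ 0 := fun h0 => hc (by
  rw [← h.left c, h0, map_zero])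

theorem exists_eigenvector {z : ℂ} (hz : z ^ 2 - tr₂ A * z + det₂ A = 0) :
    ∃ v : dom, (v : State) ≠ 0 ∧ B v = z • (v : State) := by
  obtain ⟨c, hc, hA⟩ := Brusselator.exists_eigenvector hz
  obtain ⟨v, hv, hB⟩ := h.inv c
  refine ⟨v, by rw [hv]; exact h.apply_ne_zero hc, ?_⟩
  rw [hB, hA, map_smul, hv]

theorem root_of_not_isInv {z : ℂ} (hz : -(1 / 160) ≤ z.re)
    (hn : ¬ ∃ R, IsInv (B - z • dom.subtype) R) : z ^ 2 - tr₂ A * z + det₂ A = 0 := by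
  by_contra hp
  obtain ⟨S, h1, h2⟩ := exists_inverse hp
  obtain ⟨R, hR⟩ := h.res z hz
  refine hn (isInv_of_reduced h.inv h.left (fun hz1 => ?_) hR h1 h2)
  rw [hz1] at hz
  norm_num at hz

theorem root_of_eigenvector {z : ℂ} (hz : -(1 / 160) ≤ z.re) {v : dom} (hv0 : (v : State) ≠ 0)
    (hv : B v = z • (v : State)) : z ^ 2 - tr₂ A * z + det₂ A = 0 := by
  refine h.root_of_not_isInv hz ?_
  rintro ⟨R, hR⟩
  have := hR.2 v
  simp only [LinearMap.sub_apply, LinearMap.smul_apply, Submodule.subtype_apply, hv, sub_self,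
    map_zero] at this
  exact hv0 this.symm

/-- A kernel vector and a vector mapped to it both lie in the invariant subspace, so algebraic
simplicity is inherited from a two by two matrix with determinant zero and nonzero trace. -/
theorem simple (hD : det₂ A = 0) (hT : tr₂ A ≠ 0) : ∃ φ : dom, (φ : State) ≠ 0 ∧ B φ = 0 ∧
    (∀ v : dom, B v = 0 → ∃ a : ℂ, (v : State) = a • (φ : State)) ∧ ¬ ∃ v : dom, B v = φ := by
  obtain ⟨x, hx0, hx⟩ := Brusselator.exists_eigenvector (A := A) (z := 0) (by rw [hD]; ring)
  rw [zero_smul] at hx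
  obtain ⟨φ, hφ, hBφ⟩ := h.inv x
  obtain ⟨R, hR⟩ := h.res 0 (by norm_num)
  rw [zero_smul, sub_zero] at hR
  rw [hx, map_zero] at hBφ
  refine ⟨φ, by rw [hφ]; exact h.apply_ne_zero hx0, hBφ, fun v hv => ?_, ?_⟩
  · obtain ⟨y, hy, hAy⟩ := mem_invariant_of_isInv h.inv h.left hR (v := v) (c := 0)
      (by rw [hv, map_zero])
    have x0 := congrFun hx 0
    have x1 := congrFun hx 1
    have y0 := congrFun hAy 0
    have y1 := congrFun hAy 1
    rw [opMat_mulVec, Pi.zero_apply] at x0 x1 y0 y1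
    -- The trace times the area spanned by `x` and `y` is the sum of the areas of `(A x, y)` and
    -- `(x, A y)`, so two null vectors are parallel.
    have hw : tr₂ A * (x 0 * y 1 - x 1 * y 0) = 0 := by
      rw [tr₂]
      linear_combination y 1 * x0 - x 1 * y0 - y 0 * x1 + x 0 * y1
    have hw' : x 0 * y 1 - x 1 * y 0 = 0 := (mul_eq_zero.1 hw).resolve_left hT
    have : ∃ a : ℂ, y = a • x := by
      by_cases h0 : x 0 = 0
      · have h1 : x 1 ≠ 0 := fun h1 => hx0 (by funext j; fin_cases j <;> simp [h0, h1])
        refine ⟨y 1 / x 1, ?_⟩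
        have hy0 : y 0 = 0 := by
          rw [h0, zero_mul, zero_sub, neg_eq_zero] at hw'
          exact (mul_eq_zero.1 hw').resolve_left h1
        funext j
        fin_cases j
        · simp [h0, hy0]
        · simp [h1]
      · refine ⟨y 0 / x 0, ?_⟩
        funext j
        fin_cases j
        · simp [h0]
        · simp only [Fin.mk_one, Pi.smul_apply, smul_eq_mul]
          field_simp
          linear_combination hw'
    obtain ⟨a, ha⟩ := this
    exact ⟨a, by rw [hy, ha, map_smul, hφ]⟩
  · rintro ⟨v, hv⟩
    obtain ⟨y, -, hAy⟩ := mem_invariant_of_isInv h.inv h.left hR (v := v) (c := x) (by rw [hv, hφ])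
    -- With determinant zero, Cayley-Hamilton reads `A² = tr A · A`; thus `A² y = 0` forces `A y =
    -- 0`.
    have hCH : tr₂ A • A y = 0 := by
      have h0 : A (A y) = 0 := by rw [hAy, hx]
      funext j
      have hj := congrFun h0 j
      rw [det₂] at hD
      simp only [opMat_mulVec A, Pi.zero_apply, Pi.smul_apply, smul_eq_mul, tr₂] at hj ⊢
      revert hj
      fin_cases j
      · intro hj
        simp only [Fin.zero_eta] at hj ⊢
        linear_combination hj + y 0 * hD
      · intro hj
        simp only [Fin.mk_one] at hj ⊢
        linear_combination hj + y 1 * hD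
    rw [hAy] at hCH
    exact hx0 ((smul_eq_zero.1 hCH).resolve_left hT)

end ReducedPair

/-- The two critical eigenvalues of the Bloch operator and what is known about them. -/
structure CritPair (ε ω σ : ℝ) (u : Profile) (C : ℝ) (x y : ℂ) : Prop where
  re_le : x.re ≤ y.re
  spec : ∀ z ∈ spec (bloch ε ω u σ), -(1 / 160) ≤ z.re → z = x ∨ z = y
  eig₁ : IsEigenvalue (bloch ε ω u σ) x
  eig₂ : IsEigenvalue (bloch ε ω u σ) y
  norm₁ : ‖x‖ ≤ C * (ε + |σ|) ^ 2
  norm₂ : ‖y‖ ≤ C * (ε + |σ|) ^ 2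
  small₁ : ‖x‖ < 1 / 1000
  small₂ : ‖y‖ < 1 / 1000
  conj : (x.im = 0 ∧ y.im = 0) ∨ y = (starRingEnd ℂ) x
  simple : x * y = 0 → x + y ≠ 0 → IsSimpleEigenvalue (bloch ε ω u σ) 0
  trace : ‖6 * (x + y) + ((8 * (ε ^ 2 * (1 - 16 * ω ^ 2)) + 32 * σ ^ 2 : ℝ) : ℂ)‖ ≤
    (ε + |σ|) ^ 2 / 2
  det : ‖36 * (x * y) - ((σ ^ 2 * (256 * σ ^ 2 + 128 * ε ^ 2 * (1 - 48 * ω ^ 2)) : ℝ) : ℂ)‖ ≤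
    |σ ^ 2 * (256 * σ ^ 2 + 128 * ε ^ 2 * (1 - 48 * ω ^ 2))| / 2 + C * (σ ^ 2 * (ε + |σ|) ^ 3)

/-- The Bloch operator as a linear map on its domain. -/
def blochMap (ε ω : ℝ) (u : Profile) (σ : ℝ) : dom →ₗ[ℂ] State := (bloch ε ω u σ).toFun

theorem blochMap_eq (ε ω : ℝ) (u : Profile) (σ : ℝ) :
    blochMap ε ω u σ = linOp (kap ε ω) (ε ^ 2) σ + onDom dom (potOp (pot₁ (ε ^ 2) u) (pot₂ u)) :=
  bloch_eq ε ω u σ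

theorem mem_resolventSet_iff (ε ω σ : ℝ) (u : Profile) (z : ℂ) :
    z ∈ resolventSet (bloch ε ω u σ) ↔
      ∃ R, IsInv (blochMap ε ω u σ - z • dom.subtype) R := Iff.rfl

/-- A reduced pair with the expected trace and determinant provides the critical eigenvalues. -/
theorem ReducedPair.exists_critPair {ε ω σ C : ℝ} {u : Profile} (h₁ : IsEven u.1) (h₂ : IsEven u.2)
    {Θ : (Fin 2 → ℂ) →L[ℂ] State} {A : (Fin 2 → ℂ) →L[ℂ] (Fin 2 → ℂ)}
    (h : ReducedPair (blochMap ε ω u σ) Θ A) (hA : ‖A‖ ≤ C * (ε + |σ|) ^ 2) (hA' : ‖A‖ < 1 / 1000)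
    (hT : ‖6 * tr₂ A + ((8 * (ε ^ 2 * (1 - 16 * ω ^ 2)) + 32 * σ ^ 2 : ℝ) : ℂ)‖ ≤
      (ε + |σ|) ^ 2 / 2)
    (hD : ‖36 * det₂ A - ((σ ^ 2 * (256 * σ ^ 2 + 128 * ε ^ 2 * (1 - 48 * ω ^ 2)) : ℝ) : ℂ)‖ ≤
      |σ ^ 2 * (256 * σ ^ 2 + 128 * ε ^ 2 * (1 - 48 * ω ^ 2))| / 2 +
        C * (σ ^ 2 * (ε + |σ|) ^ 3)) : ∃ x y, CritPair ε ω σ u C x y := by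
  obtain ⟨x, y, hxy, hs, hp⟩ := exists_roots (tr₂ A) (det₂ A)
  have hroot : ∀ z, z ^ 2 - tr₂ A * z + det₂ A = (z - x) * (z - y) := fun z => by
    rw [← hs, ← hp]; ring
  have hx : x ^ 2 - tr₂ A * x + det₂ A = 0 := by rw [hroot]; ring
  have hy : y ^ 2 - tr₂ A * y + det₂ A = 0 := by rw [hroot]; ring
  have hnorm : ∀ z, z ^ 2 - tr₂ A * z + det₂ A = 0 → ‖z‖ ≤ ‖A‖ := fun z hz => by
    obtain ⟨c, hc, hAc⟩ := Brusselator.exists_eigenvector hz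
    have := A.le_opNorm c
    rw [hAc, norm_smul] at this
    exact le_of_mul_le_mul_right this (norm_pos_iff.2 hc)
  have hor : ∀ z, z ^ 2 - tr₂ A * z + det₂ A = 0 → z = x ∨ z = y := fun z hz => by
    rw [hroot, mul_eq_zero, sub_eq_zero, sub_eq_zero] at hz
    exact hz
  have g₁ : IsEven (pot₁ (ε ^ 2) u) := fun t => by simp [pot₁, h₁ t, h₂ t]
  have g₂ : IsEven (pot₂ u) := fun t => by simp [pot₂, h₁ t]
  -- The conjugate is again an eigenvalue of the Bloch operator, and it is still to the right of
  -- `-1/160`, so it must be one of the two roots.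
  have hconj : ∀ z, z ^ 2 - tr₂ A * z + det₂ A = 0 →
      (starRingEnd ℂ) z = x ∨ (starRingEnd ℂ) z = y := fun z hz => by
    obtain ⟨v, hv0, hv⟩ := h.exists_eigenvector hz
    rw [blochMap_eq] at hv
    obtain ⟨w, hw0, hw⟩ := eigenvector_conj g₁ g₂ hv0 hv
    rw [← blochMap_eq] at hw
    refine hor _ (h.root_of_eigenvector ?_ hw0 hw)
    rw [Complex.conj_re]
    have := abs_le.1 (Complex.abs_re_le_norm z)
    linarith [hnorm z hz]
  have him : ∀ z : ℂ, (starRingEnd ℂ) z = z → z.im = 0 := fun z hz => Complex.conj_eq_iff_im.1 hz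
  refine ⟨x, y, hxy, fun z hz hre => ?_, h.exists_eigenvector hx, h.exists_eigenvector hy,
    (hnorm x hx).trans hA, (hnorm y hy).trans hA, (hnorm x hx).trans_lt hA',
    (hnorm y hy).trans_lt hA', ?_, fun h0 h1 => ?_, by rwa [hs], by rwa [hp]⟩
  · exact hor z (h.root_of_not_isInv hre fun hR => hz ((mem_resolventSet_iff ..).2 hR))
  · rcases hconj x hx with hx' | hx'
    · rcases hconj y hy with hy' | hy'
      · refine Or.inr ?_
        rw [← hy', Complex.conj_conj]
      · exact Or.inl ⟨him x hx', him y hy'⟩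
    · exact Or.inr hx'.symm
  · rw [hp] at h0
    rw [hs] at h1
    obtain ⟨φ, hφ0, hφ, hker, hgen⟩ := h.simple h0 h1
    refine ⟨φ, hφ0, ?_, fun v hv => hker v ?_, fun ⟨v, hv⟩ => hgen ⟨v, ?_⟩⟩
    · rw [zero_smul]; exact hφ
    · rw [zero_smul] at hv; exact hv
    · rw [zero_smul, sub_zero] at hv; exact hv

/-- The determinant is recovered by division and not by subtraction, so the error is relative; an
absolute error in `A` would destroy the factor `σ²`. -/
theorem det_quotient_bound {n a w x : ℂ} {q : ℝ} (h : n * a = w) (hn : ‖n - 1‖ ≤ 1 / 4)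
    (hw : ‖36 * w - x‖ ≤ q) : ‖36 * a - x‖ ≤ ‖x‖ / 2 + 2 * q := by
  have h1 : 3 / 4 ≤ ‖n‖ := by
    have := norm_sub_norm_le (1 : ℂ) n
    rw [norm_one, norm_sub_rev] at this
    linarith
  have e : n * (36 * a - x) = (36 * w - x) - (n - 1) * x := by rw [← h]; ring
  have h2 : ‖n‖ * ‖36 * a - x‖ ≤ q + 1 / 4 * ‖x‖ := by
    rw [← norm_mul, e]
    refine (norm_sub_le _ _).trans (add_le_add hw ?_)
    rw [norm_mul]
    gcongr
  have h3 : 3 / 4 * ‖36 * a - x‖ ≤ ‖n‖ * ‖36 * a - x‖ := by gcongr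
  have h4 : 0 ≤ q := (norm_nonneg _).trans hw
  linarith [norm_nonneg x]

/-- From `N A = W` with `N` close to `-1` the invariants of `A` are those of `-W`, approximately. -/
theorem reduced_op_bounds {C ν ε ω σ : ℝ} {N A : (Fin 2 → ℂ) →L[ℂ] (Fin 2 → ℂ)}
    {W : Matrix (Fin 2) (Fin 2) ℂ} (hC : 0 < C) (hε : 0 ≤ ε) (hN : ‖N + 1‖ ≤ ν)
    (hν : ν ≤ 1 / 10 ^ 3) (hνC : ν * C ≤ 1 / 10 ^ 3) (hW : ∀ j k, opMat (N ∘L A) j k = W j k)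
    (hb : RedBounds C ε ω σ W) (hρ : C * (ε + |σ|) ≤ 1 / 4) :
    ‖A‖ ≤ 3 * C * (ε + |σ|) ^ 2 ∧
    ‖6 * tr₂ A + ((8 * (ε ^ 2 * (1 - 16 * ω ^ 2)) + 32 * σ ^ 2 : ℝ) : ℂ)‖ ≤ (ε + |σ|) ^ 2 / 2 ∧
    ‖36 * det₂ A - ((σ ^ 2 * (256 * σ ^ 2 + 128 * ε ^ 2 * (1 - 48 * ω ^ 2)) : ℝ) : ℂ)‖ ≤
      |σ ^ 2 * (256 * σ ^ 2 + 128 * ε ^ 2 * (1 - 48 * ω ^ 2))| / 2 +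
        3 * C * (σ ^ 2 * (ε + |σ|) ^ 3) := by
  set ρ := ε + |σ| with hρd
  have hρ0 : 0 ≤ ρ := by positivity
  have hν0 : 0 ≤ ν := (norm_nonneg _).trans hN
  have hWn : ‖N ∘L A‖ ≤ 2 * (C * ρ ^ 2) := norm_le_of_opMat_le fun j k => by
    rw [hW]; exact hb.entry j k
  have hEA : ‖(N + 1) ∘L A‖ ≤ ν * ‖A‖ :=
    (ContinuousLinearMap.opNorm_comp_le _ _).trans (by gcongr)
  -- `N` is close to `-1`, so `A` is close to `-N A`; the difference is absorbed on the left.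
  have hAe : A = (N + 1) ∘L A - N ∘L A := by
    refine ContinuousLinearMap.ext fun c => ?_
    simp
  have hA1 : ‖A‖ ≤ ν * ‖A‖ + 2 * (C * ρ ^ 2) := by
    conv_lhs => rw [hAe]
    exact (norm_sub_le _ _).trans (add_le_add hEA hWn)
  have hq : 0 ≤ C * ρ ^ 2 := by positivity
  have hνA : ν * ‖A‖ ≤ 1 / 10 ^ 3 * ‖A‖ := by gcongr
  have hA : ‖A‖ ≤ 3 * C * ρ ^ 2 := by linarith [norm_nonneg A]
  refine ⟨hA, ?_, ?_⟩
  · have hE : ∀ j, opMat ((N + 1) ∘L A) j j = opMat A j j + W j j := fun j => by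
      rw [← hW]
      simp [opMat, add_apply, add_comm]
    have hEn : ∀ j, ‖opMat ((N + 1) ∘L A) j j‖ ≤ 3 / 10 ^ 3 * ρ ^ 2 := fun j => by
      refine (norm_opMat_le _ _ _).trans (hEA.trans ?_)
      calc ν * ‖A‖ ≤ ν * (3 * C * ρ ^ 2) := by gcongr
        _ = 3 * (ν * C) * ρ ^ 2 := by ring
        _ ≤ 3 * (1 / 10 ^ 3) * ρ ^ 2 := by gcongr
        _ = _ := by ring
    have e : 6 * tr₂ A + ((8 * (ε ^ 2 * (1 - 16 * ω ^ 2)) + 32 * σ ^ 2 : ℝ) : ℂ) =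
        6 * opMat ((N + 1) ∘L A) 0 0 + 6 * opMat ((N + 1) ∘L A) 1 1 -
        (6 * (W 0 0 + W 1 1) - ((8 * (ε ^ 2 * (1 - 16 * ω ^ 2)) + 32 * σ ^ 2 : ℝ) : ℂ)) := by
      rw [hE, hE, tr₂]; ring
    rw [e]
    refine (norm_sub_le _ _).trans ?_
    have h1 : ‖6 * opMat ((N + 1) ∘L A) 0 0 + 6 * opMat ((N + 1) ∘L A) 1 1‖ ≤
        36 / 10 ^ 3 * ρ ^ 2 := by
      refine (norm_add_le _ _).trans ?_
      rw [norm_mul, norm_mul, Complex.norm_ofNat]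
      linarith [hEn 0, hEn 1]
    have h2 : C * ρ ^ 3 ≤ 1 / 4 * ρ ^ 2 := by
      calc C * ρ ^ 3 = C * ρ * ρ ^ 2 := by ring
        _ ≤ _ := by gcongr
    have := hb.trace
    linarith [sq_nonneg ρ]
  · have hdet : det₂ N * det₂ A = W 0 0 * W 1 1 - W 0 1 * W 1 0 := by
      rw [← det₂_comp, det₂, hW, hW, hW, hW]
    have hNe : ∀ j k, opMat N j k = opMat (N + 1) j k - if j = k then 1 else 0 := fun j k => by
      by_cases hjk : j = k
      · subst hjk; simp [opMat, add_apply]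
      · simp [opMat, add_apply, hjk]
    have hNn : ∀ j k, ‖opMat (N + 1) j k‖ ≤ 1 / 10 ^ 3 := fun j k =>
      (norm_opMat_le _ _ _).trans (hN.trans hν)
    have hdN : ‖det₂ N - 1‖ ≤ 1 / 4 := by
      have e : det₂ N - 1 = opMat (N + 1) 0 0 * opMat (N + 1) 1 1 - opMat (N + 1) 0 0 -
          opMat (N + 1) 1 1 - opMat (N + 1) 0 1 * opMat (N + 1) 1 0 := by
        rw [det₂, hNe, hNe, hNe 0 1, hNe 1 0]
        simp
        ring
      have h2 : ∀ j k l m, ‖opMat (N + 1) j k * opMat (N + 1) l m‖ ≤ 1 / 10 ^ 3 * (1 / 10 ^ 3) :=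
        fun j k l m => by
          rw [norm_mul]; exact mul_le_mul (hNn _ _) (hNn _ _) (norm_nonneg _) (by norm_num)
      rw [e]
      refine (norm_sub_le _ _).trans ?_
      have := (norm_sub_le (opMat (N + 1) 0 0 * opMat (N + 1) 1 1 - opMat (N + 1) 0 0)
        (opMat (N + 1) 1 1)).trans (add_le_add_left (norm_sub_le _ _) _)
      linarith [hNn 0 0, hNn 1 1, h2 0 0 1 1, h2 0 1 1 0]
    have := det_quotient_bound hdet hdN hb.det
    rw [Complex.norm_real, Real.norm_eq_abs] at this
    have h0 : 0 ≤ C * (σ ^ 2 * ρ ^ 3) := by positivity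
    linarith

/-- All smallness is measured against the base point `shiftRes 1 0 0 0`, so the neighbourhood from
the implicit function theorem is the same for every `ω`. -/
theorem exists_reducedPair {C₀ : ℝ} (hC₀ : 0 < C₀) : ∃ C > 0, ∃ ε₁ > 0, ∃ σ₁ > 0, σ₁ ≤ 1 / 2 ∧
    ε₁ ≤ 1 / 20 ∧ ∀ ε ω s : ℝ, ∀ u : Profile, 0 ≤ ε → ε < ε₁ → |ω| ≤ 1 / 4 → PatternData C₀ ε ω s u →
    IsSteady ε ω u → ‖potOp (pot₁ (ε ^ 2) u) (pot₂ u)‖ ≤ C * ε ∧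
    ∀ σ, |σ| < σ₁ → ∃ x y, CritPair ε ω σ u C x y := by
  obtain ⟨C, hC, ε₂, hε₂, hε₂', H⟩ := exists_redBounds hC₀
  have hΨΦ : critOut ∘L critIn = -1 := ContinuousLinearMap.ext fun c => by
    simp [critOut_critIn]
  -- The closeness to the base point is chosen after `C`, so that `40000 k` and `40000 k C` meet the
  -- requirements of `reduced_op_bounds`.
  set k : ℝ := 1 / (10 ^ 8 * (1 + C)) with hk
  have hk0 : 0 < k := by positivity
  have hkC : k * (1 + C) = 1 / 10 ^ 8 := by rw [hk]; field_simp
  have hkC' : k + k * C = 1 / 10 ^ 8 := by rw [← hkC]; ring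
  have hkC0 : 0 < k * C := by positivity
  obtain ⟨ρ₀, hρ₀, Hinv⟩ := exists_invariant_pair (shiftRes 1 0 0 0) critIn critOut shiftRes_critIn
    hΨΦ hk0
  set p := min ρ₀ k with hp
  have hp0 : 0 < p := lt_min hρ₀ hk0
  have hpk : p ≤ k := min_le_right _ _
  set τ := p / (4 * (C + 10 ^ 12)) with hτ
  have hτ0 : 0 < τ := by positivity
  have hτC : C * τ + 10 ^ 12 * τ = p / 4 := by rw [hτ]; field_simp
  have hCτ : 0 < C * τ := by positivity
  refine ⟨3 * C, by positivity, min ε₂ τ, lt_min hε₂ hτ0, τ, hτ0, by linarith,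
    (min_le_left _ _).trans hε₂', fun ε ω s u hε0 hε hω hP hu => ?_⟩
  have hετ : ε ≤ τ := (hε.trans_le (min_le_right _ _)).le
  obtain ⟨hU, R, hR⟩ := H ε ω s u hε0 (hε.trans_le (min_le_left _ _)) hω hP hu
  have hCε : C * ε ≤ C * τ := by gcongr
  refine ⟨hU.trans (by nlinarith [mul_nonneg hC.le hε0]), fun σ hσ => ?_⟩
  have hσ2 : |σ| ≤ 1 / 2 := by linarith
  obtain ⟨hRi, hRd, hRb⟩ := hR σ hσ2
  obtain ⟨hκ, -⟩ := abs_kap_sub_one_le hε0 (by linarith) hω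
  have hκ10 : |kap ε ω - 1| ≤ 1 / 10 := by linarith
  have hb1 : |ε ^ 2| ≤ ε := by
    rw [abs_of_nonneg (sq_nonneg ε), sq]
    exact mul_le_of_le_one_left hε0 (by linarith)
  have hb10 : |ε ^ 2| ≤ 1 / 10 := by linarith
  have hRR : ‖R σ - shiftRes 1 0 0 0‖ < p := by
    have h1 := norm_shiftRes_sub_le hκ10 hb10 hσ2
    have h2 := norm_add_le (R σ - shiftRes (kap ε ω) (ε ^ 2) σ 0)
      (shiftRes (kap ε ω) (ε ^ 2) σ 0 - shiftRes 1 0 0 0)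
    rw [sub_add_sub_cancel] at h2
    linarith
  obtain ⟨Θ, A, hΘn, hAn, hΘ, hΨ⟩ := Hinv (R σ) (hRR.trans_le (min_le_left _ _))
  set U := potOp (pot₁ (ε ^ 2) u) (pot₂ u) with hUd
  have hΘe : ∀ c, Θ c = R σ (Θ (A c) + critIn c) := fun c =>
    congrArg (fun L : (Fin 2 → ℂ) →L[ℂ] State => L c) hΘ
  have hΨe : ∀ c, critOut (Θ c) = c := fun c =>
    congrArg (fun L : (Fin 2 → ℂ) →L[ℂ] (Fin 2 → ℂ) => L c) hΨ
  have hΘ5 : ‖Θ‖ ≤ 5 := by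
    have h1 := norm_sub_le (Θ + critIn) critIn
    rw [add_sub_cancel_right] at h1
    linarith [norm_critIn_le]
  have hpair : ReducedPair (blochMap ε ω u σ) Θ A := by
    refine ⟨fun c => ?_, hΨe, fun z hz => ?_⟩
    · obtain ⟨v, hv, hTv⟩ := hRi.1 (Θ (A c) + critIn c)
      rw [← hΘe] at hv
      refine ⟨v, hv, ?_⟩
      simp only [LinearMap.add_apply, onDom_apply] at hTv
      have h1 : shiftOp (v : State) = critIn c := by
        rw [shiftOp, ContinuousLinearMap.comp_apply, hv, hΨe]
      rw [h1] at hTv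
      rw [blochMap_eq, LinearMap.add_apply, onDom_apply]
      linear_combination (norm := module) hTv
    · have hI := isInv_shiftRes hκ10 hb10 hσ2 hz
      -- Moving the invariant subspace to `-1` subtracts `Θ (A + 1) Ψ`. As `Θ` is near `-Φ` and `A`
      -- near `0`, this is almost the addition of `ΦΨ`, and the known resolvent of the shifted
      -- operator can be perturbed.
      set X := U - (Θ ∘L A + (Θ + critIn)) ∘L critOut with hX
      have hXn : ‖X‖ ≤ 1 / 10 ^ 6 := by
        have h1 : ‖Θ ∘L A‖ ≤ 5 * k := (ContinuousLinearMap.opNorm_comp_le _ _).trans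
          (mul_le_mul hΘ5 hAn.le (norm_nonneg _) (by norm_num))
        have h2 : ‖Θ ∘L A + (Θ + critIn)‖ ≤ 6 * k := (norm_add_le _ _).trans (by linarith)
        have h3 : ‖(Θ ∘L A + (Θ + critIn)) ∘L critOut‖ ≤ 6 * k * 1 :=
          (ContinuousLinearMap.opNorm_comp_le _ _).trans
            (mul_le_mul h2 norm_critOut_le (norm_nonneg _) (by positivity))
        refine (norm_sub_le _ _).trans ?_
        linarith
      obtain ⟨R', hR', -⟩ := hI.perturb X (norm_shiftRes_le hκ10 hb10 hσ2 hz) (by linarith)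
      refine ⟨R', ?_⟩
      convert hR' using 1
      refine LinearMap.ext fun v => ?_
      rw [blochMap_eq]
      simp only [LinearMap.add_apply, LinearMap.sub_apply, onDom_apply, hX, sub_apply, add_apply,
        ContinuousLinearMap.comp_apply, shiftOp, map_add, one_apply_eq_self]
      abel
  set N := critOut ∘L R σ ∘L Θ with hN
  have hNn : ‖N + 1‖ ≤ 40000 * k := by
    have e : N + 1 = critOut ∘L ((R σ - shiftRes 1 0 0 0) ∘L Θ + shiftRes 1 0 0 0 ∘L (Θ + critIn)) := by
      refine ContinuousLinearMap.ext fun c => ?_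
      have h1 : shiftRes 1 0 0 0 (critIn c) = -critIn c :=
        congrArg (fun L : (Fin 2 → ℂ) →L[ℂ] State => L c) shiftRes_critIn
      simp only [hN, add_apply, sub_apply, ContinuousLinearMap.comp_apply, map_add, map_sub, h1,
        map_neg, critOut_critIn, one_apply_eq_self]
      abel
    have h1 : ‖(R σ - shiftRes 1 0 0 0) ∘L Θ‖ ≤ k * 5 := (ContinuousLinearMap.opNorm_comp_le _ _).trans
      (mul_le_mul (hRR.le.trans hpk) hΘ5 (norm_nonneg _) hk0.le)
    have h2 : ‖shiftRes 1 0 0 0 ∘L (Θ + critIn)‖ ≤ 30720 * k :=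
      (ContinuousLinearMap.opNorm_comp_le _ _).trans
        (mul_le_mul (norm_shiftRes_le (by norm_num) (by norm_num) (by norm_num) (by norm_num)) hΘn.le
          (norm_nonneg _) (by norm_num))
    rw [e]
    have h3 := (ContinuousLinearMap.opNorm_comp_le critOut
      ((R σ - shiftRes 1 0 0 0) ∘L Θ + shiftRes 1 0 0 0 ∘L (Θ + critIn))).trans
      (mul_le_mul norm_critOut_le ((norm_add_le _ _).trans (add_le_add h1 h2)) (norm_nonneg _)
        zero_le_one)
    linarith
  -- Apply `Ψ` to `Θ = R (Θ A + Φ)` and use `Ψ Θ = 1`.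
  have hW : ∀ i j, opMat (N ∘L A) i j = redMat (R σ) i j := fun i j => by
    have h1 := congrFun (congrArg critOut (hΘe (Pi.single j 1))) i
    rw [hΨe, map_add, map_add, Pi.add_apply] at h1
    have h2 : opMat (N ∘L A) i j = critOut (R σ (Θ (A (Pi.single j 1)))) i := rfl
    rw [h2, redMat, entry_apply]
    have h3 : (Pi.single j 1 : Fin 2 → ℂ) i = if i = j then 1 else 0 := Pi.single_apply _ _ _
    rw [h3] at h1
    linear_combination -h1
  have hρ : C * (ε + |σ|) ≤ 1 / 4 := by
    have : C * |σ| ≤ C * τ := by gcongr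
    rw [mul_add]
    linarith
  obtain ⟨b1, b2, b3⟩ := reduced_op_bounds hC hε0 hNn (by linarith) (by linarith) hW hRb hρ
  exact hpair.exists_critPair hP.even₁ hP.even₂ b1 (by linarith) b2 b3

/-! ### Stability and instability -/

theorem IsEigenvalue.mem_spec {E : Type*} [NormedAddCommGroup E] [NormedSpace ℂ E]
    {T : E →ₗ.[ℂ] E} {z : ℂ} (h : IsEigenvalue T z) : z ∈ spec T := by
  obtain ⟨v, hv0, hv⟩ := h
  rintro ⟨R, -, hR⟩
  have := hR v
  rw [hv, sub_self, map_zero] at this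
  exact hv0 this.symm

theorem add_sq_le_two (a b : ℝ) : (a + |b|) ^ 2 ≤ 2 * (a ^ 2 + b ^ 2) := by
  rw [← sq_abs b]
  nlinarith [sq_nonneg (a - |b|)]

theorem add_cube_le {a b : ℝ} (ha : 0 ≤ a) (hb : 0 ≤ b) : (a + b) ^ 3 ≤ 4 * (a ^ 3 + b ^ 3) := by
  nlinarith [mul_nonneg (add_nonneg ha hb) (sq_nonneg (a - b))]

namespace CritPair

variable {ε ω σ C : ℝ} {u : Profile} {x y : ℂ} (h : CritPair ε ω σ u C x y)
include h

theorem trace_bounds : |6 * (x.re + y.re) + (8 * (ε ^ 2 * (1 - 16 * ω ^ 2)) + 32 * σ ^ 2)| ≤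
    ε ^ 2 + σ ^ 2 := by
  have h1 := (Complex.abs_re_le_norm _).trans h.trace
  rw [Complex.add_re, Complex.ofReal_re, Complex.mul_re, Complex.add_re] at h1
  simp only [Complex.re_ofNat, Complex.im_ofNat, zero_mul, sub_zero] at h1
  linarith [add_sq_le_two ε σ]

theorem det_bounds :
    |36 * (x * y).re - σ ^ 2 * (256 * σ ^ 2 + 128 * ε ^ 2 * (1 - 48 * ω ^ 2))| ≤
      |σ ^ 2 * (256 * σ ^ 2 + 128 * ε ^ 2 * (1 - 48 * ω ^ 2))| / 2 + C * (σ ^ 2 * (ε + |σ|) ^ 3) := by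
  have h1 := (Complex.abs_re_le_norm _).trans h.det
  rw [Complex.sub_re, Complex.ofReal_re, Complex.mul_re 36] at h1
  simpa only [Complex.re_ofNat, Complex.im_ofNat, zero_mul, sub_zero] using h1

/-- Inside the Eckhaus interval both critical eigenvalues are in the left half plane. -/
theorem re_le_of_stable (hε : 0 ≤ ε) (hμ : 0 ≤ 1 - 48 * ω ^ 2) (hC : 0 ≤ C) (hσ : C * |σ| ≤ 16)
    (hεC : C * ε ≤ 8 * (1 - 48 * ω ^ 2)) :
    x.re ≤ -(ε ^ 2 / 4) - σ ^ 2 ∧ y.re ≤ -((1 - 48 * ω ^ 2) / 10) * σ ^ 2 := by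
  set μ := 1 - 48 * ω ^ 2 with hμd
  have hμ1 : μ ≤ 1 := by linarith [sq_nonneg ω]
  have hT := abs_le.1 h.trace_bounds
  have hε2 := sq_nonneg ε
  have hσ2 := sq_nonneg σ
  have hω1 : ε ^ 2 * (2 / 3) ≤ ε ^ 2 * (1 - 16 * ω ^ 2) :=
    mul_le_mul_of_nonneg_left (by linarith) hε2
  have hω2 : ε ^ 2 * (1 - 16 * ω ^ 2) ≤ ε ^ 2 * 1 :=
    mul_le_mul_of_nonneg_left (by linarith [sq_nonneg ω]) hε2
  have hTu : x.re + y.re ≤ -(ε ^ 2 / 2) - 2 * σ ^ 2 := by linarith [hT.2]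
  have hTl : -(6 * (ε ^ 2 + σ ^ 2)) ≤ x.re + y.re := by linarith [hT.1]
  have hx : x.re ≤ -(ε ^ 2 / 4) - σ ^ 2 := by linarith [h.re_le]
  refine ⟨hx, ?_⟩
  have hμσ : μ * σ ^ 2 ≤ 1 * σ ^ 2 := by gcongr
  rcases h.conj with ⟨hxi, hyi⟩ | hc
  · have hD := (abs_le.1 h.det_bounds).1
    have hX : 0 ≤ σ ^ 2 * (256 * σ ^ 2 + 128 * ε ^ 2 * μ) := by positivity
    rw [← hμd, abs_of_nonneg hX, Complex.mul_re, hxi, zero_mul, sub_zero] at hD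
    have hρ : C * (ε + |σ|) ^ 3 ≤ 64 * σ ^ 2 + 32 * μ * ε ^ 2 := by
      calc C * (ε + |σ|) ^ 3 ≤ C * (4 * (ε ^ 3 + |σ| ^ 3)) := by
            gcongr; exact add_cube_le hε (abs_nonneg σ)
        _ = 4 * (C * |σ|) * |σ| ^ 2 + 4 * (C * ε) * ε ^ 2 := by ring
        _ ≤ 4 * 16 * |σ| ^ 2 + 4 * (8 * μ) * ε ^ 2 := by gcongr
        _ = _ := by rw [sq_abs]; ring
    have hD1 : σ ^ 2 * (C * (ε + |σ|) ^ 3) ≤ σ ^ 2 * (64 * σ ^ 2 + 32 * μ * ε ^ 2) := by gcongr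
    have hD2 : 32 * μ * (σ ^ 2 * (ε ^ 2 + σ ^ 2)) ≤ 36 * (x.re * y.re) := by
      have h1 : μ * σ ^ 2 * σ ^ 2 ≤ 1 * σ ^ 2 * σ ^ 2 := by gcongr
      have h2 : 0 ≤ σ ^ 2 * σ ^ 2 := by positivity
      linarith
    -- Division by `ε² + σ²` follows; when it is zero the eigenvalues vanish by their size bound.
    rcases eq_or_lt_of_le (add_nonneg hε2 hσ2) with hq | hq
    · have hσ0 : σ ^ 2 = 0 := by linarith
      rw [hσ0, mul_zero]
      have hε0 : ε ^ 2 = 0 := by linarith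
      have hy2 := h.norm₂
      have hρ0 : (ε + |σ|) ^ 2 = 0 := le_antisymm (by linarith [add_sq_le_two ε σ]) (sq_nonneg _)
      rw [hρ0, mul_zero] at hy2
      linarith [le_abs_self y.re, Complex.abs_re_le_norm y]
    · have hx0 : x.re < 0 := by linarith
      have hxy : 0 ≤ x.re * y.re := by
        have : 0 ≤ 32 * μ * (σ ^ 2 * (ε ^ 2 + σ ^ 2)) := by positivity
        linarith
      have hy0 : y.re ≤ 0 := by
        by_contra hy
        exact absurd (mul_neg_of_neg_of_pos hx0 (not_le.1 hy)) (not_lt.2 hxy)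
      -- Both eigenvalues are nonpositive, so neither is below the trace bound `-6 (ε² + σ²)`;
      -- dividing the lower bound on the product by it bounds `-y` from below by a multiple of `σ²`
      -- that is uniform in `ε`.
      have h1 : x.re * y.re ≤ -(6 * (ε ^ 2 + σ ^ 2)) * y.re :=
        mul_le_mul_of_nonpos_right (by linarith) hy0
      have h2 : (ε ^ 2 + σ ^ 2) * (32 * μ * σ ^ 2) ≤ (ε ^ 2 + σ ^ 2) * (216 * -y.re) := by linarith
      have h3 := le_of_mul_le_mul_left h2 hq
      have h4 : 0 ≤ μ * σ ^ 2 := by positivity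
      linarith
  · have hyx : y.re = x.re := by rw [hc, Complex.conj_re]
    rw [hyx]
    linarith

/-- Outside the Eckhaus interval one of the critical eigenvalues is positive for suitable `σ`. -/
theorem re_pos_of_unstable (hε : 0 < ε) (hσ0 : 0 < σ) (hω : |ω| ≤ 1 / 4)
    (hσ : 4 * σ ^ 2 = -(1 - 48 * ω ^ 2) * ε ^ 2) (hC : 0 ≤ C) (hεC : C * ε < -(1 - 48 * ω ^ 2)) :
    0 < y.re := by
  have hω2 : ω ^ 2 ≤ (1 / 4) ^ 2 := by rw [← sq_abs]; gcongr
  have hD := (abs_le.1 h.det_bounds).2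
  -- At this `σ` the leading determinant is minimal, with value `-256 σ⁴`; half of it beats the
  -- cubic error, and a negative product excludes a conjugate pair.
  have e : 256 * σ ^ 2 + 128 * ε ^ 2 * (1 - 48 * ω ^ 2) = -(256 * σ ^ 2) := by linarith
  have hσε : σ ≤ ε := by
    refine (sq_le_sq₀ hσ0.le hε.le).1 ?_
    have : -(1 - 48 * ω ^ 2) * ε ^ 2 ≤ 2 * ε ^ 2 := by gcongr; linarith
    linarith [sq_nonneg ε]
  have hX : σ ^ 2 * -(256 * σ ^ 2) ≤ 0 := by
    have : 0 ≤ σ ^ 2 * σ ^ 2 := by positivity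
    linarith
  rw [e, abs_of_nonpos hX, abs_of_pos hσ0] at hD
  have hρ : C * (ε + σ) ^ 3 < 32 * σ ^ 2 := by
    calc C * (ε + σ) ^ 3 ≤ C * (ε + ε) ^ 3 := by gcongr
      _ = 8 * ε ^ 2 * (C * ε) := by ring
      _ < 8 * ε ^ 2 * -(1 - 48 * ω ^ 2) := by gcongr
      _ = 32 * σ ^ 2 := by linarith
  have hσp : 0 < σ ^ 2 := by positivity
  have hD1 : σ ^ 2 * (C * (ε + σ) ^ 3) < σ ^ 2 * (32 * σ ^ 2) := by gcongr
  have hneg : (x * y).re < 0 := by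
    have : 0 ≤ σ ^ 2 * σ ^ 2 := by positivity
    linarith
  rcases h.conj with ⟨hxi, hyi⟩ | hc
  · rw [Complex.mul_re, hxi, zero_mul, sub_zero] at hneg
    by_contra hy
    have hy' := not_lt.1 hy
    exact absurd (mul_nonneg_of_nonpos_of_nonpos (h.re_le.trans hy') hy') (not_le.2 hneg)
  · rw [hc, Complex.mul_conj, Complex.ofReal_re] at hneg
    exact absurd (Complex.normSq_nonneg x) (not_le.2 hneg)

end CritPair

/-! ### Noncritical Floquet exponents and diffusive stability. -/

/-- Away from `σ = 0` the spectrum stays away from the imaginary axis. -/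
theorem re_lt_of_noncritical {ε ω σ s C : ℝ} {u : Profile} (hs : 0 < s) (hs' : s ≤ 1 / 2)
    (hε : 0 ≤ ε) (hω : |ω| ≤ 1 / 4) (hεs : ε ≤ s / 20)
    (hU : ‖potOp (pot₁ (ε ^ 2) u) (pot₂ u)‖ ≤ C * ε) (hC : C * ε ≤ s ^ 2 / 10 ^ 5)
    (hσ : |σ| ≤ 1 / 2) (hsσ : s ≤ |σ|) {z : ℂ} (hz : z ∈ spec (bloch ε ω u σ)) :
    z.re < -(s ^ 2 / 256) := by
  by_contra hre
  have hre' : -(s ^ 2 / 8 / 32) ≤ z.re := by linarith [not_lt.1 hre]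
  have hκ := (abs_kap_sub_one_le hε (by linarith) hω).1
  have hb : |ε ^ 2| ≤ s ^ 2 / 10 := by
    rw [abs_of_nonneg (sq_nonneg ε)]
    calc ε ^ 2 ≤ (s / 20) ^ 2 := by gcongr
      _ ≤ _ := by linarith [sq_nonneg s]
  have hA := admissible_noncritical hs hs' (by linarith) hb hσ hsσ (κ := kap ε ω)
  have hI := hA.isInv hre' (X := 0) (by simp) (by simp)
  obtain ⟨R, hR, -⟩ := hI.perturb (potOp (pot₁ (ε ^ 2) u) (pot₂ u)) (hA.norm_resMult_one_le hre') (by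
    have hs2 : 0 < s ^ 2 := by positivity
    calc _ ≤ 6144 / (s ^ 2 / 8) * (s ^ 2 / 10 ^ 5) := by gcongr; exact hU.trans hC
      _ = 6144 * 8 / 10 ^ 5 := by field_simp
      _ ≤ _ := by norm_num)
  refine hz ((mem_resolventSet_iff ..).2 ⟨R, ?_⟩)
  convert hR using 1
  refine LinearMap.ext fun v => ?_
  rw [blochMap_eq]
  simp only [LinearMap.add_apply, LinearMap.sub_apply, onDom_apply, zero_apply]
  abel

/-- The Brillouin zone is split at `|σ| = s`: inside, the two critical eigenvalues decay
quadratically and all other spectrum is left of `-1/160`; outside there is a uniform gap. -/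
theorem diffusivelyStable_of_critPair {ε ω s C μ : ℝ} {u : Profile} (hs : 0 < s) (hs' : s ≤ 1 / 2)
    (hε : 0 < ε) (hω : |ω| ≤ 1 / 4) (hεs : ε ≤ s / 20)
    (hU : ‖potOp (pot₁ (ε ^ 2) u) (pot₂ u)‖ ≤ C * ε) (hC0 : 0 ≤ C) (hC : C * ε ≤ s ^ 2 / 10 ^ 5)
    (hcrit : ∀ σ, |σ| < s → ∃ x y, CritPair ε ω σ u C x y) (hsC : C * s ≤ 16)
    (hμ : μ = 1 - 48 * ω ^ 2) (hμ0 : 0 < μ) (hμC : C * ε ≤ 8 * μ) :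
    DiffusivelyStable ε ω u := by
  obtain ⟨x, y, hxy⟩ := hcrit 0 (by rwa [abs_zero])
  have hx := (hxy.re_le_of_stable hε.le (hμ ▸ hμ0.le) hC0 (by rw [abs_zero]; linarith) (hμ ▸ hμC)).1
  have hε2 : 0 < ε ^ 2 := by positivity
  have hxneg : x.re < 0 := by linarith
  have hx0 : x ≠ 0 := fun h => by rw [h] at hxneg; exact lt_irrefl _ hxneg
  -- At `σ = 0` the determinant bound has right side `0`, so one eigenvalue is exactly zero: the
  -- translation mode.
  have hprod : x * y = 0 := by
    have h1 : ‖36 * (x * y)‖ ≤ 0 := by simpa using hxy.det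
    exact (mul_eq_zero.1 (norm_le_zero_iff.1 h1)).resolve_left (by norm_num)
  have hy0 : y = 0 := (mul_eq_zero.1 hprod).resolve_left hx0
  refine ⟨hxy.simple hprod (by rwa [hy0, add_zero]), fun z hz hz0 => ?_, ?_⟩
  · by_contra hre
    rcases hxy.spec z hz (by linarith [not_lt.1 hre]) with h | h
    · exact hre (h ▸ hxneg)
    · exact hz0 (h.trans hy0)
  · refine ⟨min (μ / 10) (s ^ 2 / 256), by positivity, fun σ hσ z hz => ?_⟩
    have hσ2 : |σ| ≤ 1 / 2 := abs_le.2 ⟨hσ.1, hσ.2.le⟩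
    have hσq : σ ^ 2 ≤ 1 / 4 := by
      rw [← sq_abs]
      calc |σ| ^ 2 ≤ (1 / 2) ^ 2 := by gcongr
        _ = _ := by norm_num
    have m1 : min (μ / 10) (s ^ 2 / 256) * σ ^ 2 ≤ μ / 10 * σ ^ 2 := by gcongr; exact min_le_left _ _
    have m2 : min (μ / 10) (s ^ 2 / 256) * σ ^ 2 ≤ s ^ 2 / 256 * (1 / 4) := by
      gcongr; exact min_le_right _ _
    have hs2 : 0 < s ^ 2 := by positivity
    have hs4 : s ^ 2 ≤ (1 / 2) ^ 2 := by gcongr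
    rw [neg_mul]
    rcases lt_or_ge |σ| s with hlt | hge
    · obtain ⟨x, y, hxy⟩ := hcrit σ hlt
      have hCσ : C * |σ| ≤ 16 := le_trans (by gcongr) hsC
      obtain ⟨b1, b2⟩ := hxy.re_le_of_stable hε.le (hμ ▸ hμ0.le) hC0 hCσ (hμ ▸ hμC)
      rw [← hμ] at b2
      rcases lt_or_ge z.re (-(1 / 160)) with hre | hre
      · linarith
      · rcases hxy.spec z hz hre with h | h
        · rw [h]; linarith [hxy.re_le]
        · rw [h]; linarith
    · have := re_lt_of_noncritical hs hs' hε.le hω hεs hU hC hσ2 hge hz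
      linarith

theorem mem_eckhausInterval_iff {ω : ℝ} : ω ∈ eckhausInterval ↔ 0 < 1 - 48 * ω ^ 2 := by
  have h3 : (0 : ℝ) < 1 / (4 * √3) := by positivity
  have h4 : (1 / (4 * √3)) ^ 2 = 1 / 48 := by
    rw [div_pow, mul_pow, Real.sq_sqrt (by norm_num)]; norm_num
  rw [eckhausInterval, Set.mem_Ioo, ← abs_lt, ← abs_of_pos h3, ← sq_lt_sq, h4]
  constructor <;> intro h <;> linarith

theorem of_notMem_closure_eckhausInterval {ω : ℝ} (h : ω ∉ closure eckhausInterval) :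
    1 - 48 * ω ^ 2 < 0 := by
  have h3 : (0 : ℝ) < 1 / (4 * √3) := by positivity
  have h4 : (1 / (4 * √3)) ^ 2 = 1 / 48 := by
    rw [div_pow, mul_pow, Real.sq_sqrt (by norm_num)]; norm_num
  rw [eckhausInterval, closure_Ioo (by linarith), Set.mem_Icc, ← abs_le, ← abs_of_pos h3, ← sq_le_sq,
    h4] at h
  linarith [not_le.1 h]

end Brusselator

end

/-! ### The choice of constants and the assembly of the result. -/

theorem theorem1p2 :
    -- the bifurcating patterns: for some `ε₀`, exactly one small pattern for each `(ε, ω)`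
    ∃ r > (0 : ℝ), ∃ ε₀ > (0 : ℝ), ∃ u : ℝ → ℝ → Profile,
      (∀ ε ∈ Set.Ico 0 ε₀, ∀ ω ∈ existInterval,
        IsPattern r ε ω (u ε ω) ∧ ∀ v, IsPattern r ε ω v → v = u ε ω) ∧
    ∃ ε₁ ∈ Set.Ioc 0 ε₀, ∃ σ₀ > (0 : ℝ), ∃ δ > (0 : ℝ), ∃ lam₁ lam₂ : ℝ → ℝ → ℝ → ℂ,
      -- decomposition of the spectrum
      (∀ ε ∈ Set.Ico 0 ε₁, ∀ σ ∈ Set.Ico 0 σ₀, ∀ ω ∈ existInterval,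
        (∃ S : Set ℂ, spec (bloch ε ω (u ε ω) σ) = S ∪ {lam₁ ε ω σ, lam₂ ε ω σ} ∧
          ∀ z ∈ S, z.re < -δ) ∧
        IsEigenvalue (bloch ε ω (u ε ω) σ) (lam₁ ε ω σ) ∧
        IsEigenvalue (bloch ε ω (u ε ω) σ) (lam₂ ε ω σ) ∧
        ‖lam₁ ε ω σ‖ < δ ∧ ‖lam₂ ε ω σ‖ < δ) ∧
      -- `λ₁, λ₂ → 0` as `(ε, σ) → 0`, uniformly in `ω`
      (∀ κ > (0 : ℝ), ∃ ρ > (0 : ℝ), ∀ ε ∈ Set.Ico 0 ε₁, ∀ σ ∈ Set.Ico 0 σ₀, ∀ ω ∈ existInterval,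
        ε < ρ → σ < ρ → ‖lam₁ ε ω σ‖ < κ ∧ ‖lam₂ ε ω σ‖ < κ) ∧
      -- diffusive stability inside the Eckhaus interval
      (∀ ω ∈ eckhausInterval, ∃ ε₂ ∈ Set.Ioo 0 ε₁,
        (∃ c c' c₁ c₂ : ℝ → ℝ, ∃ K : ℝ,
          (∀ ε ∈ Set.Ico 0 ε₂, (0 < ε → c ε < 0) ∧ (ε = 0 → c ε = 0) ∧ 0 < c₁ ε ∧ 0 < c₂ ε) ∧
          ∀ ε ∈ Set.Ico 0 ε₂, ∀ σ ∈ Set.Ico 0 σ₀,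
            (lam₁ ε ω σ).re ≤ c ε + c' ε * σ - c₁ ε * σ ^ 2 + K * σ ^ 3 ∧
            (lam₂ ε ω σ).re ≤ -c₂ ε * σ ^ 2 + K * σ ^ 3) ∧
        ∀ ε ∈ Set.Ioo 0 ε₂, DiffusivelyStable ε ω (u ε ω)) ∧
      -- diffusive instability outside its closure
      (∀ ω ∈ existInterval \ closure eckhausInterval, ∃ ε₂ ∈ Set.Ioo 0 ε₁,
        ∀ ε ∈ Set.Ioo 0 ε₂, ∃ σ ∈ Set.Ico 0 σ₀,
          0 < max (lam₁ ε ω σ).re (lam₂ ε ω σ).re) := by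
  obtain ⟨r, hr, ε₀, hε₀, u, C₀, hC₀, hpat⟩ := exists_patterns
  obtain ⟨C, hC, ε', hε', s, hs, hs', hε'', H⟩ := exists_reducedPair hC₀
  have hcrit : ∀ ε ω σ : ℝ, ε ∈ Set.Ico 0 (min ε₀ ε') → ω ∈ existInterval → |σ| < s →
      ∃ x y, CritPair ε ω σ (u ε ω) C x y := fun ε ω σ hε hω hσ => by
    obtain ⟨⟨hu, -⟩, a, ha⟩ := hpat ε ⟨hε.1, hε.2.trans_le (min_le_left _ _)⟩ ω hω
    exact (H ε ω a (u ε ω) hε.1 (hε.2.trans_le (min_le_right _ _)) (abs_le.2 hω) ha hu.steady).2 σ hσ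
  have hpot : ∀ ε ω : ℝ, ε ∈ Set.Ico 0 (min ε₀ ε') → ω ∈ existInterval →
      ‖potOp (pot₁ (ε ^ 2) (u ε ω)) (pot₂ (u ε ω))‖ ≤ C * ε := fun ε ω hε hω => by
    obtain ⟨⟨hu, -⟩, a, ha⟩ := hpat ε ⟨hε.1, hε.2.trans_le (min_le_left _ _)⟩ ω hω
    exact (H ε ω a (u ε ω) hε.1 (hε.2.trans_le (min_le_right _ _)) (abs_le.2 hω) ha hu.steady).1
  choose! lam₁ lam₂ hlam using hcrit
  set σ₀ := min s (16 / C) with hσ₀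
  have hσ₀p : 0 < σ₀ := lt_min hs (by positivity)
  have hσ₀C : C * σ₀ ≤ 16 := by
    calc C * σ₀ ≤ C * (16 / C) := by gcongr; exact min_le_right _ _
      _ = 16 := by field_simp
  have habs : ∀ {σ : ℝ}, σ ∈ Set.Ico 0 σ₀ → |σ| < σ₀ := fun {σ} hσ => by
    rw [abs_of_nonneg hσ.1]; exact hσ.2
  have hlam' : ∀ {ε ω σ : ℝ}, ε ∈ Set.Ico 0 (min ε₀ ε') → ω ∈ existInterval → σ ∈ Set.Ico 0 σ₀ →
      CritPair ε ω σ (u ε ω) C (lam₁ ε ω σ) (lam₂ ε ω σ) := fun {ε ω σ} hε hω hσ =>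
    hlam ε ω σ hε hω ((habs hσ).trans_le (min_le_left _ _))
  refine ⟨r, hr, ε₀, hε₀, u, fun ε hε ω hω => (hpat ε hε ω hω).1, min ε₀ ε',
    -- `δ = 1/200` lies between the size bound `1/1000` of the critical eigenvalues and the gap
    -- `1/160` of the remaining spectrum.
    ⟨lt_min hε₀ hε', min_le_left _ _⟩, σ₀, hσ₀p, 1 / 200, by norm_num, lam₁, lam₂, ?_, ?_, ?_, ?_⟩
  · intro ε hε σ hσ ω hω
    have h := hlam' hε hω hσ
    refine ⟨⟨{z | z ∈ spec (bloch ε ω (u ε ω) σ) ∧ z.re < -(1 / 200)}, ?_, fun z hz => hz.2⟩,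
      h.eig₁, h.eig₂, h.small₁.trans (by norm_num), h.small₂.trans (by norm_num)⟩
    ext z
    simp only [Set.mem_union, Set.mem_ofPred_eq, Set.mem_insert_iff, Set.mem_singleton_iff]
    constructor
    · intro hz
      by_cases hre : z.re < -(1 / 200)
      · exact Or.inl ⟨hz, hre⟩
      · exact Or.inr (h.spec z hz (by linarith [not_lt.1 hre]))
    · rintro (hz | rfl | rfl)
      · exact hz.1
      · exact h.eig₁.mem_spec
      · exact h.eig₂.mem_spec
  · intro κ hκ
    refine ⟨min 1 (κ / (4 * C)), by positivity, fun ε hε σ hσ ω hω hερ hσρ => ?_⟩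
    have h := hlam' hε hω hσ
    have h1 : C * (ε + |σ|) ^ 2 < κ := by
      rw [abs_of_nonneg hσ.1]
      set ρ := min 1 (κ / (4 * C)) with hρ
      have hρ0 : 0 < ρ := by positivity
      have h2 : (ε + σ) ^ 2 < (2 * ρ) ^ 2 := by
        have := hε.1
        have := hσ.1
        gcongr
        linarith
      have h3 : ρ ^ 2 ≤ κ / (4 * C) := by
        calc ρ ^ 2 = ρ * ρ := sq ρ
          _ ≤ 1 * (κ / (4 * C)) := by
            gcongr
            · exact min_le_left _ _
            · exact min_le_right _ _
          _ = _ := one_mul _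
      calc C * (ε + σ) ^ 2 < C * (2 * ρ) ^ 2 := by gcongr
        _ = 4 * C * ρ ^ 2 := by ring
        _ ≤ 4 * C * (κ / (4 * C)) := by gcongr
        _ = κ := by field_simp
    exact ⟨h.norm₁.trans_lt h1, h.norm₂.trans_lt h1⟩
  · intro ω hωS
    have hμ := mem_eckhausInterval_iff.1 hωS
    have hω4 : |ω| ≤ 1 / 4 := by
      refine abs_le_of_sq_le_sq ?_ (by norm_num)
      linarith
    have hω : ω ∈ existInterval := abs_le.1 hω4
    set μ := 1 - 48 * ω ^ 2 with hμd
    set ε₂ := min (min ε₀ ε' / 2) (min (σ₀ / 20) (min (σ₀ ^ 2 / (10 ^ 5 * C)) (8 * μ / C))) with hε₂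
    have hε₂p : 0 < ε₂ := by positivity
    have hlt : ε₂ < min ε₀ ε' :=
      (min_le_left _ _).trans_lt (half_lt_self (lt_min hε₀ hε'))
    have b1 : ε₂ ≤ σ₀ / 20 := (min_le_right _ _).trans (min_le_left _ _)
    have b2 : ε₂ ≤ σ₀ ^ 2 / (10 ^ 5 * C) :=
      (min_le_right _ _).trans ((min_le_right _ _).trans (min_le_left _ _))
    have b3 : ε₂ ≤ 8 * μ / C := (min_le_right _ _).trans ((min_le_right _ _).trans (min_le_right _ _))
    have c2 : C * ε₂ ≤ σ₀ ^ 2 / 10 ^ 5 := by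
      calc C * ε₂ ≤ C * (σ₀ ^ 2 / (10 ^ 5 * C)) := by gcongr
        _ = _ := by field_simp
    have c3 : C * ε₂ ≤ 8 * μ := by
      calc C * ε₂ ≤ C * (8 * μ / C) := by gcongr
        _ = _ := by field_simp
    -- `lam₁` is the root with the smaller real part, so it receives the bound with `-(ε²/4)`. The
    -- linear and cubic terms are not needed: the errors are already absorbed into the quadratic
    -- coefficients.
    refine ⟨ε₂, ⟨hε₂p, hlt⟩, ⟨fun ε => -(ε ^ 2 / 4), fun _ => 0, fun _ => 1, fun _ => μ / 10, 0,
      fun ε hε => ⟨fun h0 => ?_, fun h0 => ?_, one_pos, by positivity⟩, fun ε hε σ hσ => ?_⟩,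
      fun ε hε => ?_⟩
    · have : 0 < ε ^ 2 := by positivity
      simp only
      linarith
    · simp [h0]
    · have hCε : C * ε ≤ 8 * μ := le_trans (by gcongr; exact hε.2.le) c3
      have hCσ : C * |σ| ≤ 16 := le_trans (by gcongr; exact (habs hσ).le) hσ₀C
      obtain ⟨h1, h2⟩ := (hlam' ⟨hε.1, hε.2.trans hlt⟩ hω hσ).re_le_of_stable hε.1 hμ.le hC.le hCσ hCε
      simp only
      constructor <;> linarith
    · have hCε : C * ε ≤ C * ε₂ := by gcongr; exact hε.2.le
      have hε' : ε ∈ Set.Ico 0 (min ε₀ ε') := ⟨hε.1.le, hε.2.trans hlt⟩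
      exact diffusivelyStable_of_critPair hσ₀p ((min_le_left _ _).trans hs') hε.1 hω4
        (hε.2.le.trans b1) (hpot ε ω hε' hω) hC.le (hCε.trans c2)
        (fun σ hσ => ⟨_, _, hlam ε ω σ hε' hω (hσ.trans_le (min_le_left _ _))⟩) hσ₀C hμd hμ
        (hCε.trans c3)
  · rintro ω ⟨hω, hωS⟩
    have hμ := of_notMem_closure_eckhausInterval hωS
    have hω4 : |ω| ≤ 1 / 4 := abs_le.2 hω
    set m := -(1 - 48 * ω ^ 2) with hm
    have hm0 : 0 < m := by linarith
    have hm2 : m ≤ 2 := by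
      have : ω ^ 2 ≤ (1 / 4) ^ 2 := by rw [← sq_abs]; gcongr
      linarith
    set ε₂ := min (min ε₀ ε' / 2) (min (σ₀ / 2) (m / C)) with hε₂
    have hε₂p : 0 < ε₂ := by positivity
    have hlt : ε₂ < min ε₀ ε' :=
      (min_le_left _ _).trans_lt (half_lt_self (lt_min hε₀ hε'))
    have b1 : ε₂ ≤ σ₀ / 2 := (min_le_right _ _).trans (min_le_left _ _)
    have b2 : ε₂ ≤ m / C := (min_le_right _ _).trans (min_le_right _ _)
    refine ⟨ε₂, ⟨hε₂p, hlt⟩, fun ε hε => ?_⟩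
    have hε0 : 0 < ε := hε.1
    have hsq : √m ^ 2 = m := Real.sq_sqrt hm0.le
    have hsm : √m ≤ 2 := Real.sqrt_le_iff.2 ⟨by norm_num, by linarith⟩
    -- This exponent minimises `σ² (256 σ² - 128 m ε²)`, the leading part of the determinant.
    have hσ : √m / 2 * ε ∈ Set.Ico 0 σ₀ := by
      refine ⟨by positivity, ?_⟩
      have : √m / 2 * ε ≤ 1 * ε := by gcongr; linarith
      linarith [hε.2]
    refine ⟨√m / 2 * ε, hσ, lt_max_of_lt_right ?_⟩
    refine (hlam' ⟨hε.1.le, hε.2.trans hlt⟩ hω hσ).re_pos_of_unstable hε0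
      (by positivity) hω4 ?_ hC.le ?_
    · rw [mul_pow, div_pow, hsq]; ring
    · calc C * ε < C * ε₂ := by gcongr; exact hε.2
        _ ≤ C * (m / C) := by gcongr
        _ = m := by field_simp
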